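/- **Setting.** Let $\mathbb K$ be a field of characteristic $0$. For a commutative $\mathbb K$-algebra $R$, a symmetric monoidal $\mathbf{Ch}_R^{[-1,0]}$-category $(\mathbf C,\otimes,I,\gamma)$ is a symmetric monoidal category enriched in cochain complexes of $R$-modules concentrated in degrees $-1$ and $0$ (composites landing in degree $-2$ vanish, so $(\partial q)q'=q(\partial q')$ for $q,q'$ of degree $-1$). Degree $0$ elements are called $1$-cells; $\mathbf C_S$ denotes extension of scalars of the hom complexes to a commutative $R$-algebra $S$. Formulas are written as if $\otimes$ were strictly associative and unital; in general the coherence isomorphisms are inserted. An *infinitesimal 2-braiding* is a pseudonatural endomorphism $t$ of $\otimes$ over $R=\mathbb K$: $1$-cells $t_{UV}:U\otimes V\to U\otimes V$ and elements $t_{f\boxtimes g}$ of degree $-1$, bilinear in the $1$-cells $f:U\to U'$, $g:V\to V'$, with $(f\otimes g)t_{UV}-t_{U'V'}(f\otimes g)=\partial t_{f\boxtimes g}$, the analogous formulas for $t_{\partial q\boxtimes g}$ and $t_{f\boxtimes\partial q}$, $t_{1\boxtimes1}=0$, and $t_{f'f\boxtimes g'g}=t_{f'\boxtimes g'}(f\otimes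 g)+(f'\otimes g')t_{f\boxtimes g}$ (and $t_{a\boxtimes1}=0=t_{1\boxtimes a}$ for $a$ an associator or a unitor). It is * *strict* if $t_{U(VW)}=t_{UV}\otimes1_W+(\gamma_{VU}\otimes1_W)(1_V\otimes t_{UW})(\gamma_{UV}\otimes1_W)$ and $t_{(UV)W}=1_U\otimes t_{VW}+(1_U\otimes\gamma_{WV})(t_{UW}\otimes1_V)(1_U\otimes\gamma_{VW})$, as pseudonatural transformations (that is, also for homotopy components); * *symmetric* if $\gamma_{UV}t_{UV}=t_{VU}\gamma_{UV}$ and $\gamma_{U'V'}t_{f\boxtimes g}=t_{g\boxtimes f}\gamma_{UV}$; *totally symmetric* if moreover $t_{\gamma_{UV}\boxtimes1_W}=0$; * *Breen* if $\gamma_{U(WV)}t_{1_U\boxtimes\gamma_{VW}}+\gamma_{(VU)W}t_{\gamma_{UV}\boxtimes1_W}=0$; * *coherent* if, for $\mathcal L_{UVW}=t_{t_{UV}\boxtimes1_W}$ and $\mathcal R_{UVW}=t_{1_U\boxtimes t_{VW}}$, $-(\gamma_{VU}\otimes1)\mathcal R_{VUW}(\gamma_{UV}\otimes1)=\mathcal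 L_{UVW}+\mathcal R_{UVW}=-(1\otimes\gamma_{WV})\mathcal L_{UWV}(1\otimes\gamma_{VW})$. A *coboundary infinitesimal syllepsis* $T:t\Rrightarrow0$ is a family of degree $-1$ elements $T_{UV}$ of the endomorphism complex of $U\otimes V$ such that $\partial T_{UV}=t_{UV}$; $(f\otimes g)T_{UV}-T_{U'V'}(f\otimes g)=t_{f\boxtimes g}$ for all $1$-cells; $T_{U(VW)}=T_{UV}\otimes1_W+(\gamma_{VU}\otimes1_W)(1_V\otimes T_{UW})(\gamma_{UV}\otimes1_W)$; $T_{(UV)W}=1_U\otimes T_{VW}+(1_U\otimes\gamma_{WV})(T_{UW}\otimes1_V)(1_U\otimes\gamma_{VW})$; and $T_{UV}=\gamma_{VU}T_{VU}\gamma_{UV}$. A *braided pentagonal strictly-unital monoidal structure* $(\alpha,\sigma,\mathcal H^L,\mathcal H^R)$ on $(\mathbf C,\otimes,I)$ consists of pseudonatural isomorphisms $\alpha_{UVW}$ and $\sigma_{UV}:U\otimes V\to V\otimes U$ satisfying the pentagon (as an equality of pseudonatural transformations), the associahedron with trivial pentagonator and the triangle, and of modifications $\mathcal H^L_{UVW}$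 from $\alpha_{VWU}\sigma_{U(VW)}\alpha_{UVW}$ to $(1_V\otimes\sigma_{UW})\alpha_{VUW}(\sigma_{UV}\otimes1_W)$ and $\mathcal H^R_{UVW}$ from $\alpha^{-1}_{WUV}\sigma_{(UV)W}\alpha^{-1}_{UVW}$ to $(\sigma_{UW}\otimes1_V)\alpha^{-1}_{UWV}(1_U\otimes\sigma_{VW})$ satisfying the left and right tetrahedron, the hexahedron and the Breen polytope axioms of a braided monoidal bicategory. It is *hexagonally braided strict* if $\alpha$, $\mathcal H^L$, $\mathcal H^R$ are trivial. A *syllepsis* on it is a family $\Sigma_{UV}$ of degree $-1$ elements with $\partial\Sigma_{UV}=\sigma_{UV}-\sigma_{VU}^{-1}$, quasinatural in $U,V$, and $$\mathcal H^L_{UVW}=\alpha_{VWU}\Sigma_{U(VW)}\alpha_{UVW}+(\mathcal H^R_{VWU})^{-1}-(1_V\otimes\sigma_{WU}^{-1})\alpha_{VUW}(\Sigma_{UV}\otimes1_W)-(1_V\otimes\Sigma_{UW})\alpha_{VUW}(\sigma_{UV}\otimes1_W),$$ $$\mathcal H^R_{UVW}=\alpha^{-1}_{WUV}\Sigma_{(UV)W}\alpha^{-1}_{UVW}+(\mathcal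 H^L_{WUV})^{-1}-(\sigma_{WU}^{-1}\otimes1_V)\alpha^{-1}_{UWV}(1_U\otimes\Sigma_{VW})-(\Sigma_{UW}\otimes1_V)\alpha^{-1}_{UWV}(1_U\otimes\sigma_{VW});$$ it is *symmetric* if $\Sigma_{UV}=\sigma_{VU}^{-1}\Sigma_{VU}\sigma_{UV}$. **The Poisson example.** Let $A$ be a semi-free CDGA over $\mathbb K$ with finitely many generators $x_p$, and $\mathbf C=\mathsf{Ho}_2({}_A\mathbf{dgMod}^{\mathrm{sf}})$: objects are finitely generated semi-free dg $A$-modules, $1$-cells are closed degree $0$ maps, elements of degree $-1$ are degree $-1$ maps modulo exact ones; $\otimes=\otimes_A$. Let $\xi_M:M\to\Omega_A[1]\otimes_AM$ be the cochain map $m_i\mapsto\sum_j\pm\, s^{-1}\mathrm d_{\mathrm{dR}}D^j_i\otimes m_j$ given by the de Rham differential of the matrix $D$ of the differential of $M$, and let $\xi_f$, with $\partial\xi_f=(1\otimes f)\xi_M-\xi_{M'}f$, be the homotopy given by the de Rham differential of the matrix of $f:M\to M'$. For a graded symmetric form $\varphi$ on $\Omega_A[1]$ of degree $0$ or $-1$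 let $\iota_\varphi=(\varphi\otimes1)(1\otimes\gamma\otimes1):\Omega_A[1]\otimes M\otimes\Omega_A[1]\otimes N\to M\otimes N$. Let $\tilde\pi\in\mathrm{Sym}^2_A(\mathsf T_A[-1])^{-1}$ and $\pi=\mathrm d\tilde\pi$; put $$t_{MN}=\iota_\pi(\xi_M\otimes\xi_N),\qquad t_{f\boxtimes g}=\iota_\pi\big(\xi_f\otimes(1\otimes g)\xi_N+\xi_{M'}f\otimes\xi_g\big),\qquad T_{MN}=\iota_{\tilde\pi}(\xi_M\otimes\xi_N).$$ **Theorem.** 1. In the Poisson example $t$ is a strict, totally symmetric and Breen infinitesimal 2-braiding, and $T:t\Rrightarrow0$ is a coboundary infinitesimal syllepsis. 2. Let $\mathbf C$ be any symmetric monoidal $\mathbf{Ch}_{\mathbb K}^{[-1,0]}$-category and $t$ a symmetric strict Breen infinitesimal 2-braiding on it. Then $\sigma=\gamma(1+\tfrac h2t)$ is a hexagonally braided strict structure on $\mathbf C_{\mathbb K[h]/(h^2)}$, and for every family $T$ of degree $-1$ elements $T_{UV}$ of the endomorphism complexes, $\Sigma=h\gamma T$ is a symmetric syllepsis on it if and only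 if $T:t\Rrightarrow0$ is a coboundary infinitesimal syllepsis. 3. Let $t$ be a coherent totally symmetric strict infinitesimal 2-braiding on $\mathbf C$. Then $$\alpha=1+\tfrac{h^2}{24}[t_{12},t_{23}],\quad \sigma=\gamma\big(1+\tfrac h2t+\tfrac{h^2}8t^2\big),\quad \mathcal H^L=\tfrac{h^2}{24}\gamma_{1(23)}(2\mathcal L+\mathcal R),\quad \mathcal H^R=\tfrac{h^2}{24}\gamma_{(12)3}(\mathcal L+2\mathcal R)$$ is a braided pentagonal strictly-unital monoidal structure on $\mathbf C_{\mathbb K[h]/(h^3)}$, and for every coboundary infinitesimal syllepsis $T:t\Rrightarrow0$ the family $\Sigma=h\gamma T$ is a symmetric syllepsis on it. -/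

import Mathlib

open CategoryTheory MonoidalCategory BraidedCategory
open scoped TensorProduct

set_option linter.unusedSectionVars false
set_option linter.unusedSimpArgs false

namespace Syl

/-- Composition of 1-cells, written from right to left. -/
notation:80 g:81 " ⊚ " f:80 => CategoryStruct.comp f g

/-- The degree `-1` part of a category enriched in cochain complexes of `R`-modules that are
concentrated in degrees `-1` and `0`.  The `R`-linear category `C` is the degree `0` part, `H X Y` is
the degree `-1` part of the hom complex, `bd` is the differential, `post g q` is the composite `g q`
and `pre q f` is the composite `q f`.  The law `peiffer` is the Leibniz rule for the composite of two
elements of degree `-1`, which lies in degree `-2` and hence vanishes. -/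
class TwoCells (R : Type*) (C : Type*) [CommRing R] [Category C] [Preadditive C] [Linear R C] where
  H : C → C → Type*
  [grp : ∀ X Y, AddCommGroup (H X Y)]
  [mod : ∀ X Y, Module R (H X Y)]
  bd (X Y : C) : H X Y →ₗ[R] (X ⟶ Y)
  post (X Y Z : C) : (Y ⟶ Z) →ₗ[R] H X Y →ₗ[R] H X Z
  pre (X Y Z : C) : H Y Z →ₗ[R] (X ⟶ Y) →ₗ[R] H X Z
  post_id : ∀ {X Y : C} (q : H X Y), post _ _ _ (𝟙 Y) q = q
  pre_id : ∀ {X Y : C} (q : H X Y), pre _ _ _ q (𝟙 X) = q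
  post_comp : ∀ {W X Y Z : C} (g' : Y ⟶ Z) (g : X ⟶ Y) (q : H W X),
    post _ _ _ (g' ⊚ g) q = post _ _ _ g' (post _ _ _ g q)
  pre_comp : ∀ {W X Y Z : C} (q : H Y Z) (f : X ⟶ Y) (f' : W ⟶ X),
    pre _ _ _ (pre _ _ _ q f) f' = pre _ _ _ q (f ⊚ f')
  post_pre : ∀ {W X Y Z : C} (g : Y ⟶ Z) (q : H X Y) (f : W ⟶ X),
    pre _ _ _ (post _ _ _ g q) f = post _ _ _ g (pre _ _ _ q f)
  bd_post : ∀ {X Y Z : C} (g : Y ⟶ Z) (q : H X Y), bd _ _ (post _ _ _ g q) = g ⊚ bd _ _ q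
  bd_pre : ∀ {X Y Z : C} (q : H Y Z) (f : X ⟶ Y), bd _ _ (pre _ _ _ q f) = bd _ _ q ⊚ f
  peiffer : ∀ {X Y Z : C} (q : H Y Z) (q' : H X Y),
    post _ _ _ (bd _ _ q) q' = pre _ _ _ q (bd _ _ q')

attribute [reducible, instance] TwoCells.grp TwoCells.mod

open TwoCells

/-- `∂[R] q` is the differential of `q`. -/
notation:max "∂[" S "]" => TwoCells.bd (R := S) _ _

/-- `g ⊳[R] q` is the composite `g q` of a 1-cell and an element of degree `-1`. -/
notation:80 g:81 " ⊳[" S "] " q:80 => TwoCells.post (R := S) _ _ _ g q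

/-- `q ⊲[R] f` is the composite `q f` of an element of degree `-1` and a 1-cell. -/
notation:80 q:81 " ⊲[" S "] " f:80 => TwoCells.pre (R := S) _ _ _ q f

/-- Compatibility of a symmetric monoidal structure on the degree `0` part with the elements of
degree `-1`: the monoidal product is a functor of enriched categories (`wl X q` is `1_X ⊗ q`, `wr Y q`
is `q ⊗ 1_Y`), and associator, unitors and symmetry are natural in the enriched sense. -/
class TwoCellsMonoidal (R : Type*) (C : Type*) [CommRing R] [Category C] [Preadditive C]
    [Linear R C] [MonoidalCategory C] [SymmetricCategory C] [TwoCells R C] where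
  wl (X Y Z : C) : H R Y Z →ₗ[R] H R (X ⊗ Y) (X ⊗ Z)
  wr (X Y Z : C) : H R X Y →ₗ[R] H R (X ⊗ Z) (Y ⊗ Z)
  bd_wl : ∀ (X : C) {Y Z : C} (q : H R Y Z), ∂[R] (wl X _ _ q) = X ◁ ∂[R] q
  bd_wr : ∀ (Z : C) {X Y : C} (q : H R X Y), ∂[R] (wr _ _ Z q) = ∂[R] q ▷ Z
  wl_post : ∀ (W : C) {X Y Z : C} (g : Y ⟶ Z) (q : H R X Y),
    wl W _ _ (g ⊳[R] q) = (W ◁ g) ⊳[R] wl W _ _ q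
  wl_pre : ∀ (W : C) {X Y Z : C} (q : H R Y Z) (f : X ⟶ Y),
    wl W _ _ (q ⊲[R] f) = wl W _ _ q ⊲[R] (W ◁ f)
  wr_post : ∀ (W : C) {X Y Z : C} (g : Y ⟶ Z) (q : H R X Y),
    wr _ _ W (g ⊳[R] q) = (g ▷ W) ⊳[R] wr _ _ W q
  wr_pre : ∀ (W : C) {X Y Z : C} (q : H R Y Z) (f : X ⟶ Y),
    wr _ _ W (q ⊲[R] f) = wr _ _ W q ⊲[R] (f ▷ W)
  wl_exch : ∀ {X X' Y Y' : C} (f : X ⟶ X') (q : H R Y Y'),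
    (f ▷ Y') ⊳[R] wl X _ _ q = wl X' _ _ q ⊲[R] (f ▷ Y)
  wr_exch : ∀ {X X' Y Y' : C} (q : H R X X') (g : Y ⟶ Y'),
    (X' ◁ g) ⊳[R] wr _ _ Y q = wr _ _ Y' q ⊲[R] (X ◁ g)
  assoc_left : ∀ {X X' : C} (q : H R X X') (Y Z : C),
    (α_ X' Y Z).hom ⊳[R] wr _ _ Z (wr _ _ Y q) = wr _ _ (Y ⊗ Z) q ⊲[R] (α_ X Y Z).hom
  assoc_middle : ∀ (X : C) {Y Y' : C} (q : H R Y Y') (Z : C),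
    (α_ X Y' Z).hom ⊳[R] wr _ _ Z (wl X _ _ q) = wl X _ _ (wr _ _ Z q) ⊲[R] (α_ X Y Z).hom
  assoc_right : ∀ (X Y : C) {Z Z' : C} (q : H R Z Z'),
    (α_ X Y Z').hom ⊳[R] wl (X ⊗ Y) _ _ q = wl X _ _ (wl Y _ _ q) ⊲[R] (α_ X Y Z).hom
  unit_left : ∀ {X X' : C} (q : H R X X'),
    (λ_ X').hom ⊳[R] wl (𝟙_ C) _ _ q = q ⊲[R] (λ_ X).hom
  unit_right : ∀ {X X' : C} (q : H R X X'),
    (ρ_ X').hom ⊳[R] wr _ _ (𝟙_ C) q = q ⊲[R] (ρ_ X).hom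
  symm_left : ∀ {X X' : C} (q : H R X X') (Y : C),
    (β_ X' Y).hom ⊳[R] wr _ _ Y q = wl Y _ _ q ⊲[R] (β_ X Y).hom
  symm_right : ∀ (X : C) {Y Y' : C} (q : H R Y Y'),
    (β_ X Y').hom ⊳[R] wl X _ _ q = wr _ _ X q ⊲[R] (β_ X Y).hom

open TwoCellsMonoidal

/-- `f ⊗ʳ[R] q` is `f ⊗ q` for a 1-cell `f` and an element `q` of degree `-1`. -/
notation:90 f:91 " ⊗ʳ[" S "] " q:90 =>
  TwoCells.post (R := S) _ _ _ (f ▷ _) (TwoCellsMonoidal.wl (R := S) _ _ _ q)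

/-- `q ⊗ˡ[R] g` is `q ⊗ g` for an element `q` of degree `-1` and a 1-cell `g`. -/
notation:90 q:91 " ⊗ˡ[" S "] " g:90 =>
  TwoCells.post (R := S) _ _ _ (_ ◁ g) (TwoCellsMonoidal.wr (R := S) _ _ _ q)

section Data

variable {R : Type*} [CommRing R] {C : Type*} [Category C] [Preadditive C] [Linear R C]
  [MonoidalCategory C] [SymmetricCategory C] [TwoCells R C] [TwoCellsMonoidal R C]

local notation:80 g:81 " ⊳ " q:80 => g ⊳[R] q
local notation:80 q:81 " ⊲ " f:80 => q ⊲[R] f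
local notation:90 f:91 " ⊗ʳ " q:90 => f ⊗ʳ[R] q
local notation:90 q:91 " ⊗ˡ " g:90 => q ⊗ˡ[R] g

variable (R C) in
/-- The components of a pseudonatural endomorphism of the monoidal product: the 1-cells
`t.app U V = t_{UV}` and the elements `t.hty f g = t_{f ⊠ g}` of degree `-1`. -/
structure InfData where
  app (U V : C) : U ⊗ V ⟶ U ⊗ V
  hty (U U' V V' : C) : (U ⟶ U') →ₗ[R] (V ⟶ V') →ₗ[R] H R (U ⊗ V) (U' ⊗ V')

namespace InfData

variable (t : InfData R C)

/-- `t_{UV}` is `t.app U V`, and `t.h f g` is `t_{f ⊠ g}`. -/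
abbrev h {U U' V V' : C} (f : U ⟶ U') (g : V ⟶ V') : H R (U ⊗ V) (U' ⊗ V') := t.hty _ _ _ _ f g

/-- `t` is an infinitesimal 2-braiding: a pseudonatural endomorphism of the monoidal product.  The last
six fields say that the homotopy components vanish on the coherence isomorphisms (which are identities
when the monoidal structure is strict). -/
structure IsInfinitesimal2Braiding : Prop where
  natural : ∀ {U U' V V' : C} (f : U ⟶ U') (g : V ⟶ V'),
    (f ⊗ₘ g) ⊚ t.app U V - t.app U' V' ⊚ (f ⊗ₘ g) = ∂[R] (t.h f g)
  natural_left : ∀ {U U' V V' : C} (q : H R U U') (g : V ⟶ V'),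
    (q ⊗ˡ g) ⊲ t.app U V - t.app U' V' ⊳ (q ⊗ˡ g) = t.h (∂[R] q) g
  natural_right : ∀ {U U' V V' : C} (f : U ⟶ U') (q : H R V V'),
    (f ⊗ʳ q) ⊲ t.app U V - t.app U' V' ⊳ (f ⊗ʳ q) = t.h f (∂[R] q)
  unit : ∀ U V : C, t.h (𝟙 U) (𝟙 V) = 0
  comp : ∀ {U U' U'' V V' V'' : C} (f' : U' ⟶ U'') (f : U ⟶ U') (g' : V' ⟶ V'') (g : V ⟶ V'),
    t.h (f' ⊚ f) (g' ⊚ g) = t.h f' g' ⊲ (f ⊗ₘ g) + (f' ⊗ₘ g') ⊳ t.h f g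
  assoc_left : ∀ U V W X : C, t.h (α_ U V W).hom (𝟙 X) = 0
  assoc_right : ∀ U V W X : C, t.h (𝟙 X) (α_ U V W).hom = 0
  leftUnitor_left : ∀ U X : C, t.h (λ_ U).hom (𝟙 X) = 0
  leftUnitor_right : ∀ U X : C, t.h (𝟙 X) (λ_ U).hom = 0
  rightUnitor_left : ∀ U X : C, t.h (ρ_ U).hom (𝟙 X) = 0
  rightUnitor_right : ∀ U X : C, t.h (𝟙 X) (ρ_ U).hom = 0

/-- The left and right infinitesimal hexagon relations, for cochain and homotopy components. -/
structure IsStrict : Prop where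
  left : ∀ U V W : C, (α_ U V W).inv ⊚ t.app U (V ⊗ W) ⊚ (α_ U V W).hom =
    t.app U V ▷ W + ((β_ V U).hom ▷ W) ⊚ (α_ V U W).inv ⊚ (V ◁ t.app U W) ⊚ (α_ V U W).hom ⊚
      ((β_ U V).hom ▷ W)
  left_hty : ∀ {U U' V V' W W' : C} (f : U ⟶ U') (g : V ⟶ V') (k : W ⟶ W'),
    (α_ U' V' W').inv ⊳ t.h f (g ⊗ₘ k) ⊲ (α_ U V W).hom =
    t.h f g ⊗ˡ k + ((β_ V' U').hom ▷ W') ⊳ (α_ V' U' W').inv ⊳ (g ⊗ʳ t.h f k) ⊲ (α_ V U W).hom ⊚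
      ((β_ U V).hom ▷ W)
  right : ∀ U V W : C, (α_ U V W).hom ⊚ t.app (U ⊗ V) W ⊚ (α_ U V W).inv =
    U ◁ t.app V W + (U ◁ (β_ W V).hom) ⊚ (α_ U W V).hom ⊚ (t.app U W ▷ V) ⊚ (α_ U W V).inv ⊚
      (U ◁ (β_ V W).hom)
  right_hty : ∀ {U U' V V' W W' : C} (f : U ⟶ U') (g : V ⟶ V') (k : W ⟶ W'),
    (α_ U' V' W').hom ⊳ t.h (f ⊗ₘ g) k ⊲ (α_ U V W).inv =
    f ⊗ʳ t.h g k + (U' ◁ (β_ W' V').hom) ⊳ (α_ U' W' V').hom ⊳ (t.h f k ⊗ˡ g) ⊲ (α_ U W V).inv ⊚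
      (U ◁ (β_ V W).hom)

structure IsSymmetric : Prop where
  app : ∀ U V : C, (β_ U V).hom ⊚ t.app U V = t.app V U ⊚ (β_ U V).hom
  hty : ∀ {U U' V V' : C} (f : U ⟶ U') (g : V ⟶ V'),
    (β_ U' V').hom ⊳ t.h f g = t.h g f ⊲ (β_ U V).hom

structure IsTotallySymmetric : Prop extends t.IsSymmetric where
  hty_symm : ∀ U V W : C, t.h (β_ U V).hom (𝟙 W) = 0

def IsBreen : Prop := ∀ U V W : C,
  (α_ W V U).hom ⊳ (β_ U (W ⊗ V)).hom ⊳ t.h (𝟙 U) (β_ V W).hom ⊲ (α_ U V W).hom +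
    (β_ (V ⊗ U) W).hom ⊳ t.h (β_ U V).hom (𝟙 W) = 0

/-- The components `L_{UVW} = t_{t_{UV} ⊠ 1_W}` of the left 4-term relationator. -/
def fourTermL (U V W : C) : H R ((U ⊗ V) ⊗ W) ((U ⊗ V) ⊗ W) := t.h (t.app U V) (𝟙 W)

/-- The components `R_{UVW} = t_{1_U ⊠ t_{VW}}` of the right 4-term relationator, transported to
`(U ⊗ V) ⊗ W`. -/
def fourTermR (U V W : C) : H R ((U ⊗ V) ⊗ W) ((U ⊗ V) ⊗ W) :=
  (α_ U V W).inv ⊳ t.h (𝟙 U) (t.app V W) ⊲ (α_ U V W).hom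

structure IsCoherent : Prop where
  left : ∀ U V W : C,
    -(((β_ V U).hom ▷ W) ⊳ t.fourTermR V U W ⊲ ((β_ U V).hom ▷ W)) =
      t.fourTermL U V W + t.fourTermR U V W
  right : ∀ U V W : C,
    t.fourTermL U V W + t.fourTermR U V W =
      -((α_ U V W).inv ⊳ (U ◁ (β_ W V).hom) ⊳ (α_ U W V).hom ⊳ t.fourTermL U W V ⊲
        (α_ U W V).inv ⊚ (U ◁ (β_ V W).hom) ⊚ (α_ U V W).hom)

/-- `T : t ⇛ 0` is a coboundary infinitesimal syllepsis. -/
structure IsCoboundarySyllepsis (T : ∀ U V : C, H R (U ⊗ V) (U ⊗ V)) : Prop where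
  homotopy : ∀ U V : C, ∂[R] (T U V) = t.app U V
  quasinatural : ∀ {U U' V V' : C} (f : U ⟶ U') (g : V ⟶ V'),
    (f ⊗ₘ g) ⊳ T U V - T U' V' ⊲ (f ⊗ₘ g) = t.h f g
  left : ∀ U V W : C, (α_ U V W).inv ⊳ T U (V ⊗ W) ⊲ (α_ U V W).hom =
    wr _ _ W (T U V) + ((β_ V U).hom ▷ W) ⊳ (α_ V U W).inv ⊳ wl V _ _ (T U W) ⊲ (α_ V U W).hom ⊚
      ((β_ U V).hom ▷ W)
  right : ∀ U V W : C, (α_ U V W).hom ⊳ T (U ⊗ V) W ⊲ (α_ U V W).inv =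
    wl U _ _ (T V W) + (U ◁ (β_ W V).hom) ⊳ (α_ U W V).hom ⊳ wr _ _ V (T U W) ⊲ (α_ U W V).inv ⊚
      (U ◁ (β_ V W).hom)
  symmetric : ∀ U V : C, T U V = (β_ V U).hom ⊳ T V U ⊲ (β_ U V).hom

end InfData

variable (R C) in
/-- The data of a braided structure with trivial pentagonator on the monoidal product of `C`: the
associator `as` with inverse `asInv` and homotopy components `asHty f g k = α_{f ⊠ g ⊠ k}`, the braiding
`br` with inverse `brInv` and homotopy components `brHty f g = σ_{f ⊠ g}`, and the components of the
left and right hexagonators. -/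
structure BraidedData where
  as (U V W : C) : (U ⊗ V) ⊗ W ⟶ U ⊗ (V ⊗ W)
  asInv (U V W : C) : U ⊗ (V ⊗ W) ⟶ (U ⊗ V) ⊗ W
  asHty {U U' V V' W W' : C} (f : U ⟶ U') (g : V ⟶ V') (k : W ⟶ W') :
    H R ((U ⊗ V) ⊗ W) (U' ⊗ (V' ⊗ W'))
  br (U V : C) : U ⊗ V ⟶ V ⊗ U
  brInv (U V : C) : V ⊗ U ⟶ U ⊗ V
  brHty {U U' V V' : C} (f : U ⟶ U') (g : V ⟶ V') : H R (U ⊗ V) (V' ⊗ U')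
  hexL (U V W : C) : H R ((U ⊗ V) ⊗ W) (V ⊗ (W ⊗ U))
  hexR (U V W : C) : H R (U ⊗ (V ⊗ W)) ((W ⊗ U) ⊗ V)

namespace BraidedData

variable (B : BraidedData R C)

/-- Homotopy components of the inverse of the associator. -/
def asInvHty {U U' V V' W W' : C} (f : U ⟶ U') (g : V ⟶ V') (k : W ⟶ W') :
    H R (U ⊗ (V ⊗ W)) ((U' ⊗ V') ⊗ W') :=
  -(B.asInv U' V' W' ⊳ B.asHty f g k ⊲ B.asInv U V W)

/-- Homotopy components of the inverse of the braiding. -/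
def brInvHty {U U' V V' : C} (f : U ⟶ U') (g : V ⟶ V') : H R (V ⊗ U) (U' ⊗ V') :=
  -(B.brInv U' V' ⊳ B.brHty f g ⊲ B.brInv U V)

/-- Components of the inverse of the left hexagonator. -/
def hexLInv (U V W : C) : H R (V ⊗ (W ⊗ U)) ((U ⊗ V) ⊗ W) :=
  -((B.asInv U V W ⊚ B.brInv U (V ⊗ W) ⊚ B.asInv V W U) ⊳ B.hexL U V W ⊲
    (B.brInv U V ▷ W) ⊚ B.asInv V U W ⊚ (V ◁ B.brInv U W))

/-- Components of the inverse of the right hexagonator. -/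
def hexRInv (U V W : C) : H R ((W ⊗ U) ⊗ V) (U ⊗ (V ⊗ W)) :=
  -((B.as U V W ⊚ B.brInv (U ⊗ V) W ⊚ B.as W U V) ⊳ B.hexR U V W ⊲
    (U ◁ B.brInv V W) ⊚ B.as U W V ⊚ (B.brInv U W ▷ V))

/-- The associator is a pseudonatural isomorphism from `(U V) W` to `U (V W)`. -/
structure AssociatorLaws : Prop where
  as_inv_comp : ∀ U V W : C, B.asInv U V W ⊚ B.as U V W = 𝟙 _
  as_comp_inv : ∀ U V W : C, B.as U V W ⊚ B.asInv U V W = 𝟙 _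
  as_linear_left : ∀ {U U' V V' W W' : C} (g : V ⟶ V') (k : W ⟶ W'),
    IsLinearMap R fun f : U ⟶ U' => B.asHty f g k
  as_linear_middle : ∀ {U U' V V' W W' : C} (f : U ⟶ U') (k : W ⟶ W'),
    IsLinearMap R fun g : V ⟶ V' => B.asHty f g k
  as_linear_right : ∀ {U U' V V' W W' : C} (f : U ⟶ U') (g : V ⟶ V'),
    IsLinearMap R fun k : W ⟶ W' => B.asHty f g k
  as_natural : ∀ {U U' V V' W W' : C} (f : U ⟶ U') (g : V ⟶ V') (k : W ⟶ W'),
    (f ⊗ₘ (g ⊗ₘ k)) ⊚ B.as U V W - B.as U' V' W' ⊚ ((f ⊗ₘ g) ⊗ₘ k) = ∂[R] (B.asHty f g k)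
  as_natural_left : ∀ {U U' V V' W W' : C} (q : H R U U') (g : V ⟶ V') (k : W ⟶ W'),
    (q ⊗ˡ (g ⊗ₘ k)) ⊲ B.as U V W - B.as U' V' W' ⊳ ((q ⊗ˡ g) ⊗ˡ k) = B.asHty (∂[R] q) g k
  as_natural_middle : ∀ {U U' V V' W W' : C} (f : U ⟶ U') (q : H R V V') (k : W ⟶ W'),
    (f ⊗ʳ (q ⊗ˡ k)) ⊲ B.as U V W - B.as U' V' W' ⊳ ((f ⊗ʳ q) ⊗ˡ k) = B.asHty f (∂[R] q) k
  as_natural_right : ∀ {U U' V V' W W' : C} (f : U ⟶ U') (g : V ⟶ V') (q : H R W W'),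
    (f ⊗ʳ (g ⊗ʳ q)) ⊲ B.as U V W - B.as U' V' W' ⊳ ((f ⊗ₘ g) ⊗ʳ q) = B.asHty f g (∂[R] q)
  as_unit : ∀ U V W : C, B.asHty (𝟙 U) (𝟙 V) (𝟙 W) = 0
  as_comp : ∀ {U U' U'' V V' V'' W W' W'' : C} (f' : U' ⟶ U'') (f : U ⟶ U') (g' : V' ⟶ V'')
    (g : V ⟶ V') (k' : W' ⟶ W'') (k : W ⟶ W'),
    B.asHty (f' ⊚ f) (g' ⊚ g) (k' ⊚ k) =
      B.asHty f' g' k' ⊲ ((f ⊗ₘ g) ⊗ₘ k) + (f' ⊗ₘ (g' ⊗ₘ k')) ⊳ B.asHty f g k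

/-- Pentagonal strictly-unital monoidal structure: the pentagon (cochain and homotopy components),
the associahedron with trivial pentagonator, and the triangle (cochain and homotopy components). -/
structure IsPentagonal : Prop extends B.AssociatorLaws where
  pentagon : ∀ U V W X : C,
    (U ◁ B.as V W X) ⊚ B.as U (V ⊗ W) X ⊚ (B.as U V W ▷ X) =
      B.as U V (W ⊗ X) ⊚ B.as (U ⊗ V) W X
  pentagon_hty : ∀ {U U' V V' W W' X X' : C} (f : U ⟶ U') (g : V ⟶ V') (k : W ⟶ W') (x : X ⟶ X'),
    (f ⊗ʳ B.asHty g k x) ⊲ B.as U (V ⊗ W) X ⊚ (B.as U V W ▷ X) +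
      (U' ◁ B.as V' W' X') ⊳ B.asHty f (g ⊗ₘ k) x ⊲ (B.as U V W ▷ X) +
      (U' ◁ B.as V' W' X') ⊳ B.as U' (V' ⊗ W') X' ⊳ (B.asHty f g k ⊗ˡ x) =
    B.asHty f g (k ⊗ₘ x) ⊲ B.as (U ⊗ V) W X + B.as U' V' (W' ⊗ X') ⊳ B.asHty (f ⊗ₘ g) k x
  associahedron : ∀ U V W X Y : C,
    B.asHty (𝟙 U) (𝟙 V) (B.as W X Y) ⊲ B.as (U ⊗ V) (W ⊗ X) Y ⊚ (B.as (U ⊗ V) W X ▷ Y) +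
      (U ◁ B.as V W (X ⊗ Y)) ⊳ B.as U (V ⊗ W) (X ⊗ Y) ⊳ B.asHty (B.as U V W) (𝟙 X) (𝟙 Y) +
      (U ◁ (V ◁ B.as W X Y)) ⊳ (U ◁ B.as V (W ⊗ X) Y) ⊳ B.asHty (𝟙 U) (B.as V W X) (𝟙 Y) ⊲
        (B.as U (V ⊗ W) X ▷ Y) ⊚ ((B.as U V W ▷ X) ▷ Y) = 0
  triangle : ∀ U V : C, (U ◁ (λ_ V).hom) ⊚ B.as U (𝟙_ C) V = (ρ_ U).hom ▷ V
  triangle_hty : ∀ {U U' V V' : C} (f : U ⟶ U') (g : V ⟶ V'), B.asHty f (𝟙 (𝟙_ C)) g = 0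

/-- The braiding is a pseudonatural isomorphism from `U V` to `V U`. -/
structure BraidingLaws : Prop where
  br_inv_comp : ∀ U V : C, B.brInv U V ⊚ B.br U V = 𝟙 _
  br_comp_inv : ∀ U V : C, B.br U V ⊚ B.brInv U V = 𝟙 _
  br_linear_left : ∀ {U U' V V' : C} (g : V ⟶ V'), IsLinearMap R fun f : U ⟶ U' => B.brHty f g
  br_linear_right : ∀ {U U' V V' : C} (f : U ⟶ U'), IsLinearMap R fun g : V ⟶ V' => B.brHty f g
  br_natural : ∀ {U U' V V' : C} (f : U ⟶ U') (g : V ⟶ V'),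
    (g ⊗ₘ f) ⊚ B.br U V - B.br U' V' ⊚ (f ⊗ₘ g) = ∂[R] (B.brHty f g)
  br_natural_left : ∀ {U U' V V' : C} (q : H R U U') (g : V ⟶ V'),
    (g ⊗ʳ q) ⊲ B.br U V - B.br U' V' ⊳ (q ⊗ˡ g) = B.brHty (∂[R] q) g
  br_natural_right : ∀ {U U' V V' : C} (f : U ⟶ U') (q : H R V V'),
    (q ⊗ˡ f) ⊲ B.br U V - B.br U' V' ⊳ (f ⊗ʳ q) = B.brHty f (∂[R] q)
  br_unit : ∀ U V : C, B.brHty (𝟙 U) (𝟙 V) = 0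
  br_comp : ∀ {U U' U'' V V' V'' : C} (f' : U' ⟶ U'') (f : U ⟶ U') (g' : V' ⟶ V'') (g : V ⟶ V'),
    B.brHty (f' ⊚ f) (g' ⊚ g) = B.brHty f' g' ⊲ (f ⊗ₘ g) + (g' ⊗ₘ f') ⊳ B.brHty f g

/-- The left hexagonator is a modification from `α_{231} σ_{1(23)} α_{123}` to `σ_{13} α_{213} σ_{12}`
and the right hexagonator is a modification from `α⁻¹_{312} σ_{(12)3} α⁻¹_{123}` to
`σ_{13} α⁻¹_{132} σ_{23}`. -/
structure HexagonatorLaws : Prop where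
  hex_left : ∀ U V W : C, ∂[R] (B.hexL U V W) =
    B.as V W U ⊚ B.br U (V ⊗ W) ⊚ B.as U V W -
      (V ◁ B.br U W) ⊚ B.as V U W ⊚ (B.br U V ▷ W)
  hex_left_quasinatural : ∀ {U U' V V' W W' : C} (f : U ⟶ U') (g : V ⟶ V') (k : W ⟶ W'),
    B.hexL U' V' W' ⊲ ((f ⊗ₘ g) ⊗ₘ k) +
      (B.asHty g k f ⊲ B.br U (V ⊗ W) ⊚ B.as U V W +
        B.as V' W' U' ⊳ B.brHty f (g ⊗ₘ k) ⊲ B.as U V W +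
        B.as V' W' U' ⊳ B.br U' (V' ⊗ W') ⊳ B.asHty f g k) =
    ((g ⊗ʳ B.brHty f k) ⊲ B.as V U W ⊚ (B.br U V ▷ W) +
        (V' ◁ B.br U' W') ⊳ B.asHty g f k ⊲ (B.br U V ▷ W) +
        (V' ◁ B.br U' W') ⊳ B.as V' U' W' ⊳ (B.brHty f g ⊗ˡ k)) +
      (g ⊗ₘ (k ⊗ₘ f)) ⊳ B.hexL U V W
  hex_right : ∀ U V W : C, ∂[R] (B.hexR U V W) =
    B.asInv W U V ⊚ B.br (U ⊗ V) W ⊚ B.asInv U V W -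
      (B.br U W ▷ V) ⊚ B.asInv U W V ⊚ (U ◁ B.br V W)
  hex_right_quasinatural : ∀ {U U' V V' W W' : C} (f : U ⟶ U') (g : V ⟶ V') (k : W ⟶ W'),
    B.hexR U' V' W' ⊲ (f ⊗ₘ (g ⊗ₘ k)) +
      (B.asInvHty k f g ⊲ B.br (U ⊗ V) W ⊚ B.asInv U V W +
        B.asInv W' U' V' ⊳ B.brHty (f ⊗ₘ g) k ⊲ B.asInv U V W +
        B.asInv W' U' V' ⊳ B.br (U' ⊗ V') W' ⊳ B.asInvHty f g k) =
    ((B.brHty f k ⊗ˡ g) ⊲ B.asInv U W V ⊚ (U ◁ B.br V W) +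
        (B.br U' W' ▷ V') ⊳ B.asInvHty f k g ⊲ (U ◁ B.br V W) +
        (B.br U' W' ▷ V') ⊳ B.asInv U' W' V' ⊳ (f ⊗ʳ B.brHty g k)) +
      ((k ⊗ₘ f) ⊗ₘ g) ⊳ B.hexR U V W

/-- A braided pentagonal strictly-unital monoidal structure: the pentagonator is trivial, and the left
and right tetrahedra, the hexahedron and the Breen polytope commute. -/
structure IsBraided : Prop extends B.IsPentagonal, B.BraidingLaws, B.HexagonatorLaws where
  leftTetrahedron : ∀ U V W X : C,
    (V ◁ B.as W X U) ⊳ B.as V (W ⊗ X) U ⊳ B.brHty (𝟙 U) (B.as V W X) ⊲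
        B.as U (V ⊗ W) X ⊚ (B.as U V W ▷ X) +
      (V ◁ B.as W X U) ⊳ B.hexL U V (W ⊗ X) ⊲ B.as (U ⊗ V) W X +
      (V ◁ (B.as W X U ⊚ B.br U (W ⊗ X))) ⊳ B.as V U (W ⊗ X) ⊳ B.asHty (B.br U V) (𝟙 W) (𝟙 X) =
    B.as V W (X ⊗ U) ⊳ B.hexL U (V ⊗ W) X ⊲ (B.as U V W ▷ X) -
      (V ◁ ((W ◁ B.br U X) ⊚ B.as W U X)) ⊳ B.asHty (𝟙 V) (B.br U W) (𝟙 X) ⊲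
        ((B.as V U W ⊚ (B.br U V ▷ W)) ▷ X) -
      B.asHty (𝟙 V) (𝟙 W) (B.br U X) ⊲ B.as (V ⊗ W) U X ⊚ ((B.br U (V ⊗ W) ⊚ B.as U V W) ▷ X) +
      (V ◁ ((W ◁ B.br U X) ⊚ B.as W U X)) ⊳ B.as V (W ⊗ U) X ⊳ wr _ _ X (B.hexL U V W) -
      wl V _ _ (B.hexL U W X) ⊲ B.as V (U ⊗ W) X ⊚ ((B.as V U W ⊚ (B.br U V ▷ W)) ▷ X)
  rightTetrahedron : ∀ U V W X : C,
    (B.asInv X U V ▷ W) ⊳ B.asInv X (U ⊗ V) W ⊳ B.brHty (B.asInv U V W) (𝟙 X) ⊲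
        B.asInv U (V ⊗ W) X ⊚ (U ◁ B.asInv V W X) +
      (B.asInv X U V ▷ W) ⊳ B.hexR (U ⊗ V) W X ⊲ B.asInv U V (W ⊗ X) +
      ((B.asInv X U V ⊚ B.br (U ⊗ V) X) ▷ W) ⊳ B.asInv (U ⊗ V) X W ⊳
        B.asInvHty (𝟙 U) (𝟙 V) (B.br W X) =
    B.asInv (X ⊗ U) V W ⊳ B.hexR U (V ⊗ W) X ⊲ (U ◁ B.asInv V W X) -
      (((B.br U X ▷ V) ⊚ B.asInv U X V) ▷ W) ⊳ B.asInvHty (𝟙 U) (B.br V X) (𝟙 W) ⊲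
        (U ◁ (B.asInv V X W ⊚ (V ◁ B.br W X))) -
      B.asInvHty (B.br U X) (𝟙 V) (𝟙 W) ⊲ B.asInv U X (V ⊗ W) ⊚
        (U ◁ (B.br (V ⊗ W) X ⊚ B.asInv V W X)) +
      (((B.br U X ▷ V) ⊚ B.asInv U X V) ▷ W) ⊳ B.asInv U (X ⊗ V) W ⊳ wl U _ _ (B.hexR V W X) -
      wr _ _ W (B.hexR U V X) ⊲ B.asInv U (V ⊗ X) W ⊚ (U ◁ (B.asInv V X W ⊚ (V ◁ B.br W X)))
  hexahedron : ∀ U V W X : C,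
    B.as W (X ⊗ U) V ⊳ (B.as W X U ▷ V) ⊳ B.hexR U V (W ⊗ X) ⊲
        (U ◁ B.as V W X) ⊚ B.as U (V ⊗ W) X -
      (W ◁ B.asInv X U V) ⊳ B.hexL (U ⊗ V) W X ⊲ (B.asInv U V W ▷ X) =
    wl W _ _ (B.hexR U V X) ⊲ B.as W U (V ⊗ X) ⊚ B.as (W ⊗ U) V X ⊚
        ((B.asInv W U V ⊚ B.br (U ⊗ V) W ⊚ B.asInv U V W) ▷ X) +
      (W ◁ ((B.br U X ▷ V) ⊚ B.asInv U X V ⊚ (U ◁ B.br V X))) ⊳ B.as W U (V ⊗ X) ⊳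
        (B.as (W ⊗ U) V X ⊳ wr _ _ X (B.hexR U V W) -
          B.asHty (B.br U W) (𝟙 V) (𝟙 X) ⊲ ((B.asInv U W V ⊚ (U ◁ B.br V W)) ▷ X)) +
      (W ◁ ((B.br U X ▷ V) ⊚ B.asInv U X V)) ⊳ B.asHty (𝟙 W) (𝟙 U) (B.br V X) ⊲
        (B.br U W ▷ (V ⊗ X)) ⊚ B.as (U ⊗ W) V X ⊚ ((B.asInv U W V ⊚ (U ◁ B.br V W)) ▷ X) +
      B.asHty (𝟙 W) (B.br U X) (𝟙 V) ⊲ (B.as W U X ▷ V) ⊚ B.asInv (W ⊗ U) X V ⊚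
        (B.br U W ⊗ₘ B.br V X) ⊚ B.as (U ⊗ W) V X ⊚ ((B.asInv U W V ⊚ (U ◁ B.br V W)) ▷ X) -
      B.as W (X ⊗ U) V ⊳ (((W ◁ B.br U X) ⊚ B.as W U X) ▷ V) ⊳ B.asInv (W ⊗ U) X V ⊳
        (B.br U W ⊗ₘ B.br V X) ⊳ B.asInv U W (V ⊗ X) ⊳ (U ◁ B.as W V X) ⊳
        B.asHty (𝟙 U) (B.br V W) (𝟙 X) -
      B.as W (X ⊗ U) V ⊳ (((W ◁ B.br U X) ⊚ B.as W U X) ▷ V) ⊳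
        B.asInvHty (B.br U W) (𝟙 X) (𝟙 V) ⊲ ((U ⊗ W) ◁ B.br V X) ⊚ B.asInv U W (V ⊗ X) ⊚
        (U ◁ (B.as W V X ⊚ (B.br V W ▷ X))) ⊚ B.as U (V ⊗ W) X +
      B.as W (X ⊗ U) V ⊳ (((W ◁ B.br U X) ⊚ B.as W U X ⊚ (B.br U W ▷ X)) ▷ V) ⊳
        B.asInv (U ⊗ W) X V ⊳ B.asInvHty (𝟙 U) (𝟙 W) (B.br V X) ⊲
        (U ◁ (B.as W V X ⊚ (B.br V W ▷ X))) ⊚ B.as U (V ⊗ W) X -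
      B.as W (X ⊗ U) V ⊳ wr _ _ V (B.hexL U W X) ⊲ B.asInv (U ⊗ W) X V ⊚ B.asInv U W (X ⊗ V) ⊚
        (U ◁ ((W ◁ B.br V X) ⊚ B.as W V X ⊚ (B.br V W ▷ X))) ⊚ B.as U (V ⊗ W) X -
      B.as W (X ⊗ U) V ⊳ ((B.as W X U ⊚ B.br U (W ⊗ X) ⊚ B.as U W X) ▷ V) ⊳
        B.asInv (U ⊗ W) X V ⊳ B.asInv U W (X ⊗ V) ⊳ wl U _ _ (B.hexL V W X) ⊲ B.as U (V ⊗ W) X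
  breen : ∀ U V W : C,
    -(B.as W V U ⊳ (B.br V W ▷ U) ⊳ B.asInv V W U ⊳ B.hexL U V W) +
      B.as W V U ⊳ B.brHty (𝟙 U) (B.br V W) ⊲ B.as U V W +
      B.hexL U W V ⊲ B.asInv U W V ⊚ (U ◁ B.br V W) ⊚ B.as U V W =
    -(B.as W V U ⊳ B.hexR V U W ⊲ B.as V U W ⊚ (B.br U V ▷ W)) -
      B.brHty (B.br U V) (𝟙 W) +
      (W ◁ B.br U V) ⊳ B.as W U V ⊳ B.hexR U V W ⊲ B.as U V W

/-- `S : σ ⇛ σ⁻¹ τ` is a syllepsis. -/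
structure IsSyllepsis (S : ∀ U V : C, H R (U ⊗ V) (V ⊗ U)) : Prop where
  homotopy : ∀ U V : C, ∂[R] (S U V) = B.br U V - B.brInv V U
  quasinatural : ∀ {U U' V V' : C} (f : U ⟶ U') (g : V ⟶ V'),
    S U' V' ⊲ (f ⊗ₘ g) + B.brHty f g = B.brInvHty g f + (g ⊗ₘ f) ⊳ S U V
  left : ∀ U V W : C, B.hexL U V W =
    B.as V W U ⊳ S U (V ⊗ W) ⊲ B.as U V W + B.hexRInv V W U -
      (V ◁ B.brInv W U) ⊳ B.as V U W ⊳ wr _ _ W (S U V) -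
      wl V _ _ (S U W) ⊲ B.as V U W ⊚ (B.br U V ▷ W)
  right : ∀ U V W : C, B.hexR U V W =
    B.asInv W U V ⊳ S (U ⊗ V) W ⊲ B.asInv U V W + B.hexLInv W U V -
      (B.brInv W U ▷ V) ⊳ B.asInv U W V ⊳ wl U _ _ (S V W) -
      wr _ _ V (S U W) ⊲ B.asInv U W V ⊚ (U ◁ B.br V W)

structure IsSymmetricSyllepsis (S : ∀ U V : C, H R (U ⊗ V) (V ⊗ U)) : Prop extends
    B.IsSyllepsis S where
  symmetric : ∀ U V : C, S U V = B.brInv V U ⊳ S V U ⊲ B.br U V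

end BraidedData

namespace InfData

variable (t : InfData R C)

/-- The braiding `γ (1 + (c/2) t)` with trivial associator and hexagonators. -/
noncomputable def firstOrder (K : Type*) [Field K] [Algebra K R] (c : R) : BraidedData R C where
  as U V W := (α_ U V W).hom
  asInv U V W := (α_ U V W).inv
  asHty _ _ _ := 0
  br U V := (β_ U V).hom ⊚ (𝟙 _ + (algebraMap K R (1 / 2) * c) • t.app U V)
  brInv U V := (𝟙 _ - (algebraMap K R (1 / 2) * c) • t.app U V) ⊚ (β_ U V).inv
  brHty {_ U' _ V'} f g := (β_ U' V').hom ⊳ ((algebraMap K R (1 / 2) * c) • t.h f g)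
  hexL _ _ _ := 0
  hexR _ _ _ := 0

/-- `t_{23}` transported to `(U ⊗ V) ⊗ W`. -/
def app23 (U V W : C) : (U ⊗ V) ⊗ W ⟶ (U ⊗ V) ⊗ W :=
  (α_ U V W).inv ⊚ (U ◁ t.app V W) ⊚ (α_ U V W).hom

/-- The cochain components of `[t_{12}, t_{23}]`. -/
def comm (U V W : C) : (U ⊗ V) ⊗ W ⟶ (U ⊗ V) ⊗ W :=
  (t.app U V ▷ W) ⊚ t.app23 U V W - t.app23 U V W ⊚ (t.app U V ▷ W)

/-- The homotopy components of `[t_{12}, t_{23}]`. -/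
def commHty {U U' V V' W W' : C} (f : U ⟶ U') (g : V ⟶ V') (k : W ⟶ W') :
    H R ((U ⊗ V) ⊗ W) ((U' ⊗ V') ⊗ W') :=
  ((t.h f g ⊗ˡ k) ⊲ t.app23 U V W +
      (t.app U' V' ▷ W') ⊳ (α_ U' V' W').inv ⊳ (f ⊗ʳ t.h g k) ⊲ (α_ U V W).hom) -
    (((α_ U' V' W').inv ⊳ (f ⊗ʳ t.h g k) ⊲ (α_ U V W).hom ⊚ (t.app U V ▷ W)) +
      t.app23 U' V' W' ⊳ (t.h f g ⊗ˡ k))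

/-- The associator `1 + (c²/24) [t_{12}, t_{23}]`, the braiding `γ (1 + (c/2) t + (c²/8) t²)` and the
hexagonators `(c²/24) γ_{1(23)} (2 L + R)` and `(c²/24) γ_{(12)3} (L + 2 R)`. -/
noncomputable def secondOrder (K : Type*) [Field K] [Algebra K R] (c : R) : BraidedData R C where
  as U V W := (α_ U V W).hom ⊚ (𝟙 _ + (algebraMap K R (1 / 24) * c ^ 2) • t.comm U V W)
  asInv U V W := (𝟙 _ - (algebraMap K R (1 / 24) * c ^ 2) • t.comm U V W) ⊚ (α_ U V W).inv
  asHty {_ U' _ V' _ W'} f g k :=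
    (α_ U' V' W').hom ⊳ ((algebraMap K R (1 / 24) * c ^ 2) • t.commHty f g k)
  br U V := (β_ U V).hom ⊚ (𝟙 _ + (algebraMap K R (1 / 2) * c) • t.app U V +
    (algebraMap K R (1 / 8) * c ^ 2) • (t.app U V ⊚ t.app U V))
  brInv U V := (𝟙 _ - (algebraMap K R (1 / 2) * c) • t.app U V +
    (algebraMap K R (1 / 8) * c ^ 2) • (t.app U V ⊚ t.app U V)) ⊚ (β_ U V).inv
  brHty {U U' V V'} f g := (β_ U' V').hom ⊳ ((algebraMap K R (1 / 2) * c) • t.h f g +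
    (algebraMap K R (1 / 8) * c ^ 2) • (t.h f g ⊲ t.app U V + t.app U' V' ⊳ t.h f g))
  hexL U V W := (α_ V W U).hom ⊳ (β_ U (V ⊗ W)).hom ⊳ (α_ U V W).hom ⊳
    ((algebraMap K R (1 / 24) * c ^ 2) • ((2 : R) • t.fourTermL U V W + t.fourTermR U V W))
  hexR U V W := (α_ W U V).inv ⊳ (β_ (U ⊗ V) W).hom ⊳
    ((algebraMap K R (1 / 24) * c ^ 2) • (t.fourTermL U V W + (2 : R) • t.fourTermR U V W)) ⊲
      (α_ U V W).inv

/-- The family `c γ T`. -/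
def syllepsisOf (c : R) (T : ∀ U V : C, H R (U ⊗ V) (U ⊗ V)) (U V : C) : H R (U ⊗ V) (V ⊗ U) :=
  c • (β_ U V).hom ⊳ T U V

end InfData
end Data

/-- A monoidal category from the laws of its whiskerings. -/
@[reducible] def monoidalOfWhiskers {C : Type*} [Category C] (S : MonoidalCategoryStruct C)
    (tensor_def : ∀ {X X' Y Y' : C} (f : X ⟶ X') (g : Y ⟶ Y'), f ⊗ₘ g = f ▷ Y ≫ X' ◁ g)
    (wl_id : ∀ X Y : C, X ◁ 𝟙 Y = 𝟙 (X ⊗ Y)) (wr_id : ∀ X Y : C, 𝟙 X ▷ Y = 𝟙 (X ⊗ Y))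
    (wl_comp : ∀ (X : C) {Y Y' Y'' : C} (f : Y ⟶ Y') (g : Y' ⟶ Y''),
      X ◁ (f ≫ g) = X ◁ f ≫ X ◁ g)
    (wr_comp : ∀ {X X' X'' : C} (f : X ⟶ X') (g : X' ⟶ X'') (Y : C),
      (f ≫ g) ▷ Y = f ▷ Y ≫ g ▷ Y)
    (exch : ∀ {X X' Y Y' : C} (f : X ⟶ X') (g : Y ⟶ Y'), X ◁ g ≫ f ▷ Y' = f ▷ Y ≫ X' ◁ g)
    (assoc_left : ∀ {X X' : C} (f : X ⟶ X') (Y Z : C),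
      (f ▷ Y) ▷ Z ≫ (α_ X' Y Z).hom = (α_ X Y Z).hom ≫ f ▷ (Y ⊗ Z))
    (assoc_middle : ∀ (X : C) {Y Y' : C} (f : Y ⟶ Y') (Z : C),
      (X ◁ f) ▷ Z ≫ (α_ X Y' Z).hom = (α_ X Y Z).hom ≫ X ◁ (f ▷ Z))
    (assoc_right : ∀ (X Y : C) {Z Z' : C} (f : Z ⟶ Z'),
      (X ⊗ Y) ◁ f ≫ (α_ X Y Z').hom = (α_ X Y Z).hom ≫ X ◁ (Y ◁ f))
    (unit_left : ∀ {X X' : C} (f : X ⟶ X'), 𝟙_ C ◁ f ≫ (λ_ X').hom = (λ_ X).hom ≫ f)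
    (unit_right : ∀ {X X' : C} (f : X ⟶ X'), f ▷ 𝟙_ C ≫ (ρ_ X').hom = (ρ_ X).hom ≫ f)
    (pentagon : ∀ W X Y Z : C,
      (α_ W X Y).hom ▷ Z ≫ (α_ W (X ⊗ Y) Z).hom ≫ W ◁ (α_ X Y Z).hom =
        (α_ (W ⊗ X) Y Z).hom ≫ (α_ W X (Y ⊗ Z)).hom)
    (triangle : ∀ X Y : C, (α_ X (𝟙_ C) Y).hom ≫ X ◁ (λ_ Y).hom = (ρ_ X).hom ▷ Y) :
    MonoidalCategory C where
  tensorHom_def := tensor_def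
  id_tensorHom_id X Y := by rw [tensor_def, wl_id, wr_id, Category.comp_id]
  tensorHom_comp_tensorHom f₁ f₂ g₁ g₂ := by
    simp only [tensor_def, wl_comp, wr_comp, Category.assoc]
    rw [← Category.assoc (_ ◁ f₂), exch, Category.assoc]
  whiskerLeft_id := wl_id
  id_whiskerRight := wr_id
  associator_naturality f₁ f₂ f₃ := by
    simp only [tensor_def, wl_comp, wr_comp, Category.assoc]
    rw [assoc_right, ← Category.assoc ((_ ◁ f₂) ▷ _), assoc_middle, Category.assoc,
      ← Category.assoc ((f₁ ▷ _) ▷ _), assoc_left, Category.assoc]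
  leftUnitor_naturality := unit_left
  rightUnitor_naturality := unit_right
  pentagon := pentagon
  triangle := triangle

section BilinearExtension

variable {K : Type*} (A : Type*) [CommRing K] [CommRing A] [Algebra K A]
variable {M N P Q S : Type*} [AddCommGroup M] [AddCommGroup N] [AddCommGroup P] [AddCommGroup Q]
  [AddCommGroup S] [Module K M] [Module K N] [Module K P] [Module K Q] [Module K S]

/-- The `A`-bilinear extension of a `K`-bilinear map. -/
noncomputable def ext2 (B : M →ₗ[K] N →ₗ[K] P) : A ⊗[K] M →ₗ[A] A ⊗[K] N →ₗ[A] A ⊗[K] P :=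
  ((LinearMap.baseChangeHom K A N P).restrictScalars K ∘ₗ B).liftBaseChange A

@[simp] theorem ext2_tmul (B : M →ₗ[K] N →ₗ[K] P) (a b : A) (x : M) (y : N) :
    ext2 A B (a ⊗ₜ x) (b ⊗ₜ y) = (a * b) ⊗ₜ B x y := by
  simp [ext2, TensorProduct.smul_tmul']

theorem ext2_assoc {T : Type*} [AddCommGroup T] [Module K T] (B₁ : P →ₗ[K] Q →ₗ[K] S)
    (B₂ : M →ₗ[K] N →ₗ[K] P) (B₃ : M →ₗ[K] T →ₗ[K] S) (B₄ : N →ₗ[K] Q →ₗ[K] T)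
    (h : ∀ x y z, B₁ (B₂ x y) z = B₃ x (B₄ y z)) (x : A ⊗[K] M) (y : A ⊗[K] N) (z : A ⊗[K] Q) :
    ext2 A B₁ (ext2 A B₂ x y) z = ext2 A B₃ x (ext2 A B₄ y z) := by
  induction x with
  | zero => simp
  | add x₁ x₂ h₁ h₂ => simp only [map_add, LinearMap.add_apply, h₁, h₂]
  | tmul a x =>
    induction y with
    | zero => simp
    | add x₁ x₂ h₁ h₂ => simp only [map_add, LinearMap.add_apply, h₁, h₂]
    | tmul b y =>
      induction z with
      | zero => simp
      | add x₁ x₂ h₁ h₂ => simp only [map_add, h₁, h₂]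
      | tmul c z => simp [h, mul_assoc]

theorem ext2_flip (B : M →ₗ[K] N →ₗ[K] P) (x : A ⊗[K] M) (y : A ⊗[K] N) :
    ext2 A B x y = ext2 A B.flip y x := by
  induction x with
  | zero => simp
  | add x₁ x₂ h₁ h₂ => simp only [map_add, LinearMap.add_apply, h₁, h₂]
  | tmul a x =>
    induction y with
    | zero => simp
    | add x₁ x₂ h₁ h₂ => simp only [map_add, LinearMap.add_apply, h₁, h₂]
    | tmul b y => simp [mul_comm]

theorem ext2_map (f : P →ₗ[K] S) (f₁ : M →ₗ[K] Q) {T : Type*} [AddCommGroup T] [Module K T]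
    (f₂ : N →ₗ[K] T) (B : M →ₗ[K] N →ₗ[K] P) (B' : Q →ₗ[K] T →ₗ[K] S)
    (h : ∀ x y, f (B x y) = B' (f₁ x) (f₂ y)) (x : A ⊗[K] M) (y : A ⊗[K] N) :
    f.baseChange A (ext2 A B x y) = ext2 A B' (f₁.baseChange A x) (f₂.baseChange A y) := by
  induction x with
  | zero => simp
  | add x₁ x₂ h₁ h₂ => simp only [map_add, LinearMap.add_apply, h₁, h₂]
  | tmul a x =>
    induction y with
    | zero => simp
    | add x₁ x₂ h₁ h₂ => simp only [map_add, h₁, h₂]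
    | tmul b y => simp [h]

theorem ext2_swap {T U : Type*} [AddCommGroup T] [Module K T] [AddCommGroup U] [Module K U]
    (f₁ : M →ₗ[K] P) (f₂ : N →ₗ[K] Q) (f₃ : N →ₗ[K] T) (f₄ : M →ₗ[K] U)
    (B : P →ₗ[K] Q →ₗ[K] S) (B' : T →ₗ[K] U →ₗ[K] S)
    (h : ∀ x y, B (f₁ x) (f₂ y) = B' (f₃ y) (f₄ x)) (x : A ⊗[K] M) (y : A ⊗[K] N) :
    ext2 A B (f₁.baseChange A x) (f₂.baseChange A y) =
      ext2 A B' (f₃.baseChange A y) (f₄.baseChange A x) := by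
  induction x with
  | zero => simp
  | add x₁ x₂ h₁ h₂ => simp only [map_add, LinearMap.add_apply, h₁, h₂]
  | tmul a x =>
    induction y with
    | zero => simp
    | add x₁ x₂ h₁ h₂ => simp only [map_add, LinearMap.add_apply, h₁, h₂]
    | tmul b y => simp [h, mul_comm]

theorem ext2_nat (F : A ⊗[K] M →ₗ[A] A ⊗[K] N) (G : A ⊗[K] M →ₗ[A] A ⊗[K] Q) (p : P)
    (B : N →ₗ[K] P →ₗ[K] S) {T : Type*} [AddCommGroup T] [Module K T] (p' : T)
    (B' : T →ₗ[K] Q →ₗ[K] S)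
    (h : ∀ x, ext2 A B (F (1 ⊗ₜ x)) (1 ⊗ₜ p) = ext2 A B' (1 ⊗ₜ p') (G (1 ⊗ₜ x)))
    (x : A ⊗[K] M) : ext2 A B (F x) (1 ⊗ₜ p) = ext2 A B' (1 ⊗ₜ p') (G x) := by
  induction x with
  | zero => simp
  | add x₁ x₂ h₁ h₂ => simp only [map_add, LinearMap.add_apply, h₁, h₂]
  | tmul a x =>
    have e : a ⊗ₜ[K] x = a • ((1 : A) ⊗ₜ[K] x) := by simp [TensorProduct.smul_tmul']
    rw [e, map_smul, map_smul, map_smul, map_smul, LinearMap.smul_apply, h]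

theorem ext2_nat' (F : A ⊗[K] M →ₗ[A] A ⊗[K] N) (G : A ⊗[K] M →ₗ[A] A ⊗[K] Q) (p : P)
    (B : P →ₗ[K] N →ₗ[K] S) {T : Type*} [AddCommGroup T] [Module K T] (p' : T)
    (B' : Q →ₗ[K] T →ₗ[K] S)
    (h : ∀ x, ext2 A B (1 ⊗ₜ p) (F (1 ⊗ₜ x)) = ext2 A B' (G (1 ⊗ₜ x)) (1 ⊗ₜ p'))
    (x : A ⊗[K] M) : ext2 A B (1 ⊗ₜ p) (F x) = ext2 A B' (G x) (1 ⊗ₜ p') := by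
  rw [ext2_flip A B, ext2_flip A B']
  refine ext2_nat A F G p _ p' _ (fun x => ?_) x
  rw [← ext2_flip, ← ext2_flip, h]

theorem baseChange_comm (f₁ : N →ₗ[K] S) (g₁ : M →ₗ[K] N) (f₂ : P →ₗ[K] S) (g₂ : M →ₗ[K] P)
    (h : ∀ x, f₁ (g₁ x) = f₂ (g₂ x)) (x : A ⊗[K] M) :
    f₁.baseChange A (g₁.baseChange A x) = f₂.baseChange A (g₂.baseChange A x) := by
  rw [← LinearMap.comp_apply, ← LinearMap.comp_apply, ← LinearMap.baseChange_comp,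
    ← LinearMap.baseChange_comp, LinearMap.ext (f := f₁ ∘ₗ g₁) (g := f₂ ∘ₗ g₂) h]

theorem ext2_one_left (m : M) (B : M →ₗ[K] N →ₗ[K] N) (h : ∀ x, B m x = x) (x : A ⊗[K] N) :
    ext2 A B (1 ⊗ₜ m) x = x := by
  induction x with
  | zero => simp
  | add x₁ x₂ h₁ h₂ => simp only [map_add, h₁, h₂]
  | tmul a x => simp [h]

theorem ext2_one_right (n : N) (B : M →ₗ[K] N →ₗ[K] M) (h : ∀ x, B x n = x) (x : A ⊗[K] M) :
    ext2 A B x (1 ⊗ₜ n) = x := by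
  induction x with
  | zero => simp
  | add x₁ x₂ h₁ h₂ => simp only [map_add, LinearMap.add_apply, h₁, h₂]
  | tmul a x => simp [h]

end BilinearExtension

section BaseChange

/-- The category with the same objects as `C` and with the hom complexes tensored with `A` over `K`. -/
structure BaseChange (K A C : Type*) where
  of : C

variable {K A C : Type*} [Field K] [CommRing A] [Algebra K A] [Category C] [Preadditive C]
  [Linear K C]

noncomputable instance : Category (BaseChange K A C) where
  Hom X Y := A ⊗[K] (X.of ⟶ Y.of)
  id X := 1 ⊗ₜ 𝟙 X.of
  comp f g := ext2 A (Linear.comp (S := K) _ _ _) f g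
  id_comp f := ext2_one_left A _ _ (by simp) f
  comp_id f := ext2_one_right A _ _ (by simp) f
  assoc f g h := ext2_assoc A _ _ _ _ (by simp) f g h

namespace BaseChange

/-- The image of a 1-cell of `C`. -/
noncomputable def ι {X Y : C} (f : X ⟶ Y) :
    (⟨X⟩ : BaseChange K A C) ⟶ (⟨Y⟩ : BaseChange K A C) :=
  ((1 : A) ⊗ₜ[K] f : A ⊗[K] (X ⟶ Y))

noncomputable instance : Preadditive (BaseChange K A C) where
  homGroup X Y := inferInstanceAs (AddCommGroup (A ⊗[K] (X.of ⟶ Y.of)))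
  add_comp _ _ _ f f' g := LinearMap.map_add₂ (ext2 A (Linear.comp (S := K) _ _ _)) f f' g
  comp_add _ _ _ f g g' := (ext2 A (Linear.comp (S := K) _ _ _) f).map_add g g'

noncomputable instance : Linear A (BaseChange K A C) where
  homModule X Y := inferInstanceAs (Module A (A ⊗[K] (X.of ⟶ Y.of)))
  smul_comp _ _ _ r f g := LinearMap.map_smul₂ (ext2 A (Linear.comp (S := K) _ _ _)) r f g
  comp_smul _ _ _ f r g := (ext2 A (Linear.comp (S := K) _ _ _) f).map_smul r g

theorem comp_def {X Y Z : BaseChange K A C} (f : X ⟶ Y) (g : Y ⟶ Z) :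
    f ≫ g = ext2 A (Linear.comp (S := K) X.of Y.of Z.of) f g := rfl

theorem ι_comp {X Y Z : C} (f : X ⟶ Y) (g : Y ⟶ Z) :
    (ι (f ≫ g) : (⟨X⟩ : BaseChange K A C) ⟶ ⟨Z⟩) = ι f ≫ ι g := by
  simp [ι, comp_def]

/-- The image of an isomorphism of `C`. -/
@[simps] noncomputable def ιIso {X Y : C} (e : X ≅ Y) : (⟨X⟩ : BaseChange K A C) ≅ ⟨Y⟩ where
  hom := ι e.hom
  inv := ι e.inv
  hom_inv_id := by rw [← ι_comp, e.hom_inv_id]; rfl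
  inv_hom_id := by rw [← ι_comp, e.inv_hom_id]; rfl

section Monoidal

variable [MonoidalCategory C] [MonoidalPreadditive C] [MonoidalLinear K C]

/-- Left whiskering as a linear map. -/
def wlLin (X Y Z : C) : (Y ⟶ Z) →ₗ[K] (X ⊗ Y ⟶ X ⊗ Z) where
  toFun f := X ◁ f
  map_add' := by simp
  map_smul' := by simp

/-- Right whiskering as a linear map. -/
def wrLin (X Y Z : C) : (X ⟶ Y) →ₗ[K] (X ⊗ Z ⟶ Y ⊗ Z) where
  toFun f := f ▷ Z
  map_add' := by simp
  map_smul' := by simp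

noncomputable instance : MonoidalCategoryStruct (BaseChange K A C) where
  tensorObj X Y := ⟨X.of ⊗ Y.of⟩
  whiskerLeft X _ _ f := (wlLin (K := K) X.of _ _).baseChange A f
  whiskerRight f Y := (wrLin (K := K) _ _ Y.of).baseChange A f
  tensorUnit := ⟨𝟙_ C⟩
  associator X Y Z := ιIso (α_ X.of Y.of Z.of)
  leftUnitor X := ιIso (λ_ X.of)
  rightUnitor X := ιIso (ρ_ X.of)

theorem wl_ι (X : BaseChange K A C) {Y Z : C} (f : Y ⟶ Z) :
    X ◁ (ι f : (⟨Y⟩ : BaseChange K A C) ⟶ ⟨Z⟩) = ι (X.of ◁ f) := rfl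

theorem wr_ι {X Y : C} (f : X ⟶ Y) (Z : BaseChange K A C) :
    (ι f : (⟨X⟩ : BaseChange K A C) ⟶ ⟨Y⟩) ▷ Z = ι (f ▷ Z.of) := rfl

noncomputable instance : MonoidalCategory (BaseChange K A C) :=
  monoidalOfWhiskers inferInstance
    (tensor_def := fun _ _ => rfl)
    (wl_id := fun X Y => congrArg ι (whiskerLeft_id X.of Y.of))
    (wr_id := fun X Y => congrArg ι (id_whiskerRight X.of Y.of))
    (wl_comp := fun X _ _ _ f g => ext2_map A _ _ _ _ _ (by simp [wlLin]) f g)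
    (wr_comp := fun f g X => ext2_map A _ _ _ _ _ (by simp [wrLin]) f g)
    (exch := fun f g =>
      (ext2_swap A _ _ _ _ _ _ (by simp [wlLin, wrLin, whisker_exchange]) f g).symm)
    (assoc_left := fun f Y Z => ext2_nat A ((wrLin _ _ Z.of).baseChange A ∘ₗ
      (wrLin _ _ Y.of).baseChange A) ((wrLin _ _ (Y.of ⊗ Z.of)).baseChange A)
      _ _ _ _ (by simp [wrLin]) f)
    (assoc_middle := fun X _ _ f Z => ext2_nat A ((wrLin _ _ Z.of).baseChange A ∘ₗ
      (wlLin X.of _ _).baseChange A) ((wlLin X.of _ _).baseChange A ∘ₗ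
      (wrLin _ _ Z.of).baseChange A) _ _ _ _ (by simp [wrLin, wlLin]) f)
    (assoc_right := fun X Y _ _ f => ext2_nat A ((wlLin (X.of ⊗ Y.of) _ _).baseChange A)
      ((wlLin X.of _ _).baseChange A ∘ₗ (wlLin Y.of _ _).baseChange A)
      _ _ _ _ (by simp [wlLin]) f)
    (unit_left := fun f => ext2_nat A ((wlLin (𝟙_ C) _ _).baseChange A) LinearMap.id
      _ _ _ _ (by simp [wlLin]) f)
    (unit_right := fun f => ext2_nat A ((wrLin _ _ (𝟙_ C)).baseChange A) LinearMap.id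
      _ _ _ _ (by simp [wrLin]) f)
    (pentagon := fun W X Y Z => by
      have h := congrArg (ι (K := K) (A := A)) (MonoidalCategory.pentagon W.of X.of Y.of Z.of)
      rwa [ι_comp, ι_comp, ι_comp] at h)
    (triangle := fun X Y => by
      have h := congrArg (ι (K := K) (A := A)) (MonoidalCategory.triangle X.of Y.of)
      rwa [ι_comp] at h)

instance : MonoidalPreadditive (BaseChange K A C) where
  whiskerLeft_zero := map_zero (LinearMap.baseChange A _)
  zero_whiskerRight := map_zero (LinearMap.baseChange A _)
  whiskerLeft_add f g := map_add (LinearMap.baseChange A _) f g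
  add_whiskerRight f g := map_add (LinearMap.baseChange A _) f g

instance : MonoidalLinear A (BaseChange K A C) where
  whiskerLeft_smul _ _ _ r f := map_smul (LinearMap.baseChange A _) r f
  smul_whiskerRight r _ _ f _ := map_smul (LinearMap.baseChange A _) r f

noncomputable instance [SymmetricCategory C] : SymmetricCategory (BaseChange K A C) where
  braiding X Y := ιIso (β_ X.of Y.of)
  braiding_naturality_right X _ _ f := ext2_nat A ((wlLin X.of _ _).baseChange A)
    ((wrLin _ _ X.of).baseChange A) _ _ _ _ (by simp [wlLin, wrLin]) f
  braiding_naturality_left f X := ext2_nat A ((wrLin _ _ X.of).baseChange A)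
    ((wlLin X.of _ _).baseChange A) _ _ _ _ (by simp [wlLin, wrLin]) f
  hexagon_forward X Y Z := by
    have h := congrArg (ι (K := K) (A := A)) (hexagon_forward X.of Y.of Z.of)
    rwa [ι_comp, ι_comp, ι_comp, ι_comp] at h
  hexagon_reverse X Y Z := by
    have h := congrArg (ι (K := K) (A := A)) (hexagon_reverse X.of Y.of Z.of)
    rwa [ι_comp, ι_comp, ι_comp, ι_comp] at h
  symmetry X Y := by
    have h := congrArg (ι (K := K) (A := A)) (SymmetricCategory.symmetry X.of Y.of)
    rwa [ι_comp] at h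

theorem braiding_hom [SymmetricCategory C] (X Y : BaseChange K A C) :
    (β_ X Y).hom = ι (β_ X.of Y.of).hom := rfl

end Monoidal

noncomputable instance [TwoCells K C] : TwoCells A (BaseChange K A C) where
  H X Y := A ⊗[K] H K X.of Y.of
  bd X Y := (bd (R := K) X.of Y.of).baseChange A
  post X Y Z := ext2 A (post (R := K) X.of Y.of Z.of)
  pre X Y Z := ext2 A (pre (R := K) X.of Y.of Z.of)
  post_id q := ext2_one_left A _ _ post_id q
  pre_id q := ext2_one_right A _ _ pre_id q
  post_comp g' g q := by
    change ext2 A _ (ext2 A (Linear.comp (S := K) _ _ _) g g') q =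
      ext2 A (post (R := K) _ _ _) g' (ext2 A (post (R := K) _ _ _) g q)
    rw [ext2_flip A (Linear.comp (S := K) _ _ _)]
    refine ext2_assoc A (post (R := K) _ _ _) (Linear.comp (S := K) _ _ _).flip
      (post (R := K) _ _ _) (post (R := K) _ _ _) ?_ g' g q
    intro g' g q
    exact post_comp g' g q
  pre_comp q f f' := by
    change ext2 A (pre (R := K) _ _ _) (ext2 A (pre (R := K) _ _ _) q f) f' =
      ext2 A _ q (ext2 A (Linear.comp (S := K) _ _ _) f' f)
    rw [ext2_flip A (Linear.comp (S := K) _ _ _)]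
    refine ext2_assoc A (pre (R := K) _ _ _) (pre (R := K) _ _ _) (pre (R := K) _ _ _)
      (Linear.comp (S := K) _ _ _).flip ?_ q f f'
    intro q f f'
    exact pre_comp q f f'
  post_pre g q f := ext2_assoc A _ _ _ _ (fun g q f => post_pre g q f) g q f
  bd_post g q := by
    have h := ext2_map A (bd (R := K) _ _) LinearMap.id (bd (R := K) _ _) (post (R := K) _ _ _)
      (Linear.comp (S := K) _ _ _).flip (fun g q => bd_post g q) g q
    rw [← ext2_flip, LinearMap.baseChange_id] at h
    exact h
  bd_pre q f := by
    have h := ext2_map A (bd (R := K) _ _) (bd (R := K) _ _) LinearMap.id (pre (R := K) _ _ _)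
      (Linear.comp (S := K) _ _ _).flip (fun q f => bd_pre q f) q f
    rw [← ext2_flip, LinearMap.baseChange_id] at h
    exact h
  peiffer {X Y Z} q q' := by
    change ext2 A (post (R := K) X.of Y.of Z.of) ((bd (R := K) Y.of Z.of).baseChange A q) q' =
      ext2 A (pre (R := K) X.of Y.of Z.of) q ((bd (R := K) X.of Y.of).baseChange A q')
    have h := ext2_swap A (bd (R := K) Y.of Z.of) (LinearMap.id (R := K) (M := H K X.of Y.of))
      (bd (R := K) X.of Y.of) (LinearMap.id (R := K) (M := H K Y.of Z.of))
      (post (R := K) X.of Y.of Z.of) (pre (R := K) X.of Y.of Z.of).flip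
      (by intro q q'; exact peiffer q q') q q'
    rw [← ext2_flip, LinearMap.baseChange_id, LinearMap.baseChange_id] at h
    exact h

theorem wl_def [MonoidalCategory C] [MonoidalPreadditive C] [MonoidalLinear K C]
    (X : BaseChange K A C) {Y Z : BaseChange K A C} (f : Y ⟶ Z) :
    X ◁ f = (wlLin (K := K) X.of _ _).baseChange A f := rfl

end BaseChange
end BaseChange

section BaseChange
variable {K A C : Type*} [Field K] [CommRing A] [Algebra K A] [Category C] [Preadditive C]
  [Linear K C]
namespace BaseChange
set_option maxHeartbeats 1000000 in
noncomputable instance [MonoidalCategory C] [MonoidalPreadditive C] [MonoidalLinear K C]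
    [SymmetricCategory C] [TwoCells K C] [TwoCellsMonoidal K C] :
    TwoCellsMonoidal A (BaseChange K A C) where
  wl X Y Z := (wl (R := K) X.of Y.of Z.of).baseChange A
  wr X Y Z := (wr (R := K) X.of Y.of Z.of).baseChange A
  bd_wl X Y Z q := baseChange_comm A (bd (R := K) _ _) (wl (R := K) X.of Y.of Z.of)
    (wlLin X.of Y.of Z.of) (bd (R := K) Y.of Z.of) (fun q => bd_wl X.of q) q
  bd_wr Z X Y q := baseChange_comm A (bd (R := K) _ _) (wr (R := K) X.of Y.of Z.of)
    (wrLin X.of Y.of Z.of) (bd (R := K) X.of Y.of) (fun q => bd_wr Z.of q) q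
  wl_post W _ _ _ g q := ext2_map A (wl (R := K) W.of _ _) (wlLin W.of _ _) (wl (R := K) W.of _ _)
    (post (R := K) _ _ _) (post (R := K) _ _ _) (fun g q => wl_post W.of g q) g q
  wl_pre W _ _ _ q f := ext2_map A (wl (R := K) W.of _ _) (wl (R := K) W.of _ _) (wlLin W.of _ _)
    (pre (R := K) _ _ _) (pre (R := K) _ _ _) (fun q f => wl_pre W.of q f) q f
  wr_post W _ _ _ g q := ext2_map A (wr (R := K) _ _ W.of) (wrLin _ _ W.of) (wr (R := K) _ _ W.of)
    (post (R := K) _ _ _) (post (R := K) _ _ _) (fun g q => wr_post W.of g q) g q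
  wr_pre W _ _ _ q f := ext2_map A (wr (R := K) _ _ W.of) (wr (R := K) _ _ W.of) (wrLin _ _ W.of)
    (pre (R := K) _ _ _) (pre (R := K) _ _ _) (fun q f => wr_pre W.of q f) q f
  wl_exch {X X' Y Y'} f q := ext2_swap A (wrLin _ _ Y'.of) (wl (R := K) X.of _ _)
    (wl (R := K) X'.of _ _) (wrLin _ _ Y.of)
    (post (R := K) _ _ _) (pre (R := K) _ _ _) (fun f q => wl_exch f q) f q
  wr_exch {X X' Y Y'} q g := ext2_swap A (wlLin X'.of _ _) (wr (R := K) _ _ Y.of)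
    (wr (R := K) _ _ Y'.of) (wlLin X.of _ _)
    (post (R := K) _ _ _) (pre (R := K) _ _ _) (fun g q => wr_exch q g) g q
  assoc_left q Y Z := ext2_nat' A
    ((wr (R := K) _ _ Z.of).baseChange A ∘ₗ (wr (R := K) _ _ Y.of).baseChange A)
    ((wr (R := K) _ _ (Y.of ⊗ Z.of)).baseChange A) _ (post (R := K) _ _ _) _ (pre (R := K) _ _ _)
    (by simp [assoc_left]) q
  assoc_middle X _ _ q Z := ext2_nat' A
    ((wr (R := K) _ _ Z.of).baseChange A ∘ₗ (wl (R := K) X.of _ _).baseChange A)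
    ((wl (R := K) X.of _ _).baseChange A ∘ₗ (wr (R := K) _ _ Z.of).baseChange A)
    _ (post (R := K) _ _ _) _ (pre (R := K) _ _ _) (by simp [assoc_middle]) q
  assoc_right X Y _ _ q := ext2_nat' A ((wl (R := K) (X.of ⊗ Y.of) _ _).baseChange A)
    ((wl (R := K) X.of _ _).baseChange A ∘ₗ (wl (R := K) Y.of _ _).baseChange A)
    _ (post (R := K) _ _ _) _ (pre (R := K) _ _ _) (by simp [assoc_right]) q
  unit_left {X X'} q := ext2_nat' A ((wl (R := K) (𝟙_ C) X.of X'.of).baseChange A)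
    (LinearMap.id (R := A) (M := A ⊗[K] H K X.of X'.of)) (λ_ X'.of).hom
    (post (R := K) (𝟙_ C ⊗ X.of) (𝟙_ C ⊗ X'.of) X'.of) (λ_ X.of).hom
    (pre (R := K) (𝟙_ C ⊗ X.of) X.of X'.of)
    (fun q => by simp only [LinearMap.baseChange_tmul, ext2_tmul, unit_left, LinearMap.id_apply]) q
  unit_right {X X'} q := ext2_nat' A ((wr (R := K) X.of X'.of (𝟙_ C)).baseChange A)
    (LinearMap.id (R := A) (M := A ⊗[K] H K X.of X'.of)) (ρ_ X'.of).hom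
    (post (R := K) (X.of ⊗ 𝟙_ C) (X'.of ⊗ 𝟙_ C) X'.of) (ρ_ X.of).hom
    (pre (R := K) (X.of ⊗ 𝟙_ C) X.of X'.of)
    (fun q => by simp only [LinearMap.baseChange_tmul, ext2_tmul, unit_right, LinearMap.id_apply]) q
  symm_left {X X'} q Y := by
    simp only [braiding_hom]
    refine ext2_nat' A ((wr (R := K) X.of X'.of Y.of).baseChange A)
      ((wl (R := K) Y.of X.of X'.of).baseChange A) (β_ X'.of Y.of).hom
      (post (R := K) (X.of ⊗ Y.of) (X'.of ⊗ Y.of) (Y.of ⊗ X'.of)) (β_ X.of Y.of).hom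
      (pre (R := K) (X.of ⊗ Y.of) (Y.of ⊗ X.of) (Y.of ⊗ X'.of)) (fun q => ?_) q
    simp only [LinearMap.baseChange_tmul, ext2_tmul, symm_left]
  symm_right X {Y Y'} q := by
    simp only [braiding_hom]
    refine ext2_nat' A ((wl (R := K) X.of Y.of Y'.of).baseChange A)
      ((wr (R := K) Y.of Y'.of X.of).baseChange A) (β_ X.of Y'.of).hom
      (post (R := K) (X.of ⊗ Y.of) (X.of ⊗ Y'.of) (Y'.of ⊗ X.of)) (β_ X.of Y.of).hom
      (pre (R := K) (X.of ⊗ Y.of) (Y.of ⊗ X.of) (Y'.of ⊗ X.of)) (fun q => ?_) q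
    simp only [LinearMap.baseChange_tmul, ext2_tmul, symm_right]

end BaseChange

/-- The `A`-bilinear extension of a pseudonatural endomorphism of the monoidal product. -/
noncomputable def InfData.baseChange (A : Type*) [CommRing A] [Algebra K A]
    [MonoidalCategory C] [MonoidalPreadditive C]
    [MonoidalLinear K C] [SymmetricCategory C] [TwoCells K C] [TwoCellsMonoidal K C]
    (t : InfData K C) : InfData A (BaseChange K A C) where
  app U V := BaseChange.ι (t.app U.of V.of)
  hty U U' V V' := (ext2 A (t.hty U.of U'.of V.of V'.of) :
    A ⊗[K] (U.of ⟶ U'.of) →ₗ[A] A ⊗[K] (V.of ⟶ V'.of) →ₗ[A]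
      A ⊗[K] H K (U.of ⊗ V.of) (U'.of ⊗ V'.of))

/-- The image of a family of elements of degree `-1`. -/
noncomputable def twoBaseChange (A : Type*) [CommRing A] [Algebra K A] [MonoidalCategory C]
    [MonoidalPreadditive C]
    [MonoidalLinear K C] [SymmetricCategory C] [TwoCells K C] [TwoCellsMonoidal K C]
    (T : ∀ U V : C, H K (U ⊗ V) (U ⊗ V)) (U V : BaseChange K A C) :
    H A (U ⊗ V) (U ⊗ V) :=
  ((1 : A) ⊗ₜ[K] T U.of V.of : A ⊗[K] H K (U.of ⊗ V.of) (U.of ⊗ V.of))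

/-- The truncated polynomial ring `K[h]/(h^n)`. -/
abbrev Trunc (K : Type*) [Field K] (n : ℕ) : Type _ :=
  AdjoinRoot ((Polynomial.X : Polynomial K) ^ n)

/-- The deformation parameter `h` in `K[h]/(h^n)`. -/
noncomputable abbrev Trunc.h (K : Type*) [Field K] (n : ℕ) : Trunc K n := AdjoinRoot.root _

end BaseChange

section Deformations

variable {K C : Type*} [Field K] [Category C] [Preadditive C] [Linear K C] [MonoidalCategory C]
  [MonoidalPreadditive C] [MonoidalLinear K C] [SymmetricCategory C] [TwoCells K C]
  [TwoCellsMonoidal K C]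

/-- The first-order deformation: over `K[h]/(h^2)`, with the braiding `γ (1 + (h/2) t)`. -/
noncomputable def InfData.deform1 (t : InfData K C) :
    BraidedData (Trunc K 2) (BaseChange K (Trunc K 2) C) :=
  (t.baseChange (Trunc K 2)).firstOrder K (Trunc.h K 2)

/-- The second-order deformation: over `K[h]/(h^3)`, with the associator, braiding and hexagonators of
`InfData.secondOrder`. -/
noncomputable def InfData.deform2 (t : InfData K C) :
    BraidedData (Trunc K 3) (BaseChange K (Trunc K 3) C) :=
  (t.baseChange (Trunc K 3)).secondOrder K (Trunc.h K 3)

/-- The family `Σ = h γ T` over `K[h]/(h^n)`. -/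
noncomputable def deformSyllepsis (n : ℕ) (T : ∀ U V : C, H K (U ⊗ V) (U ⊗ V))
    (U V : BaseChange K (Trunc K n) C) : H (Trunc K n) (U ⊗ V) (V ⊗ U) :=
  InfData.syllepsisOf (Trunc.h K n) (twoBaseChange (Trunc K n) T) U V

end Deformations

section Algebra

variable (K : Type*) [Field K]

/-- The sign `(-1)^n` as an element of `K`. -/
def sg (n : ℤ) : K := ((n.negOnePow : ℤ) : K)

variable {K}

theorem sg_zero : sg K 0 = 1 := by simp [sg]

theorem sg_add (m n : ℤ) : sg K (m + n) = sg K m * sg K n := by simp [sg, Int.negOnePow_add]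

theorem sg_congr {m n : ℤ} (r : ℤ) (h : m = n + 2 * r) : sg K m = sg K n := by
  have e : Even (m - n) := ⟨r, by rw [h]; ring⟩
  rw [sg, (Int.negOnePow_eq_iff m n).2 e, sg]

theorem sg_sq (n : ℤ) : sg K n * sg K n = 1 := by
  rw [← sg_add, ← sg_zero]; exact sg_congr n (by ring)

theorem sg_one : sg K 1 = -1 := by simp [sg]

variable {N : ℕ} (K) (deg : Fin N → ℤ)

/-- The relations `x_p x_q = (-1)^{|x_p| |x_q|} x_q x_p`. -/
inductive FreeGC.Rel : FreeAlgebra K (Fin N) → FreeAlgebra K (Fin N) → Prop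
  | comm (p q : Fin N) : FreeGC.Rel (FreeAlgebra.ι K p * FreeAlgebra.ι K q)
      (sg K (deg p * deg q) • (FreeAlgebra.ι K q * FreeAlgebra.ι K p))

/-- The free graded-commutative `K`-algebra on generators `x_p` of degree `deg p`. -/
def FreeGC : Type _ := RingQuot (FreeGC.Rel K deg)

namespace FreeGC

instance : Ring (FreeGC K deg) := inferInstanceAs (Ring (RingQuot (FreeGC.Rel K deg)))
instance : Algebra K (FreeGC K deg) := inferInstanceAs (Algebra K (RingQuot (FreeGC.Rel K deg)))

/-- The generators. -/
def x (p : Fin N) : FreeGC K deg := RingQuot.mkAlgHom K (FreeGC.Rel K deg) (FreeAlgebra.ι K p)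

/-- The homogeneous elements of degree `i`. -/
def gr (i : ℤ) : Submodule K (FreeGC K deg) :=
  Submodule.span K {a | ∃ l : List (Fin N), (l.map deg).sum = i ∧ a = (l.map (x K deg)).prod}

variable {K deg}

theorem gr_induction {i : ℤ} {P : ∀ a : FreeGC K deg, a ∈ gr K deg i → Prop}
    (zero : P 0 (zero_mem _))
    (add : ∀ a b ha hb, P a ha → P b hb → P (a + b) (add_mem ha hb))
    (smul : ∀ (c : K) a ha, P a ha → P (c • a) (Submodule.smul_mem _ c ha))
    (list : ∀ (l : List (Fin N)) (hl : (l.map deg).sum = i),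
      P (l.map (x K deg)).prod (Submodule.subset_span ⟨l, hl, rfl⟩))
    (a : FreeGC K deg) (ha : a ∈ gr K deg i) : P a ha := by
  induction ha using Submodule.span_induction with
  | mem a h => obtain ⟨l, hl, rfl⟩ := h; exact list l hl
  | zero => exact zero
  | add a b _ _ h₁ h₂ => exact add a b _ _ h₁ h₂
  | smul c a _ h => exact smul c a _ h

theorem list_mem (l : List (Fin N)) : (l.map (x K deg)).prod ∈ gr K deg (l.map deg).sum :=
  Submodule.subset_span ⟨l, rfl, rfl⟩

theorem x_mem (p : Fin N) : x K deg p ∈ gr K deg (deg p) := by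
  simpa using list_mem (K := K) (deg := deg) [p]

theorem one_mem : (1 : FreeGC K deg) ∈ gr K deg 0 := by
  simpa using list_mem (K := K) (deg := deg) []

theorem mul_mem {i j : ℤ} {a b : FreeGC K deg} (ha : a ∈ gr K deg i) (hb : b ∈ gr K deg j) :
    a * b ∈ gr K deg (i + j) := by
  induction a, ha using gr_induction with
  | zero => simp
  | add a b _ _ h₁ h₂ => rw [add_mul]; exact add_mem h₁ h₂
  | smul c a _ h => rw [smul_mul_assoc]; exact Submodule.smul_mem _ _ h
  | list l hl =>
    induction b, hb using gr_induction with
    | zero => simp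
    | add a b _ _ h₁ h₂ => rw [mul_add]; exact add_mem h₁ h₂
    | smul c a _ h => rw [mul_smul_comm]; exact Submodule.smul_mem _ _ h
    | list l' hl' =>
      subst hl hl'
      simpa using list_mem (K := K) (deg := deg) (l ++ l')

theorem x_comm (p q : Fin N) :
    x K deg p * x K deg q = sg K (deg p * deg q) • (x K deg q * x K deg p) := by
  have h := RingQuot.mkAlgHom_rel K (FreeGC.Rel.comm (K := K) (deg := deg) p q)
  rw [map_smul, map_mul, map_mul] at h
  exact h

theorem comm {i j : ℤ} {a b : FreeGC K deg} (ha : a ∈ gr K deg i) (hb : b ∈ gr K deg j) :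
    a * b = sg K (i * j) • (b * a) := by
  induction a, ha using gr_induction with
  | zero => simp
  | add a b _ _ h₁ h₂ => rw [add_mul, mul_add, h₁, h₂, smul_add]
  | smul c a _ h => rw [smul_mul_assoc, mul_smul_comm, h, smul_comm]
  | list l hl =>
    induction b, hb using gr_induction with
    | zero => simp
    | add a b _ _ h₁ h₂ => rw [add_mul, mul_add, h₁, h₂, smul_add]
    | smul c a _ h => rw [smul_mul_assoc, mul_smul_comm, h, smul_comm]
    | list l' hl' =>
      subst hl hl'
      induction l with
      | nil => simp [sg_zero]
      | cons p l ih =>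
        have hp : x K deg p * (l'.map (x K deg)).prod =
            sg K (deg p * (l'.map deg).sum) • ((l'.map (x K deg)).prod * x K deg p) := by
          clear ih
          induction l' with
          | nil => simp [sg_zero]
          | cons q l' ih =>
            simp only [List.map_cons, List.prod_cons, List.sum_cons]
            rw [← mul_assoc, x_comm, smul_mul_assoc, mul_assoc, ih, mul_smul_comm, smul_smul,
              ← sg_add, mul_assoc, mul_add]
        simp only [List.map_cons, List.prod_cons, List.sum_cons]
        rw [mul_assoc, ih, mul_smul_comm, ← mul_assoc, hp, smul_mul_assoc, smul_smul, ← sg_add,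
          mul_assoc, add_mul, add_comm]

/-- Two derivations of degree `k` that agree on the generators agree on homogeneous elements. -/
theorem der_ext (k : ℤ) (F G : FreeGC K deg →ₗ[K] FreeGC K deg)
    (hF : ∀ {i j : ℤ} {a b : FreeGC K deg}, a ∈ gr K deg i → b ∈ gr K deg j →
      F (a * b) = F a * b + sg K (k * i) • (a * F b))
    (hG : ∀ {i j : ℤ} {a b : FreeGC K deg}, a ∈ gr K deg i → b ∈ gr K deg j →
      G (a * b) = G a * b + sg K (k * i) • (a * G b))
    (h : ∀ p, F (x K deg p) = G (x K deg p)) {i : ℤ} {a : FreeGC K deg} (ha : a ∈ gr K deg i) :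
    F a = G a := by
  induction a, ha using gr_induction with
  | zero => simp
  | add a b _ _ h₁ h₂ => simp [h₁, h₂]
  | smul c a _ h => simp [h]
  | list l hl =>
    clear hl
    induction l with
    | nil =>
      have h₁ := hF one_mem (one_mem (K := K) (deg := deg))
      have h₂ := hG one_mem (one_mem (K := K) (deg := deg))
      simp only [mul_zero, sg_zero, one_smul, one_mul, mul_one, left_eq_add] at h₁ h₂
      simp [h₁, h₂]
    | cons p l ih =>
      simp only [List.map_cons, List.prod_cons]
      rw [hF (x_mem p) (list_mem l), hG (x_mem p) (list_mem l), ih, h]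

end FreeGC
end Algebra

section Algebra
variable {K : Type*} [Field K] {N : ℕ} {deg : Fin N → ℤ}
namespace FreeGC

theorem derHom_rel (k : ℤ) (v : Fin N → FreeGC K deg) (hv : ∀ p, v p ∈ gr K deg (deg p + k))
    ⦃a b : FreeAlgebra K (Fin N)⦄ (h : Rel K deg a b) :
    FreeAlgebra.lift K (fun p => (!![sg K (k * deg p) • x K deg p, v p; 0, x K deg p] :
      Matrix (Fin 2) (Fin 2) (FreeGC K deg))) a =
    FreeAlgebra.lift K (fun p => (!![sg K (k * deg p) • x K deg p, v p; 0, x K deg p] :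
      Matrix (Fin 2) (Fin 2) (FreeGC K deg))) b := by
  obtain ⟨p, q⟩ := h
  have h₁ : sg K (deg p * (deg q + k)) = sg K (deg p * deg q) * sg K (k * deg p) := by
    rw [← sg_add]; congr 1; ring
  have h₂ : sg K ((deg p + k) * deg q) = sg K (deg p * deg q) * sg K (k * deg q) := by
    rw [← sg_add]; congr 1; ring
  have h₃ : sg K (k * deg p) * sg K (k * deg p) = 1 := sg_sq _
  simp only [map_mul, map_smul, FreeAlgebra.lift_ι_apply]
  ext i j
  fin_cases i <;> fin_cases j <;> simp [Matrix.mul_apply]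
  · rw [x_comm]
    module
  · rw [comm (x_mem p) (hv q), comm (hv p) (x_mem q), h₁, h₂, smul_smul, smul_smul, add_comm]
    congr 2
    linear_combination (sg K (deg p * deg q)) * h₃
  · rw [x_comm]

/-- The algebra morphism `a ↦ [[(-1)^{k|a|} a, D a], [0, a]]`, where `D` is the derivation of degree
`k` with values `v p` on the generators. -/
def derHom (k : ℤ) (v : Fin N → FreeGC K deg) (hv : ∀ p, v p ∈ gr K deg (deg p + k)) :
    FreeGC K deg →ₐ[K] Matrix (Fin 2) (Fin 2) (FreeGC K deg) :=
  RingQuot.liftAlgHom K ⟨FreeAlgebra.lift K fun p =>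
    !![sg K (k * deg p) • x K deg p, v p; 0, x K deg p], derHom_rel k v hv⟩

/-- The derivation of degree `k` with values `v p` on the generators. -/
def der (k : ℤ) (v : Fin N → FreeGC K deg) (hv : ∀ p, v p ∈ gr K deg (deg p + k)) :
    FreeGC K deg →ₗ[K] FreeGC K deg where
  toFun a := derHom k v hv a 0 1
  map_add' := by simp
  map_smul' := by simp

section
variable (k : ℤ) (v : Fin N → FreeGC K deg) (hv : ∀ p, v p ∈ gr K deg (deg p + k))

theorem derHom_x (p : Fin N) :
    derHom k v hv (x K deg p) = !![sg K (k * deg p) • x K deg p, v p; 0, x K deg p] := by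
  have h := RingQuot.liftAlgHom_mkAlgHom_apply K (FreeAlgebra.lift K (fun p =>
    (!![sg K (k * deg p) • x K deg p, v p; 0, x K deg p] :
      Matrix (Fin 2) (Fin 2) (FreeGC K deg)))) (derHom_rel k v hv) (FreeAlgebra.ι K p)
  rw [FreeAlgebra.lift_ι_apply] at h
  exact h

theorem der_x (p : Fin N) : der k v hv (x K deg p) = v p := by
  change derHom k v hv (x K deg p) 0 1 = v p
  rw [derHom_x]; rfl

theorem derHom_entries {i : ℤ} {a : FreeGC K deg} (ha : a ∈ gr K deg i) :
    derHom k v hv a 0 0 = sg K (k * i) • a ∧ derHom k v hv a 1 1 = a := by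
  induction a, ha using gr_induction with
  | zero => simp
  | add a b _ _ h₁ h₂ => simp [h₁, h₂]
  | smul c a _ h => simp [h, smul_comm c]
  | list l hl =>
    have h₁₀ : ∀ l : List (Fin N), derHom k v hv (l.map (x K deg)).prod 1 0 = 0 := by
      intro l
      induction l with
      | nil => simp
      | cons p l ih => simp [Matrix.mul_apply, derHom_x, ih]
    subst hl
    induction l with
    | nil => simp [sg_zero]
    | cons p l ih =>
      simp [Matrix.mul_apply, derHom_x, ih, h₁₀, smul_smul, mul_add, sg_add, mul_comm]

theorem der_mul {i j : ℤ} {a b : FreeGC K deg} (ha : a ∈ gr K deg i) (hb : b ∈ gr K deg j) :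
    der k v hv (a * b) = der k v hv a * b + sg K (k * i) • (a * der k v hv b) := by
  change derHom k v hv (a * b) 0 1 = _
  rw [map_mul, Matrix.mul_apply, Fin.sum_univ_two, (derHom_entries k v hv ha).1,
    (derHom_entries k v hv hb).2, add_comm, smul_mul_assoc]
  rfl

theorem der_one : der k v hv 1 = 0 := by
  change derHom k v hv 1 0 1 = _
  simp

theorem der_mem {i : ℤ} {a : FreeGC K deg} (ha : a ∈ gr K deg i) :
    der k v hv a ∈ gr K deg (i + k) := by
  induction a, ha using gr_induction with
  | zero => simp
  | add a b _ _ h₁ h₂ => rw [map_add]; exact add_mem h₁ h₂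
  | smul c a _ h => rw [map_smul]; exact Submodule.smul_mem _ _ h
  | list l hl =>
    subst hl
    induction l with
    | nil => simp [der_one]
    | cons p l ih =>
      simp only [List.map_cons, List.prod_cons, List.sum_cons]
      rw [der_mul k v hv (x_mem p) (list_mem l), der_x]
      refine add_mem ?_ (Submodule.smul_mem _ _ ?_)
      · have h := mul_mem (hv p) (list_mem (K := K) l)
        rwa [add_right_comm] at h
      · have h := mul_mem (x_mem (K := K) p) ih
        rwa [← add_assoc] at h

end

/-- The partial derivative with respect to `x_p`, a derivation of degree `-|x_p|`. -/
def pd (p : Fin N) : FreeGC K deg →ₗ[K] FreeGC K deg :=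
  der (-deg p) (fun q => if q = p then 1 else 0) fun q => by
    split_ifs with h
    · subst h; simpa using one_mem (K := K) (deg := deg)
    · exact zero_mem _

end FreeGC
end Algebra

open FreeGC

/-- A semi-free commutative differential graded algebra: the free graded-commutative algebra on
finitely many generators, with a differential of degree `1` that is determined by its values `dx p` on
the generators and squares to zero. -/
structure SemiFreeCDGA (K : Type*) [Field K] where
  N : ℕ
  deg : Fin N → ℤ
  dx : Fin N → FreeGC K deg
  dx_mem : ∀ p, dx p ∈ gr K deg (deg p + 1)
  d_dx : ∀ p, der 1 dx dx_mem (dx p) = 0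

namespace SemiFreeCDGA

variable {K : Type*} [Field K] (A : SemiFreeCDGA K)

/-- The underlying algebra. -/
abbrev Alg : Type _ := FreeGC K A.deg

/-- Homogeneous elements of degree `i`. -/
abbrev Gr (i : ℤ) : Submodule K A.Alg := gr K A.deg i

/-- The differential. -/
def d : A.Alg →ₗ[K] A.Alg := der 1 A.dx A.dx_mem

/-- The partial derivative with respect to the generator `x_p`. -/
def pd (p : Fin A.N) : A.Alg →ₗ[K] A.Alg := FreeGC.pd p

variable {A}

theorem d_mem {i : ℤ} {a : A.Alg} (ha : a ∈ A.Gr i) : A.d a ∈ A.Gr (i + 1) := der_mem _ _ _ ha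

theorem d_mul {i j : ℤ} {a b : A.Alg} (ha : a ∈ A.Gr i) (hb : b ∈ A.Gr j) :
    A.d (a * b) = A.d a * b + sg K i • (a * A.d b) := by
  simpa [d] using der_mul 1 A.dx A.dx_mem ha hb

theorem d_one : A.d 1 = 0 := der_one _ _ _

theorem pd_mem (p : Fin A.N) {i : ℤ} {a : A.Alg} (ha : a ∈ A.Gr i) :
    A.pd p a ∈ A.Gr (i - A.deg p) := der_mem _ _ _ ha

theorem pd_mul (p : Fin A.N) {i j : ℤ} {a b : A.Alg} (ha : a ∈ A.Gr i) (hb : b ∈ A.Gr j) :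
    A.pd p (a * b) = A.pd p a * b + sg K (A.deg p * i) • (a * A.pd p b) := by
  have h := der_mul (-A.deg p) _ (fun q => by
    split_ifs with h
    · subst h; simpa using FreeGC.one_mem (K := K) (deg := A.deg)
    · exact zero_mem _ : ∀ q, (if q = p then (1 : A.Alg) else 0) ∈ A.Gr (A.deg q + -A.deg p)) ha hb
  rw [sg_congr (n := A.deg p * i) (-(A.deg p * i)) (by ring)] at h
  exact h

theorem d_d {i : ℤ} {a : A.Alg} (ha : a ∈ A.Gr i) : A.d (A.d a) = 0 := by
  refine der_ext 2 (A.d ∘ₗ A.d) 0 ?_ (by simp) ?_ ha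
  · intro i j a b ha hb
    have h₁ : sg K (i + 1) = - sg K i := by simp [sg_add, sg_one]
    have h₂ : sg K i * sg K i = 1 := sg_sq _
    have h₃ : sg K (2 * i) = 1 := by rw [← sg_zero]; exact sg_congr i (by ring)
    simp only [LinearMap.comp_apply]
    rw [d_mul ha hb, map_add, map_smul, d_mul (d_mem ha) hb, d_mul ha (d_mem hb), h₁, h₃, smul_add,
      smul_smul, h₂]
    module
  · intro p
    have h : A.d (x K A.deg p) = A.dx p := der_x _ _ _ p
    simp only [LinearMap.comp_apply, h]
    exact A.d_dx p

/-- The commutator of `∂_p` and `d`. -/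
theorem pd_d (p : Fin A.N) {i : ℤ} {a : A.Alg} (ha : a ∈ A.Gr i) :
    A.pd p (A.d a) = ∑ r, A.pd p (A.dx r) * A.pd r a + sg K (A.deg p) • A.d (A.pd p a) := by
  have h : (A.pd p ∘ₗ A.d - sg K (A.deg p) • (A.d ∘ₗ A.pd p)) a =
      (∑ r, LinearMap.mulLeft K (A.pd p (A.dx r)) ∘ₗ A.pd r) a := by
    refine der_ext (1 - A.deg p) _ _ ?_ ?_ ?_ ha
    · intro i j a b ha hb
      have h₁ : sg K (A.deg p * (i + 1)) = sg K (A.deg p * i) * sg K (A.deg p) := by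
        rw [← sg_add]; congr 1; ring
      have h₂ : sg K (i - A.deg p) = sg K i * sg K (A.deg p) := by
        rw [← sg_add]; exact sg_congr (-A.deg p) (by ring)
      have h₃ : sg K ((1 - A.deg p) * i) = sg K i * sg K (A.deg p * i) := by
        rw [← sg_add]; exact sg_congr (-(A.deg p * i)) (by ring)
      have h₄ : sg K (A.deg p) * sg K (A.deg p) = 1 := sg_sq _
      simp only [LinearMap.sub_apply, LinearMap.smul_apply, LinearMap.comp_apply]
      rw [d_mul ha hb, pd_mul p ha hb, map_add, map_add, map_smul, map_smul,
        pd_mul p (d_mem ha) hb, pd_mul p ha (d_mem hb), d_mul (pd_mem p ha) hb,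
        d_mul ha (pd_mem p hb), h₁, h₂, h₃, sub_mul, mul_sub, smul_mul_assoc, mul_smul_comm]
      match_scalars <;> first | ring1 | linear_combination (-sg K i) * h₄
    · intro i j a b ha hb
      simp only [LinearMap.sum_apply, LinearMap.comp_apply, LinearMap.mulLeft_apply,
        Finset.sum_mul, Finset.mul_sum, Finset.smul_sum, ← Finset.sum_add_distrib]
      refine Finset.sum_congr rfl fun r _ => ?_
      rw [pd_mul r ha hb, mul_add, mul_smul_comm, ← mul_assoc, ← mul_assoc, ← mul_assoc,
        comm (pd_mem p (A.dx_mem r)) ha, smul_mul_assoc, smul_smul, ← sg_add]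
      congr 2
      exact sg_congr (A.deg r * i) (by ring)
    · intro q
      have h₁ : A.d (x K A.deg q) = A.dx q := der_x _ _ _ q
      have h₂ : ∀ r, A.pd r (x K A.deg q) = if q = r then 1 else 0 := fun r => der_x _ _ _ q
      simp only [LinearMap.sub_apply, LinearMap.smul_apply, LinearMap.comp_apply,
        LinearMap.sum_apply, LinearMap.mulLeft_apply, h₁, h₂]
      split_ifs <;> simp [d_one]
  simp only [LinearMap.sub_apply, LinearMap.smul_apply, LinearMap.comp_apply,
    LinearMap.sum_apply, LinearMap.mulLeft_apply] at h
  rw [← h]; abel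

end SemiFreeCDGA

section Matrices

variable {K : Type*} [Field K] (A : SemiFreeCDGA K)
variable {I J L I' J' : Type} [Fintype I] [Fintype J] [Fintype L] [Fintype I'] [Fintype J']
  [DecidableEq I] [DecidableEq J] [DecidableEq L] [DecidableEq I'] [DecidableEq J']

/-- Degree `k` morphisms from the free graded module with generators of degrees `u` to the one with
generators of degrees `v`, as matrices: the generator `i` is sent to the combination of the generators
`j` with coefficients `f j i`. -/
def homs (k : ℤ) (u : I → ℤ) (v : J → ℤ) : Submodule K (Matrix J I A.Alg) where
  carrier := {f | ∀ j i, f j i ∈ A.Gr (k + u i - v j)}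
  zero_mem' _ _ := zero_mem _
  add_mem' hf hg j i := add_mem (hf j i) (hg j i)
  smul_mem' c _ hf j i := Submodule.smul_mem _ c (hf j i)

variable {A}

/-- The differential of the coefficients of a matrix. -/
def sd (v : J → ℤ) : Matrix J I A.Alg →ₗ[K] Matrix J I A.Alg where
  toFun f := Matrix.of fun j i => sg K (v j) • A.d (f j i)
  map_add' f g := by ext; simp
  map_smul' c f := by ext; simp [smul_comm c]

/-- `1 ⊗ f` for `f` of degree `k`. -/
def wlM (u : I → ℤ) (k : ℤ) : Matrix J L A.Alg →ₗ[K] Matrix (I × J) (I × L) A.Alg where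
  toFun f := Matrix.of fun q p => if q.1 = p.1 then sg K (k * u p.1) • f q.2 p.2 else 0
  map_add' f g := by ext q p; simp only [Matrix.of_apply, Matrix.add_apply]; split_ifs <;> simp
  map_smul' c f := by
    ext q p
    simp only [Matrix.of_apply, Matrix.smul_apply, RingHom.id_apply]
    split_ifs <;> simp [smul_comm c]

/-- `f ⊗ 1` for `f` of degree `k`. -/
def wrM (u : I → ℤ) (v : J → ℤ) (w : L → ℤ) (k : ℤ) :
    Matrix J I A.Alg →ₗ[K] Matrix (J × L) (I × L) A.Alg where
  toFun f := Matrix.of fun q p => if q.2 = p.2 then sg K (w p.2 * (k + u p.1 - v q.1)) • f q.1 p.1 else 0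
  map_add' f g := by ext q p; simp only [Matrix.of_apply, Matrix.add_apply]; split_ifs <;> simp
  map_smul' c f := by
    ext q p
    simp only [Matrix.of_apply, Matrix.smul_apply, RingHom.id_apply]
    split_ifs <;> simp [smul_comm c]

/-- The matrix that sends the generator `i` to `c i` times the generator `e i`. -/
def pmM (A : SemiFreeCDGA K) (e : I ≃ J) (c : I → K) : Matrix J I A.Alg :=
  Matrix.of fun j i => if j = e i then c i • 1 else 0

theorem sd_apply (v : J → ℤ) (f : Matrix J I A.Alg) (j : J) (i : I) :
    sd v f j i = sg K (v j) • A.d (f j i) := rfl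

theorem wl_apply (u : I → ℤ) (k : ℤ) (f : Matrix J L A.Alg) (i i' : I) (j : J) (l : L) :
    wlM u k f (i, j) (i', l) = if i = i' then sg K (k * u i') • f j l else 0 := rfl

theorem wr_apply (u : I → ℤ) (v : J → ℤ) (w : L → ℤ) (k : ℤ) (f : Matrix J I A.Alg) (j : J) (i : I)
    (l l' : L) : wrM u v w k f (j, l) (i, l') =
      if l = l' then sg K (w l' * (k + u i - v j)) • f j i else 0 := rfl

theorem pm_mul (e : I ≃ J) (c : I → K) (f : Matrix I L A.Alg) (i : I) (l : L) :
    (pmM A e c * f) (e i) l = c i • f i l := by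
  simp [Matrix.mul_apply, pmM]

theorem mul_pm (e : I ≃ J) (c : I → K) (f : Matrix L J A.Alg) (l : L) (i : I) :
    (f * pmM A e c) l i = c i • f l (e i) := by
  simp [Matrix.mul_apply, pmM]

theorem gr_cast {i j : ℤ} {a : A.Alg} (ha : a ∈ A.Gr i) (h : i = j) : a ∈ A.Gr j := h ▸ ha

variable {k m : ℤ} {u : I → ℤ} {v : J → ℤ} {w : L → ℤ} {u' : I' → ℤ} {v' : J' → ℤ}

theorem one_mem_homs : (1 : Matrix I I A.Alg) ∈ homs A 0 u u := by
  intro j i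
  rw [Matrix.one_apply]
  split_ifs with h
  · subst h; exact gr_cast FreeGC.one_mem (by ring)
  · exact zero_mem _

theorem mul_mem_homs {g : Matrix L J A.Alg} {f : Matrix J I A.Alg} (hg : g ∈ homs A m v w)
    (hf : f ∈ homs A k u v) : g * f ∈ homs A (m + k) u w := by
  intro l i
  rw [Matrix.mul_apply]
  exact sum_mem fun j _ => gr_cast (FreeGC.mul_mem (hg l j) (hf j i)) (by ring)

theorem sd_mem {f : Matrix J I A.Alg} (hf : f ∈ homs A k u v) : sd v f ∈ homs A (k + 1) u v :=
  fun j i => Submodule.smul_mem _ _ (gr_cast (SemiFreeCDGA.d_mem (hf j i)) (by ring))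

theorem sd_one : sd u (1 : Matrix I I A.Alg) = 0 := by
  ext j i
  simp only [sd_apply, Matrix.one_apply]
  split_ifs <;> simp [SemiFreeCDGA.d_one]

theorem sd_mul {g : Matrix L J A.Alg} {f : Matrix J I A.Alg} (hg : g ∈ homs A m v w)
    (hf : f ∈ homs A k u v) : sd w (g * f) = sd w g * f + sg K m • (g * sd v f) := by
  ext l i
  simp only [sd_apply, Matrix.add_apply, Matrix.smul_apply,
    Matrix.mul_apply, map_sum, Finset.smul_sum, ← Finset.sum_add_distrib]
  refine Finset.sum_congr rfl fun j _ => ?_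
  rw [SemiFreeCDGA.d_mul (hg l j) (hf j i), smul_add, smul_smul, ← sg_add, mul_smul_comm,
    smul_mul_assoc, smul_smul, ← sg_add]
  congr 3
  ring

theorem sd_sd {f : Matrix J I A.Alg} (hf : f ∈ homs A k u v) : sd v (sd v f) = 0 := by
  ext j i
  simp [sd_apply, SemiFreeCDGA.d_d (hf j i)]

theorem wl_mem {f : Matrix J L A.Alg} (hf : f ∈ homs A k w v) :
    wlM u k f ∈ homs A k (fun p : I × L => u p.1 + w p.2) (fun p : I × J => u p.1 + v p.2) := by
  rintro ⟨i, j⟩ ⟨i', l⟩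
  simp only [wl_apply]
  split_ifs with h
  · subst h
    exact Submodule.smul_mem _ _ (gr_cast (hf j l) (by ring))
  · exact zero_mem _

theorem wr_mem {f : Matrix J I A.Alg} (hf : f ∈ homs A k u v) :
    wrM u v w k f ∈ homs A k (fun p : I × L => u p.1 + w p.2)
      (fun p : J × L => v p.1 + w p.2) := by
  rintro ⟨i, j⟩ ⟨i', l⟩
  simp only [wr_apply]
  split_ifs with h
  · subst h
    exact Submodule.smul_mem _ _ (gr_cast (hf i i') (by ring))
  · exact zero_mem _

theorem wl_one : wlM u 0 (1 : Matrix J J A.Alg) = 1 := by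
  ext ⟨i, j⟩ ⟨i', j'⟩
  simp only [wl_apply, Matrix.one_apply, Prod.mk.injEq, zero_mul,
    sg_zero, one_smul, ite_and]

theorem wr_one : wrM u u w 0 (1 : Matrix I I A.Alg) = 1 := by
  ext ⟨i, j⟩ ⟨i', j'⟩
  simp only [wr_apply, Matrix.one_apply, Prod.mk.injEq]
  by_cases h : i = i'
  · subst h; simp [sg_zero]
  · simp [h]

theorem wl_mul (g : Matrix L J A.Alg) (f : Matrix J I A.Alg) :
    wlM u' (m + k) (g * f) = wlM u' m g * wlM u' k f := by
  ext ⟨i, l⟩ ⟨i', j'⟩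
  rw [wl_apply, Matrix.mul_apply, Matrix.mul_apply, Fintype.sum_prod_type,
    Finset.sum_eq_single i' (fun x _ hx => Finset.sum_eq_zero fun y _ => by simp [wl_apply, hx])
      (by simp)]
  by_cases h : i = i'
  · simp only [h, wl_apply, if_true, Finset.smul_sum, mul_smul_comm, smul_mul_assoc, smul_smul,
      ← sg_add]
    refine Finset.sum_congr rfl fun j _ => ?_
    congr 2
    ring
  · simp [h, wl_apply]

theorem wr_mul (g : Matrix L J A.Alg) (f : Matrix J I A.Alg) :
    wrM u w u' (m + k) (g * f) = wrM v w u' m g * wrM u v u' k f := by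
  ext ⟨l, i⟩ ⟨j', i'⟩
  rw [wr_apply, Matrix.mul_apply, Matrix.mul_apply, Fintype.sum_prod_type_right,
    Finset.sum_eq_single i' (fun x _ hx => Finset.sum_eq_zero fun y _ => by simp [wr_apply, hx])
      (by simp)]
  by_cases h : i = i'
  · simp only [h, wr_apply, if_true, Finset.smul_sum, mul_smul_comm, smul_mul_assoc, smul_smul,
      ← sg_add]
    refine Finset.sum_congr rfl fun j _ => ?_
    congr 2
    ring
  · simp [h, wr_apply]

theorem wl_wr {g : Matrix J I A.Alg} (hg : g ∈ homs A k u v) {f : Matrix J' I' A.Alg}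
    (hf : f ∈ homs A m u' v') :
    wlM v m f * wrM u v u' k g = sg K (m * k) • (wrM u v v' k g * wlM u m f) := by
  ext ⟨j, j'⟩ ⟨i, i'⟩
  rw [Matrix.smul_apply, Matrix.mul_apply, Matrix.mul_apply, Fintype.sum_prod_type,
    Finset.sum_eq_single j (fun x _ hx => Finset.sum_eq_zero fun y _ => by
      simp [wl_apply, hx.symm]) (by simp),
    Finset.sum_eq_single i' (fun x _ hx => by simp [wr_apply, hx]) (by simp),
    Fintype.sum_prod_type,
    Finset.sum_eq_single i (fun x _ hx => Finset.sum_eq_zero fun y _ => by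
      simp [wl_apply, hx]) (by simp),
    Finset.sum_eq_single j' (fun x _ hx => by simp [wr_apply, hx.symm]) (by simp)]
  simp only [wl_apply, wr_apply, if_true, mul_smul_comm, smul_mul_assoc, smul_smul, ← sg_add]
  rw [FreeGC.comm (hf j' i') (hg j i), smul_smul, ← sg_add]
  congr 1
  exact sg_congr ((u' i' - v' j') * (k + u i - v j)) (by ring)

theorem sd_wl (f : Matrix J L A.Alg) :
    sd (fun p : I × J => u p.1 + v p.2) (wlM u k f) = wlM u (k + 1) (sd v f) := by
  ext ⟨i, j⟩ ⟨i', l⟩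
  rw [sd_apply, wl_apply, wl_apply]
  split_ifs with h
  · subst h
    rw [sd_apply, map_smul, smul_smul, smul_smul, ← sg_add, ← sg_add]
    congr 2
    ring
  · simp

theorem sd_wr (f : Matrix J I A.Alg) :
    sd (fun p : J × L => v p.1 + w p.2) (wrM u v w k f) = wrM u v w (k + 1) (sd v f) := by
  ext ⟨j, l⟩ ⟨i, l'⟩
  rw [sd_apply, wr_apply, wr_apply]
  split_ifs with h
  · subst h
    rw [sd_apply, map_smul, smul_smul, smul_smul, ← sg_add, ← sg_add]
    congr 2
    ring
  · simp

end Matrices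

section Matrices

variable {K : Type*} [Field K] {A : SemiFreeCDGA K}
variable {I J L I' J' : Type} [Fintype I] [Fintype J] [Fintype L] [Fintype I'] [Fintype J']
  [DecidableEq I] [DecidableEq J] [DecidableEq L] [DecidableEq I'] [DecidableEq J']
variable {k m : ℤ} {u : I → ℤ} {v : J → ℤ} {w : L → ℤ} {u' : I' → ℤ} {v' : J' → ℤ}

theorem pm_ext {e e' : I ≃ J} {c c' : I → K} (he : ∀ i, e i = e' i) (hc : ∀ i, c i = c' i) :
    pmM A e c = pmM A e' c' := by
  rw [Equiv.ext he, funext hc]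

theorem pm_refl : pmM A (Equiv.refl I) (fun _ => (1 : K)) = 1 := by
  ext j i
  simp [pmM, Matrix.one_apply]

theorem pm_pm (e' : J ≃ L) (c' : J → K) (e : I ≃ J) (c : I → K) :
    pmM A e' c' * pmM A e c = pmM A (e.trans e') (fun i => c' (e i) * c i) := by
  ext l i
  rw [mul_pm]
  simp only [pmM, Matrix.of_apply, Equiv.trans_apply]
  by_cases h : l = e' (e i)
  · simp [h, smul_smul, mul_comm]
  · simp [h]

theorem pm_mem (e : I ≃ J) (c : I → K) (h : ∀ i, v (e i) = u i) : pmM A e c ∈ homs A 0 u v := by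
  intro j i
  simp only [pmM, Matrix.of_apply]
  split_ifs with h'
  · subst h'
    exact Submodule.smul_mem _ _ (gr_cast FreeGC.one_mem (by rw [h]; ring))
  · exact zero_mem _

theorem sd_pm (e : I ≃ J) (c : I → K) : sd v (pmM A e c) = 0 := by
  ext j i
  simp only [sd_apply, pmM, Matrix.of_apply]
  split_ifs <;> simp [SemiFreeCDGA.d_one]

theorem wl_pm (e : I ≃ J) (c : I → K) :
    wlM u' 0 (pmM A e c) = pmM A ((Equiv.refl I').prodCongr e) (fun p => c p.2) := by
  ext ⟨i, j⟩ ⟨i', j'⟩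
  simp only [wl_apply, pmM, Matrix.of_apply, zero_mul, sg_zero, one_smul, Equiv.prodCongr_apply,
    Prod.map_apply, Equiv.refl_apply, Prod.mk.injEq, ite_and]

theorem wr_pm (e : I ≃ J) (c : I → K) (h : ∀ i, v (e i) = u i) :
    wrM u v w 0 (pmM A e c) = pmM A (e.prodCongr (Equiv.refl L)) (fun p => c p.1) := by
  ext ⟨j, i⟩ ⟨j', i'⟩
  simp only [wr_apply, pmM, Matrix.of_apply, Equiv.prodCongr_apply,
    Prod.map_apply, Equiv.refl_apply, Prod.mk.injEq]
  by_cases h' : j = e j'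
  · subst h'; simp [h, sg_zero]
  · simp [h']

/-- The associator. -/
def asM (A : SemiFreeCDGA K) (I J L : Type) [DecidableEq I] [DecidableEq J] [DecidableEq L] :
    Matrix (I × J × L) ((I × J) × L) A.Alg :=
  pmM A (Equiv.prodAssoc I J L) (fun _ => 1)

/-- The left unitor. -/
def luM (A : SemiFreeCDGA K) (I : Type) [DecidableEq I] : Matrix I (Unit × I) A.Alg :=
  pmM A (Equiv.punitProd I) (fun _ => 1)

/-- The right unitor. -/
def ruM (A : SemiFreeCDGA K) (I : Type) [DecidableEq I] : Matrix I (I × Unit) A.Alg :=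
  pmM A (Equiv.prodPUnit I) (fun _ => 1)

/-- The symmetry. -/
def brM (A : SemiFreeCDGA K) (u : I → ℤ) (v : J → ℤ) : Matrix (J × I) (I × J) A.Alg :=
  pmM A (Equiv.prodComm I J) (fun p => sg K (u p.1 * v p.2))

theorem as_left (f : Matrix I' I A.Alg) :
    asM A I' J L * wrM (fun p : I × J => u p.1 + v p.2) (fun p : I' × J => u' p.1 + v p.2) w k
      (wrM u u' v k f) = wrM u u' (fun p : J × L => v p.1 + w p.2) k f * asM A I J L := by
  ext ⟨i, j, l⟩ ⟨⟨i', j'⟩, l'⟩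
  refine (pm_mul _ _ _ ((i, j), l) _).trans (Eq.trans ?_ (mul_pm _ _ _ _ _).symm)
  simp only [wr_apply, Equiv.prodAssoc_apply, one_smul, Prod.mk.injEq]
  by_cases h : l = l' <;> by_cases h' : j = j'
  · subst h h'
    simp only [if_true, and_self, smul_smul, ← sg_add]
    congr 2
    ring
  all_goals simp [h, h']

theorem as_middle (f : Matrix J' J A.Alg) :
    asM A I J' L * wrM (fun p : I × J => u p.1 + v p.2) (fun p : I × J' => u p.1 + v' p.2) w k
      (wlM u k f) = wlM u k (wrM v v' w k f) * asM A I J L := by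
  ext ⟨i, j, l⟩ ⟨⟨i', j'⟩, l'⟩
  refine (pm_mul _ _ _ ((i, j), l) _).trans (Eq.trans ?_ (mul_pm _ _ _ _ _).symm)
  simp only [wr_apply, wl_apply, Equiv.prodAssoc_apply, one_smul]
  by_cases h : l = l' <;> by_cases h' : i = i'
  · subst h h'
    simp only [if_true, smul_smul, ← sg_add]
    congr 2
    ring
  all_goals simp [h, h']

theorem as_right (f : Matrix I' L A.Alg) :
    asM A I J I' * wlM (fun p : I × J => u p.1 + v p.2) k f =
      wlM u k (wlM v k f) * asM A I J L := by
  ext ⟨i, j, l⟩ ⟨⟨i', j'⟩, l'⟩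
  refine (pm_mul _ _ _ ((i, j), l) _).trans (Eq.trans ?_ (mul_pm _ _ _ _ _).symm)
  simp only [wl_apply, Equiv.prodAssoc_apply, one_smul, Prod.mk.injEq]
  by_cases h : i = i' <;> by_cases h' : j = j'
  · subst h h'
    simp only [if_true, and_self, smul_smul, ← sg_add]
    congr 2
    ring
  all_goals simp [h, h']

theorem lu_nat (f : Matrix J I A.Alg) :
    luM A J * wlM (fun _ : Unit => 0) k f = f * luM A I := by
  ext j ⟨⟨⟩, i⟩
  refine (pm_mul _ _ _ ((), j) _).trans (Eq.trans ?_ (mul_pm _ _ _ _ _).symm)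
  simp [wl_apply, sg_zero]

theorem ru_nat (f : Matrix J I A.Alg) :
    ruM A J * wrM u v (fun _ : Unit => 0) k f = f * ruM A I := by
  ext j ⟨i, ⟨⟩⟩
  refine (pm_mul _ _ _ (j, ()) _).trans (Eq.trans ?_ (mul_pm _ _ _ _ _).symm)
  simp [wr_apply, sg_zero]

theorem br_left (f : Matrix J I A.Alg) :
    brM A v w * wrM u v w k f = wlM w k f * brM A u w := by
  ext ⟨l, j⟩ ⟨i, l'⟩
  refine (pm_mul _ _ _ (j, l) _).trans (Eq.trans ?_ (mul_pm _ _ _ _ _).symm)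
  simp only [wl_apply, wr_apply, Equiv.prodComm_apply, Prod.swap_prod_mk]
  split_ifs with h
  · subst h
    rw [smul_smul, smul_smul, ← sg_add, ← sg_add]
    congr 2
    ring
  · simp

theorem br_right (f : Matrix J I A.Alg) :
    brM A w v * wlM w k f = wrM u v w k f * brM A w u := by
  ext ⟨j, l⟩ ⟨l', i⟩
  refine (pm_mul _ _ _ (l, j) _).trans (Eq.trans ?_ (mul_pm _ _ _ _ _).symm)
  simp only [wl_apply, wr_apply, Equiv.prodComm_apply, Prod.swap_prod_mk]
  split_ifs with h
  · subst h
    rw [smul_smul, smul_smul, ← sg_add, ← sg_add]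
    congr 1
    exact sg_congr (w l * (v j - u i)) (by ring)
  · simp

/-- The differential of the hom complex between free modules with differential matrices `D` and
`D'`. -/
def pt (k : ℤ) (v : J → ℤ) (D : Matrix I I A.Alg) (D' : Matrix J J A.Alg) :
    Matrix J I A.Alg →ₗ[K] Matrix J I A.Alg where
  toFun f := D' * f + sd v f - sg K k • (f * D)
  map_add' f g := by simp only [map_add, Matrix.mul_add, Matrix.add_mul]; module
  map_smul' c f := by
    simp only [Matrix.mul_smul, Matrix.smul_mul, map_smul, RingHom.id_apply]; module

section
variable {D : Matrix I I A.Alg} {D' : Matrix J J A.Alg} {D'' : Matrix L L A.Alg}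

theorem pt_apply (f : Matrix J I A.Alg) :
    pt k v D D' f = D' * f + sd v f - sg K k • (f * D) := rfl

theorem pt_mem (hD : D ∈ homs A 1 u u) (hD' : D' ∈ homs A 1 v v) {f : Matrix J I A.Alg}
    (hf : f ∈ homs A k u v) : pt k v D D' f ∈ homs A (k + 1) u v := by
  refine sub_mem (add_mem ?_ (sd_mem hf)) (Submodule.smul_mem _ _ (mul_mem_homs hf hD))
  have h := mul_mem_homs hD' hf
  rwa [add_comm] at h

theorem pt_mul {g : Matrix L J A.Alg} {f : Matrix J I A.Alg} (hg : g ∈ homs A m v w)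
    (hf : f ∈ homs A k u v) :
    pt (m + k) w D D'' (g * f) = pt m w D' D'' g * f + sg K m • (g * pt k v D D' f) := by
  simp only [pt_apply, sd_mul hg hf, sg_add, Matrix.mul_add, Matrix.mul_sub, Matrix.add_mul,
    Matrix.sub_mul, Matrix.mul_assoc, Matrix.mul_smul, Matrix.smul_mul]
  module

theorem pt_pt (hD : D ∈ homs A 1 u u) (hD' : D' ∈ homs A 1 v v) (mc : D * D + sd u D = 0)
    (mc' : D' * D' + sd v D' = 0) {f : Matrix J I A.Alg} (hf : f ∈ homs A k u v) :
    pt (k + 1) v D D' (pt k v D D' f) = 0 := by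
  have h₁ : sd v D' = -(D' * D') := by rw [eq_neg_iff_add_eq_zero, add_comm, mc']
  have h₂ : sd u D = -(D * D) := by rw [eq_neg_iff_add_eq_zero, add_comm, mc]
  have h₃ : sg K (k + 1) = - sg K k := by simp [sg_add, sg_one]
  have h₄ : sg K k * sg K k = 1 := sg_sq k
  simp only [pt_apply, map_add, map_sub, map_smul, sd_mul hD' hf, sd_mul hf hD, sd_sd hf, h₁, h₂,
    h₃, sg_one, mul_add, mul_sub, add_mul, sub_mul, Matrix.mul_add, Matrix.mul_sub, Matrix.add_mul,
    Matrix.sub_mul, Matrix.mul_assoc,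
    Matrix.mul_smul, Matrix.smul_mul, Matrix.neg_mul, Matrix.mul_neg, smul_add, smul_sub, smul_smul,
    smul_neg, neg_smul, h₄]
  module

/-- The differential matrix of a tensor product. -/
def tD (u : I → ℤ) (v : J → ℤ) (D : Matrix I I A.Alg) (D' : Matrix J J A.Alg) :
    Matrix (I × J) (I × J) A.Alg := wrM u u v 1 D + wlM u 1 D'

theorem tD_mem (hD : D ∈ homs A 1 u u) (hD' : D' ∈ homs A 1 v v) :
    tD u v D D' ∈ homs A 1 (fun p : I × J => u p.1 + v p.2) (fun p : I × J => u p.1 + v p.2) :=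
  add_mem (wr_mem hD) (wl_mem hD')

theorem tD_mc (hD : D ∈ homs A 1 u u) (hD' : D' ∈ homs A 1 v v) (mc : D * D + sd u D = 0)
    (mc' : D' * D' + sd v D' = 0) :
    tD u v D D' * tD u v D D' + sd (fun p : I × J => u p.1 + v p.2) (tD u v D D') = 0 := by
  have h₁ : sd v D' = -(D' * D') := by rw [eq_neg_iff_add_eq_zero, add_comm, mc']
  have h₂ : sd u D = -(D * D) := by rw [eq_neg_iff_add_eq_zero, add_comm, mc]
  have h₃ : wlM u 1 D' * wrM u u v 1 D = -(wrM u u v 1 D * wlM u 1 D') := by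
    rw [wl_wr hD hD', mul_one, sg_one, neg_one_smul]
  rw [tD, map_add, sd_wr, sd_wl, h₁, h₂, map_neg, map_neg, wr_mul (v := u), wl_mul, Matrix.mul_add,
    Matrix.add_mul, Matrix.add_mul, h₃]
  abel

theorem pt_wl {E : Matrix I' I' A.Alg} (hE : E ∈ homs A 1 u' u') {f : Matrix J I A.Alg}
    (hf : f ∈ homs A k u v) :
    pt k (fun p : I' × J => u' p.1 + v p.2) (tD u' u E D) (tD u' v E D') (wlM u' k f) =
      wlM u' (k + 1) (pt k v D D' f) := by
  have h := wl_wr hE hf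
  have h₁ : wlM u' (k + 1) (D' * f) = wlM u' 1 D' * wlM u' k f := by rw [add_comm, wl_mul]
  rw [mul_one] at h
  rw [pt_apply, pt_apply, map_sub, map_add, map_smul, h₁, wl_mul, sd_wl, tD, tD, Matrix.mul_add,
    Matrix.add_mul, h, smul_add, smul_smul, sg_sq, one_smul]
  abel

theorem pt_wr {E : Matrix I' I' A.Alg} (hE : E ∈ homs A 1 u' u') {f : Matrix J I A.Alg}
    (hf : f ∈ homs A k u v) :
    pt k (fun p : J × I' => v p.1 + u' p.2) (tD u u' D E) (tD v u' D' E) (wrM u v u' k f) =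
      wrM u v u' (k + 1) (pt k v D D' f) := by
  have h := wl_wr hf hE
  have h₁ : wrM u v u' (k + 1) (D' * f) = wrM v v u' 1 D' * wrM u v u' k f := by
    rw [add_comm, wr_mul (v := v)]
  rw [one_mul] at h
  rw [pt_apply, pt_apply, map_sub, map_add, map_smul, h₁, wr_mul (v := u), sd_wr, tD, tD,
    Matrix.mul_add, Matrix.add_mul, h, smul_add]
  abel

end
end Matrices

/-- A semi-free dg module over `A` with finitely many generators: generators `ι` of degrees `deg`, and
the differential given by `d m_i = ∑ j, D j i m_j`. -/
structure BasedMod {K : Type*} [Field K] (A : SemiFreeCDGA K) where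
  ι : Type
  [fin : Fintype ι]
  [dec : DecidableEq ι]
  deg : ι → ℤ
  D : Matrix ι ι A.Alg
  D_mem : D ∈ homs A 1 deg deg
  mc : D * D + sd deg D = 0

attribute [instance] BasedMod.fin BasedMod.dec

/-- A bilinear map descends to quotients in its second variable and its target. -/
def quotBilin {R P M N : Type*} [CommRing R] [AddCommGroup P] [AddCommGroup M] [AddCommGroup N]
    [Module R P] [Module R M] [Module R N] (p : Submodule R M) (q : Submodule R N)
    (B : P →ₗ[R] M →ₗ[R] N) (h : ∀ x, p ≤ q.comap (B x)) : P →ₗ[R] M ⧸ p →ₗ[R] N ⧸ q where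
  toFun x := p.mapQ q (B x) (h x)
  map_add' x y := by ext; simp
  map_smul' c x := by ext; simp

namespace BasedMod

variable {K : Type*} [Field K] {A : SemiFreeCDGA K}

/-- Degree `k` maps of graded modules. -/
abbrev Hom' (k : ℤ) (M N : BasedMod A) : Submodule K (Matrix N.ι M.ι A.Alg) :=
  homs A k M.deg N.deg

/-- The differential of the hom complex. -/
def pt' (k : ℤ) (M N : BasedMod A) : Matrix N.ι M.ι A.Alg →ₗ[K] Matrix N.ι M.ι A.Alg :=
  pt k N.deg M.D N.D

/-- Closed maps of degree `0`. -/
def Z0 (M N : BasedMod A) : Submodule K (Matrix N.ι M.ι A.Alg) :=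
  Hom' 0 M N ⊓ LinearMap.ker (pt' 0 M N)

/-- Exact maps of degree `-1`. -/
def exact (M N : BasedMod A) : Submodule K ↥(Hom' (-1) M N) :=
  ((Hom' (-2) M N).map (pt' (-2) M N)).submoduleOf (Hom' (-1) M N)

theorem pt'_mem {k l : ℤ} {M N : BasedMod A} {f : Matrix N.ι M.ι A.Alg} (hf : f ∈ Hom' k M N)
    (h : k + 1 = l := by rfl) : pt' k M N f ∈ Hom' l M N := h ▸ pt_mem M.D_mem N.D_mem hf

theorem pt'_pt' {k l : ℤ} {M N : BasedMod A} {f : Matrix N.ι M.ι A.Alg} (hf : f ∈ Hom' k M N)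
    (h : k + 1 = l := by rfl) : pt' l M N (pt' k M N f) = 0 := h ▸ pt_pt M.D_mem N.D_mem M.mc N.mc hf

theorem pt'_mul {k l m : ℤ} {M N P : BasedMod A} {g : Matrix P.ι N.ι A.Alg}
    {f : Matrix N.ι M.ι A.Alg} (hg : g ∈ Hom' m N P) (hf : f ∈ Hom' k M N) (h : m + k = l := by rfl) :
    pt' l M P (g * f) = pt' m N P g * f + sg K m • (g * pt' k M N f) := h ▸ pt_mul hg hf

theorem mul_mem' {k l m : ℤ} {M N P : BasedMod A} {g : Matrix P.ι N.ι A.Alg}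
    {f : Matrix N.ι M.ι A.Alg} (hg : g ∈ Hom' m N P) (hf : f ∈ Hom' k M N) (h : m + k = l := by rfl) :
    g * f ∈ Hom' l M P := h ▸ mul_mem_homs hg hf

theorem one_mem_Z0 (M : BasedMod A) : (1 : Matrix M.ι M.ι A.Alg) ∈ Z0 M M := by
  refine ⟨one_mem_homs, ?_⟩
  change pt 0 M.deg M.D M.D 1 = 0
  rw [pt_apply, sd_one, Matrix.mul_one, Matrix.one_mul, sg_zero]
  simp

theorem comp_mem_Z0 {M N P : BasedMod A} {g : Matrix P.ι N.ι A.Alg} {f : Matrix N.ι M.ι A.Alg}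
    (hg : g ∈ Z0 N P) (hf : f ∈ Z0 M N) : g * f ∈ Z0 M P := by
  refine ⟨mul_mem' hg.1 hf.1, ?_⟩
  have h₁ : pt' 0 N P g = 0 := hg.2
  have h₂ : pt' 0 M N f = 0 := hf.2
  change pt' 0 M P (g * f) = 0
  rw [pt'_mul (l := 0) hg.1 hf.1, h₁, h₂, Matrix.zero_mul, Matrix.mul_zero, smul_zero, add_zero]

/-- Closed maps of degree `0`, as morphisms. -/
instance : Category (BasedMod A) where
  Hom M N := ↥(Z0 M N)
  id M := ⟨1, one_mem_Z0 M⟩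
  comp f g := ⟨g.1 * f.1, comp_mem_Z0 g.2 f.2⟩
  id_comp f := Subtype.ext (Matrix.mul_one f.1)
  comp_id f := Subtype.ext (Matrix.one_mul f.1)
  assoc f g h := Subtype.ext (Matrix.mul_assoc h.1 g.1 f.1).symm

instance : Preadditive (BasedMod A) where
  homGroup M N := inferInstanceAs (AddCommGroup ↥(Z0 M N))
  add_comp _ _ _ f f' g := Subtype.ext (Matrix.mul_add g.1 f.1 f'.1)
  comp_add _ _ _ f g g' := Subtype.ext (Matrix.add_mul g.1 g'.1 f.1)

instance : Linear K (BasedMod A) where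
  homModule M N := inferInstanceAs (Module K ↥(Z0 M N))
  smul_comp _ _ _ r f g := Subtype.ext (Matrix.mul_smul g.1 r f.1)
  comp_smul _ _ _ f r g := Subtype.ext (Matrix.smul_mul r g.1 f.1)

/-- The underlying matrix. -/
def mat {M N : BasedMod A} (f : M ⟶ N) : Matrix N.ι M.ι A.Alg := f.1

theorem hom_ext {M N : BasedMod A} {f g : M ⟶ N} (h : mat f = mat g) : f = g := Subtype.ext h

theorem mat_comp {M N P : BasedMod A} (f : M ⟶ N) (g : N ⟶ P) : mat (f ≫ g) = mat g * mat f := rfl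

theorem mat_mem {M N : BasedMod A} (f : M ⟶ N) : mat f ∈ Hom' 0 M N := f.2.1

theorem pt_mat {M N : BasedMod A} (f : M ⟶ N) : pt' 0 M N (mat f) = 0 := f.2.2

/-- Composition of a closed map of degree `0` with a map of degree `-1`. -/
def postL (M N P : BasedMod A) : (N ⟶ P) →ₗ[K] ↥(Hom' (-1) M N) →ₗ[K] ↥(Hom' (-1) M P) :=
  LinearMap.mk₂ K (fun g q => ⟨mat g * q.1, mul_mem' (mat_mem g) q.2 rfl⟩)
    (fun g g' q => Subtype.ext (Matrix.add_mul (mat g) (mat g') q.1))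
    (fun c g q => Subtype.ext (Matrix.smul_mul c (mat g) q.1))
    (fun g q q' => Subtype.ext (Matrix.mul_add (mat g) q.1 q'.1))
    (fun c g q => Subtype.ext (Matrix.mul_smul (mat g) c q.1))

/-- Composition of a map of degree `-1` with a closed map of degree `0`. -/
def preL (M N P : BasedMod A) : (M ⟶ N) →ₗ[K] ↥(Hom' (-1) N P) →ₗ[K] ↥(Hom' (-1) M P) :=
  LinearMap.mk₂ K (fun f q => ⟨q.1 * mat f, mul_mem' q.2 (mat_mem f) rfl⟩)
    (fun g g' q => Subtype.ext (Matrix.mul_add q.1 (mat g) (mat g')))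
    (fun c g q => Subtype.ext (Matrix.mul_smul q.1 c (mat g)))
    (fun g q q' => Subtype.ext (Matrix.add_mul q.1 q'.1 (mat g)))
    (fun c g q => Subtype.ext (Matrix.smul_mul c q.1 (mat g)))

/-- The differential on maps of degree `-1`. -/
def bdL (M N : BasedMod A) : ↥(Hom' (-1) M N) →ₗ[K] (M ⟶ N) where
  toFun q := ⟨pt' (-1) M N q.1, pt'_mem q.2 rfl, pt'_pt' q.2 rfl⟩
  map_add' q q' := Subtype.ext (map_add (pt' (-1) M N) q.1 q'.1)
  map_smul' c q := Subtype.ext (map_smul (pt' (-1) M N) c q.1)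

theorem postL_le {M N P : BasedMod A} (g : N ⟶ P) :
    exact M N ≤ (exact M P).comap (postL M N P g) := by
  rintro q ⟨r, hr, h⟩
  refine ⟨mat g * r, mul_mem' (mat_mem g) hr rfl, ?_⟩
  rw [pt'_mul (l := -2) (mat_mem g) hr, pt_mat, h, sg_zero, one_smul, Matrix.zero_mul, zero_add]
  rfl

theorem preL_le {M N P : BasedMod A} (f : M ⟶ N) :
    exact N P ≤ (exact M P).comap (preL M N P f) := by
  rintro q ⟨r, hr, h⟩
  refine ⟨r * mat f, mul_mem' hr (mat_mem f) rfl, ?_⟩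
  rw [pt'_mul (l := -2) hr (mat_mem f), pt_mat, h, Matrix.mul_zero, smul_zero, add_zero]
  rfl

theorem bdL_le (M N : BasedMod A) : exact M N ≤ LinearMap.ker (bdL M N) := by
  rintro q ⟨r, hr, h⟩
  refine Subtype.ext ?_
  change pt' (-1) M N q.1 = 0
  rw [← pt'_pt' hr (show (-2 : ℤ) + 1 = -1 from rfl), h]
  rfl

/-- The elements of degree `-1`: maps of degree `-1` modulo exact ones. -/
abbrev HH (M N : BasedMod A) : Type _ := ↥(Hom' (-1) M N) ⧸ exact M N

/-- The class of a map of degree `-1`. -/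
def cls {M N : BasedMod A} (q : ↥(Hom' (-1) M N)) : HH M N := Submodule.Quotient.mk q

theorem cls_eq {M N : BasedMod A} {q q' : ↥(Hom' (-1) M N)} (h : q.1 = q'.1) : cls q = cls q' := by
  rw [Subtype.ext h]

theorem cls_surj {M N : BasedMod A} (x : HH M N) : ∃ q, cls q = x :=
  Submodule.Quotient.mk_surjective _ x

instance : TwoCells K (BasedMod A) where
  H := HH
  bd M N := (exact M N).liftQ (bdL M N) (bdL_le M N)
  post M N P := quotBilin _ _ (postL M N P) postL_le
  pre M N P := (quotBilin _ _ (preL M N P) preL_le).flip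
  post_id q := by
    obtain ⟨q, rfl⟩ := cls_surj q
    exact cls_eq (q' := q) (Matrix.one_mul q.1)
  pre_id q := by
    obtain ⟨q, rfl⟩ := cls_surj q
    exact cls_eq (q' := q) (Matrix.mul_one q.1)
  post_comp g' g q := by
    obtain ⟨q, rfl⟩ := cls_surj q
    change cls (postL _ _ _ (g' ⊚ g) q) = cls (postL _ _ _ g' (postL _ _ _ g q))
    exact cls_eq (Matrix.mul_assoc (mat g') (mat g) q.1)
  pre_comp q f f' := by
    obtain ⟨q, rfl⟩ := cls_surj q
    change cls (preL _ _ _ f' (preL _ _ _ f q)) = cls (preL _ _ _ (f ⊚ f') q)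
    exact cls_eq (Matrix.mul_assoc q.1 (mat f) (mat f'))
  post_pre g q f := by
    obtain ⟨q, rfl⟩ := cls_surj q
    change cls (preL _ _ _ f (postL _ _ _ g q)) = cls (postL _ _ _ g (preL _ _ _ f q))
    exact cls_eq (Matrix.mul_assoc (mat g) q.1 (mat f))
  bd_post g q := by
    obtain ⟨q, rfl⟩ := cls_surj q
    refine hom_ext ?_
    change pt' (-1) _ _ (mat g * q.1) = mat g * pt' (-1) _ _ q.1
    rw [pt'_mul (mat_mem g) q.2, pt_mat, sg_zero, one_smul, Matrix.zero_mul, zero_add]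
  bd_pre q f := by
    obtain ⟨q, rfl⟩ := cls_surj q
    refine hom_ext ?_
    change pt' (-1) _ _ (q.1 * mat f) = pt' (-1) _ _ q.1 * mat f
    rw [pt'_mul q.2 (mat_mem f), pt_mat, Matrix.mul_zero, smul_zero, add_zero]
  peiffer {M N P} q q' := by
    obtain ⟨q, rfl⟩ := cls_surj q
    obtain ⟨q', rfl⟩ := cls_surj q'
    refine (Submodule.Quotient.eq _).2 ⟨q.1 * q'.1, mul_mem' q.2 q'.2, ?_⟩
    change pt' (-2) _ _ (q.1 * q'.1) = pt' (-1) _ _ q.1 * q'.1 - q.1 * pt' (-1) _ _ q'.1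
    rw [pt'_mul (l := -2) q.2 q'.2, sg_congr (m := -1) (n := 1) (-1) rfl, sg_one, neg_one_smul,
      ← sub_eq_add_neg]

end BasedMod

namespace BasedMod

variable {K : Type*} [Field K] {A : SemiFreeCDGA K}

/-- The isomorphism that sends the generator `i` to the sign `c i` times the generator `e i`. -/
def pmIso {M N : BasedMod A} (e : M.ι ≃ N.ι) (c : M.ι → K) (hc : ∀ i, c i * c i = 1)
    (hdeg : ∀ i, N.deg (e i) = M.deg i) (hD : pmM A e c * M.D = N.D * pmM A e c) : M ≅ N := by
  have h₁ : pmM A e.symm (fun j => c (e.symm j)) * pmM A e c = 1 := by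
    rw [pm_pm, ← pm_refl]
    exact pm_ext (by simp) (by simp [hc])
  have h₂ : pmM A e c * pmM A e.symm (fun j => c (e.symm j)) = 1 := by
    rw [pm_pm, ← pm_refl]
    exact pm_ext (by simp) (by simp [hc])
  refine ⟨⟨pmM A e c, pm_mem e c hdeg, ?_⟩, ⟨pmM A e.symm (fun j => c (e.symm j)),
    pm_mem _ _ fun j => by rw [← hdeg, e.apply_symm_apply], ?_⟩, Subtype.ext h₁, Subtype.ext h₂⟩
  · change pt 0 N.deg M.D N.D (pmM A e c) = 0
    rw [pt_apply, sd_pm, hD, sg_zero]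
    simp
  · change pt 0 M.deg N.D M.D (pmM A e.symm _) = 0
    have h : M.D * pmM A e.symm (fun j => c (e.symm j)) =
        pmM A e.symm (fun j => c (e.symm j)) * N.D := by
      rw [← Matrix.one_mul M.D, ← h₁, Matrix.mul_assoc (pmM A e.symm _), hD, Matrix.mul_assoc,
        Matrix.mul_assoc, h₂, Matrix.mul_one]
    rw [pt_apply, sd_pm, h, sg_zero]
    simp

/-- The tensor product over `A`. -/
def tens (M N : BasedMod A) : BasedMod A where
  ι := M.ι × N.ι
  deg p := M.deg p.1 + N.deg p.2
  D := tD M.deg N.deg M.D N.D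
  D_mem := tD_mem M.D_mem N.D_mem
  mc := tD_mc M.D_mem N.D_mem M.mc N.mc

variable (A) in
/-- The free module of rank one. -/
def unit : BasedMod A where
  ι := Unit
  deg _ := 0
  D := 0
  D_mem := zero_mem _
  mc := by simp

theorem as_D (M N P : BasedMod A) :
    asM A M.ι N.ι P.ι * tD (fun p : M.ι × N.ι => M.deg p.1 + N.deg p.2) P.deg
        (tD M.deg N.deg M.D N.D) P.D =
      tD M.deg (fun p : N.ι × P.ι => N.deg p.1 + P.deg p.2) M.D (tD N.deg P.deg N.D P.D) *
        asM A M.ι N.ι P.ι := by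
  simp only [tD, map_add, Matrix.mul_add, Matrix.add_mul]
  rw [as_left, as_middle, as_right, add_assoc]

theorem br_D (M N : BasedMod A) : brM A M.deg N.deg * tD M.deg N.deg M.D N.D =
    tD N.deg M.deg N.D M.D * brM A M.deg N.deg := by
  simp only [tD, Matrix.mul_add, Matrix.add_mul]
  rw [br_left, br_right, add_comm]

theorem lu_D (M : BasedMod A) : luM A M.ι * tD (fun _ : Unit => 0) M.deg 0 M.D =
    M.D * luM A M.ι := by
  rw [tD, map_zero, zero_add, lu_nat]

theorem ru_D (M : BasedMod A) : ruM A M.ι * tD M.deg (fun _ : Unit => 0) M.D 0 =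
    M.D * ruM A M.ι := by
  rw [tD, map_zero, add_zero, ru_nat]

/-- Left whiskering of a map of degree `k`. -/
abbrev wl' (k : ℤ) (X M N : BasedMod A) (f : Matrix N.ι M.ι A.Alg) :
    Matrix (tens X N).ι (tens X M).ι A.Alg := wlM X.deg k f

/-- Right whiskering of a map of degree `k`. -/
abbrev wr' (k : ℤ) (X M N : BasedMod A) (f : Matrix N.ι M.ι A.Alg) :
    Matrix (tens N X).ι (tens M X).ι A.Alg := wrM M.deg N.deg X.deg k f

theorem pt'_wl {k l : ℤ} (X : BasedMod A) {M N : BasedMod A} {f : Matrix N.ι M.ι A.Alg}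
    (hf : f ∈ Hom' k M N) (h : k + 1 = l := by rfl) :
    pt' k (tens X M) (tens X N) (wl' k X M N f) = wl' l X M N (pt' k M N f) :=
  h ▸ pt_wl X.D_mem hf

theorem pt'_wr {k l : ℤ} (X : BasedMod A) {M N : BasedMod A} {f : Matrix N.ι M.ι A.Alg}
    (hf : f ∈ Hom' k M N) (h : k + 1 = l := by rfl) :
    pt' k (tens M X) (tens N X) (wr' k X M N f) = wr' l X M N (pt' k M N f) :=
  h ▸ pt_wr X.D_mem hf

/-- Left whiskering of a morphism. -/
def wlZ (X : BasedMod A) {M N : BasedMod A} (f : M ⟶ N) : tens X M ⟶ tens X N :=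
  ⟨wl' 0 X M N (mat f), wl_mem (mat_mem f), by
    change pt' 0 (tens X M) (tens X N) _ = 0
    rw [pt'_wl X (mat_mem f), pt_mat]; exact map_zero (wlM X.deg 1)⟩

/-- Right whiskering of a morphism. -/
def wrZ {M N : BasedMod A} (f : M ⟶ N) (X : BasedMod A) : tens M X ⟶ tens N X :=
  ⟨wr' 0 X M N (mat f), wr_mem (mat_mem f), by
    change pt' 0 (tens M X) (tens N X) _ = 0
    rw [pt'_wr X (mat_mem f), pt_mat]; exact map_zero (wrM M.deg N.deg X.deg 1)⟩

instance : MonoidalCategoryStruct (BasedMod A) where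
  tensorObj := tens
  whiskerLeft X _ _ f := wlZ X f
  whiskerRight f X := wrZ f X
  tensorUnit := unit A
  associator M N P := pmIso (Equiv.prodAssoc M.ι N.ι P.ι) (fun _ => 1) (by simp)
    (fun _ => (add_assoc _ _ _).symm) (as_D M N P)
  leftUnitor M := pmIso (M := tens (unit A) M) (Equiv.punitProd M.ι) (fun _ => 1) (by simp)
    (fun _ => (zero_add _).symm) (lu_D M)
  rightUnitor M := pmIso (M := tens M (unit A)) (Equiv.prodPUnit M.ι) (fun _ => 1) (by simp)
    (fun _ => (add_zero _).symm) (ru_D M)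

instance : MonoidalCategory (BasedMod A) :=
  monoidalOfWhiskers inferInstance
    (tensor_def := fun _ _ => rfl)
    (wl_id := fun X Y => hom_ext wl_one)
    (wr_id := fun X Y => hom_ext wr_one)
    (wl_comp := fun X _ _ _ f g => hom_ext (wl_mul (m := 0) (k := 0) (mat g) (mat f)))
    (wr_comp := fun f g X => hom_ext (wr_mul (m := 0) (k := 0) (mat g) (mat f)))
    (exch := fun f g => hom_ext (by
      have h := wl_wr (mat_mem f) (mat_mem g)
      rw [mul_zero, sg_zero, one_smul] at h
      exact h.symm))
    (assoc_left := fun f Y Z => hom_ext (as_left (mat f)))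
    (assoc_middle := fun X _ _ f Z => hom_ext (as_middle (mat f)))
    (assoc_right := fun X Y _ _ f => hom_ext (as_right (mat f)))
    (unit_left := fun f => hom_ext (lu_nat (mat f)))
    (unit_right := fun f => hom_ext (ru_nat (mat f)))
    (pentagon := fun W X Y Z => hom_ext (by
      change wlM W.deg 0 (asM A X.ι Y.ι Z.ι) * asM A W.ι (X.ι × Y.ι) Z.ι *
        wrM (fun p : (W.ι × X.ι) × Y.ι => W.deg p.1.1 + X.deg p.1.2 + Y.deg p.2)
          (fun p : W.ι × X.ι × Y.ι => W.deg p.1 + (X.deg p.2.1 + Y.deg p.2.2)) Z.deg 0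
          (asM A W.ι X.ι Y.ι) = asM A W.ι X.ι (Y.ι × Z.ι) * asM A (W.ι × X.ι) Y.ι Z.ι
      rw [asM, asM, asM, asM, asM, wl_pm, wr_pm, pm_pm, pm_pm, pm_pm]
      · exact pm_ext (fun _ => rfl) (fun _ => by simp)
      · exact fun _ => (add_assoc _ _ _).symm))
    (triangle := fun X Y => hom_ext (by
      change wlM X.deg 0 (luM A Y.ι) * asM A X.ι Unit Y.ι =
        wrM (fun p : X.ι × Unit => X.deg p.1 + 0) X.deg Y.deg 0 (ruM A X.ι)
      rw [luM, ruM, asM, wl_pm, wr_pm, pm_pm]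
      · exact pm_ext (fun _ => rfl) (fun _ => by simp)
      · exact fun _ => (add_zero _).symm))

instance : SymmetricCategory (BasedMod A) where
  braiding M N := pmIso (Equiv.prodComm M.ι N.ι) (fun p => sg K (M.deg p.1 * N.deg p.2))
    (fun _ => sg_sq _) (fun _ => add_comm _ _) (br_D M N)
  braiding_naturality_right X _ _ f := hom_ext (br_right (mat f))
  braiding_naturality_left f X := hom_ext (br_left (mat f))
  hexagon_forward X Y Z := hom_ext (by
    change asM A Y.ι Z.ι X.ι * brM A X.deg (fun p : Y.ι × Z.ι => Y.deg p.1 + Z.deg p.2) *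
      asM A X.ι Y.ι Z.ι = wlM Y.deg 0 (brM A X.deg Z.deg) * asM A Y.ι X.ι Z.ι *
      wrM (fun p : X.ι × Y.ι => X.deg p.1 + Y.deg p.2) (fun p : Y.ι × X.ι => Y.deg p.1 + X.deg p.2)
        Z.deg 0 (brM A X.deg Y.deg)
    rw [asM, asM, asM, brM, brM, brM, wl_pm, wr_pm, pm_pm, pm_pm, pm_pm, pm_pm]
    · exact pm_ext (fun _ => rfl) (fun _ => by simp [mul_add, sg_add, mul_comm])
    · exact fun _ => add_comm _ _)
  hexagon_reverse X Y Z := hom_ext (by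
    change pmM A (Equiv.prodAssoc Z.ι X.ι Y.ι).symm (fun _ => 1) *
      brM A (fun p : X.ι × Y.ι => X.deg p.1 + Y.deg p.2) Z.deg *
      pmM A (Equiv.prodAssoc X.ι Y.ι Z.ι).symm (fun _ => 1) =
      wrM (fun p : X.ι × Z.ι => X.deg p.1 + Z.deg p.2) (fun p : Z.ι × X.ι => Z.deg p.1 + X.deg p.2)
        Y.deg 0 (brM A X.deg Z.deg) * pmM A (Equiv.prodAssoc X.ι Z.ι Y.ι).symm (fun _ => 1) *
      wlM X.deg 0 (brM A Y.deg Z.deg)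
    rw [brM, brM, brM, wl_pm, wr_pm, pm_pm, pm_pm, pm_pm, pm_pm]
    · exact pm_ext (fun _ => rfl) (fun _ => by simp [add_mul, sg_add, mul_comm])
    · exact fun _ => add_comm _ _)
  symmetry X Y := hom_ext (by
    change brM A Y.deg X.deg * brM A X.deg Y.deg = 1
    rw [brM, brM, pm_pm, ← pm_refl]
    exact pm_ext (fun _ => rfl) (fun _ => by simp [mul_comm, sg_sq]))

instance : MonoidalPreadditive (BasedMod A) where
  whiskerLeft_zero := hom_ext (map_zero (wlM _ _))
  zero_whiskerRight := hom_ext (map_zero (wrM _ _ _ _))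
  whiskerLeft_add f g := hom_ext (map_add (wlM _ _) (mat f) (mat g))
  add_whiskerRight f g := hom_ext (map_add (wrM _ _ _ _) (mat f) (mat g))

instance : MonoidalLinear K (BasedMod A) where
  whiskerLeft_smul _ _ _ r f := hom_ext (map_smul (wlM _ _) r (mat f))
  smul_whiskerRight r _ _ f _ := hom_ext (map_smul (wrM _ _ _ _) r (mat f))

/-- Left whiskering of maps of degree `-1`. -/
def wlL (X M N : BasedMod A) : ↥(Hom' (-1) M N) →ₗ[K] ↥(Hom' (-1) (X ⊗ M) (X ⊗ N)) where
  toFun q := ⟨wl' (-1) X M N q.1, wl_mem q.2⟩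
  map_add' q q' := Subtype.ext (map_add (wlM _ _) q.1 q'.1)
  map_smul' c q := Subtype.ext (map_smul (wlM _ _) c q.1)

/-- Right whiskering of maps of degree `-1`. -/
def wrL (M N X : BasedMod A) : ↥(Hom' (-1) M N) →ₗ[K] ↥(Hom' (-1) (M ⊗ X) (N ⊗ X)) where
  toFun q := ⟨wr' (-1) X M N q.1, wr_mem q.2⟩
  map_add' q q' := Subtype.ext (map_add (wrM _ _ _ _) q.1 q'.1)
  map_smul' c q := Subtype.ext (map_smul (wrM _ _ _ _) c q.1)

theorem wlL_le (X M N : BasedMod A) : exact M N ≤ (exact (X ⊗ M) (X ⊗ N)).comap (wlL X M N) := by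
  rintro q ⟨r, hr, h⟩
  refine ⟨wl' (-2) X M N r, wl_mem hr, ?_⟩
  refine (pt'_wl (l := -1) X hr).trans ?_
  rw [h]
  rfl

theorem wrL_le (M N X : BasedMod A) : exact M N ≤ (exact (M ⊗ X) (N ⊗ X)).comap (wrL M N X) := by
  rintro q ⟨r, hr, h⟩
  refine ⟨wr' (-2) X M N r, wr_mem hr, ?_⟩
  refine (pt'_wr (l := -1) X hr).trans ?_
  rw [h]
  rfl

theorem wlL_postL (W : BasedMod A) {X Y Z : BasedMod A} (g : Y ⟶ Z) (q : ↥(Hom' (-1) X Y)) :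
    wlL W X Z (postL X Y Z g q) = postL _ _ _ (W ◁ g) (wlL W X Y q) := by
  have h := wl_mul (u' := W.deg) (m := 0) (k := -1) (mat g) q.1
  rw [zero_add] at h
  exact Subtype.ext h

theorem wrL_postL (W : BasedMod A) {X Y Z : BasedMod A} (g : Y ⟶ Z) (q : ↥(Hom' (-1) X Y)) :
    wrL X Z W (postL X Y Z g q) = postL _ _ _ (g ▷ W) (wrL X Y W q) := by
  have h := wr_mul (u := X.deg) (v := Y.deg) (w := Z.deg) (u' := W.deg) (m := 0) (k := -1)
    (mat g) q.1
  rw [zero_add] at h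
  exact Subtype.ext h

theorem wlL_preL (W : BasedMod A) {X Y Z : BasedMod A} (q : ↥(Hom' (-1) Y Z)) (f : X ⟶ Y) :
    wlL W X Z (preL X Y Z f q) = preL _ _ _ (W ◁ f) (wlL W Y Z q) := by
  have h := wl_mul (u' := W.deg) (m := -1) (k := 0) q.1 (mat f)
  rw [add_zero] at h
  exact Subtype.ext h

theorem wrL_preL (W : BasedMod A) {X Y Z : BasedMod A} (q : ↥(Hom' (-1) Y Z)) (f : X ⟶ Y) :
    wrL X Z W (preL X Y Z f q) = preL _ _ _ (f ▷ W) (wrL Y Z W q) := by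
  have h := wr_mul (u := X.deg) (v := Y.deg) (w := Z.deg) (u' := W.deg) (m := -1) (k := 0)
    q.1 (mat f)
  rw [add_zero] at h
  exact Subtype.ext h

instance : TwoCellsMonoidal K (BasedMod A) where
  wl X M N := (exact M N).mapQ (exact (X ⊗ M) (X ⊗ N)) (wlL X M N) (wlL_le X M N)
  wr M N X := (exact M N).mapQ (exact (M ⊗ X) (N ⊗ X)) (wrL M N X) (wrL_le M N X)
  bd_wl X _ _ q := by
    obtain ⟨q, rfl⟩ := cls_surj q
    exact hom_ext (pt'_wl X q.2)
  bd_wr X _ _ q := by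
    obtain ⟨q, rfl⟩ := cls_surj q
    refine hom_ext ?_
    change pt' (-1) (tens _ X) (tens _ X) (wr' (-1) X _ _ q.1) = wr' 0 X _ _ (pt' (-1) _ _ q.1)
    exact pt'_wr X q.2
  wl_post W _ _ _ g q := by
    obtain ⟨q, rfl⟩ := cls_surj q
    exact congrArg cls (wlL_postL W g q)
  wl_pre W _ _ _ q f := by
    obtain ⟨q, rfl⟩ := cls_surj q
    exact congrArg cls (wlL_preL W q f)
  wr_post W _ _ _ g q := by
    obtain ⟨q, rfl⟩ := cls_surj q
    exact congrArg cls (wrL_postL W g q)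
  wr_pre W _ _ _ q f := by
    obtain ⟨q, rfl⟩ := cls_surj q
    exact congrArg cls (wrL_preL W q f)
  wl_exch {X X' Y Y'} f q := by
    obtain ⟨q, rfl⟩ := cls_surj q
    change cls (postL _ _ _ (f ▷ Y') (wlL _ _ _ q)) = cls (preL _ _ _ (f ▷ Y) (wlL _ _ _ q))
    have h := wl_wr (mat_mem f) q.2
    rw [mul_zero, sg_zero, one_smul] at h
    exact cls_eq h.symm
  wr_exch {X X' Y Y'} q g := by
    obtain ⟨q, rfl⟩ := cls_surj q
    change cls (postL _ _ _ (X' ◁ g) (wrL _ _ _ q)) = cls (preL _ _ _ (X ◁ g) (wrL _ _ _ q))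
    have h := wl_wr q.2 (mat_mem g)
    rw [zero_mul, sg_zero, one_smul] at h
    exact cls_eq h
  assoc_left {X X'} q Y Z := by
    obtain ⟨q, rfl⟩ := cls_surj q
    change cls (postL _ _ _ (α_ X' Y Z).hom (wrL _ _ Z (wrL _ _ Y q))) =
      cls (preL _ _ _ (α_ X Y Z).hom (wrL _ _ (Y ⊗ Z) q))
    exact cls_eq (as_left q.1)
  assoc_middle X {Y Y'} q Z := by
    obtain ⟨q, rfl⟩ := cls_surj q
    change cls (postL _ _ _ (α_ X Y' Z).hom (wrL _ _ Z (wlL X _ _ q))) =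
      cls (preL _ _ _ (α_ X Y Z).hom (wlL X _ _ (wrL _ _ Z q)))
    exact cls_eq (as_middle q.1)
  assoc_right X Y {Z Z'} q := by
    obtain ⟨q, rfl⟩ := cls_surj q
    change cls (postL _ _ _ (α_ X Y Z').hom (wlL (X ⊗ Y) _ _ q)) =
      cls (preL _ _ _ (α_ X Y Z).hom (wlL X _ _ (wlL Y _ _ q)))
    exact cls_eq (as_right q.1)
  unit_left {X X'} q := by
    obtain ⟨q, rfl⟩ := cls_surj q
    change cls (postL _ _ _ (λ_ X').hom (wlL _ _ _ q)) = cls (preL _ _ _ (λ_ X).hom q)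
    exact cls_eq (lu_nat q.1)
  unit_right {X X'} q := by
    obtain ⟨q, rfl⟩ := cls_surj q
    change cls (postL _ _ _ (ρ_ X').hom (wrL _ _ _ q)) = cls (preL _ _ _ (ρ_ X).hom q)
    exact cls_eq (ru_nat q.1)
  symm_left {X X'} q Y := by
    obtain ⟨q, rfl⟩ := cls_surj q
    change cls (postL _ _ _ (β_ X' Y).hom (wrL _ _ Y q)) =
      cls (preL _ _ _ (β_ X Y).hom (wlL Y _ _ q))
    exact cls_eq (br_left q.1)
  symm_right X {Y Y'} q := by
    obtain ⟨q, rfl⟩ := cls_surj q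
    change cls (postL _ _ _ (β_ X Y').hom (wlL X _ _ q)) =
      cls (preL _ _ _ (β_ X Y).hom (wrL _ _ X q))
    exact cls_eq (br_right q.1)

end BasedMod

namespace BasedMod

variable {K : Type*} [Field K] {A : SemiFreeCDGA K}

theorem sg_sub_one (n : ℤ) : sg K (n - 1) = -sg K n := by
  rw [sub_eq_add_neg, sg_add, sg_congr (m := -1) (n := 1) (-1) rfl, sg_one, mul_neg_one]

variable (A) in
/-- The differential of the shifted module of Kähler differentials. -/
def cotD : Matrix (Fin A.N) (Fin A.N) A.Alg := Matrix.of fun q p => -A.pd q (A.dx p)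

variable (A) in
/-- The shifted module of Kähler differentials `Ω_A[1]`, with generators `s⁻¹ d_dR x_p` of degree
`|x_p| - 1`. -/
def cot : BasedMod A where
  ι := Fin A.N
  deg p := A.deg p - 1
  D := cotD A
  D_mem q p := neg_mem (gr_cast (SemiFreeCDGA.pd_mem q (A.dx_mem p)) (by ring))
  mc := by
    ext r p
    have h := SemiFreeCDGA.pd_d r (A.dx_mem p)
    rw [show A.d (A.dx p) = 0 from A.d_dx p, map_zero] at h
    simp only [Matrix.add_apply, Matrix.mul_apply, sd_apply, cotD, Matrix.of_apply, neg_mul_neg, map_neg,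
      sg_sub_one, neg_smul, smul_neg, neg_neg, Matrix.zero_apply]
    exact h.symm

/-- The matrix of `f ↦ (s⁻¹ d_dR ⊗ 1) f`, up to the sign `c`. -/
def atM (c : K) (M N : BasedMod A) :
    Matrix N.ι M.ι A.Alg →ₗ[K] Matrix (Fin A.N × N.ι) M.ι A.Alg where
  toFun f := Matrix.of fun q i => (c * sg K (N.deg q.2 * A.deg q.1)) • A.pd q.1 (f q.2 i)
  map_add' f g := by ext; simp
  map_smul' r f := by ext; simp [smul_comm r]

theorem atM_mem {c : K} {k l : ℤ} {M N : BasedMod A} {f : Matrix N.ι M.ι A.Alg}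
    (hf : f ∈ Hom' k M N) (h : k = l + 1 := by rfl) : atM c M N f ∈ Hom' l M (cot A ⊗ N) := by
  rintro ⟨p, j⟩ i
  subst h
  refine Submodule.smul_mem _ _ (gr_cast (SemiFreeCDGA.pd_mem p (hf j i)) ?_)
  change _ = l + M.deg i - ((A.deg p - 1) + N.deg j)
  ring

theorem tD_mul_apply {I J L : Type} [Fintype I] [Fintype J] [DecidableEq I] [DecidableEq J]
    (u : I → ℤ) (v : J → ℤ) (D : Matrix I I A.Alg) (D' : Matrix J J A.Alg)
    (f : Matrix (I × J) L A.Alg) (p : I) (j : J) (i : L) : (tD u v D D' * f) (p, j) i =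
      ∑ q, sg K (v j * (1 + u q - u p)) • (D p q * f (q, j) i) +
      ∑ l, sg K (u p) • (D' j l * f (p, l) i) := by
  rw [tD, Matrix.add_mul, Matrix.add_apply, Matrix.mul_apply, Matrix.mul_apply,
    Fintype.sum_prod_type_right, Fintype.sum_prod_type,
    Finset.sum_eq_single j (fun x _ hx => Finset.sum_eq_zero fun y _ => by
      simp [wr_apply, hx.symm]) (by simp),
    Finset.sum_eq_single p (fun x _ hx => Finset.sum_eq_zero fun y _ => by
      simp [wl_apply, hx.symm]) (by simp)]
  simp [wr_apply, wl_apply]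

theorem pt_atM (M : BasedMod A) : pt' 0 M (cot A ⊗ M) (atM 1 M M M.D) = 0 := by
  suffices H : ∀ (p : Fin A.N) (j i : M.ι),
      pt' 0 M (cot A ⊗ M) (atM 1 M M M.D) (p, j) i = 0 from
    Matrix.ext fun q i => H q.1 q.2 i
  intro p j i
  have h := congrFun (congrFun M.mc j) i
  simp only [Matrix.add_apply, Matrix.mul_apply, sd_apply, Matrix.zero_apply] at h
  have h₁ := congrArg (A.pd p) h
  rw [map_add, map_sum, map_smul, SemiFreeCDGA.pd_d p (M.D_mem j i), map_zero] at h₁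
  simp only [fun l => SemiFreeCDGA.pd_mul p (M.D_mem j l) (M.D_mem l i)] at h₁
  change (tD (fun p : Fin A.N => A.deg p - 1) M.deg (cotD A) M.D * atM 1 M M M.D) (p, j) i +
    sg K (A.deg p - 1 + M.deg j) • A.d ((1 * sg K (M.deg j * A.deg p)) • A.pd p (M.D j i)) -
    sg K 0 • (atM 1 M M M.D * M.D) (p, j) i = 0
  rw [tD_mul_apply, Matrix.mul_apply, sg_zero, one_smul]
  change ∑ q, sg K (M.deg j * (1 + (A.deg q - 1) - (A.deg p - 1))) • (-A.pd p (A.dx q) *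
    (1 * sg K (M.deg j * A.deg q)) • A.pd q (M.D j i)) + ∑ l, sg K (A.deg p - 1) • (M.D j l *
    (1 * sg K (M.deg l * A.deg p)) • A.pd p (M.D l i)) + _ - ∑ l, (1 * sg K (M.deg j * A.deg p)) •
    A.pd p (M.D j l) * M.D l i = 0
  have e₁ : ∀ q, sg K (M.deg j * (1 + (A.deg q - 1) - (A.deg p - 1))) • (-A.pd p (A.dx q) *
      (1 * sg K (M.deg j * A.deg q)) • A.pd q (M.D j i)) =
      (-(sg K (M.deg j * A.deg p) * sg K (M.deg j))) • (A.pd p (A.dx q) * A.pd q (M.D j i)) := by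
    intro q
    rw [one_mul, mul_smul_comm, smul_smul, ← sg_add, ← sg_add, neg_mul, smul_neg, neg_smul,
      sg_congr (M.deg j * (A.deg q - A.deg p))]
    ring
  have e₂ : ∀ l, sg K (A.deg p - 1) • (M.D j l * (1 * sg K (M.deg l * A.deg p)) • A.pd p (M.D l i))
      = (-(sg K (M.deg j * A.deg p))) • (sg K (A.deg p * (1 + M.deg l - M.deg j)) •
        (M.D j l * A.pd p (M.D l i))) := by
    intro l
    rw [one_mul, mul_smul_comm, smul_smul, smul_smul, sg_sub_one, neg_mul, neg_mul, ← sg_add,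
      ← sg_add]
    congr 2
    congr 1
    ring
  have e₃ : sg K (A.deg p - 1 + M.deg j) * sg K (M.deg j * A.deg p) =
      -(sg K (M.deg j * A.deg p) * sg K (M.deg j) * sg K (A.deg p)) := by
    rw [sg_add, sg_sub_one]; ring
  have e₄ : ∀ l, (1 * sg K (M.deg j * A.deg p)) • A.pd p (M.D j l) * M.D l i =
      sg K (M.deg j * A.deg p) • (A.pd p (M.D j l) * M.D l i) := fun l => by
    rw [one_mul, smul_mul_assoc]
  rw [Finset.sum_add_distrib] at h₁
  rw [Finset.sum_congr rfl fun q _ => e₁ q, Finset.sum_congr rfl fun l _ => e₂ l,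
    Finset.sum_congr rfl fun l _ => e₄ l, ← Finset.smul_sum, ← Finset.smul_sum, ← Finset.smul_sum,
    one_mul, map_smul, smul_smul, e₃]
  refine Eq.trans ?_ ((congrArg (fun a => (-sg K (M.deg j * A.deg p)) • a) h₁).trans (smul_zero _))
  module

/-- The cochain map `ξ_M : M → Ω_A[1] ⊗ M`. -/
def atiyah (M : BasedMod A) : M ⟶ cot A ⊗ M := ⟨atM 1 M M M.D, atM_mem M.D_mem, pt_atM M⟩

/-- The homotopy component `ξ_f` of the pseudonatural family `ξ`. -/
def atiyahHty (M N : BasedMod A) : (M ⟶ N) →ₗ[K] H K M (cot A ⊗ N) where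
  toFun f := cls ⟨atM (-1) M N (mat f), atM_mem (mat_mem f)⟩
  map_add' f g := cls_eq (map_add (atM (-1) M N) (mat f) (mat g))
  map_smul' c f := cls_eq (map_smul (atM (-1) M N) c (mat f))

/-- The map `(Ω_A[1] ⊗ M) ⊗ (Ω_A[1] ⊗ N) → (Ω_A[1] ⊗ Ω_A[1]) ⊗ (M ⊗ N) → A ⊗ (M ⊗ N) → M ⊗ N`. -/
def contract (π : cot A ⊗ cot A ⟶ 𝟙_ (BasedMod A)) (M N : BasedMod A) :
    (cot A ⊗ M) ⊗ (cot A ⊗ N) ⟶ M ⊗ N :=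
  (λ_ (M ⊗ N)).hom ⊚ (π ▷ (M ⊗ N)) ⊚ tensorμ (cot A) M (cot A) N

/-- The components of the infinitesimal 2-braiding induced by a bivector. -/
def poisson (π : cot A ⊗ cot A ⟶ 𝟙_ (BasedMod A)) : InfData K (BasedMod A) where
  app M N := contract π M N ⊚ (atiyah M ⊗ₘ atiyah N)
  hty M M' N N' := LinearMap.mk₂ K
    (fun f g => contract π M' N' ⊳[K] ((atiyahHty M M' f) ⊗ˡ[K] ((cot A ◁ g) ⊚ atiyah N) +
      (atiyah M' ⊚ f) ⊗ʳ[K] (atiyahHty N N' g)))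
    (fun f f' g => by
      simp only [map_add, LinearMap.add_apply, Preadditive.add_comp,
        MonoidalPreadditive.add_whiskerRight]
      abel)
    (fun c f g => by
      simp only [map_smul, LinearMap.smul_apply, Linear.smul_comp, MonoidalLinear.smul_whiskerRight,
        ← smul_add])
    (fun f g g' => by
      simp only [map_add, LinearMap.add_apply, Preadditive.comp_add,
        MonoidalPreadditive.whiskerLeft_add]
      abel)
    (fun c f g => by
      simp only [map_smul, LinearMap.smul_apply, Linear.comp_smul, MonoidalLinear.whiskerLeft_smul,
        ← smul_add])

variable (A) in
/-- The elements of degree `-1` of `Sym²_A(T_A[-1])`, as graded symmetric bilinear forms on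
`Ω_A[1]`. -/
def bivectors : Submodule K ↥(Hom' (-1) (cot A ⊗ cot A) (𝟙_ (BasedMod A))) :=
  LinearMap.eqLocus (preL _ _ _ (β_ (cot A) (cot A)).hom) LinearMap.id

/-- The family `T` induced by a bilinear form of degree `-1`. -/
def poissonHty (ϖ : ↥(Hom' (-1) (cot A ⊗ cot A) (𝟙_ (BasedMod A)))) (M N : BasedMod A) :
    H K (M ⊗ N) (M ⊗ N) :=
  (λ_ (M ⊗ N)).hom ⊳[K] wr (R := K) (cot A ⊗ cot A) (𝟙_ _) (M ⊗ N) (cls ϖ) ⊲[K]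
    tensorμ (cot A) M (cot A) N ⊚ (atiyah M ⊗ₘ atiyah N)

end BasedMod

end Syl

namespace Syl

section Coherence

/-- Bracketed tensor words in labelled objects of `C`. -/
inductive Wd (C : Type*)
  | leaf (n : ℕ) (A : C)
  | unit
  | ten (a b : Wd C)

namespace Wd

variable {C : Type*} [Category C] [MonoidalCategory C]

/-- The object represented by a word. -/
@[reducible] def ev : Wd C → C
  | leaf _ A => A
  | unit => 𝟙_ C
  | ten a b => ev a ⊗ ev b

/-- The labels of a word, from left to right. -/
def labels : Wd C → List ℕ
  | leaf n _ => [n]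
  | unit => []
  | ten a b => labels a ++ labels b

variable [SymmetricCategory C]

/-- The morphisms composed of associators and symmetries. -/
inductive Coh : (w v : Wd C) → (ev w ⟶ ev v) → Prop
  | id (w : Wd C) : Coh w w (𝟙 (ev w))
  | comp (w : Wd C) (v x : Wd C) (f : ev w ⟶ ev v) (g : ev v ⟶ ev x) :
      Coh w v f → Coh v x g → Coh w x (f ≫ g)
  | wl (a b : Wd C) (c : Wd C) (f : ev b ⟶ ev c) :
      Coh b c f → Coh (ten a b) (ten a c) (ev a ◁ f)
  | wr (a b : Wd C) (c : Wd C) (f : ev a ⟶ ev c) :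
      Coh a c f → Coh (ten a b) (ten c b) (f ▷ ev b)
  | assoc (a b c : Wd C) : Coh (ten (ten a b) c) (ten a (ten b c)) (α_ (ev a) (ev b) (ev c)).hom
  | assocInv (a b c : Wd C) : Coh (ten a (ten b c)) (ten (ten a b) c) (α_ (ev a) (ev b) (ev c)).inv
  | braid (a b : Wd C) : Coh (ten a b) (ten b a) (β_ (ev a) (ev b)).hom

/-- Extraction of a leaf from a word. -/
inductive Extract (n : ℕ) (X : C) : (w w' : Wd C) → (ev w ⟶ X ⊗ ev w') → Prop
  | leaf : Extract n X (leaf n X) unit (ρ_ X).inv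
  | left (a a' b : Wd C) (m : ev a ⟶ X ⊗ ev a') : Extract n X a a' m →
      Extract n X (ten a b) (ten a' b) (m ▷ ev b ≫ (α_ X (ev a') (ev b)).hom)
  | right (a b b' : Wd C) (m : ev b ⟶ X ⊗ ev b') : Extract n X b b' m →
      Extract n X (ten a b) (ten a b') (ev a ◁ m ≫ (α_ (ev a) X (ev b')).inv ≫
        (β_ (ev a) X).hom ▷ ev b' ≫ (α_ X (ev a) (ev b')).hom)

variable {n : ℕ} {X : C} {w v x : Wd C}

theorem Extract.isIso {m : ev w ⟶ X ⊗ ev v} (h : Extract n X w v m) : IsIso m := by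
  induction h <;> infer_instance

theorem Extract.perm {m : ev w ⟶ X ⊗ ev v} (h : Extract n X w v m) :
    w.labels.Perm (n :: v.labels) := by
  induction h with
  | leaf => rfl
  | left a a' b m h ih => exact ih.append_right _
  | right a b b' m h ih => exact (ih.append_left _).trans List.perm_middle

theorem Extract.mem {m : ev w ⟶ X ⊗ ev v} (h : Extract n X w v m) : n ∈ w.labels :=
  h.perm.symm.subset (List.mem_cons_self)

theorem Extract.exists {w : Wd C} (h : w.labels ≠ []) :
    ∃ (n : ℕ) (X : C) (w' : Wd C) (m : ev w ⟶ X ⊗ ev w'), Extract n X w w' m := by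
  induction w with
  | leaf n A => exact ⟨n, A, _, _, .leaf⟩
  | unit => exact absurd rfl h
  | ten a b iha ihb =>
    by_cases ha : a.labels = []
    · have hb : b.labels ≠ [] := fun hb => h (by simp [labels, ha, hb])
      obtain ⟨n, X, w', m, e⟩ := ihb hb
      exact ⟨n, X, _, _, .right _ _ _ _ e⟩
    · obtain ⟨n, X, w', m, e⟩ := iha ha
      exact ⟨n, X, _, _, .left _ _ _ _ e⟩

theorem Extract.unique {w v : Wd C} {m : ev w ⟶ X ⊗ ev v} (h : Extract n X w v m)
    (hw : w.labels.Nodup) : ∀ {v' : Wd C} {m' : ev w ⟶ X ⊗ ev v'}, Extract n X w v' m' →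
    (⟨v, m⟩ : Σ v : Wd C, (ev w ⟶ X ⊗ ev v)) = ⟨v', m'⟩ := by
  induction h with
  | leaf => intro v' m' h'; cases h'; rfl
  | left a a' b m h ih =>
    intro v' m' h'
    rw [labels, List.nodup_append'] at hw
    cases h' with
    | left _ a'' _ m'' h'' => cases ih hw.1 h''; rfl
    | right _ _ b'' m'' h'' => exact absurd h''.mem (hw.2.2 h.mem)
  | right a b b' m h ih =>
    intro v' m' h'
    rw [labels, List.nodup_append'] at hw
    cases h' with
    | left _ a'' _ m'' h'' => exact absurd h.mem (hw.2.2 h''.mem)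
    | right _ _ b'' m'' h'' => cases ih hw.2.1 h''; rfl

theorem Extract.transport {f : ev w ⟶ ev v} (h : Coh w v f) :
    ∀ {w' : Wd C} {m : ev w ⟶ X ⊗ ev w'}, Extract n X w w' m →
      ∃ (v' : Wd C) (m' : ev v ⟶ X ⊗ ev v') (f' : ev w' ⟶ ev v'), Extract n X v v' m' ∧
        Coh w' v' f' ∧ f ≫ m' = m ≫ X ◁ f' := by
  induction h with
  | id w => intro w' m e; exact ⟨w', m, 𝟙 _, e, .id _, by simp⟩
  | comp w v x f g _ _ ihf ihg =>
    intro w' m e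
    obtain ⟨v', m', f', e', h', p⟩ := ihf e
    obtain ⟨x', m'', g', e'', h'', q⟩ := ihg e'
    exact ⟨x', m'', f' ≫ g', e'', .comp _ _ _ _ _ h' h'', by
      rw [Category.assoc, q, reassoc_of% p, MonoidalCategory.whiskerLeft_comp]⟩
  | wl a b c f hf ih =>
    intro w' m e
    cases e with
    | left _ a' _ m h =>
      exact ⟨_, _, _, .left _ _ _ _ h, .wl _ _ _ _ hf, by
        simp [whisker_exchange_assoc]⟩
    | right _ _ b' m h =>
      obtain ⟨c', m', f', e', h', p⟩ := ih h
      refine ⟨_, _, _, .right _ _ _ _ e', .wl _ _ _ _ h', ?_⟩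
      rw [← MonoidalCategory.whiskerLeft_comp_assoc, p, MonoidalCategory.whiskerLeft_comp]
      simp only [Category.assoc, associator_inv_naturality_right_assoc, whisker_exchange_assoc,
        associator_naturality_right]
  | wr a b c f hf ih =>
    intro w' m e
    cases e with
    | right _ _ b' m h =>
      refine ⟨_, _, _, .right _ _ _ _ h, .wr _ _ _ _ hf, ?_⟩
      rw [← whisker_exchange_assoc]
      simp only [Category.assoc]
      rw [associator_inv_naturality_left_assoc, ← comp_whiskerRight_assoc, braiding_naturality_left]
      simp
    | left _ a' _ m h =>
      obtain ⟨c', m', f', e', h', p⟩ := ih h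
      refine ⟨_, _, _, .left _ _ _ _ e', .wr _ _ _ _ h', ?_⟩
      rw [← comp_whiskerRight_assoc, p]
      simp
  | assoc a b c =>
    intro w' m e
    cases e with
    | left _ a' _ m h =>
      cases h with
      | left _ a' _ m h =>
        exact ⟨_, _, _, .left _ _ _ _ h, .assoc _ _ _, by simp⟩
      | right _ _ b' m h =>
        refine ⟨_, _, _, .right _ _ _ _ (.left _ _ _ _ h), .assoc _ _ _, ?_⟩
        simp
    | right _ _ b' m h =>
      refine ⟨_, _, _, .right _ _ _ _ (.right _ _ _ _ h), .assoc _ _ _, ?_⟩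
      simp [BraidedCategory.braiding_tensor_left_hom]
  | assocInv a b c =>
    intro w' m e
    cases e with
    | left _ a' _ m h =>
      refine ⟨_, _, _, .left _ _ _ _ (.left _ _ _ _ h), .assocInv _ _ _, ?_⟩
      simp
    | right _ _ b' m h =>
      cases h with
      | left _ a' _ m h =>
        refine ⟨_, _, _, .left _ _ _ _ (.right _ _ _ _ h), .assocInv _ _ _, ?_⟩
        simp
      | right _ _ b' m h =>
        refine ⟨_, _, _, .right _ _ _ _ h, .assocInv _ _ _, ?_⟩
        simp [BraidedCategory.braiding_tensor_left_hom]
  | braid a b =>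
    intro w' m e
    cases e with
    | left _ a' _ m h =>
      refine ⟨_, _, _, .right _ _ _ _ h, .braid _ _, ?_⟩
      rw [← braiding_naturality_left_assoc, BraidedCategory.braiding_tensor_left_hom]
      simp [← comp_whiskerRight_assoc]
    | right _ _ b' m h =>
      refine ⟨_, _, _, .left _ _ _ _ h, .braid _ _, ?_⟩
      rw [← braiding_naturality_right_assoc, BraidedCategory.braiding_tensor_right_hom]
      simp

theorem Coh.perm {f : ev w ⟶ ev v} (h : Coh w v f) : w.labels.Perm v.labels := by
  induction h with
  | id => rfl
  | comp _ _ _ _ _ _ _ h h' => exact h.trans h'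
  | wl _ _ _ _ _ h => exact h.append_left _
  | wr _ _ _ _ _ h => exact h.append_right _
  | assoc => simp [labels]
  | assocInv => simp [labels]
  | braid => exact List.perm_append_comm

/-- The map to the unit object from a word without leaves. -/
def collapse : (w : Wd C) → w.labels = [] → (ev w ⟶ 𝟙_ C)
  | leaf _ _, h => absurd h (by simp [labels])
  | unit, _ => 𝟙 _
  | ten a b, h => (collapse a (List.append_eq_nil_iff.1 h).1 ⊗ₘ
      collapse b (List.append_eq_nil_iff.1 h).2) ≫ (λ_ (𝟙_ C)).hom

theorem collapse_isIso (w : Wd C) (h : w.labels = []) : IsIso (collapse w h) := by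
  induction w with
  | leaf n A => exact absurd h (by simp [labels])
  | unit => exact inferInstanceAs (IsIso (𝟙 (𝟙_ C)))
  | ten a b iha ihb =>
    have := iha (List.append_eq_nil_iff.1 h).1
    have := ihb (List.append_eq_nil_iff.1 h).2
    rw [collapse]
    infer_instance

theorem collapse_assoc {A B D : C} (f : A ⟶ 𝟙_ C) (g : B ⟶ 𝟙_ C) (h : D ⟶ 𝟙_ C) :
    (α_ A B D).hom ≫ (f ⊗ₘ ((g ⊗ₘ h) ≫ (λ_ (𝟙_ C)).hom)) ≫ (λ_ (𝟙_ C)).hom =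
      (((f ⊗ₘ g) ≫ (λ_ (𝟙_ C)).hom) ⊗ₘ h) ≫ (λ_ (𝟙_ C)).hom := by
  monoidal

theorem Coh.collapse {f : ev w ⟶ ev v} (h : Coh w v f) (hw : w.labels = [])
    (hv : v.labels = []) : f ≫ collapse v hv = collapse w hw := by
  induction h with
  | id => simp
  | comp w v x f g hf hg ihf ihg =>
    have h' : v.labels = [] := by have := hf.perm; rw [hw] at this; simpa using this.symm
    rw [Category.assoc, ihg h' hv, ihf hw h']
  | wl a b c f hf ih =>
    have h := ih (List.append_eq_nil_iff.1 hw).2 (List.append_eq_nil_iff.1 hv).2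
    simp only [Wd.collapse, ← h, MonoidalCategory.tensorHom_def]
    simp [whisker_exchange_assoc]
  | wr a b c f hf ih =>
    have h := ih (List.append_eq_nil_iff.1 hw).1 (List.append_eq_nil_iff.1 hv).1
    simp only [Wd.collapse, ← h, MonoidalCategory.tensorHom_def]
    simp
  | assoc a b c =>
    simp only [Wd.collapse]
    exact collapse_assoc _ _ _
  | assocInv a b c =>
    simp only [Wd.collapse]
    rw [Iso.inv_comp_eq]
    exact (collapse_assoc _ _ _).symm
  | braid a b =>
    simp only [Wd.collapse]
    rw [← braiding_naturality_assoc, braiding_leftUnitor, unitors_equal]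

theorem Coh.unique {f : ev w ⟶ ev v} (h : Coh w v f) : ∀ {g : ev w ⟶ ev v}, Coh w v g →
    w.labels.Nodup → f = g := by
  generalize hk : w.labels.length = k
  intro g hg hw
  induction k generalizing w v with
  | zero =>
    have hw' := List.length_eq_zero_iff.1 hk
    have hv : v.labels = [] := by have := h.perm; rw [hw'] at this; simpa using this.symm
    have := collapse_isIso v hv
    rw [← cancel_mono (Wd.collapse v hv), h.collapse hw' hv, hg.collapse hw' hv]
  | succ k ih =>
    obtain ⟨n, X, w', m, e⟩ := Extract.exists (w := w) (by
      intro h'; simp [h'] at hk)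
    obtain ⟨v', m', f', e', h', p⟩ := e.transport h
    obtain ⟨v'', m'', g', e'', h'', q⟩ := e.transport hg
    cases e'.unique (h.perm.nodup hw) e''
    have hn := e.perm.nodup hw
    have hl := e.perm.length_eq
    have := e'.isIso
    rw [← cancel_mono m', p, q, ih h' (by rw [hk] at hl; simpa using hl.symm) h''
      (List.nodup_cons.1 hn).2]

/-- The word `w` represents the object `A`. -/
class Rep (w : Wd C) (A : C) : Prop where
  eq : ev w = A

instance (n : ℕ) (A : C) : Rep (leaf n A) A := ⟨rfl⟩
instance (a b : Wd C) (A B : C) [h : Rep a A] [h' : Rep b B] : Rep (ten a b) (A ⊗ B) :=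
  ⟨congrArg₂ (· ⊗ ·) h.eq h'.eq⟩

/-- A version of `Coh` for which words are found by instance resolution. -/
class IsCoh (w : Wd C) (v : outParam (Wd C)) {A B : C} (f : A ⟶ B) : Prop where
  out : ∃ (hw : ev w = A) (hv : B = ev v), Coh w v (eqToHom hw ≫ f ≫ eqToHom hv)

section
variable {A A' B B' D : C} {a a' b b' c : Wd C}

instance [h : Rep a A] : IsCoh a a (𝟙 A) := by
  obtain ⟨rfl⟩ := h
  exact ⟨rfl, rfl, by simpa using .id a⟩

instance (f : A ⟶ B) (g : B ⟶ D) [h : IsCoh a b f] [h' : IsCoh b c g] : IsCoh a c (f ≫ g) := by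
  obtain ⟨rfl, rfl, h⟩ := h
  obtain ⟨_, rfl, h'⟩ := h'
  exact ⟨rfl, rfl, by simpa using Coh.comp _ _ _ _ _ h h'⟩

instance (f : A ⟶ A') [h : IsCoh a a' f] [h' : Rep b B] : IsCoh (ten a b) (ten a' b) (f ▷ B) := by
  obtain ⟨rfl, rfl, h⟩ := h
  obtain ⟨rfl⟩ := h'
  exact ⟨rfl, rfl, by simpa [ev] using Coh.wr _ _ _ _ h⟩

instance (f : B ⟶ B') [h : IsCoh b b' f] [h' : Rep a A] : IsCoh (ten a b) (ten a b') (A ◁ f) := by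
  obtain ⟨rfl, rfl, h⟩ := h
  obtain ⟨rfl⟩ := h'
  exact ⟨rfl, rfl, by simpa [ev] using Coh.wl _ _ _ _ h⟩

instance [h : Rep a A] [h' : Rep b B] [h'' : Rep c D] :
    IsCoh (ten (ten a b) c) (ten a (ten b c)) (α_ A B D).hom := by
  obtain ⟨rfl⟩ := h; obtain ⟨rfl⟩ := h'; obtain ⟨rfl⟩ := h''
  exact ⟨rfl, rfl, by simpa [ev] using Coh.assoc a b c⟩

instance [h : Rep a A] [h' : Rep b B] [h'' : Rep c D] :
    IsCoh (ten a (ten b c)) (ten (ten a b) c) (α_ A B D).inv := by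
  obtain ⟨rfl⟩ := h; obtain ⟨rfl⟩ := h'; obtain ⟨rfl⟩ := h''
  exact ⟨rfl, rfl, by simpa [ev] using Coh.assocInv a b c⟩

instance [h : Rep a A] [h' : Rep b B] : IsCoh (ten a b) (ten b a) (β_ A B).hom := by
  obtain ⟨rfl⟩ := h; obtain ⟨rfl⟩ := h'
  exact ⟨rfl, rfl, by simpa [ev] using Coh.braid a b⟩

end

/-- Coherence for symmetric monoidal categories: parallel morphisms that are composed of associators
and symmetries are equal if the labels are distinct. -/
theorem coherence (w : Wd C) {v : Wd C} {A B : C} {f g : A ⟶ B} [h : IsCoh w v f]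
    [h' : IsCoh w v g] (hw : w.labels.Nodup := by simp [labels]) : f = g := by
  obtain ⟨rfl, rfl, h⟩ := h
  obtain ⟨_, _, h'⟩ := h'
  simpa using h.unique h' hw

end Wd
end Coherence
end Syl

namespace Syl

open TwoCells TwoCellsMonoidal

section Preadditive

variable {C : Type*} [Category C] [Preadditive C] [MonoidalCategory C] [MonoidalPreadditive C]

theorem whiskerLeft_sub (X : C) {Y Z : C} (f g : Y ⟶ Z) : X ◁ (f - g) = X ◁ f - X ◁ g := by
  rw [eq_sub_iff_add_eq, ← MonoidalPreadditive.whiskerLeft_add, sub_add_cancel]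

theorem sub_whiskerRight {Y Z : C} (f g : Y ⟶ Z) (X : C) : (f - g) ▷ X = f ▷ X - g ▷ X := by
  rw [eq_sub_iff_add_eq, ← MonoidalPreadditive.add_whiskerRight, sub_add_cancel]

end Preadditive

section Squares

variable {R : Type*} [CommRing R] {C : Type*} [Category C] [Preadditive C] [Linear R C]
  [TwoCells R C]

local notation:80 g:81 " ⊳ " q:80 => g ⊳[R] q
local notation:80 q:81 " ⊲ " f:80 => q ⊲[R] f

/-- The 1-cells of `C`, as objects of the category of squares that commute up to a chosen element of
degree `-1`. -/
structure Arr (R C : Type*) [Category C] where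
  {src tgt : C}
  map : src ⟶ tgt

namespace Arr

/-- The failure of a square with a chosen element of degree `-1` to commute up to that element. -/
def defect (F G : Arr R C) :
    (F.src ⟶ G.src) × (F.tgt ⟶ G.tgt) × H R F.src G.tgt →ₗ[R] (F.src ⟶ G.tgt) where
  toFun p := G.map ⊚ p.1 - p.2.1 ⊚ F.map - ∂[R] p.2.2
  map_add' p q := by simp; abel
  map_smul' c p := by simp [smul_sub]

instance : Category (Arr R C) where
  Hom F G := ↥(LinearMap.ker (defect F G))
  id F := ⟨(𝟙 _, 𝟙 _, 0), by simp [defect]⟩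
  comp {F G K} f g := ⟨(g.1.1 ⊚ f.1.1, g.1.2.1 ⊚ f.1.2.1, g.1.2.2 ⊲ f.1.1 + g.1.2.1 ⊳ f.1.2.2), by
    have hf := sub_eq_zero.1 (LinearMap.mem_ker.1 f.2)
    have hg := sub_eq_zero.1 (LinearMap.mem_ker.1 g.2)
    simp only [defect, LinearMap.coe_mk, AddHom.coe_mk, LinearMap.mem_ker, map_add, bd_post,
      bd_pre, ← hf, ← hg]
    simp⟩
  id_comp f := Subtype.ext <| Prod.ext (Category.id_comp _) <| Prod.ext (Category.id_comp _) <| by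
    simp [pre_id]
  comp_id f := Subtype.ext <| Prod.ext (Category.comp_id _) <| Prod.ext (Category.comp_id _) <| by
    simp [post_id]
  assoc f g k := Subtype.ext <| Prod.ext (Category.assoc _ _ _) <| Prod.ext (Category.assoc _ _ _) <| by
    simp [pre_comp, post_comp, post_pre, add_assoc]

variable {F G K F' G' : Arr R C}

/-- The source of a square. -/
def l (f : F ⟶ G) : F.src ⟶ G.src := f.1.1

/-- The target of a square. -/
def r (f : F ⟶ G) : F.tgt ⟶ G.tgt := f.1.2.1

/-- The element of degree `-1` of a square. -/
def h (f : F ⟶ G) : H R F.src G.tgt := f.1.2.2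

theorem w (f : F ⟶ G) : G.map ⊚ l f - r f ⊚ F.map = ∂[R] (h f) :=
  sub_eq_zero.1 (LinearMap.mem_ker.1 f.2)

/-- The square with given components. -/
def mk' (l : F.src ⟶ G.src) (r : F.tgt ⟶ G.tgt) (h : H R F.src G.tgt)
    (w : G.map ⊚ l - r ⊚ F.map = ∂[R] h) : F ⟶ G := ⟨(l, r, h), sub_eq_zero.2 w⟩

@[ext] theorem hom_ext {f g : F ⟶ G} (hl : l f = l g) (hr : r f = r g) (hh : h f = h g) : f = g :=
  Subtype.ext (Prod.ext hl (Prod.ext hr hh))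

section
variable (l' : F.src ⟶ G.src) (r' : F.tgt ⟶ G.tgt) (h' : H R F.src G.tgt)
  (w' : G.map ⊚ l' - r' ⊚ F.map = ∂[R] h')
@[simp] theorem l_mk' : l (mk' l' r' h' w') = l' := rfl
@[simp] theorem r_mk' : r (mk' l' r' h' w') = r' := rfl
@[simp] theorem h_mk' : h (mk' l' r' h' w') = h' := rfl
end

@[simp] theorem l_id : l (𝟙 F) = 𝟙 _ := rfl
@[simp] theorem r_id : r (𝟙 F) = 𝟙 _ := rfl
@[simp] theorem h_id : h (𝟙 F) = 0 := rfl
@[simp] theorem l_comp (f : F ⟶ G) (g : G ⟶ K) : l (f ≫ g) = l f ≫ l g := rfl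
@[simp] theorem r_comp (f : F ⟶ G) (g : G ⟶ K) : r (f ≫ g) = r f ≫ r g := rfl
@[simp] theorem h_comp (f : F ⟶ G) (g : G ⟶ K) : h (f ≫ g) = h g ⊲ l f + r g ⊳ h f := rfl

instance : Preadditive (Arr R C) where
  homGroup F G := inferInstanceAs (AddCommGroup ↥(LinearMap.ker (defect F G)))
  add_comp F G K f f' g := by
    refine hom_ext ?_ ?_ ?_
    · exact Preadditive.add_comp _ _ _ (l f) (l f') (l g)
    · exact Preadditive.add_comp _ _ _ (r f) (r f') (r g)
    · change h g ⊲ (l f + l f') + r g ⊳ (h f + h f') = h g ⊲ l f + r g ⊳ h f + (h g ⊲ l f' + r g ⊳ h f')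
      rw [map_add, map_add]; abel
  comp_add F G K f g g' := by
    refine hom_ext ?_ ?_ ?_
    · exact Preadditive.comp_add _ _ _ (l f) (l g) (l g')
    · exact Preadditive.comp_add _ _ _ (r f) (r g) (r g')
    · change (h g + h g') ⊲ l f + (r g + r g') ⊳ h f = h g ⊲ l f + r g ⊳ h f + (h g' ⊲ l f + r g' ⊳ h f)
      rw [map_add, map_add, LinearMap.add_apply, LinearMap.add_apply]; abel

instance : Linear R (Arr R C) where
  homModule F G := inferInstanceAs (Module R ↥(LinearMap.ker (defect F G)))
  smul_comp F G K c f g := by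
    refine hom_ext ?_ ?_ ?_
    · exact Linear.smul_comp _ _ _ c (l f) (l g)
    · exact Linear.smul_comp _ _ _ c (r f) (r g)
    · change h g ⊲ (c • l f) + r g ⊳ (c • h f) = c • (h g ⊲ l f + r g ⊳ h f)
      rw [map_smul, map_smul, smul_add]
  comp_smul F G K f c g := by
    refine hom_ext ?_ ?_ ?_
    · exact Linear.comp_smul _ _ _ (l f) c (l g)
    · exact Linear.comp_smul _ _ _ (r f) c (r g)
    · change (c • h g) ⊲ l f + (c • r g) ⊳ h f = c • (h g ⊲ l f + r g ⊳ h f)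
      rw [map_smul, map_smul, smul_add, LinearMap.smul_apply, LinearMap.smul_apply]

@[simp] theorem l_add (f g : F ⟶ G) : l (f + g) = l f + l g := rfl
@[simp] theorem r_add (f g : F ⟶ G) : r (f + g) = r f + r g := rfl
@[simp] theorem h_add (f g : F ⟶ G) : h (f + g) = h f + h g := rfl
@[simp] theorem l_sub (f g : F ⟶ G) : l (f - g) = l f - l g := rfl
@[simp] theorem r_sub (f g : F ⟶ G) : r (f - g) = r f - r g := rfl
@[simp] theorem h_sub (f g : F ⟶ G) : h (f - g) = h f - h g := rfl
@[simp] theorem l_zero : l (0 : F ⟶ G) = 0 := rfl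
@[simp] theorem r_zero : r (0 : F ⟶ G) = 0 := rfl
@[simp] theorem h_zero : h (0 : F ⟶ G) = 0 := rfl
@[simp] theorem l_smul (c : R) (f : F ⟶ G) : l (c • f) = c • l f := rfl
@[simp] theorem r_smul (c : R) (f : F ⟶ G) : r (c • f) = c • r f := rfl
@[simp] theorem h_smul (c : R) (f : F ⟶ G) : h (c • f) = c • h f := rfl

/-- An isomorphism in the category of squares from a strictly commutative square of isomorphisms. -/
def isoMk (e : F.src ≅ G.src) (e' : F.tgt ≅ G.tgt) (p : e.hom ≫ G.map = F.map ≫ e'.hom) : F ≅ G where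
  hom := mk' e.hom e'.hom 0 (by rw [p, sub_self, map_zero])
  inv := mk' e.inv e'.inv 0 (by
    rw [← cancel_epi e.hom, ← cancel_mono e'.hom]; simp [Preadditive.sub_comp, ← p])
  hom_inv_id := by ext <;> simp
  inv_hom_id := by ext <;> simp

variable [MonoidalCategory C] [MonoidalPreadditive C] [MonoidalLinear R C] [SymmetricCategory C]
  [TwoCellsMonoidal R C]

local notation:90 f:91 " ⊗ʳ " q:90 => f ⊗ʳ[R] q
local notation:90 q:91 " ⊗ˡ " g:90 => q ⊗ˡ[R] g

theorem associator_naturality' (F G K : Arr R C) :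
    (α_ F.src G.src K.src).hom ≫ (F.map ⊗ₘ (G.map ⊗ₘ K.map)) =
      ((F.map ⊗ₘ G.map) ⊗ₘ K.map) ≫ (α_ F.tgt G.tgt K.tgt).hom :=
  (MonoidalCategory.associator_naturality _ _ _).symm

instance : MonoidalCategoryStruct (Arr R C) where
  tensorObj F G := ⟨F.map ⊗ₘ G.map⟩
  whiskerLeft F G G' f := mk' (F.src ◁ l f) (F.tgt ◁ r f) (F.map ⊗ʳ h f) (by
    rw [bd_post, bd_wl, ← w]
    simp [MonoidalCategory.tensorHom_def, whisker_exchange, whisker_exchange_assoc, whiskerLeft_sub])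
  whiskerRight {F F'} f G := mk' (l f ▷ G.src) (r f ▷ G.tgt) (h f ⊗ˡ G.map) (by
    rw [bd_post, bd_wr, ← w]
    simp [MonoidalCategory.tensorHom_def, whisker_exchange, sub_whiskerRight])
  tensorUnit := ⟨𝟙 (𝟙_ C)⟩
  associator F G K := isoMk (α_ _ _ _) (α_ _ _ _) (associator_naturality' F G K)
  leftUnitor F := isoMk (λ_ _) (λ_ _) (by simp)
  rightUnitor F := isoMk (ρ_ _) (ρ_ _) (by simp)

section
variable (F) (f : G ⟶ K)
@[simp] theorem l_wl : l (F ◁ f) = F.src ◁ l f := rfl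
@[simp] theorem r_wl : r (F ◁ f) = F.tgt ◁ r f := rfl
@[simp] theorem h_wl : h (F ◁ f) = F.map ⊗ʳ h f := rfl
@[simp] theorem l_wr : l (f ▷ F) = l f ▷ F.src := rfl
@[simp] theorem r_wr : r (f ▷ F) = r f ▷ F.tgt := rfl
@[simp] theorem h_wr : h (f ▷ F) = h f ⊗ˡ F.map := rfl
end

section
variable (F G K)
@[simp] theorem src_tensor : (F ⊗ G).src = F.src ⊗ G.src := rfl
@[simp] theorem tgt_tensor : (F ⊗ G).tgt = F.tgt ⊗ G.tgt := rfl
@[simp] theorem map_tensor : (F ⊗ G).map = F.map ⊗ₘ G.map := rfl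
@[simp] theorem src_unit : (𝟙_ (Arr R C)).src = 𝟙_ C := rfl
@[simp] theorem tgt_unit : (𝟙_ (Arr R C)).tgt = 𝟙_ C := rfl
@[simp] theorem map_unit : (𝟙_ (Arr R C)).map = 𝟙 (𝟙_ C) := rfl
@[simp] theorem l_assoc : l (α_ F G K).hom = (α_ F.src G.src K.src).hom := rfl
@[simp] theorem r_assoc : r (α_ F G K).hom = (α_ F.tgt G.tgt K.tgt).hom := rfl
@[simp] theorem h_assoc : h (α_ F G K).hom = 0 := rfl
@[simp] theorem l_assoc_inv : l (α_ F G K).inv = (α_ F.src G.src K.src).inv := rfl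
@[simp] theorem r_assoc_inv : r (α_ F G K).inv = (α_ F.tgt G.tgt K.tgt).inv := rfl
@[simp] theorem h_assoc_inv : h (α_ F G K).inv = 0 := rfl
@[simp] theorem l_leftUnitor : l (λ_ F).hom = (λ_ F.src).hom := rfl
@[simp] theorem r_leftUnitor : r (λ_ F).hom = (λ_ F.tgt).hom := rfl
@[simp] theorem h_leftUnitor : h (λ_ F).hom = 0 := rfl
@[simp] theorem l_rightUnitor : l (ρ_ F).hom = (ρ_ F.src).hom := rfl
@[simp] theorem r_rightUnitor : r (ρ_ F).hom = (ρ_ F.tgt).hom := rfl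
@[simp] theorem h_rightUnitor : h (ρ_ F).hom = 0 := rfl
end

theorem whisker_exch (f : F ⟶ F') (g : G ⟶ G') : F ◁ g ≫ f ▷ G' = f ▷ G ≫ F' ◁ g := by
  refine hom_ext (whisker_exchange _ _) (whisker_exchange _ _) ?_
  dsimp only [h_comp, h_wl, h_wr, l_wl, l_wr, r_wl, r_wr, src_tensor, tgt_tensor]
  rw [post_pre, post_pre, ← wr_exch, ← wl_exch, ← post_comp, ← post_comp, ← post_comp, ← post_comp,
    ← MonoidalCategory.whiskerLeft_comp, ← MonoidalCategory.whiskerLeft_comp,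
    ← comp_whiskerRight, ← comp_whiskerRight]
  have h₁ := congrArg (fun k => (F'.tgt ◁ k) ⊳ wr _ _ _ (h f)) (w g)
  have h₂ := congrArg (fun k => (k ▷ G'.tgt) ⊳ wl _ _ _ (h g)) (w f)
  simp only [whiskerLeft_sub, sub_whiskerRight, map_sub, LinearMap.sub_apply] at h₁ h₂
  have h₃ : (F'.tgt ◁ ∂[R] (h g)) ⊳ wr _ _ _ (h f) = (∂[R] (h f) ▷ G'.tgt) ⊳ wl _ _ _ (h g) := by
    rw [← bd_wl, peiffer, bd_wr, wl_exch]
  rw [h₃, ← h₂] at h₁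
  rw [← sub_eq_zero] at h₁ ⊢
  rw [← h₁]
  abel

theorem nat_left (f : F ⟶ F') (G K : Arr R C) :
    (f ▷ G) ▷ K ≫ (α_ F' G K).hom = (α_ F G K).hom ≫ f ▷ (G ⊗ K) := by
  refine hom_ext (by simp) (by simp) ?_
  dsimp only [h_comp, h_wr, l_wr, r_wr, h_assoc, l_assoc, r_assoc, map_tensor, src_tensor, tgt_tensor]
  simp only [map_zero, LinearMap.zero_apply, zero_add, add_zero, wr_post, post_pre,
    ← TwoCellsMonoidal.assoc_left, ← post_comp, MonoidalCategory.tensorHom_def]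
  simp

theorem nat_middle (F : Arr R C) (f : G ⟶ G') (K : Arr R C) :
    (F ◁ f) ▷ K ≫ (α_ F G' K).hom = (α_ F G K).hom ≫ F ◁ (f ▷ K) := by
  refine hom_ext (by simp) (by simp) ?_
  dsimp only [h_comp, h_wr, l_wr, r_wr, h_wl, l_wl, r_wl, h_assoc, l_assoc, r_assoc, map_tensor, src_tensor, tgt_tensor]
  simp only [map_zero, LinearMap.zero_apply, zero_add, add_zero, wr_post, wl_post, post_pre,
    ← TwoCellsMonoidal.assoc_middle, ← post_comp, MonoidalCategory.tensorHom_def, Category.assoc,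
    whisker_exchange]
  simp

theorem nat_right (F G : Arr R C) (f : K ⟶ F') :
    (F ⊗ G) ◁ f ≫ (α_ F G F').hom = (α_ F G K).hom ≫ F ◁ (G ◁ f) := by
  refine hom_ext (by simp) (by simp) ?_
  dsimp only [h_comp, h_wr, l_wr, r_wr, h_wl, l_wl, r_wl, h_assoc, l_assoc, r_assoc, map_tensor, src_tensor, tgt_tensor]
  simp only [map_zero, LinearMap.zero_apply, zero_add, add_zero, wr_post, wl_post, post_pre,
    ← TwoCellsMonoidal.assoc_right, ← post_comp, MonoidalCategory.tensorHom_def, Category.assoc,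
    whisker_exchange]
  simp

instance : MonoidalCategory (Arr R C) :=
  monoidalOfWhiskers inferInstance
    (tensor_def := fun _ _ => rfl)
    (wl_id := fun F G => hom_ext (by simp) (by simp) (by simp))
    (wr_id := fun F G => hom_ext (by simp) (by simp) (by simp))
    (wl_comp := fun F _ _ _ f g => hom_ext (by simp) (by simp) (by
      dsimp only [h_comp, h_wl, l_wl, r_wl, src_tensor, tgt_tensor]
      simp only [map_add, wl_pre, wl_post, post_pre, ← post_comp, whisker_exchange]))
    (wr_comp := fun f g F => hom_ext (by simp) (by simp) (by
      dsimp only [h_comp, h_wr, l_wr, r_wr, src_tensor, tgt_tensor]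
      simp only [map_add, wr_pre, wr_post, post_pre, ← post_comp, whisker_exchange]))
    (exch := whisker_exch)
    (assoc_left := nat_left)
    (assoc_middle := fun F _ _ f K => nat_middle F f K)
    (assoc_right := fun F G _ _ f => nat_right F G f)
    (unit_left := fun f => hom_ext (leftUnitor_naturality _) (leftUnitor_naturality _) (by
      dsimp only [h_comp, h_wl, l_wl, r_wl, src_tensor, tgt_tensor, map_unit, src_unit, tgt_unit,
        h_leftUnitor, l_leftUnitor, r_leftUnitor, h_rightUnitor, l_rightUnitor, r_rightUnitor]
      simp [post_id, unit_left]))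
    (unit_right := fun f => hom_ext (rightUnitor_naturality _) (rightUnitor_naturality _) (by
      dsimp only [h_comp, h_wr, l_wr, r_wr, src_tensor, tgt_tensor, map_unit, src_unit, tgt_unit,
        h_leftUnitor, l_leftUnitor, r_leftUnitor, h_rightUnitor, l_rightUnitor, r_rightUnitor]
      simp [post_id, unit_right]))
    (pentagon := fun W X Y Z => hom_ext (by simp) (by simp) (by simp))
    (triangle := fun X Y => hom_ext (by simp) (by simp) (by simp))

instance : MonoidalPreadditive (Arr R C) where
  whiskerLeft_zero := hom_ext (by simp) (by simp) (by simp)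
  zero_whiskerRight := hom_ext (by simp) (by simp) (by simp)
  whiskerLeft_add f g := hom_ext (by simp) (by simp) (by simp)
  add_whiskerRight f g := hom_ext (by simp) (by simp) (by simp)

instance : MonoidalLinear R (Arr R C) where
  whiskerLeft_smul _ _ _ c f := hom_ext (by simp) (by simp) (by simp)
  smul_whiskerRight c _ _ f _ := hom_ext (by simp) (by simp) (by simp)

/-- The symmetry on the category of squares. -/
def braid (F G : Arr R C) : F ⊗ G ≅ G ⊗ F :=
  isoMk (β_ F.src G.src) (β_ F.tgt G.tgt) (braiding_naturality F.map G.map).symm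

theorem braid_right (F : Arr R C) (f : G ⟶ K) :
    F ◁ f ≫ (braid F K).hom = (braid F G).hom ≫ f ▷ F := by
  refine hom_ext (braiding_naturality_right _ _) (braiding_naturality_right _ _) ?_
  change (0 : H R _ _) ⊲ _ + (β_ F.tgt K.tgt).hom ⊳ (F.map ⊗ʳ h f) =
    (h f ⊗ˡ F.map) ⊲ (β_ F.src G.src).hom + _ ⊳ (0 : H R _ _)
  simp only [map_zero, LinearMap.zero_apply, zero_add, add_zero, post_pre, ← symm_right, ← post_comp]
  simp

theorem braid_left (f : G ⟶ K) (F : Arr R C) :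
    f ▷ F ≫ (braid K F).hom = (braid G F).hom ≫ F ◁ f := by
  refine hom_ext (braiding_naturality_left _ _) (braiding_naturality_left _ _) ?_
  change (0 : H R _ _) ⊲ _ + (β_ K.tgt F.tgt).hom ⊳ (h f ⊗ˡ F.map) =
    (F.map ⊗ʳ h f) ⊲ (β_ G.src F.src).hom + _ ⊳ (0 : H R _ _)
  simp only [map_zero, LinearMap.zero_apply, zero_add, add_zero, post_pre, ← symm_left, ← post_comp]
  simp

instance : SymmetricCategory (Arr R C) where
  braiding := braid
  braiding_naturality_right F _ _ f := braid_right F f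
  braiding_naturality_left f F := braid_left f F
  hexagon_forward F G K := hom_ext (hexagon_forward _ _ _) (hexagon_forward _ _ _) (by
    simp [braid, isoMk])
  hexagon_reverse F G K := hom_ext (hexagon_reverse _ _ _) (hexagon_reverse _ _ _) (by
    simp [braid, isoMk])
  symmetry F G := hom_ext (SymmetricCategory.symmetry _ _) (SymmetricCategory.symmetry _ _) (by
    simp [braid, isoMk])

section
variable (F G)
@[simp] theorem l_braid : l (β_ F G).hom = (β_ F.src G.src).hom := rfl
@[simp] theorem r_braid : r (β_ F G).hom = (β_ F.tgt G.tgt).hom := rfl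
@[simp] theorem h_braid : h (β_ F G).hom = 0 := rfl
@[simp] theorem l_braid_inv : l (β_ F G).inv = (β_ F.src G.src).inv := rfl
@[simp] theorem r_braid_inv : r (β_ F G).inv = (β_ F.tgt G.tgt).inv := rfl
@[simp] theorem h_braid_inv : h (β_ F G).inv = 0 := rfl
end

end Arr
end Squares
end Syl

namespace Syl

section Conjugation

variable {C : Type*} [Category C]

/-- Conjugation of an endomorphism by an isomorphism. -/
def cj {A B : C} (p : A ≅ B) (f : B ⟶ B) : A ⟶ A := p.hom ≫ f ≫ p.inv

variable {A B D : C}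

theorem cj_cj (p : A ≅ B) (q : B ≅ D) (f : D ⟶ D) : cj p (cj q f) = cj (p ≪≫ q) f := by
  simp [cj]

theorem cj_congr {p q : A ≅ B} (h : p.hom = q.hom) (f : B ⟶ B) : cj p f = cj q f := by
  rw [Iso.ext h]

theorem cj_id (p : A ≅ B) : cj p (𝟙 B) = 𝟙 A := by simp [cj]

theorem cj_comp (p : A ≅ B) (f g : B ⟶ B) : cj p (f ≫ g) = cj p f ≫ cj p g := by simp [cj]

theorem hom_cj (p : A ≅ B) (f : B ⟶ B) : p.hom ≫ f = cj p f ≫ p.hom := by simp [cj]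

theorem cj_eq_iff (p : A ≅ B) (f : B ⟶ B) (g : A ⟶ A) : cj p f = g ↔ f = cj p.symm g := by
  constructor
  · rintro rfl; simp [cj]
  · rintro rfl; simp [cj]

theorem cj_refl {p : A ≅ A} (h : p.hom = 𝟙 A) (f : A ⟶ A) : cj p f = f := by
  rw [cj_congr (q := Iso.refl A) h]; simp [cj]

section Linear

variable [Preadditive C]

theorem cj_add (p : A ≅ B) (f g : B ⟶ B) : cj p (f + g) = cj p f + cj p g := by simp [cj]

theorem cj_sub (p : A ≅ B) (f g : B ⟶ B) : cj p (f - g) = cj p f - cj p g := by simp [cj]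

theorem cj_smul {R : Type*} [CommRing R] [Linear R C] (c : R) (p : A ≅ B) (f : B ⟶ B) :
    cj p (c • f) = c • cj p f := by simp [cj]

end Linear

section Monoidal

variable [MonoidalCategory C]

theorem cj_whiskerRight (p : A ≅ B) (f : B ⟶ B) (X : C) :
    cj p f ▷ X = cj (whiskerRightIso p X) (f ▷ X) := by simp [cj]

theorem cj_whiskerLeft (X : C) (p : A ≅ B) (f : B ⟶ B) :
    X ◁ cj p f = cj (whiskerLeftIso X p) (X ◁ f) := by simp [cj]

theorem whiskerRight_whiskerRight (f : A ⟶ A) (X Y : C) :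
    f ▷ X ▷ Y = cj (α_ A X Y) (f ▷ (X ⊗ Y)) := by simp [cj]

theorem whiskerRight_tensor' (f : A ⟶ A) (X Y : C) :
    f ▷ (X ⊗ Y) = cj (α_ A X Y).symm (f ▷ X ▷ Y) := by simp [cj]

theorem whiskerLeft_eq_cj [SymmetricCategory C] (X : C) (f : A ⟶ A) :
    X ◁ f = cj (β_ X A) (f ▷ X) := by
  rw [cj, ← braiding_naturality_right_assoc]; simp

end Monoidal
end Conjugation

section Families

open Wd

variable {R : Type*} [CommRing R] {C : Type*} [Category C] [MonoidalCategory C]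
  [SymmetricCategory C]

/-- The isomorphism `(U ⊗ V) ⊗ W ≅ (U ⊗ W) ⊗ V`. -/
def swap23 (U V W : C) : (U ⊗ V) ⊗ W ≅ (U ⊗ W) ⊗ V :=
  α_ U V W ≪≫ whiskerLeftIso U (β_ V W) ≪≫ (α_ U W V).symm

/-- The isomorphism `(U ⊗ V) ⊗ W ≅ (V ⊗ W) ⊗ U`. -/
def rot (U V W : C) : (U ⊗ V) ⊗ W ≅ (V ⊗ W) ⊗ U := α_ U V W ≪≫ β_ U (V ⊗ W)

theorem cj_whiskerRight_swap {A : C} (f : A ⟶ A) (X Y : C) :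
    f ▷ X ▷ Y = cj (swap23 A X Y) (f ▷ Y ▷ X) := by
  have h : f ▷ (Y ⊗ X) = cj (whiskerLeftIso A (β_ Y X)) (f ▷ (X ⊗ Y)) := by
    simp only [cj, whiskerLeftIso_hom, whiskerLeftIso_inv, ← whisker_exchange]
    simp
  rw [whiskerRight_whiskerRight f Y X, h, cj_cj, cj_cj, whiskerRight_whiskerRight f X Y]
  apply cj_congr
  simp [swap23, ← MonoidalCategory.whiskerLeft_comp]

/-- The endomorphism `t_{13}` of `(U ⊗ V) ⊗ W`. -/
def on13 (t : ∀ U V : C, U ⊗ V ⟶ U ⊗ V) (U V W : C) : (U ⊗ V) ⊗ W ⟶ (U ⊗ V) ⊗ W :=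
  cj (swap23 U V W) (t U W ▷ V)

/-- The endomorphism `t_{23}` of `(U ⊗ V) ⊗ W`. -/
def on23 (t : ∀ U V : C, U ⊗ V ⟶ U ⊗ V) (U V W : C) : (U ⊗ V) ⊗ W ⟶ (U ⊗ V) ⊗ W :=
  cj (α_ U V W) (U ◁ t V W)

theorem on23_eq (t : ∀ U V : C, U ⊗ V ⟶ U ⊗ V) (U V W : C) :
    on23 t U V W = cj (rot U V W) (t V W ▷ U) := by
  rw [on23, whiskerLeft_eq_cj, cj_cj, rot]

variable [Preadditive C]

/-- The hexagon relations of a family of endomorphisms of the monoidal product. -/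
structure StrictFamily (t : ∀ U V : C, U ⊗ V ⟶ U ⊗ V) : Prop where
  left : ∀ U V W : C, cj (α_ U V W) (t U (V ⊗ W)) = t U V ▷ W + on13 t U V W
  right : ∀ U V W : C, t (U ⊗ V) W = on13 t U V W + on23 t U V W

/-- The commutator `[t_{12}, t_{23}]`. -/
def commFam (t : ∀ U V : C, U ⊗ V ⟶ U ⊗ V) (U V W : C) : (U ⊗ V) ⊗ W ⟶ (U ⊗ V) ⊗ W :=
  (t U V ▷ W) ⊚ on23 t U V W - on23 t U V W ⊚ (t U V ▷ W)

variable [Linear R C]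

/-- The associator `α (1 + s [t_{12}, t_{23}])`. -/
def asFam (s : R) (t : ∀ U V : C, U ⊗ V ⟶ U ⊗ V) (U V W : C) : (U ⊗ V) ⊗ W ⟶ U ⊗ (V ⊗ W) :=
  (α_ U V W).hom ⊚ (𝟙 _ + s • commFam t U V W)

/-- The inverse of `asFam`. -/
def asInvFam (s : R) (t : ∀ U V : C, U ⊗ V ⟶ U ⊗ V) (U V W : C) : U ⊗ (V ⊗ W) ⟶ (U ⊗ V) ⊗ W :=
  (𝟙 _ - s • commFam t U V W) ⊚ (α_ U V W).inv

/-- The braiding `γ (1 + a t + 3 s t²)`. -/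
def brFam (a s : R) (t : ∀ U V : C, U ⊗ V ⟶ U ⊗ V) (U V : C) : U ⊗ V ⟶ V ⊗ U :=
  (β_ U V).hom ⊚ (𝟙 _ + a • t U V + (3 * s) • (t U V ⊚ t U V))

/-- The inverse of `brFam`. -/
def brInvFam (a s : R) (t : ∀ U V : C, U ⊗ V ⟶ U ⊗ V) (U V : C) : V ⊗ U ⟶ U ⊗ V :=
  (𝟙 _ - a • t U V + (3 * s) • (t U V ⊚ t U V)) ⊚ (β_ U V).inv

variable [MonoidalPreadditive C] [MonoidalLinear R C]

section Pentagon

variable (t : ∀ U V : C, U ⊗ V ⟶ U ⊗ V)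

/-- The endomorphism `t_{24}` of `((U ⊗ V) ⊗ W) ⊗ X`. -/
def on24 (U V W X : C) : ((U ⊗ V) ⊗ W) ⊗ X ⟶ ((U ⊗ V) ⊗ W) ⊗ X :=
  cj (whiskerRightIso (swap23 U V W) X ≪≫ α_ (U ⊗ W) V X) ((U ⊗ W) ◁ t V X)

theorem comm_12_34 (U V W X : C) :
    (t U V ▷ W ▷ X) ≫ on23 t (U ⊗ V) W X = on23 t (U ⊗ V) W X ≫ (t U V ▷ W ▷ X) := by
  rw [on23, whiskerRight_whiskerRight, ← cj_comp, ← cj_comp, whisker_exchange]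

theorem comm_13_24 (U V W X : C) :
    (on13 t U V W ▷ X) ≫ on24 t U V W X = on24 t U V W X ≫ (on13 t U V W ▷ X) := by
  rw [on13, on24, cj_whiskerRight, whiskerRight_whiskerRight, cj_cj, ← cj_comp, ← cj_comp,
    whisker_exchange]

variable {t}

theorem StrictFamily.left₁₂ (ht : StrictFamily t) (U V W X : C) :
    cj (whiskerRightIso (α_ U V W) X) (t U (V ⊗ W) ▷ X) =
      t U V ▷ W ▷ X + on13 t U V W ▷ X := by
  rw [← cj_whiskerRight, ht.left, MonoidalPreadditive.add_whiskerRight]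

theorem StrictFamily.right₃₄ (ht : StrictFamily t) (U V W X : C) :
    cj (whiskerRightIso (α_ U V W) X) (on23 t U (V ⊗ W) X) =
      on24 t U V W X + on23 t (U ⊗ V) W X := by
  rw [on23, ht.right, MonoidalPreadditive.whiskerLeft_add, cj_add, cj_add, on13, on24, on23, on23]
  simp only [whiskerLeft_eq_cj, cj_whiskerRight, cj_cj]
  congr 1
  · rw [cj_whiskerRight_swap, whiskerRight_tensor', cj_cj, cj_cj]
    apply cj_congr
    simp only [Iso.trans_hom, whiskerRightIso_hom, whiskerLeftIso_hom, Iso.symm_hom, swap23]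
    exact coherence (ten (ten (ten (leaf 0 U) (leaf 1 V)) (leaf 2 W)) (leaf 3 X))
  · rw [cj_whiskerRight_swap, whiskerRight_tensor', cj_cj, cj_cj]
    apply cj_congr
    simp only [Iso.trans_hom, whiskerRightIso_hom, whiskerLeftIso_hom, Iso.symm_hom, swap23]
    exact coherence (ten (ten (ten (leaf 0 U) (leaf 1 V)) (leaf 2 W)) (leaf 3 X))

theorem StrictFamily.left₂₃ (ht : StrictFamily t) (U V W X : C) :
    cj (α_ (U ⊗ V) W X) (on23 t U V (W ⊗ X)) = on23 t U V W ▷ X + on24 t U V W X := by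
  have h := (cj_eq_iff _ _ _).1 (ht.left V W X)
  rw [on23, h, cj_add, MonoidalPreadditive.whiskerLeft_add, cj_add, cj_add, on13, on24, on23]
  simp only [whiskerLeft_eq_cj, cj_whiskerRight, cj_cj]
  congr 1
  · rw [cj_whiskerRight_swap, cj_cj]
    apply cj_congr
    simp only [Iso.trans_hom, whiskerRightIso_hom, whiskerLeftIso_hom, Iso.symm_hom, swap23]
    exact coherence (ten (ten (ten (leaf 0 U) (leaf 1 V)) (leaf 2 W)) (leaf 3 X))
  · rw [cj_whiskerRight_swap, whiskerRight_tensor', cj_cj, cj_cj]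
    apply cj_congr
    simp only [Iso.trans_hom, whiskerRightIso_hom, whiskerLeftIso_hom, Iso.symm_hom, swap23]
    exact coherence (ten (ten (ten (leaf 0 U) (leaf 1 V)) (leaf 2 W)) (leaf 3 X))

end Pentagon

section Algebra

variable {E : Type*} [Ring E] [Algebra R E] {a s : R}

theorem hexL_identity (h₁ : a * a = 6 * s) (h₂ : a * s = 0) (h₃ : s * s = 0) (A B D : E) :
    (1 + s • (D * B - B * D)) * ((1 + a • (A + B) + (3 * s) • ((A + B) * (A + B))) *
      (1 + s • (A * D - D * A))) -
    (1 + a • B + (3 * s) • (B * B)) * ((1 + s • (A * B - B * A)) *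
      (1 + a • A + (3 * s) • (A * A))) =
    s • ((2 : R) • (A * (B + D) - (B + D) * A) + (D * (A + B) - (A + B) * D)) := by
  have h₄ : s * a = 0 := by rw [mul_comm, h₂]
  have h₅ : a * (3 * s) = 0 := by linear_combination 3 * h₂
  have h₆ : 3 * s * a = 0 := by linear_combination 3 * h₂
  have h₇ : s * (3 * s) = 0 := by linear_combination 3 * h₃
  have h₈ : 3 * s * s = 0 := by linear_combination 3 * h₃
  have h₉ : 3 * s * (3 * s) = 0 := by linear_combination 9 * h₃
  simp only [mul_add, add_mul, one_mul, mul_one, smul_mul_assoc, mul_smul_comm, smul_add, smul_smul,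
    mul_sub, sub_mul, smul_sub, h₁, h₂, h₃, h₄, h₅, h₆, h₇, h₈, h₉, zero_smul, add_zero, zero_add,
    sub_zero, mul_zero, zero_mul]
  module

theorem hexR_identity (h₁ : a * a = 6 * s) (h₂ : a * s = 0) (h₃ : s * s = 0) (A B D : E) :
    (1 - s • (B * A - A * B)) * ((1 + a • (B + D) + (3 * s) • ((B + D) * (B + D))) *
      (1 - s • (A * D - D * A))) -
    (1 + a • B + (3 * s) • (B * B)) * ((1 - s • (B * D - D * B)) *
      (1 + a • D + (3 * s) • (D * D))) =
    s • ((A * (B + D) - (B + D) * A) + (2 : R) • (D * (A + B) - (A + B) * D)) := by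
  have h₄ : s * a = 0 := by rw [mul_comm, h₂]
  have h₅ : a * (3 * s) = 0 := by linear_combination 3 * h₂
  have h₆ : 3 * s * a = 0 := by linear_combination 3 * h₂
  have h₇ : s * (3 * s) = 0 := by linear_combination 3 * h₃
  have h₈ : 3 * s * s = 0 := by linear_combination 3 * h₃
  have h₉ : 3 * s * (3 * s) = 0 := by linear_combination 9 * h₃
  simp only [mul_add, add_mul, one_mul, mul_one, smul_mul_assoc, mul_smul_comm, smul_add, smul_smul,
    mul_sub, sub_mul, smul_sub, h₁, h₂, h₃, h₄, h₅, h₆, h₇, h₈, h₉, zero_smul, add_zero, zero_add,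
    sub_zero, mul_zero, zero_mul]
  module

theorem br_identity (h₁ : a * a = 6 * s) (h₂ : a * s = 0) (h₃ : s * s = 0) (A : E) :
    (1 - a • A + (3 * s) • (A * A)) * (1 + a • A + (3 * s) • (A * A)) = 1 := by
  have h₅ : a * (3 * s) = 0 := by linear_combination 3 * h₂
  have h₆ : 3 * s * a = 0 := by linear_combination 3 * h₂
  have h₉ : 3 * s * (3 * s) = 0 := by linear_combination 9 * h₃
  simp only [mul_add, add_mul, one_mul, mul_one, smul_mul_assoc, mul_smul_comm, smul_add, smul_smul,
    mul_sub, sub_mul, smul_sub, h₁, h₅, h₆, h₉, zero_smul, add_zero, zero_add,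
    sub_zero, mul_zero, zero_mul]
  module

theorem pentagon_identity (h₃ : s * s = 0) (A B D F G : E) (h₁ : A * G = G * A)
    (h₂ : B * F = F * B) :
    (1 + s • (D * G - G * D)) * ((1 + s • ((A + B) * (F + G) - (F + G) * (A + B))) *
      (1 + s • (A * D - D * A))) =
    (1 + s • (A * (D + F) - (D + F) * A)) * (1 + s • ((B + D) * G - G * (B + D))) := by
  simp only [mul_add, add_mul, one_mul, mul_one, smul_mul_assoc, mul_smul_comm, smul_add, smul_smul,
    mul_sub, sub_mul, smul_sub, h₁, h₂, h₃, zero_smul, add_zero, zero_add,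
    sub_zero, mul_zero, zero_mul]
  module

end Algebra

section Relations

variable {t : ∀ U V : C, U ⊗ V ⟶ U ⊗ V} {a s : R}

theorem asFam_eq (U V W : C) :
    asFam s t U V W = (𝟙 _ + s • commFam t U V W) ≫ (α_ U V W).hom := rfl

theorem brFam_eq (U V : C) :
    brFam a s t U V = (𝟙 _ + a • t U V + (3 * s) • (t U V ≫ t U V)) ≫ (β_ U V).hom := rfl

theorem asInvFam_eq (U V W : C) :
    asInvFam s t U V W = (α_ U V W).inv ≫ (𝟙 _ - s • commFam t U V W) := rfl

/-- The commutator of two endomorphisms. -/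
def bracket {A : C} (f g : A ⟶ A) : A ⟶ A := f ⊚ g - g ⊚ f

theorem asFam_comp_inv (h : s * s = 0) (U V W : C) :
    asFam s t U V W ≫ asInvFam s t U V W = 𝟙 _ := by
  simp [asFam, asInvFam, smul_smul, h, smul_sub, smul_add]

theorem asInvFam_comp (h : s * s = 0) (U V W : C) :
    asInvFam s t U V W ≫ asFam s t U V W = 𝟙 _ := by
  rw [asFam, asInvFam, Category.assoc, Iso.inv_comp_eq, Category.comp_id, ← Category.assoc]
  simp [smul_smul, h, smul_sub, smul_add]

theorem brInvFam_comp (h₁ : a * a = 6 * s) (h₂ : a * s = 0) (h₃ : s * s = 0) (U V : C) :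
    brInvFam a s t U V ≫ brFam a s t U V = 𝟙 _ := by
  have k := br_identity (E := End (U ⊗ V)) (a := -a) (by simpa using h₁) (by simp [h₂]) h₃ (t U V)
  simp only [End.mul_def, End.one_def, neg_smul, sub_neg_eq_add, ← sub_eq_add_neg] at k
  rw [brFam, brInvFam, Category.assoc, reassoc_of% k, Iso.inv_hom_id]

theorem brFam_comp_inv (h₁ : a * a = 6 * s) (h₂ : a * s = 0) (h₃ : s * s = 0) (U V : C) :
    brFam a s t U V ≫ brInvFam a s t U V = 𝟙 _ := by
  have k := br_identity (E := End (U ⊗ V)) h₁ h₂ h₃ (t U V)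
  simp only [End.mul_def, End.one_def] at k
  rw [brFam, brInvFam, Category.assoc, Iso.hom_inv_id_assoc, k]

theorem StrictFamily.pentagon (ht : StrictFamily t) (h : s * s = 0) (U V W X : C) :
    asFam s t U V W ▷ X ≫ asFam s t U (V ⊗ W) X ≫ U ◁ asFam s t V W X =
      asFam s t (U ⊗ V) W X ≫ asFam s t U V (W ⊗ X) := by
  have h₁ : cj (whiskerRightIso (α_ U V W) X) (commFam t U (V ⊗ W) X) =
      bracket (t U V ▷ W ▷ X + on13 t U V W ▷ X) (on24 t U V W X + on23 t (U ⊗ V) W X) := by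
    rw [commFam, cj_sub, cj_comp, cj_comp, ht.left₁₂, ht.right₃₄, bracket]
  have h₂ : cj (whiskerRightIso (α_ U V W) X ≪≫ α_ U (V ⊗ W) X) (U ◁ commFam t V W X) =
      bracket (on23 t U V W ▷ X) (on23 t (U ⊗ V) W X) := by
    rw [commFam, whiskerLeft_sub, MonoidalCategory.whiskerLeft_comp,
      MonoidalCategory.whiskerLeft_comp, cj_sub, cj_comp, cj_comp, bracket]
    have e₁ : cj (whiskerRightIso (α_ U V W) X ≪≫ α_ U (V ⊗ W) X) (U ◁ t V W ▷ X) =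
        on23 t U V W ▷ X := by
      rw [on23]
      simp only [whiskerLeft_eq_cj, cj_whiskerRight, cj_cj]
      rw [cj_whiskerRight_swap, cj_cj]
      apply cj_congr
      simp only [Iso.trans_hom, whiskerRightIso_hom, whiskerLeftIso_hom, Iso.symm_hom, swap23]
      exact coherence (ten (ten (ten (leaf 0 U) (leaf 1 V)) (leaf 2 W)) (leaf 3 X))
    have e₂ : cj (whiskerRightIso (α_ U V W) X ≪≫ α_ U (V ⊗ W) X) (U ◁ on23 t V W X) =
        on23 t (U ⊗ V) W X := by
      rw [on23, on23]
      simp only [whiskerLeft_eq_cj, cj_whiskerRight, cj_cj]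
      rw [whiskerRight_tensor', cj_whiskerRight_swap, cj_cj, cj_cj]
      apply cj_congr
      simp only [Iso.trans_hom, whiskerRightIso_hom, whiskerLeftIso_hom, Iso.symm_hom, swap23]
      exact coherence (ten (ten (ten (leaf 0 U) (leaf 1 V)) (leaf 2 W)) (leaf 3 X))
    rw [e₁, e₂]
  have h₃ : cj (α_ (U ⊗ V) W X) (commFam t U V (W ⊗ X)) =
      bracket (t U V ▷ W ▷ X) (on23 t U V W ▷ X + on24 t U V W X) := by
    rw [commFam, cj_sub, cj_comp, cj_comp, ht.left₂₃, bracket, ← whiskerRight_whiskerRight]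
  have h₄ : commFam t (U ⊗ V) W X =
      bracket (on13 t U V W ▷ X + on23 t U V W ▷ X) (on23 t (U ⊗ V) W X) := by
    rw [commFam, ht.right, MonoidalPreadditive.add_whiskerRight, bracket]
  have h₅ : commFam t U V W ▷ X = bracket (t U V ▷ W ▷ X) (on23 t U V W ▷ X) := by
    rw [commFam, sub_whiskerRight, comp_whiskerRight, comp_whiskerRight, bracket]
  have k := pentagon_identity (E := End (((U ⊗ V) ⊗ W) ⊗ X)) h (t U V ▷ W ▷ X) (on13 t U V W ▷ X)
    (on23 t U V W ▷ X) (on24 t U V W X) (on23 t (U ⊗ V) W X) (comm_12_34 t U V W X).symm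
    (comm_13_24 t U V W X).symm
  simp only [End.mul_def, End.one_def] at k
  have hα := MonoidalCategory.pentagon U V W X
  have l₂ : (α_ U V W).hom ▷ X ≫ (𝟙 _ + s • commFam t U (V ⊗ W) X) =
      (𝟙 _ + s • cj (whiskerRightIso (α_ U V W) X) (commFam t U (V ⊗ W) X)) ≫
        (α_ U V W).hom ▷ X := by
    rw [← cj_smul, ← cj_id (whiskerRightIso (α_ U V W) X), ← cj_add, ← whiskerRightIso_hom,
      ← hom_cj]
  have l₃ : (α_ U V W).hom ▷ X ≫ (α_ U (V ⊗ W) X).hom ≫ (𝟙 _ + s • U ◁ commFam t V W X) =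
      (𝟙 _ + s • cj (whiskerRightIso (α_ U V W) X ≪≫ α_ U (V ⊗ W) X) (U ◁ commFam t V W X)) ≫
        (α_ U V W).hom ▷ X ≫ (α_ U (V ⊗ W) X).hom := by
    rw [← cj_smul, ← cj_id (whiskerRightIso (α_ U V W) X ≪≫ α_ U (V ⊗ W) X), ← cj_add,
      ← whiskerRightIso_hom, ← Iso.trans_hom, ← hom_cj, Iso.trans_hom, Category.assoc]
  have l₄ : (α_ (U ⊗ V) W X).hom ≫ (𝟙 _ + s • commFam t U V (W ⊗ X)) =
      (𝟙 _ + s • cj (α_ (U ⊗ V) W X) (commFam t U V (W ⊗ X))) ≫ (α_ (U ⊗ V) W X).hom := by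
    rw [← cj_smul, ← cj_id (α_ (U ⊗ V) W X), ← cj_add, ← hom_cj]
  rw [h₁] at l₂
  rw [h₂] at l₃
  rw [h₃] at l₄
  simp only [asFam_eq, comp_whiskerRight, MonoidalCategory.whiskerLeft_comp,
    MonoidalPreadditive.whiskerLeft_add, MonoidalPreadditive.add_whiskerRight,
    MonoidalLinear.smul_whiskerRight, MonoidalLinear.whiskerLeft_smul, id_whiskerRight,
    MonoidalCategory.whiskerLeft_id, h₅, h₄, Category.assoc]
  rw [reassoc_of% l₂, reassoc_of% l₃, reassoc_of% l₄, hα]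
  simp only [← Category.assoc]
  simp only [Category.assoc, bracket] at k ⊢
  rw [reassoc_of% k]

/-- The operator `2 [t_{12}, t_{13} + t_{23}] + [t_{23}, t_{12} + t_{13}]`. -/
def hexCore (c d : R) (t : ∀ U V : C, U ⊗ V ⟶ U ⊗ V) (U V W : C) : (U ⊗ V) ⊗ W ⟶ (U ⊗ V) ⊗ W :=
  c • bracket (t U V ▷ W) (t (U ⊗ V) W) + d • bracket (on23 t U V W) (cj (α_ U V W) (t U (V ⊗ W)))

theorem cj_rot_on23 (hs : ∀ U V : C, t U V = cj (β_ U V) (t V U)) (U V W : C) : cj (rot U V W) (on23 t V W U) = on13 t U V W := by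
  rw [on23, hs W U, on13]
  simp only [whiskerLeft_eq_cj, cj_whiskerRight, cj_cj]
  apply cj_congr
  simp only [Iso.trans_hom, whiskerRightIso_hom, whiskerLeftIso_hom, Iso.symm_hom, swap23, rot]
  exact coherence (ten (ten (leaf 0 U) (leaf 1 V)) (leaf 2 W))

theorem cj_braid_on23 (U V W : C) :
    cj (whiskerRightIso (β_ U V) W) (on23 t V U W) = on13 t U V W := by
  rw [on23, on13]
  simp only [whiskerLeft_eq_cj, cj_whiskerRight, cj_cj]
  apply cj_congr
  simp only [Iso.trans_hom, whiskerRightIso_hom, whiskerLeftIso_hom, Iso.symm_hom, swap23, rot]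
  exact coherence (ten (ten (leaf 0 U) (leaf 1 V)) (leaf 2 W))

theorem cj_braid_left (U V W : C) :
    cj (whiskerRightIso (β_ U V) W ≪≫ α_ V U W) (V ◁ t U W) = on13 t U V W := by
  rw [← cj_cj, ← on23, cj_braid_on23]

theorem cj_rot_commFam (hs : ∀ U V : C, t U V = cj (β_ U V) (t V U)) (U V W : C) : cj (rot U V W) (commFam t V W U) =
    bracket (on23 t U V W) (on13 t U V W) := by
  rw [commFam, cj_sub, cj_comp, cj_comp, cj_rot_on23 hs, ← on23_eq, bracket]

theorem cj_braid_commFam (hs : ∀ U V : C, t U V = cj (β_ U V) (t V U)) (U V W : C) : cj (whiskerRightIso (β_ U V) W) (commFam t V U W) =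
    bracket (t U V ▷ W) (on13 t U V W) := by
  rw [commFam, cj_sub, cj_comp, cj_comp, cj_braid_on23, ← cj_whiskerRight, ← hs, bracket]

theorem StrictFamily.hexL (ht : StrictFamily t)
    (hs : ∀ U V : C, t U V = cj (β_ U V) (t V U)) (h₁ : a * a = 6 * s) (h₂ : a * s = 0)
    (h₃ : s * s = 0) (U V W : C) :
    asFam s t U V W ≫ brFam a s t U (V ⊗ W) ≫ asFam s t V W U -
      brFam a s t U V ▷ W ≫ asFam s t V U W ≫ V ◁ brFam a s t U W =
    (s • hexCore (2 : R) 1 t U V W) ≫ (α_ U V W).hom ≫ (β_ U (V ⊗ W)).hom ≫ (α_ V W U).hom := by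
  have k := hexL_identity (E := End ((U ⊗ V) ⊗ W)) h₁ h₂ h₃ (t U V ▷ W) (on13 t U V W)
    (on23 t U V W)
  simp only [End.mul_def, End.one_def] at k
  have l₁ : (α_ U V W).hom ≫ (𝟙 _ + a • t U (V ⊗ W) + (3 * s) • (t U (V ⊗ W) ≫ t U (V ⊗ W))) =
      (𝟙 _ + a • (t U V ▷ W + on13 t U V W) +
        (3 * s) • ((t U V ▷ W + on13 t U V W) ≫ (t U V ▷ W + on13 t U V W))) ≫
        (α_ U V W).hom := by
    rw [hom_cj, cj_add, cj_add, cj_smul, cj_smul, cj_comp, cj_id, ht.left]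
  have l₂ : (α_ U V W).hom ≫ (β_ U (V ⊗ W)).hom ≫ (𝟙 _ + s • commFam t V W U) =
      (𝟙 _ + s • bracket (on23 t U V W) (on13 t U V W)) ≫ (α_ U V W).hom ≫ (β_ U (V ⊗ W)).hom := by
    have := hom_cj (rot U V W) (𝟙 _ + s • commFam t V W U)
    rwa [cj_add, cj_smul, cj_rot_commFam hs, cj_id, rot, Iso.trans_hom, Category.assoc] at this
  have l₃ : (β_ U V).hom ▷ W ≫ (𝟙 _ + s • commFam t V U W) =
      (𝟙 _ + s • bracket (t U V ▷ W) (on13 t U V W)) ≫ (β_ U V).hom ▷ W := by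
    have := hom_cj (whiskerRightIso (β_ U V) W) (𝟙 _ + s • commFam t V U W)
    rwa [cj_add, cj_smul, cj_braid_commFam hs, cj_id] at this
  have l₄ : (β_ U V).hom ▷ W ≫ (α_ V U W).hom ≫
      (𝟙 _ + a • V ◁ t U W + (3 * s) • (V ◁ t U W ≫ V ◁ t U W)) =
      (𝟙 _ + a • on13 t U V W + (3 * s) • (on13 t U V W ≫ on13 t U V W)) ≫
        (β_ U V).hom ▷ W ≫ (α_ V U W).hom := by
    have := hom_cj (whiskerRightIso (β_ U V) W ≪≫ α_ V U W)
      (𝟙 _ + a • V ◁ t U W + (3 * s) • (V ◁ t U W ≫ V ◁ t U W))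
    rwa [cj_add, cj_add, cj_smul, cj_smul, cj_comp, cj_id, cj_braid_left, Iso.trans_hom,
      Category.assoc] at this
  have hα : (β_ U V).hom ▷ W ≫ (α_ V U W).hom ≫ V ◁ (β_ U W).hom =
      (α_ U V W).hom ≫ (β_ U (V ⊗ W)).hom ≫ (α_ V W U).hom :=
    coherence (ten (ten (leaf 0 U) (leaf 1 V)) (leaf 2 W))
  simp only [asFam_eq, brFam_eq, comp_whiskerRight, MonoidalCategory.whiskerLeft_comp,
    MonoidalPreadditive.whiskerLeft_add, MonoidalPreadditive.add_whiskerRight,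
    MonoidalLinear.smul_whiskerRight, MonoidalLinear.whiskerLeft_smul, id_whiskerRight,
    MonoidalCategory.whiskerLeft_id, Category.assoc]
  rw [reassoc_of% l₁, reassoc_of% l₂, reassoc_of% l₃, reassoc_of% l₄, hα]
  simp only [← Category.assoc, ← Preadditive.sub_comp]
  congr 3
  rw [hexCore, ht.left, ht.right, one_smul]
  simp only [Category.assoc, bracket, commFam] at k ⊢
  exact k

theorem StrictFamily.hexR (ht : StrictFamily t)
    (hs : ∀ U V : C, t U V = cj (β_ U V) (t V U)) (h₁ : a * a = 6 * s) (h₂ : a * s = 0)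
    (h₃ : s * s = 0) (U V W : C) :
    asInvFam s t U V W ≫ brFam a s t (U ⊗ V) W ≫ asInvFam s t W U V -
      U ◁ brFam a s t V W ≫ asInvFam s t U W V ≫ brFam a s t U W ▷ V =
    (α_ U V W).inv ≫ (s • hexCore 1 (2 : R) t U V W) ≫ (β_ (U ⊗ V) W).hom ≫ (α_ W U V).inv := by
  have k := hexR_identity (E := End ((U ⊗ V) ⊗ W)) h₁ h₂ h₃ (t U V ▷ W) (on13 t U V W)
    (on23 t U V W)
  simp only [End.mul_def, End.one_def] at k
  have c₁ : cj (β_ (U ⊗ V) W ≪≫ (α_ W U V).symm) (commFam t W U V) =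
      bracket (on13 t U V W) (t U V ▷ W) := by
    have e₁ : cj (β_ (U ⊗ V) W ≪≫ (α_ W U V).symm) (on23 t W U V) = t U V ▷ W := by
      rw [on23, cj_cj, whiskerLeft_eq_cj, cj_cj]
      apply cj_refl
      simp only [Iso.trans_hom, Iso.symm_hom]
      exact coherence (ten (ten (leaf 0 U) (leaf 1 V)) (leaf 2 W))
    have e₂ : cj (β_ (U ⊗ V) W ≪≫ (α_ W U V).symm) (t W U ▷ V) = on13 t U V W := by
      rw [hs W U, on13, cj_whiskerRight, cj_cj]
      apply cj_congr
      simp only [Iso.trans_hom, whiskerRightIso_hom, whiskerLeftIso_hom, Iso.symm_hom, swap23]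
      exact coherence (ten (ten (leaf 0 U) (leaf 1 V)) (leaf 2 W))
    rw [commFam, cj_sub, cj_comp, cj_comp, e₁, e₂, bracket]
  have c₂ : cj (swap23 U V W) (commFam t U W V) = bracket (on13 t U V W) (on23 t U V W) := by
    have e₁ : cj (swap23 U V W) (on23 t U W V) = on23 t U V W := by
      rw [on23, hs W V, on23, cj_whiskerLeft, cj_cj, cj_cj]
      apply cj_congr
      simp only [Iso.trans_hom, whiskerRightIso_hom, whiskerLeftIso_hom, Iso.symm_hom, swap23]
      exact coherence (ten (ten (leaf 0 U) (leaf 1 V)) (leaf 2 W))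
    rw [commFam, cj_sub, cj_comp, cj_comp, e₁, on13, bracket]
  have l₁ : (α_ U V W).hom ≫ (𝟙 _ + a • U ◁ t V W + (3 * s) • (U ◁ t V W ≫ U ◁ t V W)) =
      (𝟙 _ + a • on23 t U V W + (3 * s) • (on23 t U V W ≫ on23 t U V W)) ≫ (α_ U V W).hom := by
    rw [hom_cj, cj_add, cj_add, cj_smul, cj_smul, cj_comp, cj_id, on23]
  have l₂ : (β_ (U ⊗ V) W).hom ≫ (α_ W U V).inv ≫ (𝟙 _ - s • commFam t W U V) =
      (𝟙 _ - s • bracket (on13 t U V W) (t U V ▷ W)) ≫ (β_ (U ⊗ V) W).hom ≫ (α_ W U V).inv := by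
    have := hom_cj (β_ (U ⊗ V) W ≪≫ (α_ W U V).symm) (𝟙 _ - s • commFam t W U V)
    rwa [cj_sub, cj_smul, c₁, cj_id, Iso.trans_hom, Iso.symm_hom, Category.assoc] at this
  have l₃ : (α_ U V W).hom ≫ U ◁ (β_ V W).hom ≫ (α_ U W V).inv ≫ (𝟙 _ - s • commFam t U W V) =
      (𝟙 _ - s • bracket (on13 t U V W) (on23 t U V W)) ≫
        (α_ U V W).hom ≫ U ◁ (β_ V W).hom ≫ (α_ U W V).inv := by
    have := hom_cj (swap23 U V W) (𝟙 _ - s • commFam t U W V)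
    rw [cj_sub, cj_smul, c₂, cj_id] at this
    simpa [swap23] using this
  have l₄ : (α_ U V W).hom ≫ U ◁ (β_ V W).hom ≫ (α_ U W V).inv ≫
      (𝟙 _ + a • t U W ▷ V + (3 * s) • (t U W ▷ V ≫ t U W ▷ V)) =
      (𝟙 _ + a • on13 t U V W + (3 * s) • (on13 t U V W ≫ on13 t U V W)) ≫
        (α_ U V W).hom ≫ U ◁ (β_ V W).hom ≫ (α_ U W V).inv := by
    have := hom_cj (swap23 U V W) (𝟙 _ + a • t U W ▷ V + (3 * s) • (t U W ▷ V ≫ t U W ▷ V))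
    rw [cj_add, cj_add, cj_smul, cj_smul, cj_comp, cj_id, ← on13] at this
    simpa [swap23] using this
  have hα : (α_ U V W).hom ≫ U ◁ (β_ V W).hom ≫ (α_ U W V).inv ≫ (β_ U W).hom ▷ V =
      (β_ (U ⊗ V) W).hom ≫ (α_ W U V).inv :=
    coherence (ten (ten (leaf 0 U) (leaf 1 V)) (leaf 2 W))
  rw [← cancel_epi (α_ U V W).hom, Preadditive.comp_sub]
  simp only [asInvFam_eq, brFam_eq, comp_whiskerRight, MonoidalCategory.whiskerLeft_comp,
    MonoidalPreadditive.whiskerLeft_add, MonoidalPreadditive.add_whiskerRight,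
    MonoidalLinear.smul_whiskerRight, MonoidalLinear.whiskerLeft_smul, id_whiskerRight,
    MonoidalCategory.whiskerLeft_id, Category.assoc, Iso.hom_inv_id_assoc]
  rw [l₂, reassoc_of% l₁, reassoc_of% l₃, reassoc_of% l₄, hα]
  simp only [← Category.assoc, ← Preadditive.sub_comp]
  congr 2
  rw [hexCore, ht.left, ht.right, one_smul]
  simp only [Category.assoc, bracket, commFam] at k ⊢
  exact k

end Relations

end Families
end Syl

namespace Syl

open TwoCells TwoCellsMonoidal

section Quadratic

variable {R : Type*} [CommRing R] {C : Type*} [Category C] [Preadditive C] [Linear R C]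
  [MonoidalCategory C] [MonoidalPreadditive C] [MonoidalLinear R C] [SymmetricCategory C]
  [TwoCells R C] [TwoCellsMonoidal R C]

local notation:80 g:81 " ⊳ " q:80 => g ⊳[R] q
local notation:80 q:81 " ⊲ " f:80 => q ⊲[R] f
local notation:90 f:91 " ⊗ʳ " q:90 => f ⊗ʳ[R] q
local notation:90 q:91 " ⊗ˡ " g:90 => q ⊗ˡ[R] g

/-- The hexagon relations in terms of composites of coherence isomorphisms. -/
theorem StrictFamily.of_hexagons (t : ∀ U V : C, U ⊗ V ⟶ U ⊗ V)
    (left : ∀ U V W : C, (α_ U V W).inv ⊚ t U (V ⊗ W) ⊚ (α_ U V W).hom =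
      t U V ▷ W + ((β_ V U).hom ▷ W) ⊚ (α_ V U W).inv ⊚ (V ◁ t U W) ⊚ (α_ V U W).hom ⊚
        ((β_ U V).hom ▷ W))
    (right : ∀ U V W : C, (α_ U V W).hom ⊚ t (U ⊗ V) W ⊚ (α_ U V W).inv =
      U ◁ t V W + (U ◁ (β_ W V).hom) ⊚ (α_ U W V).hom ⊚ (t U W ▷ V) ⊚ (α_ U W V).inv ⊚
        (U ◁ (β_ V W).hom)) : StrictFamily t where
  left U V W := by
    have := left U V W
    rw [← cj_braid_left]
    simpa [cj, SymmetricCategory.braiding_swap_eq_inv_braiding] using this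
  right U V W := by
    have := congrArg (fun f => (α_ U V W).hom ≫ f ≫ (α_ U V W).inv) (right U V W)
    simp only [on13, on23, cj, swap23]
    simpa [SymmetricCategory.braiding_swap_eq_inv_braiding, add_comm] using this

namespace InfData

variable (a s : R) (t : InfData R C)

/-- The data with associator `1 + s [t_{12}, t_{23}]`, braiding `γ (1 + a t + 3 s t²)` and hexagonators
`s γ_{1(23)} (2 L + R)` and `s γ_{(12)3} (L + 2 R)`. -/
def quad : BraidedData R C where
  as := asFam s t.app
  asInv := asInvFam s t.app
  asHty {_ U' _ V' _ W'} f g k := (α_ U' V' W').hom ⊳ (s • t.commHty f g k)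
  br := brFam a s t.app
  brInv := brInvFam a s t.app
  brHty {U U' V V'} f g := (β_ U' V').hom ⊳ (a • t.h f g +
    (3 * s) • (t.h f g ⊲ t.app U V + t.app U' V' ⊳ t.h f g))
  hexL U V W := (α_ V W U).hom ⊳ (β_ U (V ⊗ W)).hom ⊳ (α_ U V W).hom ⊳
    (s • ((2 : R) • t.fourTermL U V W + t.fourTermR U V W))
  hexR U V W := (α_ W U V).inv ⊳ (β_ (U ⊗ V) W).hom ⊳
    (s • (t.fourTermL U V W + (2 : R) • t.fourTermR U V W)) ⊲ (α_ U V W).inv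

variable {a s t}

theorem app23_eq (U V W : C) : t.app23 U V W = on23 t.app U V W := by
  simp [app23, on23, cj]

/-- The endomorphism of the monoidal product of squares given by an infinitesimal 2-braiding. -/
def arr (ht : t.IsInfinitesimal2Braiding) (F G : Arr R C) : F ⊗ G ⟶ F ⊗ G :=
  Arr.mk' (t.app F.src G.src) (t.app F.tgt G.tgt) (t.h F.map G.map) (ht.natural _ _)

variable (ht : t.IsInfinitesimal2Braiding)

@[simp] theorem l_arr (F G : Arr R C) : Arr.l (arr ht F G) = t.app F.src G.src := rfl
@[simp] theorem r_arr (F G : Arr R C) : Arr.r (arr ht F G) = t.app F.tgt G.tgt := rfl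
@[simp] theorem h_arr (F G : Arr R C) : Arr.h (arr ht F G) = t.h F.map G.map := rfl

theorem IsStrict.family (hst : t.IsStrict) : StrictFamily t.app :=
  .of_hexagons _ hst.left hst.right

theorem IsStrict.arr_family (hst : t.IsStrict) : StrictFamily (arr ht) := by
  refine .of_hexagons _ (fun F G K => ?_) (fun F G K => ?_)
  · refine Arr.hom_ext (hst.left _ _ _) (hst.left _ _ _) ?_
    have := hst.left_hty F.map G.map K.map
    dsimp only [Arr.h_comp, Arr.h_wl, Arr.l_wl, Arr.r_wl, Arr.h_wr, Arr.l_wr, Arr.r_wr,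
      Arr.src_tensor, Arr.tgt_tensor, Arr.map_tensor, Arr.h_assoc, Arr.h_assoc_inv, Arr.l_assoc,
      Arr.r_assoc, Arr.l_assoc_inv, Arr.r_assoc_inv, h_arr, Arr.h_braid, Arr.l_braid, Arr.r_braid,
      Arr.h_add, Arr.l_comp, Arr.r_comp]
    simpa only [map_zero, LinearMap.zero_apply, zero_add, add_zero, post_pre, pre_comp, post_comp] using this
  · refine Arr.hom_ext (hst.right _ _ _) (hst.right _ _ _) ?_
    have := hst.right_hty F.map G.map K.map
    dsimp only [Arr.h_comp, Arr.h_wl, Arr.l_wl, Arr.r_wl, Arr.h_wr, Arr.l_wr, Arr.r_wr,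
      Arr.src_tensor, Arr.tgt_tensor, Arr.map_tensor, Arr.h_assoc, Arr.h_assoc_inv, Arr.l_assoc,
      Arr.r_assoc, Arr.l_assoc_inv, Arr.r_assoc_inv, h_arr, Arr.h_braid, Arr.l_braid, Arr.r_braid,
      Arr.h_add, Arr.l_comp, Arr.r_comp]
    simpa only [map_zero, LinearMap.zero_apply, zero_add, add_zero, post_pre, pre_comp, post_comp] using this

theorem IsSymmetric.family (hs : t.IsSymmetric) (U V : C) :
    t.app U V = cj (β_ U V) (t.app V U) := by
  rw [cj, ← Category.assoc, ← hs.app]; simp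

theorem IsSymmetric.arr_family (hs : t.IsSymmetric) (F G : Arr R C) :
    arr ht F G = cj (β_ F G) (arr ht G F) := by
  have : arr ht F G ≫ (β_ F G).hom = (β_ F G).hom ≫ arr ht G F := by
    refine Arr.hom_ext (hs.app _ _) (hs.app _ _) ?_
    have := hs.hty F.map G.map
    dsimp only [Arr.h_comp, Arr.src_tensor, Arr.tgt_tensor, Arr.map_tensor, h_arr, Arr.h_braid,
      Arr.l_braid, Arr.r_braid, Arr.l_comp, Arr.r_comp]
    simpa only [map_zero, LinearMap.zero_apply, zero_add, add_zero] using this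
  rw [cj, ← Category.assoc, ← this]; simp

section Components

variable (F G K : Arr R C)

theorem l_on23 : Arr.l (on23 (arr ht) F G K) = on23 t.app F.src G.src K.src := rfl
theorem r_on23 : Arr.r (on23 (arr ht) F G K) = on23 t.app F.tgt G.tgt K.tgt := rfl

theorem h_on23 : Arr.h (on23 (arr ht) F G K) =
    (α_ F.tgt G.tgt K.tgt).inv ⊳ (F.map ⊗ʳ t.h G.map K.map) ⊲ (α_ F.src G.src K.src).hom := by
  dsimp only [on23, cj, Arr.h_comp, Arr.h_wl, Arr.h_assoc, Arr.h_assoc_inv, Arr.l_assoc,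
    Arr.r_assoc_inv, Arr.l_comp, Arr.r_comp, h_arr, Arr.src_tensor, Arr.tgt_tensor]
  simp only [map_zero, LinearMap.zero_apply, zero_add, add_zero, post_pre]

theorem h_commFam : Arr.h (commFam (arr ht) F G K) = t.commHty F.map G.map K.map := by
  dsimp only [commFam, Arr.h_comp, Arr.h_wr, Arr.l_wr, Arr.r_wr, Arr.h_sub, Arr.src_tensor,
    Arr.tgt_tensor]
  rw [h_on23, l_on23, r_on23]
  simp only [commHty, app23_eq, h_arr, l_arr, r_arr, post_pre, pre_comp]

theorem l_asFam : Arr.l (asFam s (arr ht) F G K) = asFam s t.app F.src G.src K.src := rfl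
theorem l_asInvFam : Arr.l (asInvFam s (arr ht) F G K) = asInvFam s t.app F.src G.src K.src := rfl
theorem r_asInvFam : Arr.r (asInvFam s (arr ht) F G K) = asInvFam s t.app F.tgt G.tgt K.tgt := rfl
theorem r_asFam : Arr.r (asFam s (arr ht) F G K) = asFam s t.app F.tgt G.tgt K.tgt := rfl

theorem h_asFam (a : R) :
    Arr.h (asFam s (arr ht) F G K) = (t.quad a s).asHty F.map G.map K.map := by
  dsimp only [asFam, quad, Arr.h_comp, Arr.h_add, Arr.h_id, Arr.h_smul, Arr.h_assoc, Arr.r_assoc,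
    Arr.src_tensor, Arr.tgt_tensor]
  rw [h_commFam]
  simp only [map_zero, LinearMap.zero_apply, zero_add, map_smul]

theorem l_brFam : Arr.l (brFam a s (arr ht) F G) = brFam a s t.app F.src G.src := rfl
theorem r_brFam : Arr.r (brFam a s (arr ht) F G) = brFam a s t.app F.tgt G.tgt := rfl

theorem h_brFam : Arr.h (brFam a s (arr ht) F G) = (t.quad a s).brHty F.map G.map := by
  dsimp only [brFam, quad, Arr.h_comp, Arr.h_add, Arr.h_id, Arr.h_smul, Arr.h_braid, Arr.r_braid,
    Arr.src_tensor, Arr.tgt_tensor]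
  simp only [map_zero, LinearMap.zero_apply, zero_add]
  rfl

/-- The homotopy component of the inverse of a 1-cell of squares. -/
theorem h_inverse {F G : Arr R C} (f : F ⟶ G) (g : G ⟶ F) (h : f ≫ g = 𝟙 _) (h' : g ≫ f = 𝟙 _) :
    Arr.h g = -(Arr.r g ⊳ Arr.h f ⊲ Arr.l g) := by
  have h₁ := congrArg Arr.h h'
  have h₂ : Arr.r f ≫ Arr.r g = 𝟙 _ := congrArg Arr.r h
  simp only [Arr.h_comp, Arr.h_id] at h₁
  have h₃ := congrArg (fun q => Arr.r g ⊳ q) (eq_neg_of_add_eq_zero_right h₁)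
  simp only [← post_comp, h₂, post_id, map_neg] at h₃
  exact h₃

theorem h_asInvFam (a : R) (h₃ : s * s = 0) : Arr.h (asInvFam s (arr ht) F G K) =
    (t.quad a s).asInvHty F.map G.map K.map := by
  rw [h_inverse _ _ (asFam_comp_inv h₃ F G K) (asInvFam_comp h₃ F G K), h_asFam ht F G K a]
  rfl

end Components

end InfData
end Quadratic
end Syl

namespace Syl

open TwoCells TwoCellsMonoidal

section FamilyNaturality

variable {R : Type*} [CommRing R] {C : Type*} [Category C] [Preadditive C] [Linear R C]
  [MonoidalCategory C] [MonoidalPreadditive C] [MonoidalLinear R C] [SymmetricCategory C]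
  {t : ∀ U V : C, U ⊗ V ⟶ U ⊗ V} {a s : R}

theorem brFam_naturality {U U' V V' : C} (f : U ⟶ U') (g : V ⟶ V')
    (h : (f ⊗ₘ g) ≫ t U' V' = t U V ≫ (f ⊗ₘ g)) :
    (f ⊗ₘ g) ≫ brFam a s t U' V' = brFam a s t U V ≫ (g ⊗ₘ f) := by
  have h' : (f ⊗ₘ g) ≫ t U' V' ≫ t U' V' = (t U V ≫ t U V) ≫ (f ⊗ₘ g) := by
    rw [reassoc_of% h, h, Category.assoc]
  simp only [brFam, Category.assoc, ← braiding_naturality]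
  simp only [← Category.assoc]
  congr 1
  simp only [Preadditive.comp_add, Preadditive.add_comp, Linear.comp_smul, Linear.smul_comp, h, h',
    Category.comp_id, Category.id_comp]

theorem asFam_naturality {U U' V V' W W' : C} (f : U ⟶ U') (g : V ⟶ V') (k : W ⟶ W')
    (h : (f ⊗ₘ g) ≫ t U' V' = t U V ≫ (f ⊗ₘ g)) (h' : (g ⊗ₘ k) ≫ t V' W' = t V W ≫ (g ⊗ₘ k)) :
    ((f ⊗ₘ g) ⊗ₘ k) ≫ asFam s t U' V' W' = asFam s t U V W ≫ (f ⊗ₘ (g ⊗ₘ k)) := by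
  have h₁ : ((f ⊗ₘ g) ⊗ₘ k) ≫ t U' V' ▷ W' = t U V ▷ W ≫ ((f ⊗ₘ g) ⊗ₘ k) := by
    rw [← tensorHom_id, ← tensorHom_id, tensorHom_comp_tensorHom, tensorHom_comp_tensorHom, h,
      Category.comp_id, Category.id_comp]
  have h₂ : ((f ⊗ₘ g) ⊗ₘ k) ≫ on23 t U' V' W' = on23 t U V W ≫ ((f ⊗ₘ g) ⊗ₘ k) := by
    have : (f ⊗ₘ (g ⊗ₘ k)) ≫ U' ◁ t V' W' = U ◁ t V W ≫ (f ⊗ₘ (g ⊗ₘ k)) := by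
      rw [← id_tensorHom, ← id_tensorHom, tensorHom_comp_tensorHom, tensorHom_comp_tensorHom, h',
        Category.comp_id, Category.id_comp]
    rw [on23, cj, associator_naturality_assoc, reassoc_of% this, associator_inv_naturality, on23, cj]
    simp
  have h₃ : ((f ⊗ₘ g) ⊗ₘ k) ≫ commFam t U' V' W' = commFam t U V W ≫ ((f ⊗ₘ g) ⊗ₘ k) := by
    rw [commFam, commFam, Preadditive.comp_sub, Preadditive.sub_comp, reassoc_of% h₁,
      reassoc_of% h₂, h₁, h₂, Category.assoc, Category.assoc]
  simp only [asFam, Category.assoc, ← associator_naturality]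
  simp only [← Category.assoc]
  congr 1
  simp only [Preadditive.comp_add, Preadditive.add_comp, Linear.comp_smul, Linear.smul_comp, h₃,
    Category.comp_id, Category.id_comp]

end FamilyNaturality

section Pasting

variable {R : Type*} [CommRing R] {C : Type*} [Category C] [Preadditive C] [Linear R C]
  [TwoCells R C]

local notation:80 g:81 " ⊳ " q:80 => g ⊳[R] q
local notation:80 q:81 " ⊲ " f:80 => q ⊲[R] f

/-- The square `p''` is the pasting of the squares `p` and `p'`. -/
structure Paste {U U' U'' X X' X'' : C} {f : U ⟶ U'} {f' : U' ⟶ U''} {f'' : U ⟶ U''}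
    {x : X ⟶ X'} {x' : X' ⟶ X''} {x'' : X ⟶ X''} (p : Arr.mk (R := R) f ⟶ Arr.mk x)
    (p' : Arr.mk (R := R) f' ⟶ Arr.mk x') (p'' : Arr.mk (R := R) f'' ⟶ Arr.mk x'') : Prop where
  left : Arr.l p'' = Arr.l p
  middle : Arr.l p' = Arr.r p
  right : Arr.r p'' = Arr.r p'
  hty : Arr.h p'' = Arr.h p' ⊲ f + x' ⊳ Arr.h p

namespace Paste

variable {U U' U'' X X' X'' Y Y' Y'' : C} {f : U ⟶ U'} {f' : U' ⟶ U''} {f'' : U ⟶ U''}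
    {x : X ⟶ X'} {x' : X' ⟶ X''} {x'' : X ⟶ X''} {y : Y ⟶ Y'} {y' : Y' ⟶ Y''} {y'' : Y ⟶ Y''}
    {p q : Arr.mk (R := R) f ⟶ Arr.mk x} {p' q' : Arr.mk (R := R) f' ⟶ Arr.mk x'}
    {p'' q'' : Arr.mk (R := R) f'' ⟶ Arr.mk x''}

theorem id : Paste (𝟙 (Arr.mk (R := R) f)) (𝟙 (Arr.mk f')) (𝟙 (Arr.mk f'')) :=
  ⟨rfl, rfl, rfl, by simp⟩

theorem comp (h : Paste p p' p'') {r : Arr.mk (R := R) x ⟶ Arr.mk y} {r' : Arr.mk x' ⟶ Arr.mk y'}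
    {r'' : Arr.mk x'' ⟶ Arr.mk y''} (h' : Paste r r' r'') : Paste (p ≫ r) (p' ≫ r') (p'' ≫ r'') where
  left := by rw [Arr.l_comp, Arr.l_comp, h.left, h'.left]
  middle := by rw [Arr.l_comp, Arr.r_comp, h.middle, h'.middle]
  right := by rw [Arr.r_comp, Arr.r_comp, h.right, h'.right]
  hty := by
    have w := Arr.w p
    have w' := Arr.w r'
    have e : Arr.h r' ⊲ (x ⊚ Arr.l p) - Arr.h r' ⊲ (Arr.r p ⊚ f) =
        (y' ⊚ Arr.l r') ⊳ Arr.h p - (Arr.r r' ⊚ x') ⊳ Arr.h p := by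
      rw [← map_sub]
      rw [w, ← peiffer, ← w', map_sub, LinearMap.sub_apply]
    dsimp only [Arr.h_comp]
    rw [h.left, h'.right, h.hty, h'.hty, h.middle, ← h'.middle]
    simp only [map_add, LinearMap.add_apply, pre_comp, post_pre, ← post_comp]
    rw [← sub_eq_zero] at e ⊢
    rw [← e]
    abel

theorem add (h : Paste p p' p'') (h' : Paste q q' q'') : Paste (p + q) (p' + q') (p'' + q'') where
  left := congrArg₂ (· + ·) h.left h'.left
  middle := congrArg₂ (· + ·) h.middle h'.middle
  right := congrArg₂ (· + ·) h.right h'.right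
  hty := by
    dsimp only [Arr.h_add]
    rw [h.hty, h'.hty, map_add, map_add, LinearMap.add_apply]; abel

theorem sub (h : Paste p p' p'') (h' : Paste q q' q'') : Paste (p - q) (p' - q') (p'' - q'') where
  left := congrArg₂ (· - ·) h.left h'.left
  middle := congrArg₂ (· - ·) h.middle h'.middle
  right := congrArg₂ (· - ·) h.right h'.right
  hty := by
    dsimp only [Arr.h_sub]
    rw [h.hty, h'.hty, map_sub, map_sub, LinearMap.sub_apply]; abel

theorem smul (c : R) (h : Paste p p' p'') : Paste (c • p) (c • p') (c • p'') where
  left := congrArg (c • ·) h.left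
  middle := congrArg (c • ·) h.middle
  right := congrArg (c • ·) h.right
  hty := by
    dsimp only [Arr.h_smul]
    rw [h.hty, map_smul, map_smul, LinearMap.smul_apply, smul_add]

variable [MonoidalCategory C] [MonoidalPreadditive C] [MonoidalLinear R C] [SymmetricCategory C]
  [TwoCellsMonoidal R C]

theorem whiskerRight (h : Paste p p' p'') (e : y'' = y' ⊚ y) :
    Paste (x := x ⊗ₘ y) (x' := x' ⊗ₘ y') (x'' := x'' ⊗ₘ y'') (f := f ⊗ₘ y) (f' := f' ⊗ₘ y')
      (f'' := f'' ⊗ₘ y'') (p ▷ Arr.mk y) (p' ▷ Arr.mk y') (p'' ▷ Arr.mk y'') where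
  left := congrArg (· ▷ Y) h.left
  middle := congrArg (· ▷ Y') h.middle
  right := congrArg (· ▷ Y'') h.right
  hty := by
    dsimp only [Arr.h_wr]
    subst e
    simp only [h.hty, map_add, wr_pre, wr_post, MonoidalCategory.whiskerLeft_comp,
      MonoidalCategory.tensorHom_def, ← pre_comp, post_pre, ← wr_exch]
    simp only [← post_comp, whisker_exchange, whisker_exchange_assoc, Category.assoc]

theorem whiskerLeft (h : Paste p p' p'') (e : y'' = y' ⊚ y) :
    Paste (x := y ⊗ₘ x) (x' := y' ⊗ₘ x') (x'' := y'' ⊗ₘ x'') (f := y ⊗ₘ f) (f' := y' ⊗ₘ f')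
      (f'' := y'' ⊗ₘ f'') (Arr.mk y ◁ p) (Arr.mk y' ◁ p') (Arr.mk y'' ◁ p'') where
  left := congrArg (Y ◁ ·) h.left
  middle := congrArg (Y' ◁ ·) h.middle
  right := congrArg (Y'' ◁ ·) h.right
  hty := by
    dsimp only [Arr.h_wl]
    subst e
    simp only [h.hty, map_add, wl_pre, wl_post, comp_whiskerRight,
      MonoidalCategory.tensorHom_def', ← pre_comp, post_pre, ← wl_exch]
    simp only [← post_comp, ← whisker_exchange, ← whisker_exchange_assoc, Category.assoc]

theorem of_h_eq_zero (h : Arr.h p = 0) (h' : Arr.h p' = 0) (h'' : Arr.h p'' = 0)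
    (e : Arr.l p'' = Arr.l p) (e' : Arr.l p' = Arr.r p) (e'' : Arr.r p'' = Arr.r p') :
    Paste p p' p'' := ⟨e, e', e'', by simp [h, h', h'']⟩

end Paste
end Pasting

section Laws

variable {R : Type*} [CommRing R] {C : Type*} [Category C] [Preadditive C] [Linear R C]
  [MonoidalCategory C] [MonoidalPreadditive C] [MonoidalLinear R C] [SymmetricCategory C]
  [TwoCells R C] [TwoCellsMonoidal R C]

local notation:80 g:81 " ⊳ " q:80 => g ⊳[R] q
local notation:80 q:81 " ⊲ " f:80 => q ⊲[R] f
local notation:90 f:91 " ⊗ʳ " q:90 => f ⊗ʳ[R] q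
local notation:90 q:91 " ⊗ˡ " g:90 => q ⊗ˡ[R] g

namespace InfData

variable {a s : R} {t : InfData R C} (ht : t.IsInfinitesimal2Braiding)

section Pasting

variable {U U' U'' V V' V'' W W' W'' : C} {f : U ⟶ U'} {f' : U' ⟶ U''} {f'' : U ⟶ U''}
    {g : V ⟶ V'} {g' : V' ⟶ V''} {g'' : V ⟶ V''} {k : W ⟶ W'} {k' : W' ⟶ W''} {k'' : W ⟶ W''}

theorem paste_arr (hf : f'' = f' ⊚ f) (hg : g'' = g' ⊚ g) :
    Paste (f := f ⊗ₘ g) (f' := f' ⊗ₘ g') (f'' := f'' ⊗ₘ g'') (x := f ⊗ₘ g) (x' := f' ⊗ₘ g')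
      (x'' := f'' ⊗ₘ g'') (arr ht ⟨f⟩ ⟨g⟩) (arr ht ⟨f'⟩ ⟨g'⟩) (arr ht ⟨f''⟩ ⟨g''⟩) where
  left := rfl
  middle := rfl
  right := rfl
  hty := by
    subst hf hg
    exact ht.comp f' f g' g

theorem paste_brFam (hf : f'' = f' ⊚ f) (hg : g'' = g' ⊚ g) :
    Paste (f := f ⊗ₘ g) (f' := f' ⊗ₘ g') (f'' := f'' ⊗ₘ g'') (x := g ⊗ₘ f) (x' := g' ⊗ₘ f')
      (x'' := g'' ⊗ₘ f'') (brFam a s (arr ht) ⟨f⟩ ⟨g⟩) (brFam a s (arr ht) ⟨f'⟩ ⟨g'⟩)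
      (brFam a s (arr ht) ⟨f''⟩ ⟨g''⟩) := by
  have h := paste_arr ht hf hg
  refine Paste.comp (((Paste.id).add (h.smul a)).add ((h.comp h).smul (3 * s))) ?_
  exact .of_h_eq_zero rfl rfl rfl rfl rfl rfl

theorem paste_asFam (hf : f'' = f' ⊚ f) (hg : g'' = g' ⊚ g) (hk : k'' = k' ⊚ k) :
    Paste (f := (f ⊗ₘ g) ⊗ₘ k) (f' := (f' ⊗ₘ g') ⊗ₘ k') (f'' := (f'' ⊗ₘ g'') ⊗ₘ k'')
      (x := f ⊗ₘ (g ⊗ₘ k)) (x' := f' ⊗ₘ (g' ⊗ₘ k')) (x'' := f'' ⊗ₘ (g'' ⊗ₘ k''))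
      (asFam s (arr ht) ⟨f⟩ ⟨g⟩ ⟨k⟩) (asFam s (arr ht) ⟨f'⟩ ⟨g'⟩ ⟨k'⟩)
      (asFam s (arr ht) ⟨f''⟩ ⟨g''⟩ ⟨k''⟩) := by
  have h₁ := (paste_arr ht hf hg).whiskerRight hk
  have h₂ : Paste (f := (f ⊗ₘ g) ⊗ₘ k) (f' := (f' ⊗ₘ g') ⊗ₘ k') (f'' := (f'' ⊗ₘ g'') ⊗ₘ k'')
      (x := (f ⊗ₘ g) ⊗ₘ k) (x' := (f' ⊗ₘ g') ⊗ₘ k') (x'' := (f'' ⊗ₘ g'') ⊗ₘ k'')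
      (on23 (arr ht) ⟨f⟩ ⟨g⟩ ⟨k⟩) (on23 (arr ht) ⟨f'⟩ ⟨g'⟩ ⟨k'⟩)
      (on23 (arr ht) ⟨f''⟩ ⟨g''⟩ ⟨k''⟩) := by
    refine Paste.comp ?_ (Paste.comp ((paste_arr ht hg hk).whiskerLeft hf) ?_)
    · exact .of_h_eq_zero rfl rfl rfl rfl rfl rfl
    · exact .of_h_eq_zero rfl rfl rfl rfl rfl rfl
  refine Paste.comp (Paste.id.add (((h₂.comp h₁).sub (h₁.comp h₂)).smul s)) ?_
  exact .of_h_eq_zero rfl rfl rfl rfl rfl rfl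

end Pasting

/-- The square with source `0`, target `∂ q` and element `q`. -/
def ofHty {U V : C} (q : H R U V) : Arr.mk (R := R) (0 : U ⟶ V) ⟶ Arr.mk (∂[R] q) :=
  Arr.mk' (𝟙 _) (𝟙 _) q (by simp)

theorem ofHty_left {U V : C} (q : H R U V) (G : Arr R C) :
    (ofHty q ⊗ₘ 𝟙 G) ≫ arr ht _ _ = arr ht _ _ ≫ (ofHty q ⊗ₘ 𝟙 G) := by
  rw [tensorHom_id]
  refine Arr.hom_ext ?_ ?_ ?_
  · change 𝟙 _ ▷ G.src ≫ t.app U G.src = t.app U G.src ≫ 𝟙 _ ▷ G.src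
    simp
  · change 𝟙 _ ▷ G.tgt ≫ t.app V G.tgt = t.app V G.tgt ≫ 𝟙 _ ▷ G.tgt
    simp
  · have := ht.natural_left q G.map
    change t.h (∂[R] q) G.map ⊲ (𝟙 U ▷ G.src) + t.app V G.tgt ⊳ (q ⊗ˡ G.map) =
      (q ⊗ˡ G.map) ⊲ t.app U G.src + (𝟙 V ▷ G.tgt) ⊳ t.h (0 : U ⟶ V) G.map
    rw [← this]
    simp [pre_id, post_id, h]

theorem ofHty_right {U V : C} (q : H R U V) (F : Arr R C) :
    (𝟙 F ⊗ₘ ofHty q) ≫ arr ht _ _ = arr ht _ _ ≫ (𝟙 F ⊗ₘ ofHty q) := by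
  rw [id_tensorHom]
  refine Arr.hom_ext ?_ ?_ ?_
  · change F.src ◁ 𝟙 _ ≫ t.app F.src U = t.app F.src U ≫ F.src ◁ 𝟙 _
    simp
  · change F.tgt ◁ 𝟙 _ ≫ t.app F.tgt V = t.app F.tgt V ≫ F.tgt ◁ 𝟙 _
    simp
  · have := ht.natural_right F.map q
    change t.h F.map (∂[R] q) ⊲ (F.src ◁ 𝟙 U) + t.app F.tgt V ⊳ (F.map ⊗ʳ q) =
      (F.map ⊗ʳ q) ⊲ t.app F.src U + (F.tgt ◁ 𝟙 V) ⊳ t.h F.map (0 : U ⟶ V)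
    rw [← this]
    simp [pre_id, post_id, h]

theorem as_linear_left {U U' V V' W W' : C} (g : V ⟶ V') (k : W ⟶ W') :
    IsLinearMap R fun f : U ⟶ U' => (t.quad a s).asHty f g k where
  map_add f f' := by
    simp only [quad, commHty, h, map_add, LinearMap.add_apply, MonoidalPreadditive.add_whiskerRight,
      smul_add, smul_sub, map_sub]
    abel
  map_smul c f := by
    simp only [quad, commHty, h, map_smul, LinearMap.smul_apply, MonoidalLinear.smul_whiskerRight,
      smul_add, smul_sub, map_sub, map_add]
    module

theorem as_linear_middle {U U' V V' W W' : C} (f : U ⟶ U') (k : W ⟶ W') :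
    IsLinearMap R fun g : V ⟶ V' => (t.quad a s).asHty f g k where
  map_add g g' := by
    simp only [quad, commHty, h, map_add, LinearMap.add_apply, smul_add, smul_sub, map_sub]
    abel
  map_smul c g := by
    simp only [quad, commHty, h, map_smul, LinearMap.smul_apply, smul_add, smul_sub, map_sub, map_add]
    module

theorem as_linear_right {U U' V V' W W' : C} (f : U ⟶ U') (g : V ⟶ V') :
    IsLinearMap R fun k : W ⟶ W' => (t.quad a s).asHty f g k where
  map_add k k' := by
    simp only [quad, commHty, h, map_add, LinearMap.add_apply, MonoidalPreadditive.whiskerLeft_add,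
      smul_add, smul_sub, map_sub]
    abel
  map_smul c k := by
    simp only [quad, commHty, h, map_smul, LinearMap.smul_apply, MonoidalLinear.whiskerLeft_smul,
      smul_add, smul_sub, map_sub, map_add]
    module

theorem br_linear_left {U U' V V' : C} (g : V ⟶ V') :
    IsLinearMap R fun f : U ⟶ U' => (t.quad a s).brHty f g where
  map_add f f' := by
    simp only [quad, h, map_add, LinearMap.add_apply, smul_add]
    abel
  map_smul c f := by
    simp only [quad, h, map_smul, LinearMap.smul_apply, smul_add, map_add]
    module

theorem br_linear_right {U U' V V' : C} (f : U ⟶ U') :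
    IsLinearMap R fun g : V ⟶ V' => (t.quad a s).brHty f g where
  map_add f f' := by
    simp only [quad, h, map_add, LinearMap.add_apply, smul_add]
    abel
  map_smul c f := by
    simp only [quad, h, map_smul, LinearMap.smul_apply, smul_add, map_add]
    module

include ht in
theorem quad_associatorLaws (a : R) (h₃ : s * s = 0) : (t.quad a s).AssociatorLaws where
  as_inv_comp U V W := asFam_comp_inv h₃ U V W
  as_comp_inv U V W := asInvFam_comp h₃ U V W
  as_linear_left := as_linear_left
  as_linear_middle := as_linear_middle
  as_linear_right := as_linear_right
  as_natural f g k := by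
    have := Arr.w (asFam s (arr ht) ⟨f⟩ ⟨g⟩ ⟨k⟩)
    rw [h_asFam ht _ _ _ a] at this
    exact this
  as_natural_left q g k := by
    have := congrArg Arr.h (asFam_naturality (s := s) (ofHty q) (𝟙 ⟨g⟩) (𝟙 ⟨k⟩) (ofHty_left ht q _)
      (by simp))
    simp only [id_tensorHom_id, id_whiskerRight, MonoidalCategory.whiskerLeft_id, tensorHom_id, Arr.h_comp, h_asFam ht _ _ _ a] at this
    dsimp only [Arr.l_wr, Arr.r_wr, Arr.h_wr, Arr.src_tensor, Arr.tgt_tensor] at this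
    rw [(as_linear_left _ _).map_zero, map_zero, add_zero] at this
    rw [sub_eq_iff_eq_add]
    refine this.symm.trans ?_
    simp [ofHty, pre_id]
    rfl
  as_natural_middle f q k := by
    have := congrArg Arr.h (asFam_naturality (s := s) (𝟙 ⟨f⟩) (ofHty q) (𝟙 ⟨k⟩) (ofHty_right ht q _)
      (ofHty_left ht q _))
    simp only [id_tensorHom, tensorHom_id, Arr.h_comp, h_asFam ht _ _ _ a] at this
    dsimp only [Arr.l_wr, Arr.r_wr, Arr.h_wr, Arr.l_wl, Arr.r_wl, Arr.h_wl, Arr.src_tensor, Arr.tgt_tensor] at this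
    rw [(as_linear_middle _ _).map_zero, map_zero, add_zero] at this
    rw [sub_eq_iff_eq_add]
    refine this.symm.trans ?_
    simp [ofHty, pre_id]
    rfl
  as_natural_right f g q := by
    have := congrArg Arr.h (asFam_naturality (s := s) (𝟙 ⟨f⟩) (𝟙 ⟨g⟩) (ofHty q) (by simp)
      (ofHty_right ht q _))
    simp only [id_tensorHom_id, id_whiskerRight, MonoidalCategory.whiskerLeft_id, id_tensorHom, Arr.h_comp, h_asFam ht _ _ _ a] at this
    dsimp only [Arr.l_wl, Arr.r_wl, Arr.h_wl, Arr.src_tensor, Arr.tgt_tensor] at this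
    rw [(as_linear_right _ _).map_zero, map_zero, add_zero] at this
    rw [sub_eq_iff_eq_add]
    refine this.symm.trans ?_
    simp [ofHty, pre_id]
    rfl
  as_unit U V W := by simp [quad, commHty, ht.unit]
  as_comp f' f g' g k' k := by
    have := (paste_asFam (s := s) ht (f := f) (f' := f') (g := g) (g' := g') (k := k) (k' := k') rfl rfl rfl).hty
    simp only [h_asFam ht _ _ _ a] at this
    exact this

include ht in
theorem quad_braidingLaws (h₁ : a * a = 6 * s) (h₂ : a * s = 0) (h₃ : s * s = 0) :
    (t.quad a s).BraidingLaws where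
  br_inv_comp U V := brFam_comp_inv h₁ h₂ h₃ U V
  br_comp_inv U V := brInvFam_comp h₁ h₂ h₃ U V
  br_linear_left := br_linear_left
  br_linear_right := br_linear_right
  br_natural f g := by
    have := Arr.w (brFam a s (arr ht) ⟨f⟩ ⟨g⟩)
    rw [h_brFam ht] at this
    exact this
  br_natural_left q g := by
    have := congrArg Arr.h (brFam_naturality (a := a) (s := s) (ofHty q) (𝟙 ⟨g⟩)
      (ofHty_left ht q _))
    simp only [tensorHom_id, id_tensorHom, Arr.h_comp, h_brFam ht] at this
    dsimp only [Arr.l_wr, Arr.r_wr, Arr.h_wr, Arr.l_wl, Arr.r_wl, Arr.h_wl, Arr.src_tensor, Arr.tgt_tensor] at this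
    rw [(br_linear_left _).map_zero, map_zero, add_zero] at this
    rw [sub_eq_iff_eq_add]
    refine this.symm.trans ?_
    simp [ofHty, pre_id]
    rfl
  br_natural_right f q := by
    have := congrArg Arr.h (brFam_naturality (a := a) (s := s) (𝟙 ⟨f⟩) (ofHty q)
      (ofHty_right ht q _))
    simp only [tensorHom_id, id_tensorHom, Arr.h_comp, h_brFam ht] at this
    dsimp only [Arr.l_wr, Arr.r_wr, Arr.h_wr, Arr.l_wl, Arr.r_wl, Arr.h_wl, Arr.src_tensor, Arr.tgt_tensor] at this
    rw [(br_linear_right _).map_zero, map_zero, add_zero] at this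
    rw [sub_eq_iff_eq_add]
    refine this.symm.trans ?_
    simp [ofHty, pre_id]
    rfl
  br_unit U V := by simp [quad, ht.unit]
  br_comp f' f g' g := by
    have := (paste_brFam (a := a) (s := s) ht (f := f) (f' := f') (g := g) (g' := g') rfl rfl).hty
    simp only [h_brFam ht] at this
    exact this

end InfData
end Laws
end Syl

namespace Syl

open TwoCells TwoCellsMonoidal

section Unit

variable {R : Type*} [CommRing R] {C : Type*} [Category C] [Preadditive C] [Linear R C]
  [MonoidalCategory C] [MonoidalPreadditive C] [MonoidalLinear R C] [SymmetricCategory C]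
  {t : ∀ U V : C, U ⊗ V ⟶ U ⊗ V} {s : R}

theorem StrictFamily.asFam_unit (ht : StrictFamily t)
    (hl : ∀ U V : C, U ◁ (λ_ V).hom ≫ t U V = t U (𝟙_ C ⊗ V) ≫ U ◁ (λ_ V).hom)
    (hr : ∀ U V : C, (ρ_ U).hom ▷ V ≫ t U V = t (U ⊗ 𝟙_ C) V ≫ (ρ_ U).hom ▷ V) (U V : C) :
    asFam s t U (𝟙_ C) V = (α_ U (𝟙_ C) V).hom := by
  have e : ∀ p : U ⊗ 𝟙_ C ⊗ V ≅ U ⊗ V, on13 t U (𝟙_ C) V =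
      cj (whiskerRightIso (ρ_ U) V) (t U V) := by
    intro _
    have : t U V ▷ 𝟙_ C = cj (ρ_ (U ⊗ V)) (t U V) := by simp [cj]
    rw [on13, this, cj_cj]
    apply cj_congr
    simp [swap23]
  have e := e (whiskerLeftIso U (λ_ V))
  have h₁ : t U (𝟙_ C) ▷ V = 0 := by
    have h₁ := ht.left U (𝟙_ C) V
    have h₂ : t U (𝟙_ C ⊗ V) = cj (whiskerLeftIso U (λ_ V)) (t U V) := by
      rw [cj, whiskerLeftIso_hom, reassoc_of% hl U V, whiskerLeftIso_inv]; simp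
    rw [h₂, cj_cj, e, cj_congr (q := whiskerRightIso (ρ_ U) V) (by simp)] at h₁
    exact right_eq_add.1 h₁
  have h₂ : on23 t U (𝟙_ C) V = 0 := by
    have h₁ := ht.right U (𝟙_ C) V
    have h₂ : t (U ⊗ 𝟙_ C) V = cj (whiskerRightIso (ρ_ U) V) (t U V) := by
      rw [cj, whiskerRightIso_hom, reassoc_of% hr U V, whiskerRightIso_inv]; simp
    rw [h₂, e] at h₁
    exact left_eq_add.1 h₁
  simp [asFam, commFam, h₁, h₂]

end Unit

section Laws

variable {R : Type*} [CommRing R] {C : Type*} [Category C] [Preadditive C] [Linear R C]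
  [MonoidalCategory C] [MonoidalPreadditive C] [MonoidalLinear R C] [SymmetricCategory C]
  [TwoCells R C] [TwoCellsMonoidal R C]

local notation:80 g:81 " ⊳ " q:80 => g ⊳[R] q
local notation:80 q:81 " ⊲ " f:80 => q ⊲[R] f
local notation:90 f:91 " ⊗ʳ " q:90 => f ⊗ʳ[R] q
local notation:90 q:91 " ⊗ˡ " g:90 => q ⊗ˡ[R] g

namespace InfData

variable {a s : R} {t : InfData R C}

theorem IsInfinitesimal2Braiding.app_natural (ht : t.IsInfinitesimal2Braiding) {U U' V V' : C}
    {f : U ⟶ U'} {g : V ⟶ V'} (h : t.h f g = 0) :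
    (f ⊗ₘ g) ≫ t.app U' V' = t.app U V ≫ (f ⊗ₘ g) := by
  have := ht.natural f g
  rw [h, map_zero, sub_eq_zero] at this
  exact this.symm

theorem IsInfinitesimal2Braiding.h_left (ht : t.IsInfinitesimal2Braiding) {U U' U'' V V' : C}
    {g : V ⟶ V'} (f' : U'' ⟶ U) (φ : U ⟶ U')
    (h : t.h φ (𝟙 V') = 0) : t.h (φ ⊚ f') g = (φ ▷ V') ⊳ t.h f' g := by
  have := ht.comp φ f' (𝟙 V') g
  rwa [Category.comp_id, h, map_zero, LinearMap.zero_apply, zero_add, tensorHom_id] at this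

theorem IsInfinitesimal2Braiding.h_left' (ht : t.IsInfinitesimal2Braiding) {U U' U'' V V' : C}
    {g : V ⟶ V'} (f' : U' ⟶ U'') (φ : U ⟶ U')
    (h : t.h φ (𝟙 V) = 0) : t.h (f' ⊚ φ) g = t.h f' g ⊲ (φ ▷ V) := by
  have := ht.comp f' φ g (𝟙 V)
  rwa [Category.id_comp, h, map_zero, add_zero, tensorHom_id] at this

theorem IsInfinitesimal2Braiding.h_right (ht : t.IsInfinitesimal2Braiding) {U U' V V' V'' : C}
    {f : U ⟶ U'} (g' : V ⟶ V') (φ : V' ⟶ V'')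
    (h : t.h (𝟙 U') φ = 0) : t.h f (φ ⊚ g') = (U' ◁ φ) ⊳ t.h f g' := by
  have := ht.comp (𝟙 U') f φ g'
  rwa [Category.comp_id, h, map_zero, LinearMap.zero_apply, zero_add, id_tensorHom] at this

theorem IsInfinitesimal2Braiding.h_right' (ht : t.IsInfinitesimal2Braiding) {U U' V V' V'' : C}
    {f : U ⟶ U'} (g' : V' ⟶ V'') (φ : V ⟶ V')
    (h : t.h (𝟙 U) φ = 0) : t.h f (g' ⊚ φ) = t.h f g' ⊲ (U ◁ φ) := by
  have := ht.comp f (𝟙 U) g' φ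
  rwa [Category.id_comp, h, map_zero, add_zero, id_tensorHom] at this

theorem IsInfinitesimal2Braiding.hom_left (ht : t.IsInfinitesimal2Braiding) {U V W : C} (e : U ≅ V)
    (h : t.h e.hom (𝟙 W) = 0) : t.h e.inv (𝟙 W) = 0 := by
  have h₁ := ht.h_left (V := W) (g := 𝟙 W) e.inv e.hom h
  rw [e.inv_hom_id, ht.unit] at h₁
  have h₂ := congrArg (fun q => (e.inv ▷ W) ⊳ q) h₁
  simp only [← post_comp, ← comp_whiskerRight, e.hom_inv_id, id_whiskerRight, post_id, map_zero] at h₂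
  exact h₂.symm

variable (ht : t.IsInfinitesimal2Braiding)

theorem arr_leftUnitor (F G : Arr R C) :
    F ◁ (λ_ G).hom ≫ arr ht F G = arr ht F (𝟙_ _ ⊗ G) ≫ F ◁ (λ_ G).hom := by
  refine Arr.hom_ext ?_ ?_ ?_
  · simpa using ht.app_natural (ht.leftUnitor_right G.src F.src)
  · simpa using ht.app_natural (ht.leftUnitor_right G.tgt F.tgt)
  · dsimp only [Arr.h_comp, Arr.h_wl, Arr.l_wl, Arr.r_wl, Arr.h_leftUnitor, Arr.l_leftUnitor,
      Arr.r_leftUnitor, h_arr, Arr.src_tensor, Arr.tgt_tensor, Arr.map_tensor, Arr.map_unit,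
      Arr.src_unit, Arr.tgt_unit]
    rw [← ht.h_right _ _ (ht.leftUnitor_right _ _), ← ht.h_right' _ _ (ht.leftUnitor_right _ _)]
    simp

theorem arr_rightUnitor (F G : Arr R C) :
    (ρ_ F).hom ▷ G ≫ arr ht F G = arr ht (F ⊗ 𝟙_ _) G ≫ (ρ_ F).hom ▷ G := by
  refine Arr.hom_ext ?_ ?_ ?_
  · simpa using ht.app_natural (ht.rightUnitor_left F.src G.src)
  · simpa using ht.app_natural (ht.rightUnitor_left F.tgt G.tgt)
  · dsimp only [Arr.h_comp, Arr.h_wr, Arr.l_wr, Arr.r_wr, Arr.h_rightUnitor, Arr.l_rightUnitor,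
      Arr.r_rightUnitor, h_arr, Arr.src_tensor, Arr.tgt_tensor, Arr.map_tensor, Arr.map_unit,
      Arr.src_unit, Arr.tgt_unit]
    have h₁ := ht.h_left (g := G.map) (F.map ⊗ₘ 𝟙 (𝟙_ C)) (ρ_ F.tgt).hom
      (ht.rightUnitor_left _ _)
    rw [← h₁, ← ht.h_left' _ _ (ht.rightUnitor_left _ _)]
    simp

include ht in
theorem quad_triangle (hst : t.IsStrict) (a : R) (U V : C) :
    (U ◁ (λ_ V).hom) ⊚ (t.quad a s).as U (𝟙_ C) V = (ρ_ U).hom ▷ V := by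
  have := (hst.family).asFam_unit (s := s)
    (fun U V => by simpa using ht.app_natural (ht.leftUnitor_right V U))
    (fun U V => by simpa using ht.app_natural (ht.rightUnitor_left U V)) U V
  change asFam s t.app U (𝟙_ C) V ≫ _ = _
  rw [this]; simp

include ht in
theorem quad_triangle_hty (hst : t.IsStrict) (a : R) {U U' V V' : C} (f : U ⟶ U') (g : V ⟶ V') :
    (t.quad a s).asHty f (𝟙 (𝟙_ C)) g = 0 := by
  have := (hst.arr_family ht).asFam_unit (s := s) (arr_leftUnitor ht) (arr_rightUnitor ht) ⟨f⟩ ⟨g⟩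
  have := congrArg Arr.h this
  rw [h_asFam ht _ _ _ a] at this
  exact this

theorem quad_pentagon (hst : t.IsStrict) (a : R) (h₃ : s * s = 0) (U V W X : C) :
    (U ◁ (t.quad a s).as V W X) ⊚ (t.quad a s).as U (V ⊗ W) X ⊚ ((t.quad a s).as U V W ▷ X) =
      (t.quad a s).as U V (W ⊗ X) ⊚ (t.quad a s).as (U ⊗ V) W X := by
  have := hst.family.pentagon h₃ U V W X
  rw [Category.assoc]
  exact this

include ht in
theorem quad_pentagon_hty (hst : t.IsStrict) (a : R) (h₃ : s * s = 0) {U U' V V' W W' X X' : C}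
    (f : U ⟶ U') (g : V ⟶ V') (k : W ⟶ W') (x : X ⟶ X') :
    (f ⊗ʳ (t.quad a s).asHty g k x) ⊲ (t.quad a s).as U (V ⊗ W) X ⊚ ((t.quad a s).as U V W ▷ X) +
      (U' ◁ (t.quad a s).as V' W' X') ⊳ (t.quad a s).asHty f (g ⊗ₘ k) x ⊲
        ((t.quad a s).as U V W ▷ X) +
      (U' ◁ (t.quad a s).as V' W' X') ⊳ (t.quad a s).as U' (V' ⊗ W') X' ⊳
        ((t.quad a s).asHty f g k ⊗ˡ x) =
    (t.quad a s).asHty f g (k ⊗ₘ x) ⊲ (t.quad a s).as (U ⊗ V) W X +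
      (t.quad a s).as U' V' (W' ⊗ X') ⊳ (t.quad a s).asHty (f ⊗ₘ g) k x := by
  have := congrArg Arr.h ((hst.arr_family ht).pentagon h₃ ⟨f⟩ ⟨g⟩ ⟨k⟩ ⟨x⟩)
  simp only [Arr.h_comp, Arr.h_wl, Arr.h_wr, h_asFam ht _ _ _ a, map_add, LinearMap.add_apply] at this
  dsimp only [Arr.l_comp, Arr.r_comp, Arr.l_wr, Arr.r_wl, l_asFam, r_asFam, Arr.src_tensor,
    Arr.tgt_tensor, Arr.map_tensor] at this
  simp only [pre_comp, post_comp, post_pre] at this ⊢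
  exact this

include ht in
theorem bd_fourTermL (U V W : C) :
    ∂[R] (t.fourTermL U V W) = bracket (t.app U V ▷ W) (t.app (U ⊗ V) W) := by
  rw [fourTermL, ← ht.natural, tensorHom_id, bracket]

include ht in
theorem bd_fourTermR (U V W : C) : ∂[R] (t.fourTermR U V W) =
    bracket (on23 t.app U V W) (cj (α_ U V W) (t.app U (V ⊗ W))) := by
  rw [fourTermR, bd_post, bd_pre, ← ht.natural, id_tensorHom, bracket, on23, ← cj_comp, ← cj_comp,
    ← cj_sub, cj]
  simp

theorem h_fourTermL (F G K : Arr R C) :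
    Arr.h (bracket (arr ht F G ▷ K) (arr ht (F ⊗ G) K)) =
      ((F.map ⊗ₘ G.map) ⊗ₘ K.map) ⊳ t.fourTermL F.src G.src K.src -
        t.fourTermL F.tgt G.tgt K.tgt ⊲ ((F.map ⊗ₘ G.map) ⊗ₘ K.map) := by
  have h₁ := ht.natural_left (t.h F.map G.map) K.map
  have h₂ := ht.comp (F.map ⊗ₘ G.map) (t.app F.src G.src) K.map (𝟙 _)
  have h₃ := ht.comp (t.app F.tgt G.tgt) (F.map ⊗ₘ G.map) (𝟙 _) K.map
  rw [← ht.natural] at h₁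
  rw [Category.id_comp, tensorHom_id] at h₂
  rw [Category.comp_id, tensorHom_id] at h₃
  have h₄ : t.h ((F.map ⊗ₘ G.map) ⊚ t.app F.src G.src - t.app F.tgt G.tgt ⊚ (F.map ⊗ₘ G.map)) K.map =
      t.h ((F.map ⊗ₘ G.map) ⊚ t.app F.src G.src) K.map -
        t.h (t.app F.tgt G.tgt ⊚ (F.map ⊗ₘ G.map)) K.map := by simp [InfData.h]
  rw [h₄, h₂, h₃] at h₁
  dsimp only [bracket, Arr.h_sub, Arr.h_comp, Arr.h_wr, Arr.l_wr, Arr.r_wr, h_arr, l_arr, r_arr,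
    Arr.src_tensor, Arr.tgt_tensor, Arr.map_tensor]
  rw [fourTermL, fourTermL]
  rw [← sub_eq_zero] at h₁ ⊢
  rw [← h₁]
  abel

theorem h_cj_assoc {F G K : Arr R C} (p : F ⊗ (G ⊗ K) ⟶ F ⊗ (G ⊗ K)) :
    Arr.h (cj (α_ F G K) p) = (α_ F.tgt G.tgt K.tgt).inv ⊳ Arr.h p ⊲ (α_ F.src G.src K.src).hom := by
  dsimp only [cj, Arr.h_comp, Arr.h_assoc, Arr.h_assoc_inv, Arr.l_assoc, Arr.r_assoc_inv,
    Arr.src_tensor, Arr.tgt_tensor]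
  simp only [map_zero, LinearMap.zero_apply, zero_add, add_zero, post_pre]

theorem h_fourTermR (F G K : Arr R C) :
    Arr.h (bracket (on23 (arr ht) F G K) (cj (α_ F G K) (arr ht F (G ⊗ K)))) =
      ((F.map ⊗ₘ G.map) ⊗ₘ K.map) ⊳ t.fourTermR F.src G.src K.src -
        t.fourTermR F.tgt G.tgt K.tgt ⊲ ((F.map ⊗ₘ G.map) ⊗ₘ K.map) := by
  have h₁ := ht.natural_right F.map (t.h G.map K.map)
  have h₂ := ht.comp F.map (𝟙 _) (G.map ⊗ₘ K.map) (t.app G.src K.src)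
  have h₃ := ht.comp (𝟙 _) F.map (t.app G.tgt K.tgt) (G.map ⊗ₘ K.map)
  rw [← ht.natural] at h₁
  rw [Category.id_comp, id_tensorHom] at h₂
  rw [Category.comp_id, id_tensorHom] at h₃
  have h₄ : t.h F.map ((G.map ⊗ₘ K.map) ⊚ t.app G.src K.src - t.app G.tgt K.tgt ⊚ (G.map ⊗ₘ K.map)) =
      t.h F.map ((G.map ⊗ₘ K.map) ⊚ t.app G.src K.src) -
        t.h F.map (t.app G.tgt K.tgt ⊚ (G.map ⊗ₘ K.map)) := by simp [InfData.h]
  rw [h₄, h₂, h₃] at h₁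
  have e : Arr.h (bracket (F ◁ arr ht G K) (arr ht F (G ⊗ K))) =
      (F.map ⊗ₘ (G.map ⊗ₘ K.map)) ⊳ t.h (𝟙 F.src) (t.app G.src K.src) -
        t.h (𝟙 F.tgt) (t.app G.tgt K.tgt) ⊲ (F.map ⊗ₘ (G.map ⊗ₘ K.map)) := by
    dsimp only [bracket, Arr.h_sub, Arr.h_comp, Arr.h_wl, Arr.l_wl, Arr.r_wl, h_arr, l_arr, r_arr,
      Arr.src_tensor, Arr.tgt_tensor, Arr.map_tensor]
    rw [← sub_eq_zero] at h₁ ⊢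
    rw [← h₁]
    abel
  rw [bracket, on23, ← cj_comp, ← cj_comp, ← cj_sub, h_cj_assoc]
  rw [bracket] at e
  rw [e, map_sub, LinearMap.sub_apply, map_sub, fourTermR, fourTermR]
  dsimp only [Arr.src_tensor, Arr.tgt_tensor]
  simp only [post_pre, pre_comp, ← post_comp]
  rw [associator_inv_naturality, associator_naturality]

theorem h_hexCore (c d : R) (F G K : Arr R C) : Arr.h (hexCore c d (arr ht) F G K) =
    ((F.map ⊗ₘ G.map) ⊗ₘ K.map) ⊳ (c • t.fourTermL F.src G.src K.src +
      d • t.fourTermR F.src G.src K.src) -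
    (c • t.fourTermL F.tgt G.tgt K.tgt + d • t.fourTermR F.tgt G.tgt K.tgt) ⊲
      ((F.map ⊗ₘ G.map) ⊗ₘ K.map) := by
  rw [hexCore, Arr.h_add, Arr.h_smul, Arr.h_smul, h_fourTermL, h_fourTermR]
  simp only [map_add, map_smul, LinearMap.add_apply, LinearMap.smul_apply, smul_sub]
  abel

include ht in
theorem bd_hexCore (c d : R) (U V W : C) :
    ∂[R] (c • t.fourTermL U V W + d • t.fourTermR U V W) = hexCore c d t.app U V W := by
  rw [hexCore, map_add, map_smul, map_smul, bd_fourTermL ht, bd_fourTermR ht]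

include ht in
theorem quad_hexagonatorLaws (hst : t.IsStrict) (hs : t.IsSymmetric) (h₁ : a * a = 6 * s)
    (h₂ : a * s = 0) (h₃ : s * s = 0) : (t.quad a s).HexagonatorLaws where
  hex_left U V W := by
    have := hst.family.hexL hs.family h₁ h₂ h₃ U V W
    have e := bd_hexCore ht (2 : R) 1 U V W
    rw [one_smul] at e
    dsimp only [quad]
    simp only [Category.assoc, bd_post, map_smul, e, this]
    simp
  hex_left_quasinatural {U U' V V' W W'} f g k := by
    have := congrArg Arr.h ((hst.arr_family ht).hexL (hs.arr_family ht) h₁ h₂ h₃ ⟨f⟩ ⟨g⟩ ⟨k⟩)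
    simp only [Arr.h_sub, Arr.h_comp, Arr.h_wl, Arr.h_wr, h_asFam ht _ _ _ a, h_brFam, Arr.h_smul,
      h_hexCore, Arr.h_assoc, Arr.h_braid, map_add, LinearMap.add_apply, map_zero,
      LinearMap.zero_apply, zero_add, add_zero] at this
    dsimp only [Arr.l_comp, Arr.r_comp, Arr.l_wr, Arr.r_wl, Arr.l_wl, Arr.r_wr, l_asFam, r_asFam,
      l_brFam, r_brFam, Arr.r_assoc, Arr.r_braid,
      Arr.src_tensor, Arr.tgt_tensor, Arr.map_tensor] at this
    have n : ((α_ U V W).hom ≫ (β_ U (V ⊗ W)).hom ≫ (α_ V W U).hom) ≫ (g ⊗ₘ (k ⊗ₘ f)) =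
        ((f ⊗ₘ g) ⊗ₘ k) ≫ (α_ U' V' W').hom ≫ (β_ U' (V' ⊗ W')).hom ≫ (α_ V' W' U').hom := by
      simp only [Category.assoc, associator_naturality_assoc, ← associator_naturality,
        braiding_naturality_assoc]
    have e₁ : (t.quad a s).hexL U' V' W' ⊲ ((f ⊗ₘ g) ⊗ₘ k) =
        ((α_ U' V' W').hom ≫ (β_ U' (V' ⊗ W')).hom ≫ (α_ V' W' U').hom) ⊳ (s •
          (((2 : R) • t.fourTermL U' V' W' + (1 : R) • t.fourTermR U' V' W') ⊲
            ((f ⊗ₘ g) ⊗ₘ k))) := by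
      dsimp only [quad]
      rw [post_comp, post_comp, post_pre, post_pre, post_pre, map_smul, LinearMap.smul_apply, one_smul]
    have e₂ : (g ⊗ₘ (k ⊗ₘ f)) ⊳ (t.quad a s).hexL U V W =
        ((α_ U' V' W').hom ≫ (β_ U' (V' ⊗ W')).hom ≫ (α_ V' W' U').hom) ⊳ (s •
          (((f ⊗ₘ g) ⊗ₘ k) ⊳
            ((2 : R) • t.fourTermL U V W + (1 : R) • t.fourTermR U V W))) := by
      dsimp only [quad]
      rw [← map_smul, ← post_comp, ← post_comp, ← post_comp, ← post_comp, ← n, one_smul]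
      simp only [Category.assoc]
    rw [e₁, e₂, ← sub_eq_zero]
    simp only [map_add, LinearMap.add_apply, smul_add, smul_sub, map_sub]
    simp only [map_add, LinearMap.add_apply, smul_add, smul_sub, map_sub] at this
    rw [← sub_eq_zero] at this
    rw [← this]
    dsimp only [quad]
    simp only [pre_comp, post_comp, post_pre]
    abel
  hex_right U V W := by
    have := hst.family.hexR hs.family h₁ h₂ h₃ U V W
    have e := bd_hexCore ht 1 (2 : R) U V W
    rw [one_smul] at e
    dsimp only [quad]
    rw [bd_post, bd_post, bd_pre, map_smul, e]
    simp only [Category.assoc]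
    exact this.symm
  hex_right_quasinatural {U U' V V' W W'} f g k := by
    have := congrArg Arr.h ((hst.arr_family ht).hexR (hs.arr_family ht) h₁ h₂ h₃ ⟨f⟩ ⟨g⟩ ⟨k⟩)
    simp only [Arr.h_sub, Arr.h_comp, Arr.h_wl, Arr.h_wr, h_asInvFam ht _ _ _ a h₃, h_brFam,
      Arr.h_smul, h_hexCore, Arr.h_assoc_inv, Arr.h_braid, map_add, LinearMap.add_apply, map_zero,
      LinearMap.zero_apply, zero_add, add_zero] at this
    dsimp only [Arr.l_comp, Arr.r_comp, Arr.l_wr, Arr.r_wl, Arr.l_wl, Arr.r_wr, l_asInvFam,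
      r_asInvFam, l_brFam, r_brFam, Arr.r_assoc_inv, Arr.l_assoc_inv, Arr.r_braid,
      Arr.src_tensor, Arr.tgt_tensor, Arr.map_tensor] at this
    have n : ((β_ (U ⊗ V) W).hom ≫ (α_ W U V).inv) ≫ ((k ⊗ₘ f) ⊗ₘ g) =
        ((f ⊗ₘ g) ⊗ₘ k) ≫ (β_ (U' ⊗ V') W').hom ≫ (α_ W' U' V').inv := by
      simp only [Category.assoc, ← associator_inv_naturality, braiding_naturality_assoc]
    have e₁ : (t.quad a s).hexR U' V' W' ⊲ (f ⊗ₘ (g ⊗ₘ k)) =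
        ((β_ (U' ⊗ V') W').hom ≫ (α_ W' U' V').inv) ⊳ (s •
          (((1 : R) • t.fourTermL U' V' W' + (2 : R) • t.fourTermR U' V' W') ⊲
            ((f ⊗ₘ g) ⊗ₘ k))) ⊲ (α_ U V W).inv := by
      dsimp only [quad]
      rw [post_comp, post_pre, post_pre, pre_comp, associator_inv_naturality, ← pre_comp, map_smul,
        LinearMap.smul_apply, one_smul]
    have e₂ : ((k ⊗ₘ f) ⊗ₘ g) ⊳ (t.quad a s).hexR U V W =
        ((β_ (U' ⊗ V') W').hom ≫ (α_ W' U' V').inv) ⊳ (s •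
          (((f ⊗ₘ g) ⊗ₘ k) ⊳
            ((1 : R) • t.fourTermL U V W + (2 : R) • t.fourTermR U V W))) ⊲ (α_ U V W).inv := by
      dsimp only [quad]
      rw [← map_smul, ← post_pre, ← post_pre, ← post_pre, ← post_comp, ← post_comp, ← post_pre, ← post_comp, ← n, one_smul]
      simp only [Category.assoc]
    rw [e₁, e₂, ← sub_eq_zero]
    simp only [map_add, LinearMap.add_apply, smul_add, smul_sub, map_sub, LinearMap.sub_apply]
    simp only [map_add, LinearMap.add_apply, smul_add, smul_sub, map_sub,
      LinearMap.sub_apply] at this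
    rw [← sub_eq_zero] at this
    rw [← this]
    dsimp only [quad]
    simp only [pre_comp, post_comp, post_pre]
    abel

end InfData
end Laws
end Syl

namespace Syl

open TwoCells TwoCellsMonoidal Wd

section HtyConjugation

variable {R : Type*} [CommRing R] {C : Type*} [Category C] [Preadditive C] [Linear R C]
  [TwoCells R C]

local notation:80 g:81 " ⊳ " q:80 => g ⊳[R] q
local notation:80 q:81 " ⊲ " f:80 => q ⊲[R] f

/-- Conjugation of an element of degree `-1` by an isomorphism. -/
def cjH {A B : C} (p : A ≅ B) (q : H R B B) : H R A A := p.inv ⊳ (q ⊲ p.hom)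

variable {A B D : C}

theorem cjH_cjH (p : A ≅ B) (p' : B ≅ D) (q : H R D D) : cjH p (cjH p' q) = cjH (p ≪≫ p') q := by
  simp only [cjH, post_pre, pre_comp, ← post_comp, Iso.trans_hom, Iso.trans_inv]

theorem cjH_congr {p p' : A ≅ B} (h : p.hom = p'.hom) (q : H R B B) : cjH p q = cjH p' q := by
  rw [Iso.ext h]

theorem cjH_refl {p : A ≅ A} (h : p.hom = 𝟙 A) (q : H R A A) : cjH p q = q := by
  rw [cjH_congr (p' := Iso.refl A) h]; simp [cjH, pre_id, post_id]

theorem cjH_add (p : A ≅ B) (q q' : H R B B) : cjH p (q + q') = cjH p q + cjH p q' := by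
  simp [cjH]

theorem cjH_neg (p : A ≅ B) (q : H R B B) : cjH p (-q) = -cjH p q := by
  simp [cjH]

theorem cjH_smul (c : R) (p : A ≅ B) (q : H R B B) : cjH p (c • q) = c • cjH p q := by
  simp [cjH]

theorem cjH_eq_iff (p : A ≅ B) (q : H R B B) (q' : H R A A) : cjH p q = q' ↔ q = cjH p.symm q' := by
  constructor
  · rintro rfl
    rw [cjH_cjH, cjH_refl (by simp)]
  · rintro rfl
    rw [cjH_cjH, cjH_refl (by simp)]

theorem bd_cjH (p : A ≅ B) (q : H R B B) : ∂[R] (cjH p q) = cj p (∂[R] q) := by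
  rw [cjH, bd_post, bd_pre, cj, Category.assoc]

theorem post_pre_eq {E : C} {f : A ⟶ B} {g : B ⟶ E} (p : A ≅ B) (k : A ⟶ E) (q : H R B B)
    (hf : f = p.hom) (hg : p.hom ≫ g = k) : g ⊳ (q ⊲ f) = k ⊳ cjH p q := by
  subst hf hg
  simp [cjH, ← post_comp]

variable [MonoidalCategory C] [MonoidalPreadditive C] [MonoidalLinear R C] [SymmetricCategory C]
  [TwoCellsMonoidal R C]

theorem wr_cjH (p : A ≅ B) (q : H R B B) (X : C) :
    wr _ _ X (cjH p q) = cjH (whiskerRightIso p X) (wr _ _ X q) := by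
  simp only [cjH, wr_post, wr_pre, whiskerRightIso_hom, whiskerRightIso_inv]

theorem wl_eq_cjH (X : C) (q : H R A A) : wl X _ _ q = cjH (β_ X A) (wr _ _ X q) := by
  rw [cjH, ← symm_right, ← post_comp]; simp [post_id]

end HtyConjugation

section Relationators

variable {R : Type*} [CommRing R] {C : Type*} [Category C] [Preadditive C] [Linear R C]
  [MonoidalCategory C] [MonoidalPreadditive C] [MonoidalLinear R C] [SymmetricCategory C]
  [TwoCells R C] [TwoCellsMonoidal R C]

local notation:80 g:81 " ⊳ " q:80 => g ⊳[R] q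
local notation:80 q:81 " ⊲ " f:80 => q ⊲[R] f
local notation:90 f:91 " ⊗ʳ " q:90 => f ⊗ʳ[R] q
local notation:90 q:91 " ⊗ˡ " g:90 => q ⊗ˡ[R] g

section
variable (Q : ∀ U V W : C, H R ((U ⊗ V) ⊗ W) ((U ⊗ V) ⊗ W)) (U V W X : C)

/-- The element `Q_{124}`. -/
def on124 : H R (((U ⊗ V) ⊗ W) ⊗ X) (((U ⊗ V) ⊗ W) ⊗ X) :=
  cjH (swap23 (U ⊗ V) W X) (wr _ _ W (Q U V X))

/-- The element `Q_{134}`. -/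
def on134 : H R (((U ⊗ V) ⊗ W) ⊗ X) (((U ⊗ V) ⊗ W) ⊗ X) :=
  cjH (whiskerRightIso (swap23 U V W) X ≪≫ swap23 (U ⊗ W) V X) (wr _ _ V (Q U W X))

/-- The element `Q_{234}`. -/
def on234 : H R (((U ⊗ V) ⊗ W) ⊗ X) (((U ⊗ V) ⊗ W) ⊗ X) :=
  cjH (whiskerRightIso (rot U V W) X ≪≫ swap23 (V ⊗ W) U X) (wr _ _ U (Q V W X))

end

/-- A family of elements of degree `-1` that is additive in each of its arguments. -/
structure Additive3 (Q : ∀ U V W : C, H R ((U ⊗ V) ⊗ W) ((U ⊗ V) ⊗ W)) : Prop where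
  first : ∀ U V W X : C, Q (U ⊗ V) W X = on134 Q U V W X + on234 Q U V W X
  second : ∀ U V W X : C, cjH (whiskerRightIso (α_ U V W) X) (Q U (V ⊗ W) X) =
    on124 Q U V W X + on134 Q U V W X
  third : ∀ U V W X : C, cjH (α_ (U ⊗ V) W X) (Q U V (W ⊗ X)) =
    wr _ _ X (Q U V W) + on124 Q U V W X

theorem Additive3.combination {Q Q' : ∀ U V W : C, H R ((U ⊗ V) ⊗ W) ((U ⊗ V) ⊗ W)}
    (h : Additive3 Q) (h' : Additive3 Q') (c d : R) :
    Additive3 fun U V W => c • Q U V W + d • Q' U V W where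
  first U V W X := by
    simp only [h.first, h'.first, on134, on234, map_add, map_smul, cjH_add, cjH_smul]
    module
  second U V W X := by
    simp only [h.second, h'.second, on134, on124, map_add, map_smul, cjH_add, cjH_smul]
    module
  third U V W X := by
    simp only [h.third, h'.third, on124, map_add, map_smul, cjH_add, cjH_smul]
    module

namespace InfData

variable {t : InfData R C}

/-- A 1-cell on which the homotopy components of `t` vanish. -/
def Null (t : InfData R C) {U V : C} (f : U ⟶ V) : Prop := ∀ X : C, t.h f (𝟙 X) = 0

theorem h_symm (hs : t.IsSymmetric) {A : C} (f : A ⟶ A) (U : C) :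
    t.h (𝟙 U) f = cjH (β_ U A) (t.h f (𝟙 U)) := by
  rw [cjH, ← hs.hty, ← post_comp]; simp [post_id]

theorem fourTermR_eq (hs : t.IsSymmetric) (U V W : C) :
    t.fourTermR U V W = cjH (rot U V W) (t.fourTermL V W U) := by
  have : t.fourTermR U V W = cjH (α_ U V W) (t.h (𝟙 U) (t.app V W)) := rfl
  rw [this, h_symm hs, cjH_cjH]
  rfl

section
variable (ht : t.IsInfinitesimal2Braiding)
include ht

theorem Null.comp {U V W : C} {f : U ⟶ V} {g : V ⟶ W} (hf : t.Null f) (hg : t.Null g) :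
    t.Null (f ≫ g) := fun X => by
  rw [ht.h_left f g (hg X), hf X, map_zero]

theorem Null.inv {U V : C} {f : U ≅ V} (hf : t.Null f.hom) : t.Null f.inv := fun X =>
  ht.hom_left f (hf X)

theorem Null.whiskerLeft (hst : t.IsStrict) {U V : C} {f : U ⟶ V} (hf : t.Null f) (A : C) :
    t.Null (A ◁ f) := fun X => by
  have := hst.right_hty (𝟙 A) f (𝟙 X)
  rw [hf X, ht.unit, id_tensorHom] at this
  simp only [map_zero, LinearMap.zero_apply, add_zero] at this
  have h := congrArg (fun q => (α_ _ _ _).inv ⊳ (q ⊲ (α_ _ _ _).hom)) this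
  simpa [post_pre, pre_comp, ← post_comp, pre_id, post_id] using h

theorem null_swap23 (hst : t.IsStrict) (hs : t.IsTotallySymmetric) (U V W : C) :
    t.Null (swap23 U V W).hom := by
  have h₁ : ∀ U V W : C, t.Null (α_ U V W).hom := fun U V W X => ht.assoc_left U V W X
  exact Null.comp ht (h₁ U V W) (Null.comp ht (Null.whiskerLeft ht hst (fun X => hs.hty_symm V W X) U)
    (Null.inv ht (h₁ U W V)))

theorem null_rot (hs : t.IsTotallySymmetric) (U V W : C) : t.Null (rot U V W).hom :=
  Null.comp ht (fun X => ht.assoc_left U V W X) (fun X => hs.hty_symm U (V ⊗ W) X)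

theorem h_cj {A B : C} (p : A ≅ B) (hp : t.Null p.hom) (f : B ⟶ B) (X : C) :
    t.h (cj p f) (𝟙 X) = cjH (whiskerRightIso p X) (t.h f (𝟙 X)) := by
  rw [cj, ht.h_left' _ _ (hp X), ht.h_left _ _ (Null.inv ht hp X), cjH, post_pre]
  rfl

theorem h_whiskerRight (hst : t.IsStrict) {A : C} (f : A ⟶ A) (V X : C) :
    t.h (f ▷ V) (𝟙 X) = cjH (swap23 A V X) (wr _ _ V (t.h f (𝟙 X))) := by
  have := hst.right_hty f (𝟙 V) (𝟙 X)
  rw [ht.unit, tensorHom_id] at this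
  have h := congrArg (fun q => (α_ _ _ _).inv ⊳ (q ⊲ (α_ _ _ _).hom)) this
  simp only [map_zero, zero_add, MonoidalCategory.whiskerLeft_id, post_id] at h
  simp only [post_pre, pre_comp, ← post_comp, Category.assoc, Iso.hom_inv_id, Iso.inv_hom_id, pre_id,
    post_id] at h
  rw [h]
  simp only [cjH, swap23, Iso.trans_hom, Iso.trans_inv, whiskerLeftIso_hom, whiskerLeftIso_inv,
    Iso.symm_hom, Iso.symm_inv, Category.assoc, SymmetricCategory.braiding_swap_eq_inv_braiding]

theorem h_id_tensor (hst : t.IsStrict) {A : C} (f : A ⟶ A) (W X : C) :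
    cjH (α_ A W X) (t.h f (𝟙 (W ⊗ X))) = wr _ _ X (t.h f (𝟙 W)) +
      cjH (whiskerRightIso (β_ A W) X ≪≫ α_ W A X) (wl W _ _ (t.h f (𝟙 X))) := by
  have := hst.left_hty f (𝟙 W) (𝟙 X)
  rw [id_tensorHom_id] at this
  simp only [MonoidalCategory.whiskerLeft_id, id_whiskerRight, post_id] at this
  rw [cjH, this]
  simp only [cjH, Iso.trans_hom, Iso.trans_inv, whiskerRightIso_hom, whiskerRightIso_inv, post_comp,
    SymmetricCategory.braiding_swap_eq_inv_braiding]

theorem additive3_fourTermL (hst : t.IsStrict) (hs : t.IsTotallySymmetric) :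
    Additive3 t.fourTermL where
  first U V W X := by
    have e : ∀ f g : (U ⊗ V) ⊗ W ⟶ (U ⊗ V) ⊗ W,
      t.h (f + g) (𝟙 X) = t.h f (𝟙 X) + t.h g (𝟙 X) := fun f g => by simp [InfData.h]
    rw [fourTermL, hst.family.right, e, on13, on23_eq, h_cj ht _ (null_swap23 ht hst hs U V W),
      h_cj ht _ (null_rot ht hs U V W), h_whiskerRight ht hst, h_whiskerRight ht hst, cjH_cjH, cjH_cjH]
    rfl
  second U V W X := by
    have e : ∀ f g : (U ⊗ V) ⊗ W ⟶ (U ⊗ V) ⊗ W,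
      t.h (f + g) (𝟙 X) = t.h f (𝟙 X) + t.h g (𝟙 X) := fun f g => by simp [InfData.h]
    rw [fourTermL, ← h_cj ht _ (fun X => ht.assoc_left U V W X), hst.family.left, e, on13,
      h_cj ht _ (null_swap23 ht hst hs U V W), h_whiskerRight ht hst, h_whiskerRight ht hst, cjH_cjH]
    rfl
  third U V W X := by
    rw [fourTermL, h_id_tensor ht hst, wl_eq_cjH, cjH_cjH, on124]
    congr 1
    apply cjH_congr
    simp only [Iso.trans_hom, whiskerRightIso_hom, whiskerLeftIso_hom, Iso.symm_hom, swap23]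
    exact coherence (ten (ten (leaf 0 (U ⊗ V)) (leaf 1 W)) (leaf 2 X))

theorem additive3_fourTermR (hst : t.IsStrict) (hs : t.IsTotallySymmetric) :
    Additive3 t.fourTermR where
  first U V W X := by
    have h := (cjH_eq_iff _ _ _).1 ((additive3_fourTermL ht hst hs).third W X U V)
    rw [fourTermR_eq hs.toIsSymmetric, h, cjH_cjH, cjH_add, on124, on134, on234, fourTermR_eq hs.toIsSymmetric,
      fourTermR_eq hs.toIsSymmetric, wr_cjH, wr_cjH, cjH_cjH, cjH_cjH, cjH_cjH]
    congr 1
    all_goals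
      apply cjH_congr
      simp only [Iso.trans_hom, whiskerRightIso_hom, whiskerLeftIso_hom, whiskerRightIso_inv,
        Iso.symm_hom, swap23, rot]
      exact coherence (ten (ten (ten (leaf 0 U) (leaf 1 V)) (leaf 2 W)) (leaf 3 X))
  second U V W X := by
    have h := (additive3_fourTermL ht hst hs).first V W X U
    rw [fourTermR_eq hs.toIsSymmetric, h, cjH_cjH, cjH_add, on124, on134, on134, on234, fourTermR_eq hs.toIsSymmetric,
      fourTermR_eq hs.toIsSymmetric, wr_cjH, wr_cjH, cjH_cjH, cjH_cjH, cjH_cjH, cjH_cjH]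
    congr 1
    all_goals
      apply cjH_congr
      simp only [Iso.trans_hom, whiskerRightIso_hom, whiskerLeftIso_hom, whiskerRightIso_inv,
        Iso.symm_hom, swap23, rot]
      exact coherence (ten (ten (ten (leaf 0 U) (leaf 1 V)) (leaf 2 W)) (leaf 3 X))
  third U V W X := by
    have h := (cjH_eq_iff _ _ _).1 ((additive3_fourTermL ht hst hs).second V W X U)
    rw [fourTermR_eq hs.toIsSymmetric, h, cjH_cjH, cjH_cjH, cjH_add, on124, on134, on124, fourTermR_eq hs.toIsSymmetric,
      fourTermR_eq hs.toIsSymmetric, wr_cjH, wr_cjH, cjH_cjH, cjH_cjH, cjH_cjH]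
    congr 1
    all_goals
      apply cjH_congr
      simp only [Iso.trans_hom, whiskerRightIso_hom, whiskerLeftIso_hom, whiskerRightIso_inv,
        Iso.symm_hom, swap23, rot]
      exact coherence (ten (ten (ten (leaf 0 U) (leaf 1 V)) (leaf 2 W)) (leaf 3 X))

end
end InfData
end Relationators
end Syl

namespace Syl

open TwoCells TwoCellsMonoidal Wd

section Reduction

variable {R : Type*} [CommRing R] {C : Type*} [Category C] [Preadditive C] [Linear R C]

/-- The 1-cells `f` and `g` agree after multiplication by `s`. -/
class Red (s : R) {X Y : C} (f : X ⟶ Y) (g : outParam (X ⟶ Y)) : Prop where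
  eq : s • f = s • g

variable {s : R}

instance (priority := low) Red.refl {X Y : C} (f : X ⟶ Y) : Red s f f := ⟨rfl⟩

instance Red.comp {X Y Z : C} (f f' : X ⟶ Y) (g g' : Y ⟶ Z) [h : Red s f f'] [h' : Red s g g'] :
    Red s (f ≫ g) (f' ≫ g') :=
  ⟨by rw [← Linear.smul_comp, h.eq, Linear.smul_comp, ← Linear.comp_smul, h'.eq, Linear.comp_smul]⟩

variable [MonoidalCategory C] [MonoidalPreadditive C] [MonoidalLinear R C]

instance Red.whiskerLeft (X : C) {Y Z : C} (f f' : Y ⟶ Z) [h : Red s f f'] :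
    Red s (X ◁ f) (X ◁ f') :=
  ⟨by rw [← MonoidalLinear.whiskerLeft_smul, h.eq, MonoidalLinear.whiskerLeft_smul]⟩

instance Red.whiskerRight (X : C) {Y Z : C} (f f' : Y ⟶ Z) [h : Red s f f'] :
    Red s (f ▷ X) (f' ▷ X) :=
  ⟨by rw [← MonoidalLinear.smul_whiskerRight, h.eq, MonoidalLinear.smul_whiskerRight]⟩

variable [SymmetricCategory C] [TwoCells R C] [TwoCellsMonoidal R C]

local notation:80 g:81 " ⊳ " q:80 => g ⊳[R] q
local notation:80 q:81 " ⊲ " f:80 => q ⊲[R] f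

theorem post_red {X Y Z : C} (f : Y ⟶ Z) {g : Y ⟶ Z} [h : Red s f g] (q : H R X Y) :
    f ⊳ (s • q) = s • (g ⊳ q) := by
  rw [map_smul, ← LinearMap.smul_apply, ← map_smul, h.eq, map_smul, LinearMap.smul_apply]

theorem pre_red {X Y Z : C} (f : X ⟶ Y) {g : X ⟶ Y} [h : Red s f g] (q : H R Y Z) :
    (s • q) ⊲ f = s • (q ⊲ g) := by
  rw [map_smul, LinearMap.smul_apply, ← map_smul, h.eq, map_smul]

theorem wl_smul (X : C) {Y Z : C} (q : H R Y Z) : wl X _ _ (s • q) = s • wl X _ _ q := map_smul _ _ _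

theorem wr_smul (X : C) {Y Z : C} (q : H R Y Z) : wr _ _ X (s • q) = s • wr _ _ X q := map_smul _ _ _

end Reduction

section Polytopes

variable {R : Type*} [CommRing R] {C : Type*} [Category C] [Preadditive C] [Linear R C]
  [MonoidalCategory C] [MonoidalPreadditive C] [MonoidalLinear R C] [SymmetricCategory C]
  [TwoCells R C] [TwoCellsMonoidal R C]

local notation:80 g:81 " ⊳ " q:80 => g ⊳[R] q
local notation:80 q:81 " ⊲ " f:80 => q ⊲[R] f
local notation:90 f:91 " ⊗ʳ " q:90 => f ⊗ʳ[R] q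
local notation:90 q:91 " ⊗ˡ " g:90 => q ⊗ˡ[R] g

section
variable {A B D : C} {a b d : Wd C}

instance {p : A ≅ B} {q : B ≅ D} [h : IsCoh a b p.hom] [h' : IsCoh b d q.hom] :
    IsCoh a d (p ≪≫ q).hom := by
  rw [Iso.trans_hom]; infer_instance

instance {p : A ≅ B} [h : IsCoh a b p.hom] [h' : Rep d D] :
    IsCoh (ten a d) (ten b d) (whiskerRightIso p D).hom := by
  rw [whiskerRightIso_hom]; infer_instance

instance {p : A ≅ B} [h : IsCoh a b p.hom] [h' : Rep d D] :
    IsCoh (ten d a) (ten d b) (whiskerLeftIso D p).hom := by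
  rw [whiskerLeftIso_hom]; infer_instance

instance [Rep a A] [Rep b B] [Rep d D] :
    IsCoh (ten a (ten b d)) (ten (ten a b) d) (α_ A B D).symm.hom := by
  rw [Iso.symm_hom]; infer_instance

instance [Rep a A] [Rep b B] [Rep d D] :
    IsCoh (ten (ten a b) d) (ten (ten a d) b) (swap23 A B D).hom := by
  simp only [swap23, Iso.trans_hom, whiskerLeftIso_hom, Iso.symm_hom]; infer_instance

instance [Rep a A] [Rep b B] [Rep d D] :
    IsCoh (ten (ten a b) d) (ten (ten b d) a) (rot A B D).hom := by
  simp only [rot, Iso.trans_hom]; infer_instance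

end

theorem post_pre_wl_eq {A B E X : C} {f : A ⟶ X ⊗ B} {g : X ⊗ B ⟶ E} (p : A ≅ B ⊗ X) (k : A ⟶ E)
    (q : H R B B) (hf : f = p.hom ≫ (β_ B X).hom) (hg : f ≫ g = k) :
    g ⊳ (wl X _ _ q ⊲ f) = k ⊳ cjH p (wr _ _ X q) := by
  rw [post_pre_eq (p ≪≫ (β_ X B).symm) k (wl X _ _ q) (by simp [hf, SymmetricCategory.braiding_swap_eq_inv_braiding])
    (by rw [← hg, hf]; simp [SymmetricCategory.braiding_swap_eq_inv_braiding]), wl_eq_cjH, cjH_cjH]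
  congr 1
  apply cjH_congr
  simp

theorem Additive3.leftTetrahedron {Q : ∀ U V W : C, H R ((U ⊗ V) ⊗ W) ((U ⊗ V) ⊗ W)}
    (hQ : Additive3 Q) (U V W X : C) :
    ((α_ U V (W ⊗ X)).hom ≫ (β_ U (V ⊗ W ⊗ X)).hom ≫ (α_ V (W ⊗ X) U).hom ≫ V ◁ (α_ W X U).hom) ⊳
        (Q U V (W ⊗ X) ⊲ (α_ (U ⊗ V) W X).hom) =
      ((α_ U (V ⊗ W) X).hom ≫ (β_ U ((V ⊗ W) ⊗ X)).hom ≫ (α_ (V ⊗ W) X U).hom ≫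
          (α_ V W (X ⊗ U)).hom) ⊳ (Q U (V ⊗ W) X ⊲ ((α_ U V W).hom ▷ X)) +
        (((α_ U V W).hom ≫ (β_ U (V ⊗ W)).hom ≫ (α_ V W U).hom) ▷ X ≫ (α_ V (W ⊗ U) X).hom ≫
          V ◁ ((α_ W U X).hom ≫ W ◁ (β_ U X).hom)) ⊳ wr _ _ X (Q U V W) -
      (V ◁ ((α_ U W X).hom ≫ (β_ U (W ⊗ X)).hom ≫ (α_ W X U).hom)) ⊳
        (wl V _ _ (Q U W X) ⊲ (((β_ U V).hom ▷ W ≫ (α_ V U W).hom) ▷ X ≫ (α_ V (U ⊗ W) X).hom)) := by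
  obtain ⟨k, hk⟩ : ∃ k, k = ((α_ U V W).hom ≫ (β_ U (V ⊗ W)).hom ≫ (α_ V W U).hom) ▷ X ≫
    (α_ V (W ⊗ U) X).hom ≫ V ◁ ((α_ W U X).hom ≫ W ◁ (β_ U X).hom) := ⟨_, rfl⟩
  rw [← hk, post_pre_eq (whiskerRightIso (α_ U V W) X) k (Q U (V ⊗ W) X) ?_ ?_,
    post_pre_eq (α_ (U ⊗ V) W X) k (Q U V (W ⊗ X)) ?_ ?_,
    post_pre_wl_eq (whiskerRightIso (swap23 U V W) X ≪≫ swap23 (U ⊗ W) V X) k (Q U W X) ?_ ?_,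
    hQ.second, hQ.third]
  · simp only [on134, map_add]
    abel
  all_goals
    subst hk
    exact coherence (ten (ten (ten (leaf 0 U) (leaf 1 V)) (leaf 2 W)) (leaf 3 X))

theorem Additive3.rightTetrahedron {Q : ∀ U V W : C, H R ((U ⊗ V) ⊗ W) ((U ⊗ V) ⊗ W)}
    (hQ : Additive3 Q) (U V W X : C) :
    ((β_ ((U ⊗ V) ⊗ W) X).hom ≫ (α_ X (U ⊗ V) W).inv ≫ (α_ X U V).inv ▷ W) ⊳
        (Q (U ⊗ V) W X ⊲ ((α_ U V (W ⊗ X)).inv ≫ (α_ (U ⊗ V) W X).inv)) =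
      ((β_ (U ⊗ V ⊗ W) X).hom ≫ (α_ X U (V ⊗ W)).inv ≫ (α_ (X ⊗ U) V W).inv) ⊳
          (Q U (V ⊗ W) X ⊲ (U ◁ (α_ V W X).inv ≫ (α_ U (V ⊗ W) X).inv)) +
        (U ◁ ((β_ (V ⊗ W) X).hom ≫ (α_ X V W).inv) ≫ (α_ U (X ⊗ V) W).inv ≫
          ((α_ U X V).inv ≫ (β_ U X).hom ▷ V) ▷ W) ⊳ (wl U _ _ (Q V W X) ⊲ (U ◁ (α_ V W X).inv)) -
      (((β_ (U ⊗ V) X).hom ≫ (α_ X U V).inv) ▷ W) ⊳ (wr _ _ W (Q U V X) ⊲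
        (U ◁ (V ◁ (β_ W X).hom ≫ (α_ V X W).inv) ≫ (α_ U (V ⊗ X) W).inv ≫ (α_ U V X).inv ▷ W)) := by
  obtain ⟨k, hk⟩ : ∃ k, k = U ◁ (α_ V W X).inv ≫ (α_ U (V ⊗ W) X).inv ≫
    (β_ (U ⊗ V ⊗ W) X).hom ≫ (α_ X U (V ⊗ W)).inv ≫ (α_ (X ⊗ U) V W).inv := ⟨_, rfl⟩
  let p : U ⊗ V ⊗ W ⊗ X ≅ ((U ⊗ V) ⊗ W) ⊗ X := (α_ U V (W ⊗ X)).symm ≪≫ (α_ (U ⊗ V) W X).symm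
  rw [post_pre_eq p k (Q (U ⊗ V) W X) ?_ ?_,
    post_pre_eq (p ≪≫ whiskerRightIso (α_ U V W) X) k (Q U (V ⊗ W) X) ?_ ?_,
    post_pre_wl_eq (p ≪≫ whiskerRightIso (rot U V W) X ≪≫ swap23 (V ⊗ W) U X) k (Q V W X) ?_ ?_,
    post_pre_eq (p ≪≫ swap23 (U ⊗ V) W X) k (wr _ _ W (Q U V X)) ?_ ?_]
  · rw [← cjH_cjH p, ← cjH_cjH p, ← cjH_cjH p, hQ.first, hQ.second]
    simp only [on124, on234, map_add, cjH_add]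
    abel
  all_goals
    subst hk
    exact coherence (ten (leaf 0 U) (ten (leaf 1 V) (ten (leaf 2 W) (leaf 3 X))))

theorem Additive3.hexahedron {Q Q' : ∀ U V W : C, H R ((U ⊗ V) ⊗ W) ((U ⊗ V) ⊗ W)}
    (hQ : Additive3 Q) (hQ' : Additive3 Q') (U V W X : C) :
    ((β_ (U ⊗ V) (W ⊗ X)).hom ≫ (α_ (W ⊗ X) U V).inv ≫ (α_ W X U).hom ▷ V ≫
        (α_ W (X ⊗ U) V).hom) ⊳ (Q' U V (W ⊗ X) ⊲
          ((α_ U (V ⊗ W) X).hom ≫ U ◁ (α_ V W X).hom ≫ (α_ U V (W ⊗ X)).inv)) -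
      ((α_ (U ⊗ V) W X).hom ≫ (β_ (U ⊗ V) (W ⊗ X)).hom ≫ (α_ W X (U ⊗ V)).hom ≫
        W ◁ (α_ X U V).inv) ⊳ (Q (U ⊗ V) W X ⊲ ((α_ U V W).inv ▷ X)) =
    (W ◁ ((β_ (U ⊗ V) X).hom ≫ (α_ X U V).inv)) ⊳ (wl W _ _ (Q' U V X) ⊲
        (((α_ U V W).inv ≫ (β_ (U ⊗ V) W).hom ≫ (α_ W U V).inv) ▷ X ≫ (α_ (W ⊗ U) V X).hom ≫
          (α_ W U (V ⊗ X)).hom ≫ W ◁ (α_ U V X).inv)) +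
      (((β_ (U ⊗ V) W).hom ≫ (α_ W U V).inv) ▷ X ≫ (α_ (W ⊗ U) V X).hom ≫ (α_ W U (V ⊗ X)).hom ≫
        W ◁ (U ◁ (β_ V X).hom ≫ (α_ U X V).inv ≫ (β_ U X).hom ▷ V)) ⊳
          (wr _ _ X (Q' U V W) ⊲ ((α_ U V W).inv ▷ X)) -
      (((α_ U W X).hom ≫ (β_ U (W ⊗ X)).hom ≫ (α_ W X U).hom) ▷ V ≫ (α_ W (X ⊗ U) V).hom) ⊳
        (wr _ _ V (Q U W X) ⊲ ((α_ U (V ⊗ W) X).hom ≫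
          U ◁ ((β_ V W).hom ▷ X ≫ (α_ W V X).hom ≫ W ◁ (β_ V X).hom) ≫
            (α_ U W (X ⊗ V)).inv ≫ (α_ (U ⊗ W) X V).inv)) -
      (U ◁ ((α_ V W X).hom ≫ (β_ V (W ⊗ X)).hom ≫ (α_ W X V).hom) ≫ (α_ U W (X ⊗ V)).inv ≫
        (α_ (U ⊗ W) X V).inv ≫ ((α_ U W X).hom ≫ (β_ U (W ⊗ X)).hom ≫ (α_ W X U).hom) ▷ V ≫
          (α_ W (X ⊗ U) V).hom) ⊳ (wl U _ _ (Q V W X) ⊲ (α_ U (V ⊗ W) X).hom) := by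
  let p : (U ⊗ V ⊗ W) ⊗ X ≅ ((U ⊗ V) ⊗ W) ⊗ X := whiskerRightIso (α_ U V W).symm X
  obtain ⟨k, hk⟩ : ∃ k, k = p.hom ≫ ((β_ (U ⊗ V) W).hom ≫ (α_ W U V).inv) ▷ X ≫
    (α_ (W ⊗ U) V X).hom ≫ (α_ W U (V ⊗ X)).hom ≫
      W ◁ (U ◁ (β_ V X).hom ≫ (α_ U X V).inv ≫ (β_ U X).hom ▷ V) := ⟨_, rfl⟩
  rw [post_pre_eq (p ≪≫ α_ (U ⊗ V) W X) k (Q' U V (W ⊗ X)) ?_ ?_,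
    post_pre_eq p k (Q (U ⊗ V) W X) ?_ ?_,
    post_pre_wl_eq (p ≪≫ swap23 (U ⊗ V) W X) k (Q' U V X) ?_ ?_,
    post_pre_eq p k (wr _ _ X (Q' U V W)) ?_ ?_,
    post_pre_eq (p ≪≫ whiskerRightIso (swap23 U V W) X ≪≫ swap23 (U ⊗ W) V X) k
      (wr _ _ V (Q U W X)) ?_ ?_,
    post_pre_wl_eq (p ≪≫ whiskerRightIso (rot U V W) X ≪≫ swap23 (V ⊗ W) U X) k (Q V W X) ?_ ?_]
  · rw [← cjH_cjH, ← cjH_cjH p, ← cjH_cjH p, ← cjH_cjH p, hQ'.third, hQ.first]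
    simp only [on124, on134, on234, map_add, map_sub, cjH_add]
    abel
  all_goals
    subst hk
    exact coherence (ten (ten (leaf 0 U) (ten (leaf 1 V) (leaf 2 W))) (leaf 3 X))

namespace InfData

variable {a s : R} {t : InfData R C}

theorem asFam_red (t : ∀ U V : C, U ⊗ V ⟶ U ⊗ V) {c : R} (h : c * s = 0) (U V W : C) :
    Red c (asFam s t U V W) (α_ U V W).hom :=
  ⟨by simp [asFam, smul_smul, h, smul_add]⟩

theorem asInvFam_red (t : ∀ U V : C, U ⊗ V ⟶ U ⊗ V) {c : R} (h : c * s = 0) (U V W : C) :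
    Red c (asInvFam s t U V W) (α_ U V W).inv :=
  ⟨by simp [asInvFam, smul_smul, h, smul_sub]⟩

theorem brFam_red (t : ∀ U V : C, U ⊗ V ⟶ U ⊗ V) {c : R} (h : c * a = 0) (h' : c * s = 0) (U V : C) :
    Red c (brFam a s t U V) (β_ U V).hom := by
  have h₃ : c * (3 * s) = 0 := by linear_combination 3 * h'
  exact ⟨by simp only [brFam, Preadditive.add_comp, Linear.smul_comp, smul_add, smul_smul, h, h₃,
    zero_smul, add_zero, Category.id_comp]⟩

theorem brInvFam_red (t : ∀ U V : C, U ⊗ V ⟶ U ⊗ V) {c : R} (h : c * a = 0) (h' : c * s = 0)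
    (U V : C) : Red c (brInvFam a s t U V) (β_ U V).inv := by
  have h₃ : c * (3 * s) = 0 := by linear_combination 3 * h'
  exact ⟨by simp only [brInvFam, Preadditive.comp_add, Preadditive.comp_sub, Linear.comp_smul,
    smul_add, smul_sub, smul_smul, h, h₃, zero_smul, add_zero, sub_zero, Category.comp_id]⟩

theorem asHty_eq_zero {U U' V V' W W' : C} (f : U ⟶ U') (g : V ⟶ V') (k : W ⟶ W')
    (h : s • t.h f g = 0) (h' : s • t.h g k = 0) : (t.quad a s).asHty f g k = 0 := by
  have e₁ : s • (t.h f g ⊗ˡ k) = 0 := by rw [← map_smul, ← map_smul, h, map_zero, map_zero]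
  have e₂ : s • (f ⊗ʳ t.h g k) = 0 := by rw [← map_smul, ← map_smul, h', map_zero, map_zero]
  have e₃ : s • t.commHty f g k = 0 := by
    rw [commHty, smul_sub, smul_add, smul_add, ← LinearMap.smul_apply, ← map_smul, e₁, ← map_smul,
      ← map_smul, ← LinearMap.smul_apply, ← map_smul, e₂, ← map_smul, ← LinearMap.smul_apply,
      ← map_smul, e₂, ← map_smul, e₁]
    simp
  dsimp only [quad]
  rw [e₃, map_zero]

theorem asInvHty_eq_zero {U U' V V' W W' : C} (f : U ⟶ U') (g : V ⟶ V') (k : W ⟶ W')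
    (h : s • t.h f g = 0) (h' : s • t.h g k = 0) : (t.quad a s).asInvHty f g k = 0 := by
  rw [BraidedData.asInvHty, asHty_eq_zero f g k h h']
  simp

theorem brHty_eq_zero {U U' V V' : C} (f : U ⟶ U') (g : V ⟶ V')
    (h : a • t.h f g = 0) (h' : s • t.h f g = 0) : (t.quad a s).brHty f g = 0 := by
  have e : (3 * s) • (t.h f g ⊲ t.app U V + t.app U' V' ⊳ t.h f g) = 0 := by
    have e₁ : s • (t.h f g ⊲ t.app U V) = 0 := by
      rw [← LinearMap.smul_apply, ← map_smul, h', map_zero, LinearMap.zero_apply]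
    have e₂ : s • (t.app U' V' ⊳ t.h f g) = 0 := by rw [← map_smul, h', map_zero]
    rw [mul_smul, smul_add, e₁, e₂, add_zero, smul_zero]
  dsimp only [quad]
  rw [h, e]
  simp

theorem smul_h_left {U U' X : C} (c : R) {f g : U ⟶ U'} (h : Red c f g) :
    c • t.h f (𝟙 X) = c • t.h g (𝟙 X) := by
  simp only [InfData.h]
  rw [← LinearMap.smul_apply, ← map_smul, h.eq, map_smul, LinearMap.smul_apply]

theorem smul_h_right {U U' X : C} (c : R) {f g : U ⟶ U'} (h : Red c f g) :
    c • t.h (𝟙 X) f = c • t.h (𝟙 X) g := by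
  simp only [InfData.h]
  rw [← map_smul, h.eq, map_smul]

theorem smul_braid_left (hco : s = 0 ∨ t.IsTotallySymmetric ∧ t.IsCoherent) (U V W : C) :
    s • t.h (β_ U V).hom (𝟙 W) = 0 := by
  rcases hco with rfl | ⟨h, -⟩
  · simp
  · rw [h.hty_symm, smul_zero]

theorem smul_braid_right (hco : s = 0 ∨ t.IsTotallySymmetric ∧ t.IsCoherent) (U V W : C) :
    s • t.h (𝟙 W) (β_ U V).hom = 0 := by
  rcases hco with rfl | ⟨h, -⟩
  · simp
  · have e := h.hty (𝟙 W) (β_ U V).hom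
    rw [h.hty_symm, map_zero, LinearMap.zero_apply] at e
    have := congrArg (fun q => (β_ W (V ⊗ U)).inv ⊳ q) e
    simp only [← post_comp, Iso.hom_inv_id, post_id, map_zero] at this
    rw [this, smul_zero]

section
variable (ht : t.IsInfinitesimal2Braiding) (h₂ : a * s = 0) (h₃ : s * s = 0)

theorem quad_as_red {c : R} (h : c * s = 0) (U V W : C) : Red c ((t.quad a s).as U V W) (α_ U V W).hom :=
  asFam_red _ h U V W

theorem quad_asInv_red {c : R} (h : c * s = 0) (U V W : C) :
    Red c ((t.quad a s).asInv U V W) (α_ U V W).inv :=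
  asInvFam_red _ h U V W

theorem quad_br_red {c : R} (h : c * a = 0) (h' : c * s = 0) (U V : C) :
    Red c ((t.quad a s).br U V) (β_ U V).hom :=
  brFam_red _ h h' U V

include ht in
theorem smul_h_as_right {c : R} (h : c * s = 0) (U V W X : C) :
    c • t.h (𝟙 X) ((t.quad a s).as U V W) = 0 := by
  rw [smul_h_right c (quad_as_red h U V W), ht.assoc_right, smul_zero]

include ht in
theorem smul_h_as_left {c : R} (h : c * s = 0) (U V W X : C) :
    c • t.h ((t.quad a s).as U V W) (𝟙 X) = 0 := by
  rw [smul_h_left c (quad_as_red h U V W), ht.assoc_left, smul_zero]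

include ht in
theorem smul_h_asInv_left {c : R} (h : c * s = 0) (U V W X : C) :
    c • t.h ((t.quad a s).asInv U V W) (𝟙 X) = 0 := by
  rw [smul_h_left c (quad_asInv_red h U V W), ht.hom_left _ (ht.assoc_left U V W X), smul_zero]

theorem smul_h_br_left (hco : s = 0 ∨ t.IsTotallySymmetric ∧ t.IsCoherent) (h₂ : a * s = 0)
    (h₃ : s * s = 0) (U V W : C) : s • t.h ((t.quad a s).br U V) (𝟙 W) = 0 := by
  rw [smul_h_left s (quad_br_red (by rw [mul_comm, h₂]) h₃ U V), smul_braid_left hco]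

theorem smul_h_br_right (hco : s = 0 ∨ t.IsTotallySymmetric ∧ t.IsCoherent) (h₂ : a * s = 0)
    (h₃ : s * s = 0) (U V W : C) : s • t.h (𝟙 W) ((t.quad a s).br U V) = 0 := by
  rw [smul_h_right s (quad_br_red (by rw [mul_comm, h₂]) h₃ U V), smul_braid_right hco]

end

section
variable (ht : t.IsInfinitesimal2Braiding) (hst : t.IsStrict) (h₂ : a * s = 0) (h₃ : s * s = 0)
  (hco : s = 0 ∨ t.IsTotallySymmetric ∧ t.IsCoherent)

include ht hst h₂ h₃ hco in
theorem quad_leftTetrahedron (U V W X : C) :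
    (V ◁ (t.quad a s).as W X U) ⊳ (t.quad a s).as V (W ⊗ X) U ⊳ (t.quad a s).brHty (𝟙 U) ((t.quad a s).as V W X) ⊲
        (t.quad a s).as U (V ⊗ W) X ⊚ ((t.quad a s).as U V W ▷ X) +
      (V ◁ (t.quad a s).as W X U) ⊳ (t.quad a s).hexL U V (W ⊗ X) ⊲ (t.quad a s).as (U ⊗ V) W X +
      (V ◁ ((t.quad a s).as W X U ⊚ (t.quad a s).br U (W ⊗ X))) ⊳ (t.quad a s).as V U (W ⊗ X) ⊳ (t.quad a s).asHty ((t.quad a s).br U V) (𝟙 W) (𝟙 X) =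
    (t.quad a s).as V W (X ⊗ U) ⊳ (t.quad a s).hexL U (V ⊗ W) X ⊲ ((t.quad a s).as U V W ▷ X) -
      (V ◁ ((W ◁ (t.quad a s).br U X) ⊚ (t.quad a s).as W U X)) ⊳ (t.quad a s).asHty (𝟙 V) ((t.quad a s).br U W) (𝟙 X) ⊲
        (((t.quad a s).as V U W ⊚ ((t.quad a s).br U V ▷ W)) ▷ X) -
      (t.quad a s).asHty (𝟙 V) (𝟙 W) ((t.quad a s).br U X) ⊲ (t.quad a s).as (V ⊗ W) U X ⊚ (((t.quad a s).br U (V ⊗ W) ⊚ (t.quad a s).as U V W) ▷ X) +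
      (V ◁ ((W ◁ (t.quad a s).br U X) ⊚ (t.quad a s).as W U X)) ⊳ (t.quad a s).as V (W ⊗ U) X ⊳ wr _ _ X ((t.quad a s).hexL U V W) -
      wl V _ _ ((t.quad a s).hexL U W X) ⊲ (t.quad a s).as V (U ⊗ W) X ⊚ (((t.quad a s).as V U W ⊚ ((t.quad a s).br U V ▷ W)) ▷ X) := by
  have r₁ := quad_as_red (a := a) (t := t) h₃
  have r₂ := quad_br_red (t := t) (by rw [mul_comm, h₂] : s * a = 0) h₃
  have r₃ := quad_asInv_red (a := a) (t := t) h₃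
  have b₁ := smul_h_br_left hco h₂ h₃
  have b₂ := smul_h_br_right hco h₂ h₃
  have b₃ : ∀ U V : C, s • t.h (𝟙 U) (𝟙 V) = 0 := fun U V => by rw [ht.unit, smul_zero]
  have ehL : ∀ U V W, (t.quad a s).hexL U V W = (α_ V W U).hom ⊳ (β_ U (V ⊗ W)).hom ⊳ (α_ U V W).hom ⊳
    (s • ((2 : R) • t.fourTermL U V W + t.fourTermR U V W)) := fun _ _ _ => rfl
  have ehR : ∀ U V W, (t.quad a s).hexR U V W = (α_ W U V).inv ⊳ (β_ (U ⊗ V) W).hom ⊳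
    (s • (t.fourTermL U V W + (2 : R) • t.fourTermR U V W)) ⊲ (α_ U V W).inv := fun _ _ _ => rfl
  simp only [ehL, ehR, brHty_eq_zero _ _ (smul_h_as_right ht h₂ _ _ _ _) (smul_h_as_right ht h₃ _ _ _ _),
    asHty_eq_zero _ _ _ (b₁ _ _ _) (b₃ _ _), asHty_eq_zero _ _ _ (b₂ _ _ _) (b₁ _ _ _),
    asHty_eq_zero _ _ _ (b₃ _ _) (b₂ _ _ _), asInvHty_eq_zero _ _ _ (b₁ _ _ _) (b₃ _ _),
    asInvHty_eq_zero _ _ _ (b₂ _ _ _) (b₁ _ _ _), asInvHty_eq_zero _ _ _ (b₃ _ _) (b₂ _ _ _),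
    map_zero, LinearMap.zero_apply, zero_add, add_zero, sub_zero, post_red, pre_red, wl_smul, wr_smul]
  rcases hco with rfl | ⟨hs, -⟩
  · simp
  have hL := additive3_fourTermL ht hst hs
  have hR := additive3_fourTermR ht hst hs
  simp only [← smul_add, ← smul_sub]
  congr 1
  have hQ := hL.combination hR 2 1
  simp only [one_smul] at hQ
  simp only [wr_post, wr_pre, wl_post, wl_pre, post_pre, ← post_comp, pre_comp, Category.assoc]
  exact hQ.leftTetrahedron U V W X

include ht hst h₂ h₃ hco in
theorem quad_rightTetrahedron (U V W X : C) :
    ((t.quad a s).asInv X U V ▷ W) ⊳ (t.quad a s).asInv X (U ⊗ V) W ⊳ (t.quad a s).brHty ((t.quad a s).asInv U V W) (𝟙 X) ⊲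
        (t.quad a s).asInv U (V ⊗ W) X ⊚ (U ◁ (t.quad a s).asInv V W X) +
      ((t.quad a s).asInv X U V ▷ W) ⊳ (t.quad a s).hexR (U ⊗ V) W X ⊲ (t.quad a s).asInv U V (W ⊗ X) +
      (((t.quad a s).asInv X U V ⊚ (t.quad a s).br (U ⊗ V) X) ▷ W) ⊳ (t.quad a s).asInv (U ⊗ V) X W ⊳
        (t.quad a s).asInvHty (𝟙 U) (𝟙 V) ((t.quad a s).br W X) =
    (t.quad a s).asInv (X ⊗ U) V W ⊳ (t.quad a s).hexR U (V ⊗ W) X ⊲ (U ◁ (t.quad a s).asInv V W X) -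
      ((((t.quad a s).br U X ▷ V) ⊚ (t.quad a s).asInv U X V) ▷ W) ⊳ (t.quad a s).asInvHty (𝟙 U) ((t.quad a s).br V X) (𝟙 W) ⊲
        (U ◁ ((t.quad a s).asInv V X W ⊚ (V ◁ (t.quad a s).br W X))) -
      (t.quad a s).asInvHty ((t.quad a s).br U X) (𝟙 V) (𝟙 W) ⊲ (t.quad a s).asInv U X (V ⊗ W) ⊚
        (U ◁ ((t.quad a s).br (V ⊗ W) X ⊚ (t.quad a s).asInv V W X)) +
      ((((t.quad a s).br U X ▷ V) ⊚ (t.quad a s).asInv U X V) ▷ W) ⊳ (t.quad a s).asInv U (X ⊗ V) W ⊳ wl U _ _ ((t.quad a s).hexR V W X) -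
      wr _ _ W ((t.quad a s).hexR U V X) ⊲ (t.quad a s).asInv U (V ⊗ X) W ⊚ (U ◁ ((t.quad a s).asInv V X W ⊚ (V ◁ (t.quad a s).br W X))) := by
  have r₁ := quad_as_red (a := a) (t := t) h₃
  have r₂ := quad_br_red (t := t) (by rw [mul_comm, h₂] : s * a = 0) h₃
  have r₃ := quad_asInv_red (a := a) (t := t) h₃
  have b₁ := smul_h_br_left hco h₂ h₃
  have b₂ := smul_h_br_right hco h₂ h₃
  have b₃ : ∀ U V : C, s • t.h (𝟙 U) (𝟙 V) = 0 := fun U V => by rw [ht.unit, smul_zero]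
  have ehL : ∀ U V W, (t.quad a s).hexL U V W = (α_ V W U).hom ⊳ (β_ U (V ⊗ W)).hom ⊳ (α_ U V W).hom ⊳
    (s • ((2 : R) • t.fourTermL U V W + t.fourTermR U V W)) := fun _ _ _ => rfl
  have ehR : ∀ U V W, (t.quad a s).hexR U V W = (α_ W U V).inv ⊳ (β_ (U ⊗ V) W).hom ⊳
    (s • (t.fourTermL U V W + (2 : R) • t.fourTermR U V W)) ⊲ (α_ U V W).inv := fun _ _ _ => rfl
  simp only [ehL, ehR, brHty_eq_zero _ _ (smul_h_asInv_left ht h₂ _ _ _ _) (smul_h_asInv_left ht h₃ _ _ _ _),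
    asHty_eq_zero _ _ _ (b₁ _ _ _) (b₃ _ _), asHty_eq_zero _ _ _ (b₂ _ _ _) (b₁ _ _ _),
    asHty_eq_zero _ _ _ (b₃ _ _) (b₂ _ _ _), asInvHty_eq_zero _ _ _ (b₁ _ _ _) (b₃ _ _),
    asInvHty_eq_zero _ _ _ (b₂ _ _ _) (b₁ _ _ _), asInvHty_eq_zero _ _ _ (b₃ _ _) (b₂ _ _ _),
    map_zero, LinearMap.zero_apply, zero_add, add_zero, sub_zero, post_red, pre_red, wl_smul, wr_smul]
  rcases hco with rfl | ⟨hs, -⟩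
  · simp
  have hL := additive3_fourTermL ht hst hs
  have hR := additive3_fourTermR ht hst hs
  simp only [← smul_add, ← smul_sub]
  congr 1
  have hQ := hL.combination hR 1 2
  simp only [one_smul] at hQ
  simp only [wr_post, wr_pre, wl_post, wl_pre, post_pre, ← post_comp, pre_comp, Category.assoc]
  exact hQ.rightTetrahedron U V W X

include ht hst h₂ h₃ hco in
theorem quad_hexahedron (U V W X : C) :
    (t.quad a s).as W (X ⊗ U) V ⊳ ((t.quad a s).as W X U ▷ V) ⊳ (t.quad a s).hexR U V (W ⊗ X) ⊲
        (U ◁ (t.quad a s).as V W X) ⊚ (t.quad a s).as U (V ⊗ W) X -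
      (W ◁ (t.quad a s).asInv X U V) ⊳ (t.quad a s).hexL (U ⊗ V) W X ⊲ ((t.quad a s).asInv U V W ▷ X) =
    wl W _ _ ((t.quad a s).hexR U V X) ⊲ (t.quad a s).as W U (V ⊗ X) ⊚ (t.quad a s).as (W ⊗ U) V X ⊚
        (((t.quad a s).asInv W U V ⊚ (t.quad a s).br (U ⊗ V) W ⊚ (t.quad a s).asInv U V W) ▷ X) +
      (W ◁ (((t.quad a s).br U X ▷ V) ⊚ (t.quad a s).asInv U X V ⊚ (U ◁ (t.quad a s).br V X))) ⊳ (t.quad a s).as W U (V ⊗ X) ⊳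
        ((t.quad a s).as (W ⊗ U) V X ⊳ wr _ _ X ((t.quad a s).hexR U V W) -
          (t.quad a s).asHty ((t.quad a s).br U W) (𝟙 V) (𝟙 X) ⊲ (((t.quad a s).asInv U W V ⊚ (U ◁ (t.quad a s).br V W)) ▷ X)) +
      (W ◁ (((t.quad a s).br U X ▷ V) ⊚ (t.quad a s).asInv U X V)) ⊳ (t.quad a s).asHty (𝟙 W) (𝟙 U) ((t.quad a s).br V X) ⊲
        ((t.quad a s).br U W ▷ (V ⊗ X)) ⊚ (t.quad a s).as (U ⊗ W) V X ⊚ (((t.quad a s).asInv U W V ⊚ (U ◁ (t.quad a s).br V W)) ▷ X) +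
      (t.quad a s).asHty (𝟙 W) ((t.quad a s).br U X) (𝟙 V) ⊲ ((t.quad a s).as W U X ▷ V) ⊚ (t.quad a s).asInv (W ⊗ U) X V ⊚
        ((t.quad a s).br U W ⊗ₘ (t.quad a s).br V X) ⊚ (t.quad a s).as (U ⊗ W) V X ⊚ (((t.quad a s).asInv U W V ⊚ (U ◁ (t.quad a s).br V W)) ▷ X) -
      (t.quad a s).as W (X ⊗ U) V ⊳ (((W ◁ (t.quad a s).br U X) ⊚ (t.quad a s).as W U X) ▷ V) ⊳ (t.quad a s).asInv (W ⊗ U) X V ⊳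
        ((t.quad a s).br U W ⊗ₘ (t.quad a s).br V X) ⊳ (t.quad a s).asInv U W (V ⊗ X) ⊳ (U ◁ (t.quad a s).as W V X) ⊳
        (t.quad a s).asHty (𝟙 U) ((t.quad a s).br V W) (𝟙 X) -
      (t.quad a s).as W (X ⊗ U) V ⊳ (((W ◁ (t.quad a s).br U X) ⊚ (t.quad a s).as W U X) ▷ V) ⊳
        (t.quad a s).asInvHty ((t.quad a s).br U W) (𝟙 X) (𝟙 V) ⊲ ((U ⊗ W) ◁ (t.quad a s).br V X) ⊚ (t.quad a s).asInv U W (V ⊗ X) ⊚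
        (U ◁ ((t.quad a s).as W V X ⊚ ((t.quad a s).br V W ▷ X))) ⊚ (t.quad a s).as U (V ⊗ W) X +
      (t.quad a s).as W (X ⊗ U) V ⊳ (((W ◁ (t.quad a s).br U X) ⊚ (t.quad a s).as W U X ⊚ ((t.quad a s).br U W ▷ X)) ▷ V) ⊳
        (t.quad a s).asInv (U ⊗ W) X V ⊳ (t.quad a s).asInvHty (𝟙 U) (𝟙 W) ((t.quad a s).br V X) ⊲
        (U ◁ ((t.quad a s).as W V X ⊚ ((t.quad a s).br V W ▷ X))) ⊚ (t.quad a s).as U (V ⊗ W) X -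
      (t.quad a s).as W (X ⊗ U) V ⊳ wr _ _ V ((t.quad a s).hexL U W X) ⊲ (t.quad a s).asInv (U ⊗ W) X V ⊚ (t.quad a s).asInv U W (X ⊗ V) ⊚
        (U ◁ ((W ◁ (t.quad a s).br V X) ⊚ (t.quad a s).as W V X ⊚ ((t.quad a s).br V W ▷ X))) ⊚ (t.quad a s).as U (V ⊗ W) X -
      (t.quad a s).as W (X ⊗ U) V ⊳ (((t.quad a s).as W X U ⊚ (t.quad a s).br U (W ⊗ X) ⊚ (t.quad a s).as U W X) ▷ V) ⊳
        (t.quad a s).asInv (U ⊗ W) X V ⊳ (t.quad a s).asInv U W (X ⊗ V) ⊳ wl U _ _ ((t.quad a s).hexL V W X) ⊲ (t.quad a s).as U (V ⊗ W) X := by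
  have r₁ := quad_as_red (a := a) (t := t) h₃
  have r₂ := quad_br_red (t := t) (by rw [mul_comm, h₂] : s * a = 0) h₃
  have r₃ := quad_asInv_red (a := a) (t := t) h₃
  have b₁ := smul_h_br_left hco h₂ h₃
  have b₂ := smul_h_br_right hco h₂ h₃
  have b₃ : ∀ U V : C, s • t.h (𝟙 U) (𝟙 V) = 0 := fun U V => by rw [ht.unit, smul_zero]
  have ehL : ∀ U V W, (t.quad a s).hexL U V W = (α_ V W U).hom ⊳ (β_ U (V ⊗ W)).hom ⊳ (α_ U V W).hom ⊳
    (s • ((2 : R) • t.fourTermL U V W + t.fourTermR U V W)) := fun _ _ _ => rfl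
  have ehR : ∀ U V W, (t.quad a s).hexR U V W = (α_ W U V).inv ⊳ (β_ (U ⊗ V) W).hom ⊳
    (s • (t.fourTermL U V W + (2 : R) • t.fourTermR U V W)) ⊲ (α_ U V W).inv := fun _ _ _ => rfl
  simp only [ehL, ehR, 
    asHty_eq_zero _ _ _ (b₁ _ _ _) (b₃ _ _), asHty_eq_zero _ _ _ (b₂ _ _ _) (b₁ _ _ _),
    asHty_eq_zero _ _ _ (b₃ _ _) (b₂ _ _ _), asInvHty_eq_zero _ _ _ (b₁ _ _ _) (b₃ _ _),
    asInvHty_eq_zero _ _ _ (b₂ _ _ _) (b₁ _ _ _), asInvHty_eq_zero _ _ _ (b₃ _ _) (b₂ _ _ _),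
    map_zero, LinearMap.zero_apply, zero_add, add_zero, sub_zero, post_red, pre_red, wl_smul, wr_smul]
  rcases hco with rfl | ⟨hs, -⟩
  · simp
  have hL := additive3_fourTermL ht hst hs
  have hR := additive3_fourTermR ht hst hs
  simp only [← smul_add, ← smul_sub]
  congr 1
  have hQ := hL.combination hR 2 1
  have hQ' := hL.combination hR 1 2
  simp only [one_smul] at hQ hQ'
  simp only [wr_post, wr_pre, wl_post, wl_pre, post_pre, ← post_comp, pre_comp, Category.assoc]
  exact hQ.hexahedron hQ' U V W X

end
end InfData
end Polytopes
end Syl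

namespace Syl

open TwoCells TwoCellsMonoidal Wd

section BreenPolytope

variable {R : Type*} [CommRing R] {C : Type*} [Category C] [Preadditive C] [Linear R C]
  [MonoidalCategory C] [MonoidalPreadditive C] [MonoidalLinear R C] [SymmetricCategory C]
  [TwoCells R C] [TwoCellsMonoidal R C]

local notation:80 g:81 " ⊳ " q:80 => g ⊳[R] q
local notation:80 q:81 " ⊲ " f:80 => q ⊲[R] f
local notation:90 f:91 " ⊗ʳ " q:90 => f ⊗ʳ[R] q
local notation:90 q:91 " ⊗ˡ " g:90 => q ⊗ˡ[R] g

theorem smul_pre_eq_zero {s : R} {X Y Z : C} {q : H R Y Z} (h : s • q = 0) (f : X ⟶ Y) :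
    s • (q ⊲ f) = 0 := by
  rw [← LinearMap.smul_apply, ← map_smul, h, map_zero, LinearMap.zero_apply]

theorem smul_post_eq_zero {s : R} {X Y Z : C} {q : H R X Y} (h : s • q = 0) (f : Y ⟶ Z) :
    s • (f ⊳ q) = 0 := by
  rw [← map_smul, h, map_zero]

namespace InfData

variable {a s : R} {t : InfData R C}
variable (ht : t.IsInfinitesimal2Braiding) (hst : t.IsStrict) (h₁ : a * a = 6 * s)
  (h₂ : a * s = 0) (h₃ : s * s = 0) (hco : s = 0 ∨ t.IsTotallySymmetric ∧ t.IsCoherent)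

theorem fourTermL_symm (ht : t.IsInfinitesimal2Braiding) (hs : t.IsTotallySymmetric) (U V W : C) :
    cjH (whiskerRightIso (β_ U V) W) (t.fourTermL V U W) = t.fourTermL U V W := by
  rw [fourTermL, ← h_cj ht _ (fun X => hs.hty_symm U V X), fourTermL]
  congr 1
  rw [cj, ← Category.assoc, ← hs.app, Category.assoc, Iso.hom_inv_id, Category.comp_id]

theorem fourTermR_symm (ht : t.IsInfinitesimal2Braiding) (hs : t.IsTotallySymmetric) (U V W : C) :
    cjH (swap23 U V W) (t.fourTermR U W V) = t.fourTermR U V W := by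
  rw [fourTermR_eq hs.toIsSymmetric, fourTermR_eq hs.toIsSymmetric, ← fourTermL_symm ht hs W V U,
    cjH_cjH, cjH_cjH]
  apply cjH_congr
  exact coherence (ten (ten (leaf 0 U) (leaf 1 V)) (leaf 2 W))

theorem IsCoherent.fourTermR_swap (hc : t.IsCoherent) (U V W : C) :
    cjH (whiskerRightIso (β_ U V) W) (t.fourTermR V U W) = -(t.fourTermL U V W + t.fourTermR U V W) := by
  rw [← hc.left, neg_neg, cjH, whiskerRightIso_inv, whiskerRightIso_hom,
    SymmetricCategory.braiding_swap_eq_inv_braiding U V]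

theorem IsCoherent.fourTermL_swap (hc : t.IsCoherent) (U V W : C) :
    cjH (swap23 U V W) (t.fourTermL U W V) = -(t.fourTermL U V W + t.fourTermR U V W) := by
  rw [hc.right, neg_neg]
  simp only [cjH, swap23, Iso.trans_hom, Iso.trans_inv, whiskerLeftIso_hom, whiskerLeftIso_inv,
    Iso.symm_hom, Iso.symm_inv, Category.assoc, SymmetricCategory.braiding_swap_eq_inv_braiding,
    post_comp]

include ht h₁ h₂ hco in
theorem smul_h_id_br (U V W : C) : a • t.h (𝟙 U) ((t.quad a s).br V W) =
    a • t.h (𝟙 U) (β_ V W).hom + s • (6 : R) • (U ◁ (β_ V W).hom) ⊳ t.h (𝟙 U) (t.app V W) := by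
  have e₁ : (t.quad a s).br V W = (β_ V W).hom + a • (t.app V W ≫ (β_ V W).hom) +
      (3 * s) • ((t.app V W ≫ t.app V W) ≫ (β_ V W).hom) := by
    simp only [quad, brFam, Preadditive.add_comp, Linear.smul_comp, Category.id_comp]
  have e₂ := ht.comp (𝟙 U) (𝟙 U) (β_ V W).hom (t.app V W)
  have e₃ := congrArg (s • ·) e₂
  simp only [Category.comp_id, id_tensorHom, smul_add] at e₃
  rw [smul_pre_eq_zero (smul_braid_right hco V W U), zero_add] at e₃
  have h₄ : a * (3 * s) = 0 := by linear_combination 3 * h₂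
  rw [e₁]
  simp only [InfData.h] at e₃ ⊢
  simp only [map_add, map_smul, smul_add, smul_smul, h₁, h₄, zero_smul, add_zero]
  rw [mul_smul, e₃, smul_comm, mul_smul, smul_comm]

include ht h₁ h₂ hco in
theorem smul_h_br_id (U V W : C) : a • t.h ((t.quad a s).br U V) (𝟙 W) =
    a • t.h (β_ U V).hom (𝟙 W) + s • (6 : R) • ((β_ U V).hom ▷ W) ⊳ t.h (t.app U V) (𝟙 W) := by
  have e₁ : (t.quad a s).br U V = (β_ U V).hom + a • (t.app U V ≫ (β_ U V).hom) +
      (3 * s) • ((t.app U V ≫ t.app U V) ≫ (β_ U V).hom) := by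
    simp only [quad, brFam, Preadditive.add_comp, Linear.smul_comp, Category.id_comp]
  have e₂ := ht.comp (β_ U V).hom (t.app U V) (𝟙 W) (𝟙 W)
  have e₃ := congrArg (s • ·) e₂
  simp only [Category.comp_id, tensorHom_id, smul_add] at e₃
  rw [smul_pre_eq_zero (smul_braid_left hco U V W), zero_add] at e₃
  have h₄ : a * (3 * s) = 0 := by linear_combination 3 * h₂
  rw [e₁]
  simp only [InfData.h] at e₃ ⊢
  simp only [map_add, map_smul, LinearMap.add_apply, LinearMap.smul_apply, smul_add, smul_smul, h₁,
    h₄, zero_smul, add_zero]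
  rw [mul_smul, e₃, smul_comm, mul_smul, smul_comm]

include ht h₁ h₂ h₃ hco in
theorem brHty_id_br (U V W : C) : (t.quad a s).brHty (𝟙 U) ((t.quad a s).br V W) =
    (β_ U (W ⊗ V)).hom ⊳ (a • t.h (𝟙 U) (β_ V W).hom +
      s • (6 : R) • (U ◁ (β_ V W).hom) ⊳ t.h (𝟙 U) (t.app V W)) := by
  have e := smul_h_br_right hco h₂ h₃ V W U
  rw [← smul_h_id_br ht h₁ h₂ hco]
  exact congrArg _ ((add_eq_left).2 (by
    rw [mul_smul, smul_add, smul_pre_eq_zero e, smul_post_eq_zero e, add_zero, smul_zero]))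

include ht h₁ h₂ h₃ hco in
theorem brHty_br_id (U V W : C) : (t.quad a s).brHty ((t.quad a s).br U V) (𝟙 W) =
    (β_ (V ⊗ U) W).hom ⊳ (a • t.h (β_ U V).hom (𝟙 W) +
      s • (6 : R) • ((β_ U V).hom ▷ W) ⊳ t.h (t.app U V) (𝟙 W)) := by
  have e := smul_h_br_left hco h₂ h₃ U V W
  rw [← smul_h_br_id ht h₁ h₂ hco]
  exact congrArg _ ((add_eq_left).2 (by
    rw [mul_smul, smul_add, smul_pre_eq_zero e, smul_post_eq_zero e, add_zero, smul_zero]))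

include ht h₁ h₂ h₃ hco in
theorem quad_breen (hBr : ∀ U V W : C, a • ((α_ W V U).hom ⊳ (β_ U (W ⊗ V)).hom ⊳
    t.h (𝟙 U) (β_ V W).hom ⊲ (α_ U V W).hom + (β_ (V ⊗ U) W).hom ⊳ t.h (β_ U V).hom (𝟙 W)) = 0)
    (U V W : C) :
    -((t.quad a s).as W V U ⊳ ((t.quad a s).br V W ▷ U) ⊳ (t.quad a s).asInv V W U ⊳ (t.quad a s).hexL U V W) +
      (t.quad a s).as W V U ⊳ (t.quad a s).brHty (𝟙 U) ((t.quad a s).br V W) ⊲ (t.quad a s).as U V W +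
      (t.quad a s).hexL U W V ⊲ (t.quad a s).asInv U W V ⊚ (U ◁ (t.quad a s).br V W) ⊚ (t.quad a s).as U V W =
    -((t.quad a s).as W V U ⊳ (t.quad a s).hexR V U W ⊲ (t.quad a s).as V U W ⊚ ((t.quad a s).br U V ▷ W)) -
      (t.quad a s).brHty ((t.quad a s).br U V) (𝟙 W) +
      (W ◁ (t.quad a s).br U V) ⊳ (t.quad a s).as W U V ⊳ (t.quad a s).hexR U V W ⊲ (t.quad a s).as U V W := by
  have r₁ := quad_as_red (a := a) (t := t) h₃
  have r₂ := quad_br_red (t := t) (by rw [mul_comm, h₂] : s * a = 0) h₃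
  have r₃ := quad_asInv_red (a := a) (t := t) h₃
  have r₄ := quad_as_red (s := s) (a := a) (t := t) h₂
  have ehL : ∀ U V W, (t.quad a s).hexL U V W = (α_ V W U).hom ⊳ (β_ U (V ⊗ W)).hom ⊳ (α_ U V W).hom ⊳
    (s • ((2 : R) • t.fourTermL U V W + t.fourTermR U V W)) := fun _ _ _ => rfl
  have ehR : ∀ U V W, (t.quad a s).hexR U V W = (α_ W U V).inv ⊳ (β_ (U ⊗ V) W).hom ⊳
    (s • (t.fourTermL U V W + (2 : R) • t.fourTermR U V W)) ⊲ (α_ U V W).inv := fun _ _ _ => rfl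
  have hB := hBr U V W
  rw [brHty_id_br ht h₁ h₂ h₃ hco, brHty_br_id ht h₁ h₂ h₃ hco]
  simp only [ehL, ehR, map_add, LinearMap.add_apply, post_red, pre_red]
  rcases hco with rfl | ⟨hs, hc⟩
  · simp only [zero_smul, map_zero, LinearMap.zero_apply, neg_zero, add_zero, zero_add, smul_add,
      sub_zero, zero_sub, post_pre, map_smul, LinearMap.smul_apply] at hB ⊢
    exact eq_neg_of_add_eq_zero_left hB
  simp only [post_pre, ← post_comp, pre_comp, Category.assoc, map_smul, LinearMap.smul_apply, smul_add,
    Iso.hom_inv_id, Iso.inv_hom_id, Iso.hom_inv_id_assoc, Iso.inv_hom_id_assoc, Category.comp_id,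
    pre_id] at hB ⊢
  obtain ⟨k, hk⟩ : ∃ k, k = (β_ U V).hom ▷ W ≫ (β_ (V ⊗ U) W).hom := ⟨_, rfl⟩
  have e₁ : (α_ U V W).hom ≫ (β_ U (V ⊗ W)).hom ≫ (β_ V W).hom ▷ U ≫ (α_ W V U).hom = k := by
    subst hk
    exact coherence (ten (ten (leaf 0 U) (leaf 1 V)) (leaf 2 W))
  have e₂ : (α_ U V W).hom ≫ U ◁ (β_ V W).hom ≫ (β_ U (W ⊗ V)).hom ≫ (α_ W V U).hom = k := by
    subst hk
    exact coherence (ten (ten (leaf 0 U) (leaf 1 V)) (leaf 2 W))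
  have e₃ : (swap23 U V W).hom ≫ (α_ U W V).hom ≫ (β_ U (W ⊗ V)).hom ≫ (α_ W V U).hom = k := by
    subst hk
    exact coherence (ten (ten (leaf 0 U) (leaf 1 V)) (leaf 2 W))
  have e₄ : (β_ (U ⊗ V) W).hom ≫ W ◁ (β_ U V).hom = k := by
    subst hk
    exact coherence (ten (ten (leaf 0 U) (leaf 1 V)) (leaf 2 W))
  have eL : t.h (t.app U V) (𝟙 W) = t.fourTermL U V W := rfl
  have eR : cjH (α_ U V W) (t.h (𝟙 U) (t.app V W)) = t.fourTermR U V W := rfl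
  rw [e₁, e₄, ← hk, post_pre_eq (α_ U V W) k _ rfl e₂, post_pre_eq (f := (α_ U V W).hom ≫ U ◁ (β_ V W).hom ≫ (α_ U W V).inv) (swap23 U V W) k _ rfl e₃,
    post_pre_eq (f := (α_ U V W).hom ≫ U ◁ (β_ V W).hom ≫ (α_ U W V).inv) (swap23 U V W) k _ rfl e₃,
    post_pre_eq (f := (β_ U V).hom ▷ W) (whiskerRightIso (β_ U V) W) k (t.fourTermL V U W) rfl hk.symm,
    post_pre_eq (f := (β_ U V).hom ▷ W) (whiskerRightIso (β_ U V) W) k (t.fourTermR V U W) rfl hk.symm,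
    fourTermL_symm ht hs, fourTermR_symm ht hs, hc.fourTermR_swap, hc.fourTermL_swap, eL, eR]
  simp only [map_add, map_neg]
  linear_combination (norm := module) hB

include ht hst h₁ h₂ h₃ hco in
theorem quad_isBraided (hBr : ∀ U V W : C, a • ((α_ W V U).hom ⊳ (β_ U (W ⊗ V)).hom ⊳
    t.h (𝟙 U) (β_ V W).hom ⊲ (α_ U V W).hom + (β_ (V ⊗ U) W).hom ⊳ t.h (β_ U V).hom (𝟙 W)) = 0)
    (hs : t.IsSymmetric) : (t.quad a s).IsBraided where
  toAssociatorLaws := quad_associatorLaws ht a h₃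
  pentagon := quad_pentagon hst a h₃
  pentagon_hty := quad_pentagon_hty ht hst a h₃
  associahedron U V W X Y := by
    have b₁ := smul_h_as_left (t := t) (a := a) ht h₃
    have b₂ := smul_h_as_right (t := t) (a := a) ht h₃
    have b₃ : ∀ U V : C, s • t.h (𝟙 U) (𝟙 V) = 0 := fun U V => by rw [ht.unit, smul_zero]
    rw [asHty_eq_zero _ _ _ (b₃ _ _) (b₂ _ _ _ _), asHty_eq_zero _ _ _ (b₁ _ _ _ _) (b₃ _ _),
      asHty_eq_zero _ _ _ (b₂ _ _ _ _) (b₁ _ _ _ _)]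
    simp
  triangle := quad_triangle ht hst a
  triangle_hty := quad_triangle_hty ht hst a
  toBraidingLaws := quad_braidingLaws ht h₁ h₂ h₃
  toHexagonatorLaws := quad_hexagonatorLaws ht hst hs h₁ h₂ h₃
  leftTetrahedron := quad_leftTetrahedron ht hst h₂ h₃ hco
  rightTetrahedron := quad_rightTetrahedron ht hst h₂ h₃ hco
  hexahedron := quad_hexahedron ht hst h₂ h₃ hco
  breen := quad_breen ht h₁ h₂ h₃ hco hBr

end InfData
end BreenPolytope
end Syl

namespace Syl

open TwoCells TwoCellsMonoidal Wd

section Syllepsis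

variable {R : Type*} [CommRing R] {C : Type*} [Category C] [Preadditive C] [Linear R C]
  [MonoidalCategory C] [MonoidalPreadditive C] [MonoidalLinear R C] [SymmetricCategory C]
  [TwoCells R C] [TwoCellsMonoidal R C]

local notation:80 g:81 " ⊳ " q:80 => g ⊳[R] q
local notation:80 q:81 " ⊲ " f:80 => q ⊲[R] f
local notation:90 f:91 " ⊗ʳ " q:90 => f ⊗ʳ[R] q
local notation:90 q:91 " ⊗ˡ " g:90 => q ⊗ˡ[R] g

theorem post_iso_inj {A B D : C} (p : B ≅ D) {q q' : H R A B} : p.hom ⊳ q = p.hom ⊳ q' ↔ q = q' := by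
  refine ⟨fun h => ?_, fun h => h ▸ rfl⟩
  simpa [← post_comp, post_id] using congrArg (fun q => p.inv ⊳ q) h

theorem smul_post_iso_inj {A B D : C} (c : R) (p : B ≅ D) {q q' : H R A B} :
    c • (p.hom ⊳ q) = c • (p.hom ⊳ q') ↔ c • q = c • q' := by
  rw [← map_smul, ← map_smul, post_iso_inj]

namespace InfData

variable {a s c : R} {t : InfData R C} {T : ∀ U V : C, H R (U ⊗ V) (U ⊗ V)}
variable (ht : t.IsInfinitesimal2Braiding) (hst : t.IsStrict) (hs : t.IsSymmetric)
  (h₁ : a * a = 6 * s) (h₂ : a * s = 0) (h₃ : s * s = 0)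
  (hco : s = 0 ∨ t.IsTotallySymmetric ∧ t.IsCoherent)

theorem fourTermL_rot (ht : t.IsInfinitesimal2Braiding) (hs : t.IsTotallySymmetric)
    (hc : t.IsCoherent) (U V W : C) :
    cjH (rot W U V).symm (t.fourTermL W U V) = -(t.fourTermL U V W + t.fourTermR U V W) := by
  rw [← fourTermL_symm ht hs, ← hc.fourTermL_swap, cjH_cjH]
  apply cjH_congr
  rw [Iso.trans_hom, ← Iso.eq_inv_comp, Iso.symm_inv]
  exact coherence (ten (ten (leaf 0 W) (leaf 1 U)) (leaf 2 V))

theorem fourTermR_rot (ht : t.IsInfinitesimal2Braiding) (hs : t.IsTotallySymmetric)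
    (hc : t.IsCoherent) (U V W : C) :
    cjH (rot U V W) (t.fourTermR V W U) = -(t.fourTermL U V W + t.fourTermR U V W) := by
  rw [← fourTermL_rot ht hs hc, fourTermR_eq hs.toIsSymmetric, cjH_cjH]
  apply cjH_congr
  rw [← cancel_mono (rot W U V).hom, Iso.symm_hom, Iso.inv_hom_id]
  simp only [Iso.trans_hom, Category.assoc]
  exact coherence (ten (ten (leaf 0 U) (leaf 1 V)) (leaf 2 W))

theorem fourTermR_rot_symm (hs : t.IsSymmetric) (U V W : C) :
    cjH (rot W U V).symm (t.fourTermR W U V) = t.fourTermL U V W := by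
  rw [fourTermR_eq hs, cjH_cjH]
  exact cjH_refl (by simp) _

theorem quad_brInv_red (h : c * s = 0) (hs : t.IsSymmetric) (U V : C) :
    Red c ((t.quad a s).brInv U V) ((β_ V U).hom - a • (t.app V U ≫ (β_ V U).hom)) := by
  constructor
  have h' : c * (3 * s) = 0 := by linear_combination 3 * h
  have e : ∀ U V : C, (β_ V U).inv = (β_ U V).hom := fun U V => by
    rw [SymmetricCategory.braiding_swap_eq_inv_braiding]
  simp only [quad, brInvFam, Preadditive.comp_add, Preadditive.comp_sub, Linear.comp_smul,
    Category.comp_id, smul_add, smul_sub, smul_smul, h', zero_smul, add_zero, e, hs.app]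

theorem quad_br_red_linear (h : c * s = 0) (U V : C) :
    Red c ((t.quad a s).br U V) ((β_ U V).hom + a • (t.app U V ≫ (β_ U V).hom)) := by
  constructor
  have h' : c * (3 * s) = 0 := by linear_combination 3 * h
  simp only [quad, brFam, Preadditive.add_comp, Linear.smul_comp, Category.id_comp, smul_add,
    smul_smul, h', zero_smul, add_zero]

theorem quad_brInv_red_braid (h : c * a = 0) (h' : c * s = 0) (U V : C) :
    Red c ((t.quad a s).brInv U V) (β_ U V).inv :=
  brInvFam_red _ h h' U V

include ht h₂ h₃ hco in
theorem quad_hexRInv (U V W : C) : (t.quad a s).hexRInv V W U = (t.quad a s).hexL U V W := by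
  have r₁ := quad_as_red (a := a) (t := t) h₃
  have r₂ := quad_brInv_red_braid (t := t) (by rw [mul_comm, h₂] : s * a = 0) h₃
  have ehL : ∀ U V W, (t.quad a s).hexL U V W = (α_ V W U).hom ⊳ (β_ U (V ⊗ W)).hom ⊳ (α_ U V W).hom ⊳
    (s • ((2 : R) • t.fourTermL U V W + t.fourTermR U V W)) := fun _ _ _ => rfl
  have ehR : ∀ U V W, (t.quad a s).hexR U V W = (α_ W U V).inv ⊳ (β_ (U ⊗ V) W).hom ⊳
    (s • (t.fourTermL U V W + (2 : R) • t.fourTermR U V W)) ⊲ (α_ U V W).inv := fun _ _ _ => rfl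
  simp only [BraidedData.hexRInv, ehL, ehR, post_red, pre_red]
  rcases hco with rfl | ⟨hs, hc⟩
  · simp
  rw [← smul_neg]
  congr 1
  simp only [post_pre, ← post_comp, pre_comp, Category.assoc]
  obtain ⟨k, hk⟩ : ∃ k, k = (α_ U V W).hom ≫ (β_ U (V ⊗ W)).hom ≫ (α_ V W U).hom := ⟨_, rfl⟩
  rw [post_pre_eq (rot U V W) k _ ?_ ?_, ← hk, cjH_add, cjH_smul, fourTermR_rot ht hs hc,
    ← fourTermR_eq hs.toIsSymmetric, ← map_neg]
  · congr 1
    module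
  all_goals
    subst hk
    simp only [← SymmetricCategory.braiding_swap_eq_inv_braiding]
    exact coherence (ten (ten (leaf 0 U) (leaf 1 V)) (leaf 2 W))

include ht h₂ h₃ hco in
theorem quad_hexLInv (U V W : C) : (t.quad a s).hexLInv W U V = (t.quad a s).hexR U V W := by
  have r₁ := quad_asInv_red (a := a) (t := t) h₃
  have r₂ := quad_brInv_red_braid (t := t) (by rw [mul_comm, h₂] : s * a = 0) h₃
  have ehL : ∀ U V W, (t.quad a s).hexL U V W = (α_ V W U).hom ⊳ (β_ U (V ⊗ W)).hom ⊳ (α_ U V W).hom ⊳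
    (s • ((2 : R) • t.fourTermL U V W + t.fourTermR U V W)) := fun _ _ _ => rfl
  have ehR : ∀ U V W, (t.quad a s).hexR U V W = (α_ W U V).inv ⊳ (β_ (U ⊗ V) W).hom ⊳
    (s • (t.fourTermL U V W + (2 : R) • t.fourTermR U V W)) ⊲ (α_ U V W).inv := fun _ _ _ => rfl
  simp only [BraidedData.hexLInv, ehL, ehR, post_red, pre_red]
  rcases hco with rfl | ⟨hs, hc⟩
  · simp
  rw [← smul_neg]
  congr 1
  simp only [post_pre, ← post_comp, pre_comp, Category.assoc]
  obtain ⟨k, hk⟩ : ∃ k, k = (α_ U V W).inv ≫ (β_ (U ⊗ V) W).hom ≫ (α_ W U V).inv := ⟨_, rfl⟩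
  have e : (rot W U V).symm.hom = (β_ (U ⊗ V) W).hom ≫ (α_ W U V).inv := by
    simp [rot, SymmetricCategory.braiding_swap_eq_inv_braiding]
  rw [post_pre_eq ((α_ U V W).symm ≪≫ (rot W U V).symm) k _ ?_ ?_,
    post_pre_eq (f := (α_ U V W).inv) (α_ U V W).symm k _ rfl (by rw [hk]; rfl), ← cjH_cjH, cjH_add, cjH_smul,
    fourTermL_rot ht hs hc, fourTermR_rot_symm hs.toIsSymmetric, ← map_neg, ← cjH_neg]
  · congr 2
    module
  all_goals
    subst hk
    rw [Iso.trans_hom, e]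
    simp only [← SymmetricCategory.braiding_swap_eq_inv_braiding]
    exact coherence (ten (leaf 0 U) (ten (leaf 1 V) (leaf 2 W)))

theorem peiffer_pair {A B E : C} (p : A ≅ B) (g : B ⟶ E) (q : H R A A) (q' : H R B B) {τ : A ⟶ A}
    {τ' : B ⟶ B} (h : (c * a) • ∂[R] q = (c * a) • τ) (h' : (c * a) • ∂[R] q' = (c * a) • τ') :
    c • ((g - a • (τ' ≫ g)) ⊳ (p.hom ⊳ q)) + c • ((g ⊳ q') ⊲ (p.hom + a • (τ ≫ p.hom))) =
      c • ((p.hom ≫ g) ⊳ (q + cjH p q')) := by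
  have e : (c * a) • ((p.hom ≫ τ' ≫ g) ⊳ q) = (c * a) • (g ⊳ (q' ⊲ (τ ≫ p.hom))) := by
    have e₁ := congrArg (fun x => g ⊳ ((q' ⊲ p.hom) ⊲ x)) h
    have e₂ := congrArg (fun x => g ⊳ (x ⊳ (p.hom ⊳ q))) h'
    simp only [map_smul, LinearMap.smul_apply] at e₁ e₂
    rw [post_comp, post_comp, ← e₂, peiffer, bd_post, ← pre_comp, e₁, pre_comp]
  simp only [map_sub, map_add, map_smul, LinearMap.sub_apply, LinearMap.smul_apply, post_pre,
    ← post_comp, Category.assoc, cjH, Iso.inv_hom_id_assoc, Iso.hom_inv_id_assoc, smul_add, smul_sub] at e ⊢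
  rw [smul_smul, smul_smul, e]
  simp only [post_comp, ← post_comp p.inv p.hom]
  simp only [← post_comp, Iso.inv_hom_id_assoc]
  module

theorem smul_bd_cjH {A B : C} (d : R) (p : A ≅ B) {q : H R B B} {τ : B ⟶ B} (h : d • ∂[R] q = d • τ) :
    d • ∂[R] (cjH p q) = d • cj p τ := by
  have e := congrArg (fun x => p.hom ≫ x ≫ p.inv) h
  simpa only [bd_cjH, cj, Linear.comp_smul, Linear.smul_comp] using e

include hs h₁ h₂ h₃ in
theorem quad_brInvHty {U U' V V' : C} (f : U ⟶ U') (g : V ⟶ V') :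
    (t.quad a s).brInvHty g f = -((β_ U' V').hom ⊳ (a • t.h f g -
      (3 * s) • (t.h f g ⊲ t.app U V + t.app U' V' ⊳ t.h f g))) := by
  have e : (β_ V U).inv = (β_ U V).hom := by
    rw [SymmetricCategory.braiding_swap_eq_inv_braiding]
  have e₁ : t.h g f ⊲ (β_ U V).hom = (β_ U' V').hom ⊳ t.h f g := (hs.hty f g).symm
  have e₂ : (t.h g f ⊲ t.app V U) ⊲ (β_ U V).hom = (β_ U' V').hom ⊳ (t.h f g ⊲ t.app U V) := by
    rw [pre_comp, ← hs.app, ← pre_comp, e₁, post_pre]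
  have e₃ : t.app V' U' ⊳ (t.h g f ⊲ (β_ U V).hom) = (β_ U' V').hom ⊳ (t.app U' V' ⊳ t.h f g) := by
    rw [e₁, ← post_comp, ← post_comp, hs.app]
  have h₄ : a * (3 * s) = 0 := by linear_combination 3 * h₂
  have h₅ : 3 * s * a = 0 := by linear_combination 3 * h₂
  have h₆ : 3 * s * (3 * s) = 0 := by linear_combination 9 * h₃
  have h₇ : a * (6 * s) = 0 := by linear_combination 6 * h₂
  have h₈ : 3 * s * (6 * s) = 0 := by linear_combination 18 * h₃
  have h₉ : 6 * s * a = 0 := by linear_combination 6 * h₂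
  have h₁₀ : 6 * s * (3 * s) = 0 := by linear_combination 18 * h₃
  simp only [BraidedData.brInvHty, quad, brInvFam, e, post_pre, ← pre_comp]
  rw [← post_comp, Iso.hom_inv_id_assoc]
  simp only [map_add, map_sub, map_smul, LinearMap.add_apply, LinearMap.sub_apply,
    LinearMap.smul_apply, pre_comp, post_id, Preadditive.comp_add, Preadditive.comp_sub,
    Linear.comp_smul, Category.comp_id, smul_add, smul_sub, smul_smul, h₁, h₂, h₄, h₅, h₆, h₇, h₈,
    h₉, h₁₀, zero_smul, sub_zero, add_zero, zero_add, post_comp, Category.id_comp, post_pre]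
  rw [pre_comp] at e₂
  rw [e₁, e₂, ← e₃, e₁]
  module

include hs h₁ h₂ h₃ in
theorem quad_syllepsis_quasinatural_iff (hc : c = 2 * a) {U U' V V' : C} (f : U ⟶ U') (g : V ⟶ V') :
    syllepsisOf c T U' V' ⊲ (f ⊗ₘ g) + (t.quad a s).brHty f g =
        (t.quad a s).brInvHty g f + (g ⊗ₘ f) ⊳ syllepsisOf c T U V ↔
      c • ((f ⊗ₘ g) ⊳ T U V - T U' V' ⊲ (f ⊗ₘ g)) = c • t.h f g := by
  have e : (g ⊗ₘ f) ⊳ syllepsisOf c T U V = (β_ U' V').hom ⊳ (c • (f ⊗ₘ g) ⊳ T U V) := by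
    simp only [syllepsisOf, map_smul, ← post_comp, braiding_naturality]
  have e' : (t.quad a s).brHty f g = (β_ U' V').hom ⊳ (a • t.h f g +
    (3 * s) • (t.h f g ⊲ t.app U V + t.app U' V' ⊳ t.h f g)) := rfl
  have e'' : syllepsisOf c T U' V' ⊲ (f ⊗ₘ g) = (β_ U' V').hom ⊳ (c • (T U' V' ⊲ (f ⊗ₘ g))) := by
    simp only [syllepsisOf, map_smul, LinearMap.smul_apply, post_pre]
  rw [e, e', e'', quad_brInvHty hs h₁ h₂ h₃, ← map_neg, ← map_add, ← map_add, post_iso_inj, hc]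
  constructor <;> intro h <;> linear_combination (norm := module) -h

include hs in
theorem quad_syllepsis_homotopy_iff (hc : c = 2 * a) (U V : C) :
    ∂[R] (syllepsisOf c T U V) = (t.quad a s).br U V - (t.quad a s).brInv V U ↔
      c • ∂[R] (T U V) = c • t.app U V := by
  have e : (t.quad a s).br U V - (t.quad a s).brInv V U = (c • t.app U V) ≫ (β_ U V).hom := by
    have e : (β_ V U).inv = (β_ U V).hom := by
      rw [SymmetricCategory.braiding_swap_eq_inv_braiding]
    simp only [quad, brFam, brInvFam, e, Preadditive.comp_add, Preadditive.comp_sub,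
      Preadditive.add_comp, Linear.comp_smul, Linear.smul_comp, Category.comp_id, Category.id_comp, hc]
    have e' : t.app U V ≫ t.app U V ≫ (β_ U V).hom = (β_ U V).hom ≫ t.app V U ≫ t.app V U := by
      rw [hs.app, ← Category.assoc, hs.app, Category.assoc]
    rw [Category.assoc, e', hs.app]
    module
  rw [e, syllepsisOf, map_smul, bd_post, ← Linear.smul_comp]
  exact cancel_mono _

variable (hT : ∀ U V : C, (c * a) • ∂[R] (T U V) = (c * a) • t.app U V)

include hs hT h₁ in
theorem quad_syllepsis_symmetric_iff (hc : c * s = 0) (U V : C) :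
    syllepsisOf c T U V = (t.quad a s).brInv V U ⊳ syllepsisOf c T V U ⊲ (t.quad a s).br U V ↔
      c • T U V = c • (β_ V U).hom ⊳ T V U ⊲ (β_ U V).hom := by
  have r₁ := quad_brInv_red (a := a) hc hs
  have r₂ := quad_br_red_linear (a := a) (t := t) hc
  have e := smul_bd_cjH (c * a) (β_ U V) (hT V U)
  have e₁ : cj (β_ U V) (t.app V U) = t.app U V := by
    rw [cj, ← Category.assoc, ← hs.app, Category.assoc, Iso.hom_inv_id, Category.comp_id]
  have e₂ : (β_ V U).hom ⊳ T V U ⊲ (β_ U V).hom = cjH (β_ U V) (T V U) := by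
    rw [cjH, SymmetricCategory.braiding_swap_eq_inv_braiding]
  rw [e₁] at e
  have e₃ : (β_ V U).hom ⊳ (T V U ⊲ (t.app U V ≫ (β_ U V).hom)) = cjH (β_ U V) (T V U) ⊲ t.app U V := by
    rw [← e₂, post_pre, pre_comp]
  have e₄ : (c * a) • (t.app U V ⊳ cjH (β_ U V) (T V U)) =
      (c * a) • (cjH (β_ U V) (T V U) ⊲ t.app U V) := by
    have e₅ := congrArg (fun x => x ⊳ cjH (β_ U V) (T V U)) e
    have e₆ := congrArg (fun x => cjH (β_ U V) (T V U) ⊲ x) e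
    simp only [map_smul, LinearMap.smul_apply] at e₅ e₆
    rw [← e₅, peiffer, e₆]
  have h₄ : c * (a * a) = 0 := by rw [h₁]; linear_combination 6 * hc
  simp only [syllepsisOf, post_red, pre_red]
  rw [← map_smul, e₂, ← post_iso_inj (β_ U V)]
  have key : c • (((β_ U V).hom - a • t.app U V ≫ (β_ U V).hom) ⊳ (((β_ V U).hom ⊳ T V U) ⊲
      ((β_ U V).hom + a • t.app U V ≫ (β_ U V).hom))) =
      (β_ U V).hom ⊳ (c • cjH (β_ U V) (T V U)) := by
    simp only [post_pre, map_add, map_sub, map_smul, LinearMap.sub_apply, LinearMap.smul_apply, e₂, e₃,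
      smul_add, smul_sub, smul_smul, h₄, zero_smul, sub_zero, post_comp]
    rw [← map_smul (post _ _ _ (β_ U V).hom) (c * a) (t.app U V ⊳ _), e₄, map_smul]
    abel
  rw [key]

include hs hT ht h₂ h₃ hco in
theorem quad_syllepsis_left_iff (hc : c * s = 0) (U V W : C) :
    (t.quad a s).hexL U V W =
      (t.quad a s).as V W U ⊳ syllepsisOf c T U (V ⊗ W) ⊲ (t.quad a s).as U V W +
        (t.quad a s).hexRInv V W U -
      (V ◁ (t.quad a s).brInv W U) ⊳ (t.quad a s).as V U W ⊳ wr _ _ W (syllepsisOf c T U V) -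
      wl V _ _ (syllepsisOf c T U W) ⊲ (t.quad a s).as V U W ⊚ ((t.quad a s).br U V ▷ W) ↔
    c • (α_ U V W).inv ⊳ T U (V ⊗ W) ⊲ (α_ U V W).hom =
      c • (wr _ _ W (T U V) + ((β_ V U).hom ▷ W) ⊳ (α_ V U W).inv ⊳ wl V _ _ (T U W) ⊲
        (α_ V U W).hom ⊚ ((β_ U V).hom ▷ W)) := by
  have r₁ := quad_brInv_red (a := a) hc hs
  have r₂ := quad_br_red_linear (a := a) (t := t) hc
  have r₃ := quad_as_red (a := a) (t := t) hc
  have key := peiffer_pair (c := c) (a := a) (whiskerRightIso (β_ U V) W ≪≫ α_ V U W)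
    (V ◁ (β_ U W).hom) (wr _ _ W (T U V)) (wl V _ _ (T U W)) (τ := t.app U V ▷ W)
    (τ' := V ◁ t.app U W)
    (by rw [bd_wr, ← MonoidalLinear.smul_whiskerRight, hT, MonoidalLinear.smul_whiskerRight])
    (by rw [bd_wl, ← MonoidalLinear.whiskerLeft_smul, hT, MonoidalLinear.whiskerLeft_smul])
  have e : (whiskerRightIso (β_ U V) W ≪≫ α_ V U W).hom ≫ V ◁ (β_ U W).hom =
      (rot U V W ≪≫ α_ V W U).hom :=
    coherence (ten (ten (leaf 0 U) (leaf 1 V)) (leaf 2 W))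
  have e₁ : V ◁ ((β_ U W).hom - a • t.app U W ≫ (β_ U W).hom) =
      V ◁ (β_ U W).hom - a • (V ◁ t.app U W ≫ V ◁ (β_ U W).hom) := by
    rw [← MonoidalCategory.whiskerLeft_comp, ← MonoidalLinear.whiskerLeft_smul]
    exact (tensorLeft V).map_sub
  have e₂ : ((β_ U V).hom + a • t.app U V ≫ (β_ U V).hom) ▷ W ≫ (α_ V U W).hom =
      (β_ U V).hom ▷ W ≫ (α_ V U W).hom + a • (t.app U V ▷ W ≫ (β_ U V).hom ▷ W ≫ (α_ V U W).hom) := by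
    simp
  rw [quad_hexRInv ht h₂ h₃ hco]
  simp only [syllepsisOf, post_red, pre_red, wl_smul, wr_smul, wr_post, wl_post, e₁, e₂]
  rw [e] at key
  simp only [Iso.trans_hom, whiskerRightIso_hom] at key
  rw [post_comp] at key
  rw [sub_sub, key]
  have e₃ : (α_ V W U).hom ⊳ (((β_ U (V ⊗ W)).hom ⊳ T U (V ⊗ W)) ⊲ (α_ U V W).hom) =
      (rot U V W ≪≫ α_ V W U).hom ⊳ ((α_ U V W).inv ⊳ (T U (V ⊗ W) ⊲ (α_ U V W).hom)) := by
    simp [rot, ← post_comp, post_pre]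
  have e₄ : cjH (whiskerRightIso (β_ U V) W ≪≫ α_ V U W) (wl V _ _ (T U W)) =
      ((β_ V U).hom ▷ W) ⊳ (α_ V U W).inv ⊳ wl V _ _ (T U W) ⊲
        (α_ V U W).hom ⊚ ((β_ U V).hom ▷ W) := by
    simp [cjH, post_comp, SymmetricCategory.braiding_swap_eq_inv_braiding]
  rw [e₃, e₄, ← Iso.trans_hom, add_sub_right_comm, right_eq_add, sub_eq_zero, smul_post_iso_inj]

include hs hT ht h₂ h₃ hco in
theorem quad_syllepsis_right_iff (hc : c * s = 0) (U V W : C) :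
    (t.quad a s).hexR U V W =
      (t.quad a s).asInv W U V ⊳ syllepsisOf c T (U ⊗ V) W ⊲ (t.quad a s).asInv U V W +
        (t.quad a s).hexLInv W U V -
      ((t.quad a s).brInv W U ▷ V) ⊳ (t.quad a s).asInv U W V ⊳ wl U _ _ (syllepsisOf c T V W) -
      wr _ _ V (syllepsisOf c T U W) ⊲ (t.quad a s).asInv U W V ⊚ (U ◁ (t.quad a s).br V W) ↔
    c • (α_ U V W).hom ⊳ T (U ⊗ V) W ⊲ (α_ U V W).inv =
      c • (wl U _ _ (T V W) + (U ◁ (β_ W V).hom) ⊳ (α_ U W V).hom ⊳ wr _ _ V (T U W) ⊲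
        (α_ U W V).inv ⊚ (U ◁ (β_ V W).hom)) := by
  have r₁ := quad_brInv_red (a := a) hc hs
  have r₂ := quad_br_red_linear (a := a) (t := t) hc
  have r₃ := quad_asInv_red (a := a) (t := t) hc
  have key := peiffer_pair (c := c) (a := a) (whiskerLeftIso U (β_ V W) ≪≫ (α_ U W V).symm)
    ((β_ U W).hom ▷ V) (wl U _ _ (T V W)) (wr _ _ V (T U W)) (τ := U ◁ t.app V W)
    (τ' := t.app U W ▷ V)
    (by rw [bd_wl, ← MonoidalLinear.whiskerLeft_smul, hT, MonoidalLinear.whiskerLeft_smul])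
    (by rw [bd_wr, ← MonoidalLinear.smul_whiskerRight, hT, MonoidalLinear.smul_whiskerRight])
  have e : (whiskerLeftIso U (β_ V W) ≪≫ (α_ U W V).symm).hom ≫ (β_ U W).hom ▷ V =
      ((α_ U V W).symm ≪≫ β_ (U ⊗ V) W ≪≫ (α_ W U V).symm).hom :=
    coherence (ten (leaf 0 U) (ten (leaf 1 V) (leaf 2 W)))
  have e₁ : ((β_ U W).hom - a • t.app U W ≫ (β_ U W).hom) ▷ V =
      (β_ U W).hom ▷ V - a • (t.app U W ▷ V ≫ (β_ U W).hom ▷ V) := by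
    rw [← comp_whiskerRight, ← MonoidalLinear.smul_whiskerRight]
    exact (tensorRight V).map_sub
  have e₂ : U ◁ ((β_ V W).hom + a • t.app V W ≫ (β_ V W).hom) ≫ (α_ U W V).inv =
      U ◁ (β_ V W).hom ≫ (α_ U W V).inv + a • (U ◁ t.app V W ≫ U ◁ (β_ V W).hom ≫ (α_ U W V).inv) := by
    simp
  rw [quad_hexLInv ht h₂ h₃ hco]
  simp only [syllepsisOf, post_red, pre_red, wl_smul, wr_smul, wr_post, wl_post, e₁, e₂]
  rw [e] at key
  simp only [Iso.trans_hom, whiskerLeftIso_hom, Iso.symm_hom] at key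
  rw [post_comp] at key
  rw [sub_sub, key]
  have e₃ : (α_ W U V).inv ⊳ (((β_ (U ⊗ V) W).hom ⊳ T (U ⊗ V) W) ⊲ (α_ U V W).inv) =
      ((α_ U V W).symm ≪≫ β_ (U ⊗ V) W ≪≫ (α_ W U V).symm).hom ⊳
        ((α_ U V W).hom ⊳ (T (U ⊗ V) W ⊲ (α_ U V W).inv)) := by
    simp [← post_comp, post_pre]
  have e₄ : cjH (whiskerLeftIso U (β_ V W) ≪≫ (α_ U W V).symm) (wr _ _ V (T U W)) =
      (U ◁ (β_ W V).hom) ⊳ (α_ U W V).hom ⊳ wr _ _ V (T U W) ⊲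
        (α_ U W V).inv ⊚ (U ◁ (β_ V W).hom) := by
    simp [cjH, post_comp, SymmetricCategory.braiding_swap_eq_inv_braiding]
  have e₅ : (α_ U V W).inv ≫ (β_ (U ⊗ V) W).hom ≫ (α_ W U V).inv =
      ((α_ U V W).symm ≪≫ β_ (U ⊗ V) W ≪≫ (α_ W U V).symm).hom := rfl
  rw [e₃, e₄, e₅, add_sub_right_comm, right_eq_add, sub_eq_zero, smul_post_iso_inj]

include ht hs h₁ h₂ h₃ hco in
/-- A family `T` gives a symmetric syllepsis `c γ T` if and only if it satisfies the laws of a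
coboundary infinitesimal syllepsis multiplied by `c`. -/
theorem quad_isSymmetricSyllepsis_iff (hc : c = 2 * a)
    (hT : ∀ U V : C, (c * a) • ∂[R] (T U V) = (c * a) • t.app U V) :
    (t.quad a s).IsSymmetricSyllepsis (syllepsisOf c T) ↔
      (∀ U V : C, c • ∂[R] (T U V) = c • t.app U V) ∧
      (∀ {U U' V V' : C} (f : U ⟶ U') (g : V ⟶ V'),
        c • ((f ⊗ₘ g) ⊳ T U V - T U' V' ⊲ (f ⊗ₘ g)) = c • t.h f g) ∧
      (∀ U V W : C, c • (α_ U V W).inv ⊳ T U (V ⊗ W) ⊲ (α_ U V W).hom =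
        c • (wr _ _ W (T U V) + ((β_ V U).hom ▷ W) ⊳ (α_ V U W).inv ⊳ wl V _ _ (T U W) ⊲
          (α_ V U W).hom ⊚ ((β_ U V).hom ▷ W))) ∧
      (∀ U V W : C, c • (α_ U V W).hom ⊳ T (U ⊗ V) W ⊲ (α_ U V W).inv =
        c • (wl U _ _ (T V W) + (U ◁ (β_ W V).hom) ⊳ (α_ U W V).hom ⊳ wr _ _ V (T U W) ⊲
          (α_ U W V).inv ⊚ (U ◁ (β_ V W).hom))) ∧
      ∀ U V : C, c • T U V = c • (β_ V U).hom ⊳ T V U ⊲ (β_ U V).hom := by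
  have hc' : c * s = 0 := by rw [hc]; linear_combination 2 * h₂
  refine ⟨fun h => ⟨fun U V => (quad_syllepsis_homotopy_iff hs hc U V).1 (h.homotopy U V),
    fun f g => (quad_syllepsis_quasinatural_iff hs h₁ h₂ h₃ hc f g).1 (h.quasinatural f g),
    fun U V W => (quad_syllepsis_left_iff ht hs h₂ h₃ hco hT hc' U V W).1 (h.left U V W),
    fun U V W => (quad_syllepsis_right_iff ht hs h₂ h₃ hco hT hc' U V W).1 (h.right U V W),
    fun U V => (quad_syllepsis_symmetric_iff hs h₁ hT hc' U V).1 (h.symmetric U V)⟩, fun h => ?_⟩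
  exact
    { homotopy := fun U V => (quad_syllepsis_homotopy_iff hs hc U V).2 (h.1 U V)
      quasinatural := fun f g => (quad_syllepsis_quasinatural_iff hs h₁ h₂ h₃ hc f g).2 (h.2.1 f g)
      left := fun U V W =>
        (quad_syllepsis_left_iff ht hs h₂ h₃ hco hT hc' U V W).2 (h.2.2.1 U V W)
      right := fun U V W =>
        (quad_syllepsis_right_iff ht hs h₂ h₃ hco hT hc' U V W).2 (h.2.2.2.1 U V W)
      symmetric := fun U V =>
        (quad_syllepsis_symmetric_iff hs h₁ hT hc' U V).2 (h.2.2.2.2 U V) }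

end InfData
end Syllepsis
end Syl

namespace Syl

open TwoCells TwoCellsMonoidal

section BaseChangeLaws

variable {K A C : Type*} [Field K] [CommRing A] [Algebra K A] [Category C] [Preadditive C]
  [Linear K C]

namespace BaseChange

/-- The image of a 1-cell of `C`, with explicit objects of the extended category. -/
noncomputable def up {X Y : BaseChange K A C} (f : X.of ⟶ Y.of) : X ⟶ Y :=
  ((1 : A) ⊗ₜ[K] f : A ⊗[K] (X.of ⟶ Y.of))

@[elab_as_elim]
theorem hom_induction {X Y : BaseChange K A C} {P : (X ⟶ Y) → Prop}
    (add : ∀ f g, P f → P g → P (f + g)) (smul : ∀ (a : A) f, P f → P (a • f))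
    (up : ∀ f, P (up f)) (f : X ⟶ Y) : P f := by
  refine TensorProduct.induction_on (motive := P) f ?_ (fun a f => ?_) (fun f g => add f g)
  · simpa using smul 0 _ (up 0)
  · have := smul a _ (up f)
    have e : a • BaseChange.up f = (a ⊗ₜ[K] f : A ⊗[K] (X.of ⟶ Y.of)) := by
      change a • ((1 : A) ⊗ₜ[K] f) = _
      rw [TensorProduct.smul_tmul', smul_eq_mul, mul_one]
    rwa [e] at this

theorem up_comp {X Y Z : BaseChange K A C} (f : X.of ⟶ Y.of) (g : Y.of ⟶ Z.of) :
    (up f : X ⟶ Y) ≫ up g = up (f ≫ g) := by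
  simp [up, comp_def]

theorem up_id (X : BaseChange K A C) : 𝟙 X = up (𝟙 X.of) := rfl

theorem up_add {X Y : BaseChange K A C} (f g : X.of ⟶ Y.of) :
    (up f : X ⟶ Y) + up g = up (f + g) := (TensorProduct.tmul_add _ _ _).symm

theorem up_sub {X Y : BaseChange K A C} (f g : X.of ⟶ Y.of) :
    (up f : X ⟶ Y) - up g = up (f - g) := (TensorProduct.tmul_sub _ _ _).symm

section
variable [TwoCells K C]

/-- The image of an element of degree `-1`. -/
noncomputable def upH {X Y : BaseChange K A C} (q : H K X.of Y.of) : H A X Y :=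
  ((1 : A) ⊗ₜ[K] q : A ⊗[K] H K X.of Y.of)

@[elab_as_elim]
theorem hty_induction {X Y : BaseChange K A C} {P : H A X Y → Prop}
    (add : ∀ f g, P f → P g → P (f + g)) (smul : ∀ (a : A) f, P f → P (a • f))
    (up : ∀ f, P (upH f)) (f : H A X Y) : P f := by
  refine TensorProduct.induction_on (motive := P) f ?_ (fun a f => ?_) (fun f g => add f g)
  · have := smul 0 _ (up 0)
    rwa [zero_smul] at this
  · have := smul a _ (up f)
    have e : a • upH f = (a ⊗ₜ[K] f : A ⊗[K] H K X.of Y.of) := by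
      change a • ((1 : A) ⊗ₜ[K] f) = _
      rw [TensorProduct.smul_tmul', smul_eq_mul, mul_one]
    rwa [e] at this

theorem upH_add {X Y : BaseChange K A C} (f g : H K X.of Y.of) :
    (upH f : H A X Y) + upH g = upH (f + g) := (TensorProduct.tmul_add _ _ _).symm

theorem upH_sub {X Y : BaseChange K A C} (f g : H K X.of Y.of) :
    (upH f : H A X Y) - upH g = upH (f - g) := (TensorProduct.tmul_sub _ _ _).symm

theorem upH_neg {X Y : BaseChange K A C} (f : H K X.of Y.of) :
    -(upH f : H A X Y) = upH (-f) := (TensorProduct.tmul_neg _ _).symm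

theorem upH_zero {X Y : BaseChange K A C} : upH (0 : H K X.of Y.of) = (0 : H A X Y) :=
  TensorProduct.tmul_zero _ _

theorem bd_upH {X Y : BaseChange K A C} (q : H K X.of Y.of) :
    ∂[A] (upH q : H A X Y) = up (∂[K] q) := rfl

theorem post_upH {X Y Z : BaseChange K A C} (g : Y.of ⟶ Z.of) (q : H K X.of Y.of) :
    (up g : Y ⟶ Z) ⊳[A] upH q = (upH (g ⊳[K] q) : H A X Z) := by
  change ext2 A _ _ _ = _
  simp [up, upH]

theorem pre_upH {X Y Z : BaseChange K A C} (q : H K Y.of Z.of) (f : X.of ⟶ Y.of) :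
    (upH q : H A Y Z) ⊲[A] (up f : X ⟶ Y) = (upH (q ⊲[K] f) : H A X Z) := by
  change ext2 A _ _ _ = _
  simp [up, upH]

end

section
variable [MonoidalCategory C] [MonoidalPreadditive C] [MonoidalLinear K C]

theorem whiskerLeft_up (X : BaseChange K A C) {Y Z : BaseChange K A C} (f : Y.of ⟶ Z.of) :
    X ◁ (up f : Y ⟶ Z) = up (X := X ⊗ Y) (Y := X ⊗ Z) (X.of ◁ f) := rfl

theorem up_whiskerRight (X : BaseChange K A C) {Y Z : BaseChange K A C} (f : Y.of ⟶ Z.of) :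
    (up f : Y ⟶ Z) ▷ X = up (X := Y ⊗ X) (Y := Z ⊗ X) (f ▷ X.of) := rfl

theorem up_tensorHom {X Y Z W : BaseChange K A C} (f : X.of ⟶ Y.of) (g : Z.of ⟶ W.of) :
    (up f : X ⟶ Y) ⊗ₘ (up g : Z ⟶ W) = up (X := X ⊗ Z) (Y := Y ⊗ W) (f ⊗ₘ g) := by
  rw [MonoidalCategory.tensorHom_def, MonoidalCategory.tensorHom_def, up_whiskerRight,
    whiskerLeft_up, up_comp]

theorem associator_hom (X Y Z : BaseChange K A C) :
    (α_ X Y Z).hom = up (X := (X ⊗ Y) ⊗ Z) (Y := X ⊗ Y ⊗ Z) (α_ X.of Y.of Z.of).hom := rfl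

theorem associator_inv (X Y Z : BaseChange K A C) :
    (α_ X Y Z).inv = up (X := X ⊗ Y ⊗ Z) (Y := (X ⊗ Y) ⊗ Z) (α_ X.of Y.of Z.of).inv := rfl

theorem leftUnitor_up (X : BaseChange K A C) :
    (λ_ X).hom = up (X := 𝟙_ _ ⊗ X) (Y := X) (λ_ X.of).hom := rfl

theorem rightUnitor_up (X : BaseChange K A C) :
    (ρ_ X).hom = up (X := X ⊗ 𝟙_ _) (Y := X) (ρ_ X.of).hom := rfl

variable [SymmetricCategory C]

theorem braiding_up (X Y : BaseChange K A C) :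
    (β_ X Y).hom = up (X := X ⊗ Y) (Y := Y ⊗ X) (β_ X.of Y.of).hom := rfl

variable [TwoCells K C] [TwoCellsMonoidal K C]

theorem wl_upH (X : BaseChange K A C) {Y Z : BaseChange K A C} (q : H K Y.of Z.of) :
    wl X _ _ (upH q : H A Y Z) = upH (X := X ⊗ Y) (Y := X ⊗ Z) (wl X.of _ _ q) := rfl

theorem wr_upH (X : BaseChange K A C) {Y Z : BaseChange K A C} (q : H K Y.of Z.of) :
    wr _ _ X (upH q : H A Y Z) = upH (X := Y ⊗ X) (Y := Z ⊗ X) (wr _ _ X.of q) := rfl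

variable (t : InfData K C)

theorem baseChange_app (U V : BaseChange K A C) :
    (t.baseChange A).app U V = up (X := U ⊗ V) (Y := U ⊗ V) (t.app U.of V.of) := rfl

theorem baseChange_hty {U U' V V' : BaseChange K A C} (f : U.of ⟶ U'.of) (g : V.of ⟶ V'.of) :
    (t.baseChange A).hty U U' V V' (up f) (up g) =
      upH (X := U ⊗ V) (Y := U' ⊗ V') (t.hty U.of U'.of V.of V'.of f g) := by
  change ext2 A _ _ _ = _
  simp [up, upH]

theorem twoBaseChange_eq (T : ∀ U V : C, H K (U ⊗ V) (U ⊗ V)) (U V : BaseChange K A C) :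
    twoBaseChange A T U V = upH (X := U ⊗ V) (Y := U ⊗ V) (T U.of V.of) := rfl

variable {t}

theorem baseChange_isInfinitesimal2Braiding (ht : t.IsInfinitesimal2Braiding) :
    (t.baseChange A).IsInfinitesimal2Braiding where
  natural {U U' V V'} f g := by
    induction f using hom_induction with
      | add x y h h' =>
        simp only [MonoidalCategory.tensorHom_def, InfData.h, map_add, map_smul, LinearMap.add_apply,
          LinearMap.smul_apply, MonoidalPreadditive.add_whiskerRight, MonoidalPreadditive.whiskerLeft_add,
          MonoidalLinear.smul_whiskerRight, MonoidalLinear.whiskerLeft_smul, Preadditive.add_comp,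
          Preadditive.comp_add, Linear.smul_comp, Linear.comp_smul] at h h' ⊢
        linear_combination (norm := module) h + h'
      | smul a x h =>
        simp only [MonoidalCategory.tensorHom_def, InfData.h, map_add, map_smul, LinearMap.add_apply,
          LinearMap.smul_apply, MonoidalPreadditive.add_whiskerRight, MonoidalPreadditive.whiskerLeft_add,
          MonoidalLinear.smul_whiskerRight, MonoidalLinear.whiskerLeft_smul, Preadditive.add_comp,
          Preadditive.comp_add, Linear.smul_comp, Linear.comp_smul] at h ⊢
        linear_combination (norm := module) a • h
      | up f =>
        induction g using hom_induction with
          | add x y h h' =>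
            simp only [MonoidalCategory.tensorHom_def, InfData.h, map_add, map_smul, LinearMap.add_apply,
              LinearMap.smul_apply, MonoidalPreadditive.add_whiskerRight, MonoidalPreadditive.whiskerLeft_add,
              MonoidalLinear.smul_whiskerRight, MonoidalLinear.whiskerLeft_smul, Preadditive.add_comp,
              Preadditive.comp_add, Linear.smul_comp, Linear.comp_smul] at h h' ⊢
            linear_combination (norm := module) h + h'
          | smul a x h =>
            simp only [MonoidalCategory.tensorHom_def, InfData.h, map_add, map_smul, LinearMap.add_apply,
              LinearMap.smul_apply, MonoidalPreadditive.add_whiskerRight, MonoidalPreadditive.whiskerLeft_add,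
              MonoidalLinear.smul_whiskerRight, MonoidalLinear.whiskerLeft_smul, Preadditive.add_comp,
              Preadditive.comp_add, Linear.smul_comp, Linear.comp_smul] at h ⊢
            linear_combination (norm := module) a • h
          | up g =>
            simp only [InfData.h, up_tensorHom, baseChange_app, baseChange_hty, up_comp, up_add, up_sub, bd_upH,
              post_upH, pre_upH, wl_upH, wr_upH, up_whiskerRight, whiskerLeft_up, associator_hom,
              associator_inv, braiding_up, upH_add, upH_sub, upH_neg, twoBaseChange_eq]
            exact congrArg up (ht.natural f g)
  natural_left {U U' V V'} q g := by
    induction q using hty_induction with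
      | add x y h h' =>
        simp only [MonoidalCategory.tensorHom_def, InfData.h, map_add, map_smul, LinearMap.add_apply,
          LinearMap.smul_apply, MonoidalPreadditive.add_whiskerRight, MonoidalPreadditive.whiskerLeft_add,
          MonoidalLinear.smul_whiskerRight, MonoidalLinear.whiskerLeft_smul, Preadditive.add_comp,
          Preadditive.comp_add, Linear.smul_comp, Linear.comp_smul] at h h' ⊢
        linear_combination (norm := module) h + h'
      | smul a x h =>
        simp only [MonoidalCategory.tensorHom_def, InfData.h, map_add, map_smul, LinearMap.add_apply,
          LinearMap.smul_apply, MonoidalPreadditive.add_whiskerRight, MonoidalPreadditive.whiskerLeft_add,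
          MonoidalLinear.smul_whiskerRight, MonoidalLinear.whiskerLeft_smul, Preadditive.add_comp,
          Preadditive.comp_add, Linear.smul_comp, Linear.comp_smul] at h ⊢
        linear_combination (norm := module) a • h
      | up q =>
        induction g using hom_induction with
          | add x y h h' =>
            simp only [MonoidalCategory.tensorHom_def, InfData.h, map_add, map_smul, LinearMap.add_apply,
              LinearMap.smul_apply, MonoidalPreadditive.add_whiskerRight, MonoidalPreadditive.whiskerLeft_add,
              MonoidalLinear.smul_whiskerRight, MonoidalLinear.whiskerLeft_smul, Preadditive.add_comp,
              Preadditive.comp_add, Linear.smul_comp, Linear.comp_smul] at h h' ⊢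
            linear_combination (norm := module) h + h'
          | smul a x h =>
            simp only [MonoidalCategory.tensorHom_def, InfData.h, map_add, map_smul, LinearMap.add_apply,
              LinearMap.smul_apply, MonoidalPreadditive.add_whiskerRight, MonoidalPreadditive.whiskerLeft_add,
              MonoidalLinear.smul_whiskerRight, MonoidalLinear.whiskerLeft_smul, Preadditive.add_comp,
              Preadditive.comp_add, Linear.smul_comp, Linear.comp_smul] at h ⊢
            linear_combination (norm := module) a • h
          | up g =>
            simp only [InfData.h, up_tensorHom, baseChange_app, baseChange_hty, up_comp, up_add, up_sub, bd_upH,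
              post_upH, pre_upH, wl_upH, wr_upH, up_whiskerRight, whiskerLeft_up, associator_hom,
              associator_inv, braiding_up, upH_add, upH_sub, upH_neg, twoBaseChange_eq]
            exact congrArg upH (ht.natural_left q g)
  natural_right {U U' V V'} f q := by
    induction f using hom_induction with
      | add x y h h' =>
        simp only [MonoidalCategory.tensorHom_def, InfData.h, map_add, map_smul, LinearMap.add_apply,
          LinearMap.smul_apply, MonoidalPreadditive.add_whiskerRight, MonoidalPreadditive.whiskerLeft_add,
          MonoidalLinear.smul_whiskerRight, MonoidalLinear.whiskerLeft_smul, Preadditive.add_comp,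
          Preadditive.comp_add, Linear.smul_comp, Linear.comp_smul] at h h' ⊢
        linear_combination (norm := module) h + h'
      | smul a x h =>
        simp only [MonoidalCategory.tensorHom_def, InfData.h, map_add, map_smul, LinearMap.add_apply,
          LinearMap.smul_apply, MonoidalPreadditive.add_whiskerRight, MonoidalPreadditive.whiskerLeft_add,
          MonoidalLinear.smul_whiskerRight, MonoidalLinear.whiskerLeft_smul, Preadditive.add_comp,
          Preadditive.comp_add, Linear.smul_comp, Linear.comp_smul] at h ⊢
        linear_combination (norm := module) a • h
      | up f =>
        induction q using hty_induction with
          | add x y h h' =>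
            simp only [MonoidalCategory.tensorHom_def, InfData.h, map_add, map_smul, LinearMap.add_apply,
              LinearMap.smul_apply, MonoidalPreadditive.add_whiskerRight, MonoidalPreadditive.whiskerLeft_add,
              MonoidalLinear.smul_whiskerRight, MonoidalLinear.whiskerLeft_smul, Preadditive.add_comp,
              Preadditive.comp_add, Linear.smul_comp, Linear.comp_smul] at h h' ⊢
            linear_combination (norm := module) h + h'
          | smul a x h =>
            simp only [MonoidalCategory.tensorHom_def, InfData.h, map_add, map_smul, LinearMap.add_apply,
              LinearMap.smul_apply, MonoidalPreadditive.add_whiskerRight, MonoidalPreadditive.whiskerLeft_add,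
              MonoidalLinear.smul_whiskerRight, MonoidalLinear.whiskerLeft_smul, Preadditive.add_comp,
              Preadditive.comp_add, Linear.smul_comp, Linear.comp_smul] at h ⊢
            linear_combination (norm := module) a • h
          | up q =>
            simp only [InfData.h, up_tensorHom, baseChange_app, baseChange_hty, up_comp, up_add, up_sub, bd_upH,
              post_upH, pre_upH, wl_upH, wr_upH, up_whiskerRight, whiskerLeft_up, associator_hom,
              associator_inv, braiding_up, upH_add, upH_sub, upH_neg, twoBaseChange_eq]
            exact congrArg upH (ht.natural_right f q)
  unit U V := by
    simp only [InfData.h, up_id, associator_hom, leftUnitor_up, rightUnitor_up, braiding_up,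
      baseChange_hty]
    exact (congrArg upH (ht.unit _ _)).trans upH_zero
  comp {U U' U'' V V' V''} f' f g' g := by
    induction f' using hom_induction with
      | add x y h h' =>
        simp only [MonoidalCategory.tensorHom_def, InfData.h, map_add, map_smul, LinearMap.add_apply,
          LinearMap.smul_apply, MonoidalPreadditive.add_whiskerRight, MonoidalPreadditive.whiskerLeft_add,
          MonoidalLinear.smul_whiskerRight, MonoidalLinear.whiskerLeft_smul, Preadditive.add_comp,
          Preadditive.comp_add, Linear.smul_comp, Linear.comp_smul] at h h' ⊢
        linear_combination (norm := module) h + h'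
      | smul a x h =>
        simp only [MonoidalCategory.tensorHom_def, InfData.h, map_add, map_smul, LinearMap.add_apply,
          LinearMap.smul_apply, MonoidalPreadditive.add_whiskerRight, MonoidalPreadditive.whiskerLeft_add,
          MonoidalLinear.smul_whiskerRight, MonoidalLinear.whiskerLeft_smul, Preadditive.add_comp,
          Preadditive.comp_add, Linear.smul_comp, Linear.comp_smul] at h ⊢
        linear_combination (norm := module) a • h
      | up f' =>
        induction f using hom_induction with
          | add x y h h' =>
            simp only [MonoidalCategory.tensorHom_def, InfData.h, map_add, map_smul, LinearMap.add_apply,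
              LinearMap.smul_apply, MonoidalPreadditive.add_whiskerRight, MonoidalPreadditive.whiskerLeft_add,
              MonoidalLinear.smul_whiskerRight, MonoidalLinear.whiskerLeft_smul, Preadditive.add_comp,
              Preadditive.comp_add, Linear.smul_comp, Linear.comp_smul] at h h' ⊢
            linear_combination (norm := module) h + h'
          | smul a x h =>
            simp only [MonoidalCategory.tensorHom_def, InfData.h, map_add, map_smul, LinearMap.add_apply,
              LinearMap.smul_apply, MonoidalPreadditive.add_whiskerRight, MonoidalPreadditive.whiskerLeft_add,
              MonoidalLinear.smul_whiskerRight, MonoidalLinear.whiskerLeft_smul, Preadditive.add_comp,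
              Preadditive.comp_add, Linear.smul_comp, Linear.comp_smul] at h ⊢
            linear_combination (norm := module) a • h
          | up f =>
            induction g' using hom_induction with
              | add x y h h' =>
                simp only [MonoidalCategory.tensorHom_def, InfData.h, map_add, map_smul, LinearMap.add_apply,
                  LinearMap.smul_apply, MonoidalPreadditive.add_whiskerRight, MonoidalPreadditive.whiskerLeft_add,
                  MonoidalLinear.smul_whiskerRight, MonoidalLinear.whiskerLeft_smul, Preadditive.add_comp,
                  Preadditive.comp_add, Linear.smul_comp, Linear.comp_smul] at h h' ⊢
                linear_combination (norm := module) h + h'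
              | smul a x h =>
                simp only [MonoidalCategory.tensorHom_def, InfData.h, map_add, map_smul, LinearMap.add_apply,
                  LinearMap.smul_apply, MonoidalPreadditive.add_whiskerRight, MonoidalPreadditive.whiskerLeft_add,
                  MonoidalLinear.smul_whiskerRight, MonoidalLinear.whiskerLeft_smul, Preadditive.add_comp,
                  Preadditive.comp_add, Linear.smul_comp, Linear.comp_smul] at h ⊢
                linear_combination (norm := module) a • h
              | up g' =>
                induction g using hom_induction with
                  | add x y h h' =>
                    simp only [MonoidalCategory.tensorHom_def, InfData.h, map_add, map_smul, LinearMap.add_apply,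
                      LinearMap.smul_apply, MonoidalPreadditive.add_whiskerRight, MonoidalPreadditive.whiskerLeft_add,
                      MonoidalLinear.smul_whiskerRight, MonoidalLinear.whiskerLeft_smul, Preadditive.add_comp,
                      Preadditive.comp_add, Linear.smul_comp, Linear.comp_smul] at h h' ⊢
                    linear_combination (norm := module) h + h'
                  | smul a x h =>
                    simp only [MonoidalCategory.tensorHom_def, InfData.h, map_add, map_smul, LinearMap.add_apply,
                      LinearMap.smul_apply, MonoidalPreadditive.add_whiskerRight, MonoidalPreadditive.whiskerLeft_add,
                      MonoidalLinear.smul_whiskerRight, MonoidalLinear.whiskerLeft_smul, Preadditive.add_comp,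
                      Preadditive.comp_add, Linear.smul_comp, Linear.comp_smul] at h ⊢
                    linear_combination (norm := module) a • h
                  | up g =>
                    simp only [InfData.h, up_tensorHom, baseChange_app, baseChange_hty, up_comp, up_add, up_sub, bd_upH,
                      post_upH, pre_upH, wl_upH, wr_upH, up_whiskerRight, whiskerLeft_up, associator_hom,
                      associator_inv, braiding_up, upH_add, upH_sub, upH_neg, twoBaseChange_eq]
                    exact congrArg upH (ht.comp f' f g' g)
  assoc_left U V W X := by
    simp only [InfData.h, up_id, associator_hom, leftUnitor_up, rightUnitor_up, braiding_up,
      baseChange_hty]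
    exact (congrArg upH (ht.assoc_left _ _ _ _)).trans upH_zero
  assoc_right U V W X := by
    simp only [InfData.h, up_id, associator_hom, leftUnitor_up, rightUnitor_up, braiding_up,
      baseChange_hty]
    exact (congrArg upH (ht.assoc_right _ _ _ _)).trans upH_zero
  leftUnitor_left U X := by
    simp only [InfData.h, up_id, associator_hom, leftUnitor_up, rightUnitor_up, braiding_up,
      baseChange_hty]
    exact (congrArg upH (ht.leftUnitor_left _ _)).trans upH_zero
  leftUnitor_right U X := by
    simp only [InfData.h, up_id, associator_hom, leftUnitor_up, rightUnitor_up, braiding_up,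
      baseChange_hty]
    exact (congrArg upH (ht.leftUnitor_right _ _)).trans upH_zero
  rightUnitor_left U X := by
    simp only [InfData.h, up_id, associator_hom, leftUnitor_up, rightUnitor_up, braiding_up,
      baseChange_hty]
    exact (congrArg upH (ht.rightUnitor_left _ _)).trans upH_zero
  rightUnitor_right U X := by
    simp only [InfData.h, up_id, associator_hom, leftUnitor_up, rightUnitor_up, braiding_up,
      baseChange_hty]
    exact (congrArg upH (ht.rightUnitor_right _ _)).trans upH_zero

theorem baseChange_isStrict (hst : t.IsStrict) : (t.baseChange A).IsStrict where
  left U V W := by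
    simp only [InfData.h, up_tensorHom, baseChange_app, baseChange_hty, up_comp, up_add, up_sub, bd_upH,
      post_upH, pre_upH, wl_upH, wr_upH, up_whiskerRight, whiskerLeft_up, associator_hom,
      associator_inv, braiding_up, upH_add, upH_sub, upH_neg, twoBaseChange_eq]
    exact congrArg up (hst.left U.of V.of W.of)
  left_hty {U U' V V' W W'} f g k := by
    induction f using hom_induction with
      | add x y h h' =>
        simp only [MonoidalCategory.tensorHom_def, InfData.h, map_add, map_smul, LinearMap.add_apply,
          LinearMap.smul_apply, MonoidalPreadditive.add_whiskerRight, MonoidalPreadditive.whiskerLeft_add,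
          MonoidalLinear.smul_whiskerRight, MonoidalLinear.whiskerLeft_smul, Preadditive.add_comp,
          Preadditive.comp_add, Linear.smul_comp, Linear.comp_smul] at h h' ⊢
        linear_combination (norm := module) h + h'
      | smul a x h =>
        simp only [MonoidalCategory.tensorHom_def, InfData.h, map_add, map_smul, LinearMap.add_apply,
          LinearMap.smul_apply, MonoidalPreadditive.add_whiskerRight, MonoidalPreadditive.whiskerLeft_add,
          MonoidalLinear.smul_whiskerRight, MonoidalLinear.whiskerLeft_smul, Preadditive.add_comp,
          Preadditive.comp_add, Linear.smul_comp, Linear.comp_smul] at h ⊢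
        linear_combination (norm := module) a • h
      | up f =>
        induction g using hom_induction with
          | add x y h h' =>
            simp only [MonoidalCategory.tensorHom_def, InfData.h, map_add, map_smul, LinearMap.add_apply,
              LinearMap.smul_apply, MonoidalPreadditive.add_whiskerRight, MonoidalPreadditive.whiskerLeft_add,
              MonoidalLinear.smul_whiskerRight, MonoidalLinear.whiskerLeft_smul, Preadditive.add_comp,
              Preadditive.comp_add, Linear.smul_comp, Linear.comp_smul] at h h' ⊢
            linear_combination (norm := module) h + h'
          | smul a x h =>
            simp only [MonoidalCategory.tensorHom_def, InfData.h, map_add, map_smul, LinearMap.add_apply,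
              LinearMap.smul_apply, MonoidalPreadditive.add_whiskerRight, MonoidalPreadditive.whiskerLeft_add,
              MonoidalLinear.smul_whiskerRight, MonoidalLinear.whiskerLeft_smul, Preadditive.add_comp,
              Preadditive.comp_add, Linear.smul_comp, Linear.comp_smul] at h ⊢
            linear_combination (norm := module) a • h
          | up g =>
            induction k using hom_induction with
              | add x y h h' =>
                simp only [MonoidalCategory.tensorHom_def, InfData.h, map_add, map_smul, LinearMap.add_apply,
                  LinearMap.smul_apply, MonoidalPreadditive.add_whiskerRight, MonoidalPreadditive.whiskerLeft_add,
                  MonoidalLinear.smul_whiskerRight, MonoidalLinear.whiskerLeft_smul, Preadditive.add_comp,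
                  Preadditive.comp_add, Linear.smul_comp, Linear.comp_smul] at h h' ⊢
                linear_combination (norm := module) h + h'
              | smul a x h =>
                simp only [MonoidalCategory.tensorHom_def, InfData.h, map_add, map_smul, LinearMap.add_apply,
                  LinearMap.smul_apply, MonoidalPreadditive.add_whiskerRight, MonoidalPreadditive.whiskerLeft_add,
                  MonoidalLinear.smul_whiskerRight, MonoidalLinear.whiskerLeft_smul, Preadditive.add_comp,
                  Preadditive.comp_add, Linear.smul_comp, Linear.comp_smul] at h ⊢
                linear_combination (norm := module) a • h
              | up k =>
                simp only [InfData.h, up_tensorHom, baseChange_app, baseChange_hty, up_comp, up_add, up_sub, bd_upH,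
                  post_upH, pre_upH, wl_upH, wr_upH, up_whiskerRight, whiskerLeft_up, associator_hom,
                  associator_inv, braiding_up, upH_add, upH_sub, upH_neg, twoBaseChange_eq]
                exact congrArg upH (hst.left_hty f g k)
  right U V W := by
    simp only [InfData.h, up_tensorHom, baseChange_app, baseChange_hty, up_comp, up_add, up_sub, bd_upH,
      post_upH, pre_upH, wl_upH, wr_upH, up_whiskerRight, whiskerLeft_up, associator_hom,
      associator_inv, braiding_up, upH_add, upH_sub, upH_neg, twoBaseChange_eq]
    exact congrArg up (hst.right U.of V.of W.of)
  right_hty {U U' V V' W W'} f g k := by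
    induction f using hom_induction with
      | add x y h h' =>
        simp only [MonoidalCategory.tensorHom_def, InfData.h, map_add, map_smul, LinearMap.add_apply,
          LinearMap.smul_apply, MonoidalPreadditive.add_whiskerRight, MonoidalPreadditive.whiskerLeft_add,
          MonoidalLinear.smul_whiskerRight, MonoidalLinear.whiskerLeft_smul, Preadditive.add_comp,
          Preadditive.comp_add, Linear.smul_comp, Linear.comp_smul] at h h' ⊢
        linear_combination (norm := module) h + h'
      | smul a x h =>
        simp only [MonoidalCategory.tensorHom_def, InfData.h, map_add, map_smul, LinearMap.add_apply,
          LinearMap.smul_apply, MonoidalPreadditive.add_whiskerRight, MonoidalPreadditive.whiskerLeft_add,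
          MonoidalLinear.smul_whiskerRight, MonoidalLinear.whiskerLeft_smul, Preadditive.add_comp,
          Preadditive.comp_add, Linear.smul_comp, Linear.comp_smul] at h ⊢
        linear_combination (norm := module) a • h
      | up f =>
        induction g using hom_induction with
          | add x y h h' =>
            simp only [MonoidalCategory.tensorHom_def, InfData.h, map_add, map_smul, LinearMap.add_apply,
              LinearMap.smul_apply, MonoidalPreadditive.add_whiskerRight, MonoidalPreadditive.whiskerLeft_add,
              MonoidalLinear.smul_whiskerRight, MonoidalLinear.whiskerLeft_smul, Preadditive.add_comp,
              Preadditive.comp_add, Linear.smul_comp, Linear.comp_smul] at h h' ⊢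
            linear_combination (norm := module) h + h'
          | smul a x h =>
            simp only [MonoidalCategory.tensorHom_def, InfData.h, map_add, map_smul, LinearMap.add_apply,
              LinearMap.smul_apply, MonoidalPreadditive.add_whiskerRight, MonoidalPreadditive.whiskerLeft_add,
              MonoidalLinear.smul_whiskerRight, MonoidalLinear.whiskerLeft_smul, Preadditive.add_comp,
              Preadditive.comp_add, Linear.smul_comp, Linear.comp_smul] at h ⊢
            linear_combination (norm := module) a • h
          | up g =>
            induction k using hom_induction with
              | add x y h h' =>
                simp only [MonoidalCategory.tensorHom_def, InfData.h, map_add, map_smul, LinearMap.add_apply,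
                  LinearMap.smul_apply, MonoidalPreadditive.add_whiskerRight, MonoidalPreadditive.whiskerLeft_add,
                  MonoidalLinear.smul_whiskerRight, MonoidalLinear.whiskerLeft_smul, Preadditive.add_comp,
                  Preadditive.comp_add, Linear.smul_comp, Linear.comp_smul] at h h' ⊢
                linear_combination (norm := module) h + h'
              | smul a x h =>
                simp only [MonoidalCategory.tensorHom_def, InfData.h, map_add, map_smul, LinearMap.add_apply,
                  LinearMap.smul_apply, MonoidalPreadditive.add_whiskerRight, MonoidalPreadditive.whiskerLeft_add,
                  MonoidalLinear.smul_whiskerRight, MonoidalLinear.whiskerLeft_smul, Preadditive.add_comp,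
                  Preadditive.comp_add, Linear.smul_comp, Linear.comp_smul] at h ⊢
                linear_combination (norm := module) a • h
              | up k =>
                simp only [InfData.h, up_tensorHom, baseChange_app, baseChange_hty, up_comp, up_add, up_sub, bd_upH,
                  post_upH, pre_upH, wl_upH, wr_upH, up_whiskerRight, whiskerLeft_up, associator_hom,
                  associator_inv, braiding_up, upH_add, upH_sub, upH_neg, twoBaseChange_eq]
                exact congrArg upH (hst.right_hty f g k)

theorem baseChange_isSymmetric (hs : t.IsSymmetric) : (t.baseChange A).IsSymmetric where
  app U V := by
    simp only [InfData.h, up_tensorHom, baseChange_app, baseChange_hty, up_comp, up_add, up_sub, bd_upH,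
      post_upH, pre_upH, wl_upH, wr_upH, up_whiskerRight, whiskerLeft_up, associator_hom,
      associator_inv, braiding_up, upH_add, upH_sub, upH_neg, twoBaseChange_eq]
    exact congrArg up (hs.app U.of V.of)
  hty {U U' V V'} f g := by
    induction f using hom_induction with
      | add x y h h' =>
        simp only [MonoidalCategory.tensorHom_def, InfData.h, map_add, map_smul, LinearMap.add_apply,
          LinearMap.smul_apply, MonoidalPreadditive.add_whiskerRight, MonoidalPreadditive.whiskerLeft_add,
          MonoidalLinear.smul_whiskerRight, MonoidalLinear.whiskerLeft_smul, Preadditive.add_comp,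
          Preadditive.comp_add, Linear.smul_comp, Linear.comp_smul] at h h' ⊢
        linear_combination (norm := module) h + h'
      | smul a x h =>
        simp only [MonoidalCategory.tensorHom_def, InfData.h, map_add, map_smul, LinearMap.add_apply,
          LinearMap.smul_apply, MonoidalPreadditive.add_whiskerRight, MonoidalPreadditive.whiskerLeft_add,
          MonoidalLinear.smul_whiskerRight, MonoidalLinear.whiskerLeft_smul, Preadditive.add_comp,
          Preadditive.comp_add, Linear.smul_comp, Linear.comp_smul] at h ⊢
        linear_combination (norm := module) a • h
      | up f =>
        induction g using hom_induction with
          | add x y h h' =>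
            simp only [MonoidalCategory.tensorHom_def, InfData.h, map_add, map_smul, LinearMap.add_apply,
              LinearMap.smul_apply, MonoidalPreadditive.add_whiskerRight, MonoidalPreadditive.whiskerLeft_add,
              MonoidalLinear.smul_whiskerRight, MonoidalLinear.whiskerLeft_smul, Preadditive.add_comp,
              Preadditive.comp_add, Linear.smul_comp, Linear.comp_smul] at h h' ⊢
            linear_combination (norm := module) h + h'
          | smul a x h =>
            simp only [MonoidalCategory.tensorHom_def, InfData.h, map_add, map_smul, LinearMap.add_apply,
              LinearMap.smul_apply, MonoidalPreadditive.add_whiskerRight, MonoidalPreadditive.whiskerLeft_add,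
              MonoidalLinear.smul_whiskerRight, MonoidalLinear.whiskerLeft_smul, Preadditive.add_comp,
              Preadditive.comp_add, Linear.smul_comp, Linear.comp_smul] at h ⊢
            linear_combination (norm := module) a • h
          | up g =>
            simp only [InfData.h, up_tensorHom, baseChange_app, baseChange_hty, up_comp, up_add, up_sub, bd_upH,
              post_upH, pre_upH, wl_upH, wr_upH, up_whiskerRight, whiskerLeft_up, associator_hom,
              associator_inv, braiding_up, upH_add, upH_sub, upH_neg, twoBaseChange_eq]
            exact congrArg upH (hs.hty f g)

theorem baseChange_isTotallySymmetric (hs : t.IsTotallySymmetric) :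
    (t.baseChange A).IsTotallySymmetric where
  toIsSymmetric := baseChange_isSymmetric hs.toIsSymmetric
  hty_symm U V W := by
    simp only [InfData.h, up_id, associator_hom, leftUnitor_up, rightUnitor_up, braiding_up,
      baseChange_hty]
    exact (congrArg upH (hs.hty_symm _ _ _)).trans upH_zero

theorem baseChange_isBreen (hb : t.IsBreen) : (t.baseChange A).IsBreen := fun U V W => by
  simp only [up_id, InfData.h, up_tensorHom, baseChange_app, baseChange_hty, up_comp, up_add, up_sub, bd_upH,
    post_upH, pre_upH, wl_upH, wr_upH, up_whiskerRight, whiskerLeft_up, associator_hom,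
    associator_inv, braiding_up, upH_add, upH_sub, upH_neg, twoBaseChange_eq]
  exact (congrArg upH (hb _ _ _)).trans upH_zero

theorem baseChange_isCoherent (hc : t.IsCoherent) : (t.baseChange A).IsCoherent where
  left U V W := by
    simp only [InfData.fourTermL, InfData.fourTermR, up_id, InfData.h, up_tensorHom, baseChange_app, baseChange_hty, up_comp, up_add, up_sub, bd_upH,
      post_upH, pre_upH, wl_upH, wr_upH, up_whiskerRight, whiskerLeft_up, associator_hom,
      associator_inv, braiding_up, upH_add, upH_sub, upH_neg, twoBaseChange_eq]
    exact congrArg upH (hc.left _ _ _)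
  right U V W := by
    simp only [InfData.fourTermL, InfData.fourTermR, up_id, InfData.h, up_tensorHom, baseChange_app, baseChange_hty, up_comp, up_add, up_sub, bd_upH,
      post_upH, pre_upH, wl_upH, wr_upH, up_whiskerRight, whiskerLeft_up, associator_hom,
      associator_inv, braiding_up, upH_add, upH_sub, upH_neg, twoBaseChange_eq]
    exact congrArg upH (hc.right _ _ _)

theorem baseChange_isCoboundarySyllepsis {T : ∀ U V : C, H K (U ⊗ V) (U ⊗ V)}
    (hT : t.IsCoboundarySyllepsis T) :
    (t.baseChange A).IsCoboundarySyllepsis (twoBaseChange A T) where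
  homotopy U V := by
    simp only [InfData.h, up_tensorHom, baseChange_app, baseChange_hty, up_comp, up_add, up_sub, bd_upH,
      post_upH, pre_upH, wl_upH, wr_upH, up_whiskerRight, whiskerLeft_up, associator_hom,
      associator_inv, braiding_up, upH_add, upH_sub, upH_neg, twoBaseChange_eq]
    exact congrArg up (hT.homotopy U.of V.of)
  quasinatural {U U' V V'} f g := by
    induction f using hom_induction with
      | add x y h h' =>
        simp only [MonoidalCategory.tensorHom_def, InfData.h, map_add, map_smul, LinearMap.add_apply,
          LinearMap.smul_apply, MonoidalPreadditive.add_whiskerRight, MonoidalPreadditive.whiskerLeft_add,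
          MonoidalLinear.smul_whiskerRight, MonoidalLinear.whiskerLeft_smul, Preadditive.add_comp,
          Preadditive.comp_add, Linear.smul_comp, Linear.comp_smul] at h h' ⊢
        linear_combination (norm := module) h + h'
      | smul a x h =>
        simp only [MonoidalCategory.tensorHom_def, InfData.h, map_add, map_smul, LinearMap.add_apply,
          LinearMap.smul_apply, MonoidalPreadditive.add_whiskerRight, MonoidalPreadditive.whiskerLeft_add,
          MonoidalLinear.smul_whiskerRight, MonoidalLinear.whiskerLeft_smul, Preadditive.add_comp,
          Preadditive.comp_add, Linear.smul_comp, Linear.comp_smul] at h ⊢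
        linear_combination (norm := module) a • h
      | up f =>
        induction g using hom_induction with
          | add x y h h' =>
            simp only [MonoidalCategory.tensorHom_def, InfData.h, map_add, map_smul, LinearMap.add_apply,
              LinearMap.smul_apply, MonoidalPreadditive.add_whiskerRight, MonoidalPreadditive.whiskerLeft_add,
              MonoidalLinear.smul_whiskerRight, MonoidalLinear.whiskerLeft_smul, Preadditive.add_comp,
              Preadditive.comp_add, Linear.smul_comp, Linear.comp_smul] at h h' ⊢
            linear_combination (norm := module) h + h'
          | smul a x h =>
            simp only [MonoidalCategory.tensorHom_def, InfData.h, map_add, map_smul, LinearMap.add_apply,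
              LinearMap.smul_apply, MonoidalPreadditive.add_whiskerRight, MonoidalPreadditive.whiskerLeft_add,
              MonoidalLinear.smul_whiskerRight, MonoidalLinear.whiskerLeft_smul, Preadditive.add_comp,
              Preadditive.comp_add, Linear.smul_comp, Linear.comp_smul] at h ⊢
            linear_combination (norm := module) a • h
          | up g =>
            simp only [InfData.h, up_tensorHom, baseChange_app, baseChange_hty, up_comp, up_add, up_sub, bd_upH,
              post_upH, pre_upH, wl_upH, wr_upH, up_whiskerRight, whiskerLeft_up, associator_hom,
              associator_inv, braiding_up, upH_add, upH_sub, upH_neg, twoBaseChange_eq]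
            exact congrArg upH (hT.quasinatural f g)
  left U V W := by
    simp only [InfData.h, up_tensorHom, baseChange_app, baseChange_hty, up_comp, up_add, up_sub, bd_upH,
      post_upH, pre_upH, wl_upH, wr_upH, up_whiskerRight, whiskerLeft_up, associator_hom,
      associator_inv, braiding_up, upH_add, upH_sub, upH_neg, twoBaseChange_eq]
    exact congrArg upH (hT.left U.of V.of W.of)
  right U V W := by
    simp only [InfData.h, up_tensorHom, baseChange_app, baseChange_hty, up_comp, up_add, up_sub, bd_upH,
      post_upH, pre_upH, wl_upH, wr_upH, up_whiskerRight, whiskerLeft_up, associator_hom,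
      associator_inv, braiding_up, upH_add, upH_sub, upH_neg, twoBaseChange_eq]
    exact congrArg upH (hT.right U.of V.of W.of)
  symmetric U V := by
    simp only [InfData.h, up_tensorHom, baseChange_app, baseChange_hty, up_comp, up_add, up_sub, bd_upH,
      post_upH, pre_upH, wl_upH, wr_upH, up_whiskerRight, whiskerLeft_up, associator_hom,
      associator_inv, braiding_up, upH_add, upH_sub, upH_neg, twoBaseChange_eq]
    exact congrArg upH (hT.symmetric U.of V.of)

end
end BaseChange
end BaseChangeLaws
end Syl

namespace Syl

open TwoCells TwoCellsMonoidal BaseChange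

section Deform

theorem InfData.IsTotallySymmetric.h_id_braid {R C : Type*} [CommRing R] [Category C]
    [Preadditive C] [Linear R C] [MonoidalCategory C] [MonoidalPreadditive C] [MonoidalLinear R C]
    [SymmetricCategory C] [TwoCells R C] [TwoCellsMonoidal R C] {t : InfData R C}
    (h : t.IsTotallySymmetric) (U V W : C) : t.h (𝟙 W) (β_ U V).hom = 0 := by
  have e := h.hty (𝟙 W) (β_ U V).hom
  rw [h.hty_symm, map_zero, LinearMap.zero_apply] at e
  have := congrArg (fun q => post (R := R) _ _ _ (β_ W (V ⊗ U)).inv q) e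
  simpa only [← post_comp, Iso.hom_inv_id, post_id, map_zero] using this

namespace Trunc

variable (K : Type*) [Field K]

theorem h_pow (n : ℕ) : h K n ^ n = 0 := by
  rw [h, AdjoinRoot.root, ← map_pow, AdjoinRoot.mk_self]

theorem h_ne_zero : h K 2 ≠ 0 := by
  rw [h, AdjoinRoot.root, Ne, AdjoinRoot.mk_eq_zero]
  intro hd
  have := Polynomial.natDegree_le_of_dvd hd Polynomial.X_ne_zero
  simp at this

variable {K} in
theorem smul_tmul_injective {M : Type*} [AddCommGroup M] [Module K M] {x y : M}
    (e : h K 2 • ((1 : Trunc K 2) ⊗ₜ[K] x) = h K 2 • ((1 : Trunc K 2) ⊗ₜ[K] y)) : x = y := by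
  obtain ⟨φ, hφ⟩ : ∃ φ : Module.Dual K (Trunc K 2), φ (h K 2) ≠ 0 := by
    by_contra! hc
    exact h_ne_zero K ((Module.forall_dual_apply_eq_zero_iff K _).1 hc)
  rw [TensorProduct.smul_tmul', TensorProduct.smul_tmul', smul_eq_mul, mul_one] at e
  have := congrArg (fun z => TensorProduct.lid K M (φ.rTensor M z)) e
  simpa [hφ] using this

end Trunc

section Quadratic

variable {R : Type*} [CommRing R] {C : Type*} [Category C] [Preadditive C] [Linear R C]
  [MonoidalCategory C] [MonoidalPreadditive C] [MonoidalLinear R C] [SymmetricCategory C]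
  [TwoCells R C] [TwoCellsMonoidal R C] (K : Type*) [Field K] [Algebra K R] (c : R)

theorem InfData.firstOrder_eq_quad (t : InfData R C) :
    t.firstOrder K c = t.quad (algebraMap K R (1 / 2) * c) 0 := by
  unfold InfData.firstOrder InfData.quad
  congr 1 <;> funext
  all_goals simp [asFam, asInvFam, brFam, brInvFam]

theorem InfData.secondOrder_eq_quad [CharZero K] (t : InfData R C) :
    t.secondOrder K c = t.quad (algebraMap K R (1 / 2) * c) (algebraMap K R (1 / 24) * c ^ 2) := by
  have e : 3 * (algebraMap K R (1 / 24) * c ^ 2) = algebraMap K R (1 / 8) * c ^ 2 := by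
    rw [← mul_assoc, ← map_ofNat (algebraMap K R) 3, ← map_mul]
    norm_num
  have e' : ∀ U V W : C, t.comm U V W = commFam t.app U V W :=
    fun U V W => by rw [InfData.comm, InfData.app23_eq]; rfl
  unfold InfData.secondOrder InfData.quad
  rw [e]
  congr 1
  · funext U V W
    simp only [asFam, e']
  · funext U V W
    simp only [asInvFam, e']
  · funext U V
    simp only [brFam, e]
  · funext U V
    simp only [brInvFam, e]

end Quadratic

section
variable {K A C : Type*} [Field K] [CommRing A] [Algebra K A] [Category C] [Preadditive C]
  [Linear K C] [MonoidalCategory C] [MonoidalPreadditive C] [MonoidalLinear K C]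
  [SymmetricCategory C] [TwoCells K C] [TwoCellsMonoidal K C] {t : InfData K C}

theorem isCoboundarySyllepsis_of_baseChange {T : ∀ U V : C, H K (U ⊗ V) (U ⊗ V)} {c : A}
    (i₁ : ∀ {X Y : C} (f g : X ⟶ Y), c • ((1 : A) ⊗ₜ[K] f) = c • ((1 : A) ⊗ₜ[K] g) → f = g)
    (i₂ : ∀ {X Y : C} (f g : H K X Y), c • ((1 : A) ⊗ₜ[K] f) = c • ((1 : A) ⊗ₜ[K] g) → f = g)
    (h₁ : ∀ U V : BaseChange K A C, c • ∂[A] (twoBaseChange A T U V) = c • (t.baseChange A).app U V)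
    (h₂ : ∀ {U U' V V' : BaseChange K A C} (f : U ⟶ U') (g : V ⟶ V'),
      c • ((f ⊗ₘ g) ⊳[A] twoBaseChange A T U V - twoBaseChange A T U' V' ⊲[A] (f ⊗ₘ g)) =
        c • (t.baseChange A).h f g)
    (h₃ : ∀ U V W : BaseChange K A C,
      c • (α_ U V W).inv ⊳[A] twoBaseChange A T U (V ⊗ W) ⊲[A] (α_ U V W).hom =
        c • (wr _ _ W (twoBaseChange A T U V) + ((β_ V U).hom ▷ W) ⊳[A] (α_ V U W).inv ⊳[A]
          wl V _ _ (twoBaseChange A T U W) ⊲[A] (α_ V U W).hom ⊚ ((β_ U V).hom ▷ W)))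
    (h₄ : ∀ U V W : BaseChange K A C,
      c • (α_ U V W).hom ⊳[A] twoBaseChange A T (U ⊗ V) W ⊲[A] (α_ U V W).inv =
        c • (wl U _ _ (twoBaseChange A T V W) + (U ◁ (β_ W V).hom) ⊳[A] (α_ U W V).hom ⊳[A]
          wr _ _ V (twoBaseChange A T U W) ⊲[A] (α_ U W V).inv ⊚ (U ◁ (β_ V W).hom)))
    (h₅ : ∀ U V : BaseChange K A C, c • twoBaseChange A T U V =
      c • (β_ V U).hom ⊳[A] twoBaseChange A T V U ⊲[A] (β_ U V).hom) :
    t.IsCoboundarySyllepsis T := by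
  refine ⟨fun U V => ?_, fun {U U' V V'} f g => ?_, fun U V W => ?_, fun U V W => ?_, fun U V => ?_⟩
  · exact i₁ _ _ (h₁ ⟨U⟩ ⟨V⟩)
  · have := h₂ (up f : (⟨U⟩ : BaseChange K A C) ⟶ ⟨U'⟩) (up g : (⟨V⟩ : BaseChange K A C) ⟶ ⟨V'⟩)
    simp only [InfData.h, up_tensorHom, twoBaseChange_eq, baseChange_hty, post_upH, pre_upH,
      upH_sub] at this
    exact i₂ _ _ this
  · have := h₃ ⟨U⟩ ⟨V⟩ ⟨W⟩
    simp only [twoBaseChange_eq, post_upH, pre_upH, up_comp, wl_upH, wr_upH, up_whiskerRight,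
      whiskerLeft_up, BaseChange.associator_hom, BaseChange.associator_inv, braiding_up,
      upH_add] at this
    exact i₂ _ _ this
  · have := h₄ ⟨U⟩ ⟨V⟩ ⟨W⟩
    simp only [twoBaseChange_eq, post_upH, pre_upH, up_comp, wl_upH, wr_upH, up_whiskerRight,
      whiskerLeft_up, BaseChange.associator_hom, BaseChange.associator_inv, braiding_up,
      upH_add] at this
    exact i₂ _ _ this
  · have := h₅ ⟨U⟩ ⟨V⟩
    simp only [twoBaseChange_eq, post_upH, pre_upH, braiding_up] at this
    exact i₂ _ _ this

end

variable {K C : Type*} [Field K] [CharZero K] [Category C] [Preadditive C] [Linear K C]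
  [MonoidalCategory C] [MonoidalPreadditive C] [MonoidalLinear K C] [SymmetricCategory C]
  [TwoCells K C] [TwoCellsMonoidal K C]

theorem half_add_half {R : Type*} [CommRing R] [Algebra K R] (c : R) :
    c = 2 * (algebraMap K R (1 / 2) * c) := by
  rw [← mul_assoc, ← map_ofNat (algebraMap K R) 2, ← map_mul]
  norm_num

theorem half_sq {R : Type*} [CommRing R] [Algebra K R] (c : R) :
    algebraMap K R (1 / 2) * c * (algebraMap K R (1 / 2) * c) =
      6 * (algebraMap K R (1 / 24) * c ^ 2) := by
  rw [← mul_assoc 6, ← map_ofNat (algebraMap K R) 6, ← map_mul]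
  rw [mul_mul_mul_comm, ← map_mul, ← sq]
  norm_num [sq]

variable {t : InfData K C}

theorem deform1_isBraided (ht : t.IsInfinitesimal2Braiding) (hst : t.IsStrict)
    (hs : t.IsSymmetric) (hb : t.IsBreen) : t.deform1.IsBraided := by
  have e := half_sq (K := K) (Trunc.h K 2)
  rw [Trunc.h_pow, mul_zero] at e
  rw [InfData.deform1, InfData.firstOrder_eq_quad]
  refine InfData.quad_isBraided (baseChange_isInfinitesimal2Braiding ht) (baseChange_isStrict hst) e
    (mul_zero _) (mul_zero _) (.inl rfl) (fun U V W => ?_) (baseChange_isSymmetric hs)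
  exact (congrArg _ (baseChange_isBreen hb U V W)).trans (smul_zero _)

theorem deform1_isSymmetricSyllepsis_iff (ht : t.IsInfinitesimal2Braiding) (hs : t.IsSymmetric)
    (T : ∀ U V : C, H K (U ⊗ V) (U ⊗ V)) :
    t.deform1.IsSymmetricSyllepsis (deformSyllepsis 2 T) ↔ t.IsCoboundarySyllepsis T := by
  have e := half_sq (K := K) (Trunc.h K 2)
  have e' : Trunc.h K 2 * (algebraMap K _ (1 / 2) * Trunc.h K 2) = 0 := by
    linear_combination algebraMap K _ (1 / 2) * Trunc.h_pow K 2
  rw [Trunc.h_pow, mul_zero] at e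
  rw [InfData.deform1, InfData.firstOrder_eq_quad]
  refine (InfData.quad_isSymmetricSyllepsis_iff (baseChange_isInfinitesimal2Braiding ht)
    (baseChange_isSymmetric hs) e (mul_zero _) (mul_zero _) (.inl rfl) (half_add_half (K := K) _)
    (fun U V => by rw [e', zero_smul, zero_smul])).trans ⟨fun h => ?_, fun h => ?_⟩
  · exact isCoboundarySyllepsis_of_baseChange (c := Trunc.h K 2)
      (fun _ _ => Trunc.smul_tmul_injective) (fun _ _ => Trunc.smul_tmul_injective)
      h.1 h.2.1 h.2.2.1 h.2.2.2.1 h.2.2.2.2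
  · have h' := baseChange_isCoboundarySyllepsis (A := Trunc K 2) h
    exact ⟨fun U V => by rw [h'.homotopy], fun f g => by rw [h'.quasinatural],
      fun U V W => by rw [h'.left], fun U V W => by rw [h'.right],
      fun U V => by rw [← h'.symmetric]⟩

theorem secondOrder_scalars :
    (algebraMap K (Trunc K 3) (1 / 2) * Trunc.h K 3) * (algebraMap K _ (1 / 24) * Trunc.h K 3 ^ 2) = 0 ∧
    (algebraMap K (Trunc K 3) (1 / 24) * Trunc.h K 3 ^ 2) *
      (algebraMap K _ (1 / 24) * Trunc.h K 3 ^ 2) = 0 := by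
  have h := Trunc.h_pow K 3
  constructor
  · linear_combination algebraMap K (Trunc K 3) (1 / 2) * algebraMap K _ (1 / 24) * h
  · linear_combination algebraMap K (Trunc K 3) (1 / 24) * algebraMap K _ (1 / 24) * Trunc.h K 3 * h

theorem deform2_isBraided (ht : t.IsInfinitesimal2Braiding) (hst : t.IsStrict)
    (hs : t.IsTotallySymmetric) (hc : t.IsCoherent) : t.deform2.IsBraided := by
  obtain ⟨e, e'⟩ := secondOrder_scalars (K := K)
  have hs' := baseChange_isTotallySymmetric (A := Trunc K 3) hs
  rw [InfData.deform2, InfData.secondOrder_eq_quad]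
  refine InfData.quad_isBraided (baseChange_isInfinitesimal2Braiding ht) (baseChange_isStrict hst)
    (half_sq _) e e' (.inr ⟨hs', baseChange_isCoherent hc⟩) (fun U V W => ?_) hs'.toIsSymmetric
  rw [hs'.h_id_braid, hs'.hty_symm]
  simp

theorem deform2_isSymmetricSyllepsis (ht : t.IsInfinitesimal2Braiding) (hs : t.IsTotallySymmetric)
    (hc : t.IsCoherent) {T : ∀ U V : C, H K (U ⊗ V) (U ⊗ V)} (hT : t.IsCoboundarySyllepsis T) :
    t.deform2.IsSymmetricSyllepsis (deformSyllepsis 3 T) := by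
  obtain ⟨e, e'⟩ := secondOrder_scalars (K := K)
  have hs' := baseChange_isTotallySymmetric (A := Trunc K 3) hs
  have h' := baseChange_isCoboundarySyllepsis (A := Trunc K 3) hT
  rw [InfData.deform2, InfData.secondOrder_eq_quad]
  exact (InfData.quad_isSymmetricSyllepsis_iff (baseChange_isInfinitesimal2Braiding ht)
    hs'.toIsSymmetric (half_sq _) e e' (.inr ⟨hs', baseChange_isCoherent hc⟩) (half_add_half (K := K) _)
    (fun U V => by rw [h'.homotopy])).2 ⟨fun U V => by rw [h'.homotopy],
      fun f g => by rw [h'.quasinatural], fun U V W => by rw [h'.left], fun U V W => by rw [h'.right],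
      fun U V => by rw [← h'.symmetric]⟩

end Deform
end Syl

namespace Syl

open TwoCells TwoCellsMonoidal Wd

section Coboundary

variable {R : Type*} [CommRing R] {C : Type*} [Category C] [Preadditive C] [Linear R C]
  [MonoidalCategory C] [MonoidalPreadditive C] [MonoidalLinear R C] [SymmetricCategory C]
  [TwoCells R C] [TwoCellsMonoidal R C]

local notation:80 g:81 " ⊳ " q:80 => g ⊳[R] q
local notation:80 q:81 " ⊲ " f:80 => q ⊲[R] f
local notation:90 f:91 " ⊗ʳ " q:90 => f ⊗ʳ[R] q
local notation:90 q:91 " ⊗ˡ " g:90 => q ⊗ˡ[R] g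

section Commutators

variable {X X' Y Y' W W' : C}

theorem commutator_wr (q : H R X X) (q' : H R X' X') (F : X ⟶ X') (k : W ⟶ W') :
    (F ⊗ₘ k) ⊳ wr _ _ W q - wr _ _ W' q' ⊲ (F ⊗ₘ k) = (F ⊳ q - q' ⊲ F) ⊗ˡ k := by
  rw [MonoidalCategory.tensorHom_def, post_comp, ← wr_post, ← pre_comp, ← wr_exch, post_pre, ← wr_pre,
    map_sub, map_sub]

theorem commutator_wl (q : H R X X) (q' : H R X' X') (F : X ⟶ X') (k : W ⟶ W') :
    (k ⊗ₘ F) ⊳ wl W _ _ q - wl W' _ _ q' ⊲ (k ⊗ₘ F) = k ⊗ʳ (F ⊳ q - q' ⊲ F) := by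
  rw [MonoidalCategory.tensorHom_def', post_comp, ← wl_post, ← pre_comp, ← wl_exch, post_pre, ← wl_pre,
    map_sub, map_sub]

theorem commutator_conj (q : H R Y Y) (q' : H R Y' Y') {F : X ⟶ X'} {G : Y ⟶ Y'} {c : Y ⟶ X}
    {d : X ⟶ Y} {c' : Y' ⟶ X'} {d' : X' ⟶ Y'} (h : F ⊚ c = c' ⊚ G) (h' : G ⊚ d = d' ⊚ F) :
    F ⊳ c ⊳ q ⊲ d - (c' ⊳ q' ⊲ d') ⊲ F = c' ⊳ (G ⊳ q - q' ⊲ G) ⊲ d := by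
  rw [post_pre, pre_comp, ← h', ← post_comp, h, post_comp, map_sub, LinearMap.sub_apply, map_sub,
    post_pre, pre_comp]

end Commutators

namespace InfData.IsCoboundarySyllepsis

variable {t : InfData R C} {T : ∀ U V : C, H R (U ⊗ V) (U ⊗ V)} (hT : t.IsCoboundarySyllepsis T)
include hT

/-- Apart from the vanishing of the homotopy components on coherence isomorphisms, the laws of an
infinitesimal 2-braiding follow from a coboundary syllepsis. -/
theorem isInfinitesimal2Braiding
    (assoc_left : ∀ U V W X : C, t.h (α_ U V W).hom (𝟙 X) = 0)
    (assoc_right : ∀ U V W X : C, t.h (𝟙 X) (α_ U V W).hom = 0)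
    (leftUnitor_left : ∀ U X : C, t.h (λ_ U).hom (𝟙 X) = 0)
    (leftUnitor_right : ∀ U X : C, t.h (𝟙 X) (λ_ U).hom = 0)
    (rightUnitor_left : ∀ U X : C, t.h (ρ_ U).hom (𝟙 X) = 0)
    (rightUnitor_right : ∀ U X : C, t.h (𝟙 X) (ρ_ U).hom = 0) : t.IsInfinitesimal2Braiding where
  natural f g := by rw [← hT.quasinatural, map_sub, bd_post, bd_pre, hT.homotopy, hT.homotopy]
  natural_left q g := by
    have e : ∂[R] (q ⊗ˡ g) = ∂[R] q ⊗ₘ g := by rw [bd_post, bd_wr, MonoidalCategory.tensorHom_def]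
    rw [← hT.quasinatural, ← hT.homotopy, ← hT.homotopy, ← e, peiffer, peiffer]
  natural_right f q := by
    have e : ∂[R] (f ⊗ʳ q) = f ⊗ₘ ∂[R] q := by rw [bd_post, bd_wl, MonoidalCategory.tensorHom_def']
    rw [← hT.quasinatural, ← hT.homotopy, ← hT.homotopy, ← e, peiffer, peiffer]
  unit U V := by
    rw [← hT.quasinatural, MonoidalCategory.id_tensorHom_id, post_id, pre_id, sub_self]
  comp f' f g' g := by
    simp only [← hT.quasinatural, MonoidalCategory.tensorHom_comp_tensorHom, map_sub, post_comp,
      pre_comp, post_pre, LinearMap.sub_apply, ← MonoidalCategory.tensorHom_comp_tensorHom]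
    abel
  assoc_left := assoc_left
  assoc_right := assoc_right
  leftUnitor_left := leftUnitor_left
  leftUnitor_right := leftUnitor_right
  rightUnitor_left := rightUnitor_left
  rightUnitor_right := rightUnitor_right

theorem isSymmetric : t.IsSymmetric where
  app U V := by
    rw [← hT.homotopy, ← hT.homotopy, hT.symmetric U V, bd_post, bd_pre, Category.assoc]
    simp
  hty {U U' V V'} f g := by
    rw [← hT.quasinatural, ← hT.quasinatural, hT.symmetric U V, hT.symmetric U' V']
    simp only [map_sub, LinearMap.sub_apply, ← post_comp, pre_comp, post_pre]
    simp [post_id]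

theorem isStrict : t.IsStrict where
  left U V W := by
    have := congrArg ∂[R] (hT.left U V W)
    simpa only [map_add, bd_post, bd_pre, bd_wl, bd_wr, hT.homotopy] using this
  right U V W := by
    have := congrArg ∂[R] (hT.right U V W)
    simpa only [map_add, bd_post, bd_pre, bd_wl, bd_wr, hT.homotopy] using this
  left_hty {U U' V V' W W'} f g k := by
    rw [← hT.quasinatural f (g ⊗ₘ k), ← commutator_conj _ _ (F := (f ⊗ₘ g) ⊗ₘ k)
      (associator_inv_naturality f g k).symm (associator_naturality f g k).symm, hT.left, hT.left]
    simp only [map_add, LinearMap.add_apply, add_sub_add_comm]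
    rw [commutator_wr, hT.quasinatural, ← post_comp ((β_ V U).hom ▷ W) (α_ V U W).inv,
      ← post_comp ((β_ V' U').hom ▷ W') (α_ V' U' W').inv,
      commutator_conj _ _ (G := g ⊗ₘ (f ⊗ₘ k)), commutator_wl, hT.quasinatural, post_comp]
    · simp only [Category.assoc, ← MonoidalCategory.tensorHom_id, associator_inv_naturality_assoc,
        MonoidalCategory.tensorHom_comp_tensorHom, braiding_naturality, Category.id_comp, Category.comp_id]
    · simp only [Category.assoc, ← MonoidalCategory.tensorHom_id, associator_naturality,
        MonoidalCategory.tensorHom_comp_tensorHom_assoc, braiding_naturality, Category.id_comp, Category.comp_id,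
        ← associator_naturality]
  right_hty {U U' V V' W W'} f g k := by
    rw [← hT.quasinatural (f ⊗ₘ g) k, ← commutator_conj _ _ (F := f ⊗ₘ (g ⊗ₘ k))
      (associator_naturality f g k).symm (associator_inv_naturality f g k).symm, hT.right, hT.right]
    simp only [map_add, LinearMap.add_apply, add_sub_add_comm]
    rw [commutator_wl, hT.quasinatural, ← post_comp (U ◁ (β_ W V).hom) (α_ U W V).hom,
      ← post_comp (U' ◁ (β_ W' V').hom) (α_ U' W' V').hom,
      commutator_conj _ _ (G := (f ⊗ₘ k) ⊗ₘ g), commutator_wr, hT.quasinatural, post_comp]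
    · simp only [Category.assoc, ← MonoidalCategory.id_tensorHom, associator_naturality_assoc,
        MonoidalCategory.tensorHom_comp_tensorHom, braiding_naturality, Category.id_comp, Category.comp_id]
    · simp only [Category.assoc, ← MonoidalCategory.id_tensorHom, associator_inv_naturality,
        MonoidalCategory.tensorHom_comp_tensorHom_assoc, braiding_naturality, Category.id_comp, Category.comp_id,
        ← associator_inv_naturality]

end InfData.IsCoboundarySyllepsis

end Coboundary

section Pairing

variable {R : Type*} [CommRing R] {C : Type*} [Category C] [Preadditive C] [Linear R C]
  [MonoidalCategory C] [MonoidalPreadditive C] [MonoidalLinear R C] [SymmetricCategory C]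
  [TwoCells R C] [TwoCellsMonoidal R C]

local notation:80 g:81 " ⊳ " q:80 => g ⊳[R] q
local notation:80 q:81 " ⊲ " f:80 => q ⊲[R] f
local notation:90 f:91 " ⊗ʳ " q:90 => f ⊗ʳ[R] q
local notation:90 q:91 " ⊗ˡ " g:90 => q ⊗ˡ[R] g

variable {c : C} (ϖ : H R (c ⊗ c) (𝟙_ C)) {X X' Y Z : C}

/-- Contraction of the factor `c ⊗ c` of the target of `f` with a form of degree `-1`. -/
def pairing (f : Y ⟶ (c ⊗ c) ⊗ X) : H R Y X := (λ_ X).hom ⊳ wr _ _ X ϖ ⊲ f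

theorem pairing_add (f f' : Y ⟶ (c ⊗ c) ⊗ X) :
    pairing ϖ (f + f') = pairing ϖ f + pairing ϖ f' := by simp [pairing]

theorem pairing_sub (f f' : Y ⟶ (c ⊗ c) ⊗ X) :
    pairing ϖ (f - f') = pairing ϖ f - pairing ϖ f' := by simp [pairing]

theorem pre_pairing (f : Y ⟶ (c ⊗ c) ⊗ X) (g : Z ⟶ Y) :
    pairing ϖ f ⊲ g = pairing ϖ (f ⊚ g) := by rw [pairing, post_pre, pre_comp, pairing]

theorem post_pairing (g : X ⟶ X') (f : Y ⟶ (c ⊗ c) ⊗ X) :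
    g ⊳ pairing ϖ f = pairing ϖ (((c ⊗ c) ◁ g) ⊚ f) := by
  rw [pairing, ← post_comp, ← leftUnitor_naturality, post_comp, ← post_pre, wr_exch, pre_comp, pairing]

theorem wr_pairing (f : Y ⟶ (c ⊗ c) ⊗ X) (Z : C) :
    wr _ _ Z (pairing ϖ f) = pairing ϖ ((α_ (c ⊗ c) X Z).hom ⊚ (f ▷ Z)) := by
  rw [pairing, wr_post, wr_pre, pairing, ← pre_comp, ← TwoCellsMonoidal.assoc_left, post_pre,
    ← post_comp, leftUnitor_tensor_hom]
  simp

theorem wl_pairing (f : Y ⟶ (c ⊗ c) ⊗ X) (Z : C) :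
    wl Z _ _ (pairing ϖ f) = pairing ϖ (((c ⊗ c) ◁ (β_ X Z).hom) ⊚ (α_ (c ⊗ c) X Z).hom ⊚
      (β_ Z ((c ⊗ c) ⊗ X)).hom ⊚ (Z ◁ f)) := by
  have h := congrArg (fun q => q ⊲ (β_ Z Y).hom) (symm_left (pairing ϖ f) Z)
  simp only [pre_comp, SymmetricCategory.symmetry, pre_id] at h
  rw [← h, wr_pairing, post_pairing, pre_pairing, braiding_naturality_right]
  simp only [Category.assoc]

theorem pairing_braid (hϖ : ϖ ⊲ (β_ c c).hom = ϖ) (f : Y ⟶ (c ⊗ c) ⊗ X) :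
    pairing ϖ (((β_ c c).hom ▷ X) ⊚ f) = pairing ϖ f := by
  rw [pairing, ← pre_comp, ← wr_pre, hϖ, pairing]

theorem pairing_bd (f : Z ⟶ (c ⊗ c) ⊗ X) (q : H R Y Z) :
    pairing ϖ (f ⊚ ∂[R] q) = ((λ_ X).hom ⊚ (∂[R] ϖ ▷ X) ⊚ f) ⊳ q := by
  rw [pairing, post_comp, post_comp, ← bd_wr, peiffer, bd_post]

variable (ξ : ∀ U : C, U ⟶ c ⊗ U)

/-- The family obtained by contracting `ξ ⊗ ξ`. -/
def pairFam (U V : C) : H R (U ⊗ V) (U ⊗ V) := pairing ϖ (tensorμ c U c V ⊚ (ξ U ⊗ₘ ξ V))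

theorem bd_pairFam (U V : C) : ∂[R] (pairFam ϖ ξ U V) =
    ((λ_ (U ⊗ V)).hom ⊚ (∂[R] ϖ ▷ (U ⊗ V)) ⊚ tensorμ c U c V) ⊚ (ξ U ⊗ₘ ξ V) := by
  rw [pairFam, pairing, bd_post, bd_pre, bd_wr]
  simp only [Category.assoc]

theorem pairFam_quasinatural {U U' V V' : C} (f : U ⟶ U') (g : V ⟶ V') (ξf : H R U (c ⊗ U'))
    (ξg : H R V (c ⊗ V')) (hf : ∂[R] ξf = (c ◁ f) ⊚ ξ U - ξ U' ⊚ f)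
    (hg : ∂[R] ξg = (c ◁ g) ⊚ ξ V - ξ V' ⊚ g) :
    (f ⊗ₘ g) ⊳ pairFam ϖ ξ U V - pairFam ϖ ξ U' V' ⊲ (f ⊗ₘ g) =
      ((λ_ (U' ⊗ V')).hom ⊚ (∂[R] ϖ ▷ (U' ⊗ V')) ⊚ tensorμ c U' c V') ⊳
        (ξf ⊗ˡ ((c ◁ g) ⊚ ξ V) + (ξ U' ⊚ f) ⊗ʳ ξg) := by
  have e : ((c ⊗ c) ◁ (f ⊗ₘ g)) ⊚ (tensorμ c U c V ⊚ (ξ U ⊗ₘ ξ V)) =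
      tensorμ c U' c V' ⊚ (((c ◁ f) ⊚ ξ U) ⊗ₘ ((c ◁ g) ⊚ ξ V)) := by
    have := tensorμ_natural (𝟙 c) f (𝟙 c) g
    rw [MonoidalCategory.id_tensorHom_id] at this
    simp only [MonoidalCategory.id_tensorHom] at this
    rw [Category.assoc, ← this, ← MonoidalCategory.tensorHom_comp_tensorHom, Category.assoc]
  rw [← pairing_bd, map_add, bd_post, bd_post, bd_wr, bd_wl, hf, hg, pairFam, pairFam, post_pairing,
    pre_pairing, e, ← Category.assoc (f ⊗ₘ g), MonoidalCategory.tensorHom_comp_tensorHom,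
    ← pairing_sub]
  simp only [MonoidalCategory.tensorHom_def, whiskerLeft_sub, sub_whiskerRight, Preadditive.comp_sub,
    Preadditive.sub_comp, Preadditive.add_comp, whisker_exchange, whisker_exchange_assoc]
  congr 1
  abel

theorem pairFam_symmetric (hϖ : ϖ ⊲ (β_ c c).hom = ϖ) (U V : C) :
    pairFam ϖ ξ U V = (β_ V U).hom ⊳ pairFam ϖ ξ V U ⊲ (β_ U V).hom := by
  rw [pairFam, pairFam, pre_pairing, post_pairing, ← pairing_braid ϖ hϖ]
  congr 1
  simp only [Category.assoc, ← braiding_naturality_assoc]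
  congr 1
  unfold tensorμ
  exact coherence (ten (ten (leaf 0 c) (leaf 1 U)) (ten (leaf 2 c) (leaf 3 V)))

theorem pairFam_left (hξ : ∀ V W : C, ξ (V ⊗ W) = (α_ c V W).hom ⊚ (ξ V ▷ W) +
      (α_ c V W).hom ⊚ ((β_ V c).hom ▷ W) ⊚ (α_ V c W).inv ⊚ (V ◁ ξ W)) (U V W : C) :
    (α_ U V W).inv ⊳ pairFam ϖ ξ U (V ⊗ W) ⊲ (α_ U V W).hom =
      wr _ _ W (pairFam ϖ ξ U V) + ((β_ V U).hom ▷ W) ⊳ (α_ V U W).inv ⊳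
        wl V _ _ (pairFam ϖ ξ U W) ⊲ (α_ V U W).hom ⊚ ((β_ U V).hom ▷ W) := by
  simp only [pairFam, pre_pairing, post_pairing, wl_pairing, wr_pairing, ← pairing_add, hξ]
  congr 1
  simp only [MonoidalCategory.tensorHom_def, MonoidalPreadditive.whiskerLeft_add, Preadditive.comp_add,
    Preadditive.add_comp, MonoidalCategory.comp_whiskerRight, MonoidalCategory.whiskerLeft_comp,
    Category.assoc]
  congr 1
  · rw [← associator_naturality_left_assoc, ← associator_naturality_middle_assoc]
    congr 2
    unfold tensorμ
    exact coherence (ten (ten (ten (leaf 0 c) (leaf 1 U)) (ten (leaf 2 c) (leaf 3 V))) (leaf 4 W))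
  · rw [← associator_naturality_left_assoc, ← associator_naturality_right_assoc,
      ← associator_naturality_middle_assoc, ← associator_naturality_right_assoc,
      ← comp_whiskerRight_assoc, ← braiding_naturality_left, comp_whiskerRight_assoc,
      ← whisker_exchange_assoc (β_ (c ⊗ U) V).hom]
    congr 2
    unfold tensorμ
    exact coherence (ten (ten (ten (leaf 0 c) (leaf 1 U)) (leaf 3 V)) (ten (leaf 2 c) (leaf 4 W)))

theorem pairFam_right (hξ : ∀ V W : C, ξ (V ⊗ W) = (α_ c V W).hom ⊚ (ξ V ▷ W) +
      (α_ c V W).hom ⊚ ((β_ V c).hom ▷ W) ⊚ (α_ V c W).inv ⊚ (V ◁ ξ W)) (U V W : C) :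
    (α_ U V W).hom ⊳ pairFam ϖ ξ (U ⊗ V) W ⊲ (α_ U V W).inv =
      wl U _ _ (pairFam ϖ ξ V W) + (U ◁ (β_ W V).hom) ⊳ (α_ U W V).hom ⊳
        wr _ _ V (pairFam ϖ ξ U W) ⊲ (α_ U W V).inv ⊚ (U ◁ (β_ V W).hom) := by
  simp only [pairFam, pre_pairing, post_pairing, wl_pairing, wr_pairing, ← pairing_add, hξ]
  congr 1
  simp only [MonoidalCategory.tensorHom_def', MonoidalPreadditive.add_whiskerRight, Preadditive.comp_add,
    Preadditive.add_comp, MonoidalCategory.comp_whiskerRight, MonoidalCategory.whiskerLeft_comp,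
    Category.assoc]
  rw [add_comm]
  congr 1
  · rw [← associator_inv_naturality_right_assoc, ← associator_inv_naturality_middle_assoc]
    congr 2
    unfold tensorμ
    exact coherence (ten (leaf 4 U) (ten (ten (leaf 0 c) (leaf 1 V)) (ten (leaf 2 c) (leaf 3 W))))
  · rw [← associator_inv_naturality_right_assoc, ← associator_inv_naturality_left_assoc,
      ← associator_inv_naturality_middle_assoc, ← associator_inv_naturality_left_assoc,
      ← MonoidalCategory.whiskerLeft_comp_assoc, ← braiding_naturality_right, whiskerLeft_comp_assoc,
      whisker_exchange_assoc, whisker_exchange_assoc, whisker_exchange_assoc]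
    congr 2
    unfold tensorμ
    exact coherence (ten (ten (leaf 0 c) (leaf 1 U)) (ten (leaf 4 V) (ten (leaf 2 c) (leaf 3 W))))

end Pairing
end Syl

namespace Syl

open TwoCells TwoCellsMonoidal

namespace BasedMod

variable {K : Type*} [Field K] {A : SemiFreeCDGA K}

theorem pt_atM_hom {M N : BasedMod A} (f : M ⟶ N) :
    pt' (-1) M (cot A ⊗ N) (atM (-1) M N (mat f)) =
      wlM (fun p : Fin A.N => A.deg p - 1) 0 (mat f) * atM 1 M M M.D - atM 1 N N N.D * mat f := by
  suffices H : ∀ (p : Fin A.N) (j : N.ι) (i : M.ι),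
      pt' (-1) M (cot A ⊗ N) (atM (-1) M N (mat f)) (p, j) i =
        (wlM (fun p : Fin A.N => A.deg p - 1) 0 (mat f) * atM 1 M M M.D - atM 1 N N N.D * mat f) (p, j) i from
    Matrix.ext fun q i => H q.1 q.2 i
  intro p j i
  have hf := mat_mem f
  have h := congrFun (congrFun (pt_mat f) j) i
  change (N.D * mat f) j i + sg K (N.deg j) • A.d (mat f j i) - sg K 0 • (mat f * M.D) j i = 0 at h
  rw [sg_zero, one_smul, Matrix.mul_apply, Matrix.mul_apply] at h
  have h₁ := congrArg (A.pd p) h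
  rw [map_sub, map_add, map_sum, map_sum, map_smul, SemiFreeCDGA.pd_d p (hf j i), map_zero] at h₁
  simp only [fun l => SemiFreeCDGA.pd_mul p (N.D_mem j l) (hf l i),
    fun l => SemiFreeCDGA.pd_mul p (hf j l) (M.D_mem l i)] at h₁
  change (tD (fun p : Fin A.N => A.deg p - 1) N.deg (cotD A) N.D * atM (-1) M N (mat f)) (p, j) i +
    sg K (A.deg p - 1 + N.deg j) • A.d ((-1 * sg K (N.deg j * A.deg p)) • A.pd p (mat f j i)) -
    sg K (-1) • (atM (-1) M N (mat f) * M.D) (p, j) i =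
    (wlM (fun p : Fin A.N => A.deg p - 1) 0 (mat f) * atM 1 M M M.D) (p, j) i -
      (atM 1 N N N.D * mat f) (p, j) i
  rw [tD_mul_apply, Matrix.mul_apply, Matrix.mul_apply, Matrix.mul_apply, Fintype.sum_prod_type,
    Finset.sum_eq_single p (fun x _ hx => Finset.sum_eq_zero fun y _ => by
      simp [wl_apply, hx.symm]) (by simp)]
  change ∑ q, sg K (N.deg j * (1 + (A.deg q - 1) - (A.deg p - 1))) • (-A.pd p (A.dx q) *
    (-1 * sg K (N.deg j * A.deg q)) • A.pd q (mat f j i)) + ∑ l, sg K (A.deg p - 1) • (N.D j l *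
    (-1 * sg K (N.deg l * A.deg p)) • A.pd p (mat f l i)) + _ -
    sg K (-1) • ∑ l, (-1 * sg K (N.deg j * A.deg p)) • A.pd p (mat f j l) * M.D l i =
    ∑ l, wlM (fun p : Fin A.N => A.deg p - 1) 0 (mat f) (p, j) (p, l) *
      (1 * sg K (M.deg l * A.deg p)) • A.pd p (M.D l i) -
    ∑ l, (1 * sg K (N.deg j * A.deg p)) • A.pd p (N.D j l) * mat f l i
  have e₁ : ∀ q, sg K (N.deg j * (1 + (A.deg q - 1) - (A.deg p - 1))) • (-A.pd p (A.dx q) *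
      (-1 * sg K (N.deg j * A.deg q)) • A.pd q (mat f j i)) =
      (sg K (N.deg j * A.deg p) * sg K (N.deg j)) • (A.pd p (A.dx q) * A.pd q (mat f j i)) := by
    intro q
    rw [neg_one_mul, neg_smul, neg_mul_neg, mul_smul_comm, smul_smul, ← sg_add, ← sg_add,
      sg_congr (N.deg j * (A.deg q - A.deg p))]
    ring
  have e₂ : ∀ l, sg K (A.deg p - 1) • (N.D j l * (-1 * sg K (N.deg l * A.deg p)) • A.pd p (mat f l i))
      = sg K (N.deg j * A.deg p) • (sg K (A.deg p * (1 + N.deg l - N.deg j)) •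
        (N.D j l * A.pd p (mat f l i))) := by
    intro l
    rw [mul_smul_comm, smul_smul, smul_smul, sg_sub_one, neg_one_mul, neg_mul_neg, ← sg_add, ← sg_add]
    congr 2
    ring
  have e₃ : sg K (A.deg p - 1 + N.deg j) * (-1 * sg K (N.deg j * A.deg p)) =
      sg K (N.deg j * A.deg p) * sg K (N.deg j) * sg K (A.deg p) := by
    rw [sg_add, sg_sub_one]; ring
  have e₄ : ∀ l, (-1 * sg K (N.deg j * A.deg p)) • A.pd p (mat f j l) * M.D l i =
      (-sg K (N.deg j * A.deg p)) • (A.pd p (mat f j l) * M.D l i) := fun l => by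
    rw [neg_one_mul, smul_mul_assoc]
  have e₅ : ∀ l, wlM (fun p : Fin A.N => A.deg p - 1) 0 (mat f) (p, j) (p, l) *
      (1 * sg K (M.deg l * A.deg p)) • A.pd p (M.D l i) = sg K (N.deg j * A.deg p) •
        (sg K (A.deg p * (0 + M.deg l - N.deg j)) • (mat f j l * A.pd p (M.D l i))) := by
    intro l
    rw [wl_apply, if_pos rfl, zero_mul, sg_zero, one_smul, one_mul, mul_smul_comm, smul_smul, ← sg_add]
    congr 2
    ring
  have e₆ : ∀ l, (1 * sg K (N.deg j * A.deg p)) • A.pd p (N.D j l) * mat f l i =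
      sg K (N.deg j * A.deg p) • (A.pd p (N.D j l) * mat f l i) := fun l => by
    rw [one_mul, smul_mul_assoc]
  rw [Finset.sum_add_distrib, Finset.sum_add_distrib] at h₁
  rw [Finset.sum_congr rfl fun q _ => e₁ q, Finset.sum_congr rfl fun l _ => e₂ l,
    Finset.sum_congr rfl fun l _ => e₄ l, Finset.sum_congr rfl fun l _ => e₅ l,
    Finset.sum_congr rfl fun l _ => e₆ l, ← Finset.smul_sum, ← Finset.smul_sum, ← Finset.smul_sum,
    ← Finset.smul_sum, ← Finset.smul_sum, map_smul, smul_smul, e₃,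
    sg_congr (m := -1) (n := 1) (-1) rfl, sg_one]
  have h₂ := (congrArg (fun a => sg K (N.deg j * A.deg p) • a) h₁).trans (smul_zero _)
  rw [← sub_eq_zero]
  refine Eq.trans ?_ h₂
  module

theorem bd_atiyahHty {M N : BasedMod A} (f : M ⟶ N) :
    ∂[K] (atiyahHty M N f) = (cot A ◁ f) ⊚ atiyah M - atiyah N ⊚ f :=
  hom_ext (pt_atM_hom f)

theorem atiyahHty_pm {M N : BasedMod A} (f : M ⟶ N) (e : M.ι ≃ N.ι) (c : M.ι → K)
    (h : mat f = pmM A e c) : atiyahHty M N f = 0 := by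
  have h₁ : ∀ p, A.pd p 1 = 0 := fun p => FreeGC.der_one _ _ _
  refine (cls_eq (q' := 0) ?_).trans rfl
  have h₂ : ∀ (p : Fin A.N) (j : N.ι) (i : M.ι),
      (-1 * sg K (N.deg j * A.deg p)) • A.pd p (mat f j i) = 0 := by
    intro p j i
    rw [h, pmM, Matrix.of_apply]
    split_ifs
    · rw [map_smul, h₁, smul_zero, smul_zero]
    · rw [map_zero, smul_zero]
  exact Matrix.ext fun q i => h₂ q.1 q.2 i

theorem atiyah_tensor (M N : BasedMod A) : atiyah (M ⊗ N) =
    (α_ (cot A) M N).hom ⊚ (atiyah M ▷ N) +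
      (α_ (cot A) M N).hom ⊚ ((β_ M (cot A)).hom ▷ N) ⊚ (α_ M (cot A) N).inv ⊚ (M ◁ atiyah N) := by
  have h : ∀ (p : Fin A.N) (j : M.ι) (l : N.ι) (i : M.ι) (k : N.ι),
      (1 * sg K ((M.deg j + N.deg l) * A.deg p)) • A.pd p (tD M.deg N.deg M.D N.D (j, l) (i, k)) =
        wrM M.deg (fun q : Fin A.N × M.ι => A.deg q.1 - 1 + M.deg q.2) N.deg 0 (atM 1 M M M.D)
          ((p, j), l) (i, k) + sg K (M.deg j * (A.deg p - 1)) •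
        wlM M.deg 0 (atM 1 N N N.D) (j, (p, l)) (i, k) := by
    intro p j l i k
    rw [tD, Matrix.add_apply, wr_apply, wl_apply, wr_apply, wl_apply, map_add, smul_add]
    congr 1
    · split_ifs with h
      · subst h
        change _ = _ • ((1 * sg K (M.deg j * A.deg p)) • A.pd p (M.D j i))
        rw [map_smul, smul_smul, smul_smul, one_mul, one_mul, ← sg_add, ← sg_add]
        congr 1
        exact sg_congr (N.deg l * (A.deg p)) (by ring)
      · simp
    · split_ifs with h
      · subst h
        change _ = _ • _ • ((1 * sg K (N.deg l * A.deg p)) • A.pd p (N.D l k))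
        rw [map_smul, smul_smul, smul_smul, smul_smul, one_mul, one_mul, one_mul, ← sg_add, ← sg_add, ← sg_add]
        congr 1
        exact sg_congr (M.deg j) (by ring)
      · simp
  have e₁ : ∀ (p : Fin A.N) (j : M.ι) (l : N.ι) (x : M.ι × N.ι),
      mat ((α_ (cot A) M N).hom ⊚ (atiyah M ▷ N)) (p, (j, l)) x =
        mat (atiyah M ▷ N) ((p, j), l) x := fun p j l x =>
    (pm_mul (Equiv.prodAssoc (Fin A.N) M.ι N.ι) (fun _ => (1 : K)) (mat (atiyah M ▷ N))
      ((p, j), l) x).trans (one_smul _ _)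
  have e₂ : ∀ (p : Fin A.N) (j : M.ι) (l : N.ι) (x : M.ι × N.ι),
      mat ((α_ (cot A) M N).hom ⊚ ((β_ M (cot A)).hom ▷ N) ⊚ (α_ M (cot A) N).inv ⊚
        (M ◁ atiyah N)) (p, (j, l)) x =
        sg K (M.deg j * (A.deg p - 1)) • mat (M ◁ atiyah N) (j, (p, l)) x := fun p j l x => by
    change (pmM A (Equiv.prodAssoc (Fin A.N) M.ι N.ι) (fun _ => 1) *
      (wrM (fun q : M.ι × Fin A.N => M.deg q.1 + (A.deg q.2 - 1))
        (fun q : Fin A.N × M.ι => A.deg q.1 - 1 + M.deg q.2) N.deg 0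
        (pmM A (Equiv.prodComm M.ι (Fin A.N)) (fun q => sg K (M.deg q.1 * (A.deg q.2 - 1)))) *
      (pmM A (Equiv.prodAssoc M.ι (Fin A.N) N.ι).symm (fun _ => 1) *
        wlM M.deg 0 (atM 1 N N N.D))))
        (p, (j, l)) x = _
    rw [wr_pm]
    · refine (pm_mul _ _ _ ((p, j), l) x).trans ((one_smul _ _).trans ?_)
      refine (pm_mul _ _ _ ((j, p), l) x).trans (congrArg _ ?_)
      exact (pm_mul _ _ _ (j, (p, l)) x).trans (one_smul _ _)
    · exact fun _ => add_comm _ _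
  refine hom_ext (Matrix.ext fun q x => ?_)
  exact (h q.1 q.2.1 q.2.2 x.1 x.2).trans
    (congrArg₂ (· + ·) (e₁ q.1 q.2.1 q.2.2 x).symm (e₂ q.1 q.2.1 q.2.2 x).symm)

section
variable {ϖ : ↥(Hom' (-1) (cot A ⊗ cot A) (𝟙_ (BasedMod A)))}

theorem poissonHty_eq (M N : BasedMod A) :
    poissonHty ϖ M N = pairFam (cls ϖ : H K (cot A ⊗ cot A) (𝟙_ (BasedMod A))) atiyah M N := rfl

theorem poisson_app (U V : BasedMod A) : (poisson (bdL _ _ ϖ)).app U V =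
    ((λ_ (U ⊗ V)).hom ⊚ (∂[K] (cls ϖ : H K (cot A ⊗ cot A) (𝟙_ (BasedMod A))) ▷ (U ⊗ V)) ⊚
      tensorμ (cot A) U (cot A) V) ⊚ (atiyah U ⊗ₘ atiyah V) := rfl

theorem poisson_h {U U' V V' : BasedMod A} (f : U ⟶ U') (g : V ⟶ V') :
    (poisson (bdL _ _ ϖ)).h f g =
    ((λ_ (U' ⊗ V')).hom ⊚ (∂[K] (cls ϖ : H K (cot A ⊗ cot A) (𝟙_ (BasedMod A))) ▷ (U' ⊗ V')) ⊚
      tensorμ (cot A) U' (cot A) V') ⊳[K] ((atiyahHty U U' f) ⊗ˡ[K] ((cot A ◁ g) ⊚ atiyah V) +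
      (atiyah U' ⊚ f) ⊗ʳ[K] (atiyahHty V V' g)) := rfl

theorem cls_braiding (hϖ : ϖ ∈ bivectors A) :
    (cls ϖ : H K (cot A ⊗ cot A) (𝟙_ (BasedMod A))) ⊲[K] (β_ (cot A) (cot A)).hom = cls ϖ :=
  congrArg cls hϖ

theorem poisson_isCoboundarySyllepsis (hϖ : ϖ ∈ bivectors A) :
    (poisson (bdL _ _ ϖ)).IsCoboundarySyllepsis (poissonHty ϖ) where
  homotopy U V := by rw [poissonHty_eq, bd_pairFam, poisson_app]
  quasinatural f g := by
    rw [poissonHty_eq, poissonHty_eq, poisson_h]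
    exact pairFam_quasinatural _ atiyah f g _ _ (bd_atiyahHty f) (bd_atiyahHty g)
  left U V W := by
    rw [poissonHty_eq, poissonHty_eq, poissonHty_eq]
    exact pairFam_left _ atiyah atiyah_tensor U V W
  right U V W := by
    rw [poissonHty_eq, poissonHty_eq, poissonHty_eq]
    exact pairFam_right _ atiyah atiyah_tensor U V W
  symmetric U V := by
    rw [poissonHty_eq, poissonHty_eq]
    exact pairFam_symmetric _ atiyah (cls_braiding hϖ) U V

theorem poisson_h_zero (π : cot A ⊗ cot A ⟶ 𝟙_ (BasedMod A)) {U U' V V' : BasedMod A} {f : U ⟶ U'}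
    {g : V ⟶ V'} (hf : atiyahHty U U' f = 0) (hg : atiyahHty V V' g = 0) :
    (poisson π).h f g = 0 := by
  change contract π U' V' ⊳[K] ((atiyahHty U U' f) ⊗ˡ[K] ((cot A ◁ g) ⊚ atiyah V) +
      (atiyah U' ⊚ f) ⊗ʳ[K] (atiyahHty V V' g)) = 0
  rw [hf, hg]
  simp only [map_zero, add_zero]

theorem atiyahHty_id (M : BasedMod A) : atiyahHty M M (𝟙 M) = 0 :=
  atiyahHty_pm _ (Equiv.refl _) (fun _ => 1) pm_refl.symm

theorem atiyahHty_associator (M N P : BasedMod A) : atiyahHty _ _ (α_ M N P).hom = 0 :=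
  atiyahHty_pm (α_ M N P).hom (Equiv.prodAssoc _ _ _) (fun _ => 1) rfl

theorem atiyahHty_leftUnitor (M : BasedMod A) : atiyahHty _ _ (λ_ M).hom = 0 :=
  atiyahHty_pm (λ_ M).hom (Equiv.punitProd M.ι) (fun _ => 1) rfl

theorem atiyahHty_rightUnitor (M : BasedMod A) : atiyahHty _ _ (ρ_ M).hom = 0 :=
  atiyahHty_pm (ρ_ M).hom (Equiv.prodPUnit M.ι) (fun _ => 1) rfl

theorem atiyahHty_braiding (M N : BasedMod A) : atiyahHty _ _ (β_ M N).hom = 0 :=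
  atiyahHty_pm (β_ M N).hom (Equiv.prodComm M.ι N.ι) (fun p => sg K (M.deg p.1 * N.deg p.2)) rfl

theorem poisson_isInfinitesimal2Braiding (hϖ : ϖ ∈ bivectors A) :
    (poisson (bdL _ _ ϖ)).IsInfinitesimal2Braiding :=
  (poisson_isCoboundarySyllepsis hϖ).isInfinitesimal2Braiding
    (fun _ _ _ _ => poisson_h_zero _ (atiyahHty_associator _ _ _) (atiyahHty_id _))
    (fun _ _ _ _ => poisson_h_zero _ (atiyahHty_id _) (atiyahHty_associator _ _ _))
    (fun _ _ => poisson_h_zero _ (atiyahHty_leftUnitor _) (atiyahHty_id _))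
    (fun _ _ => poisson_h_zero _ (atiyahHty_id _) (atiyahHty_leftUnitor _))
    (fun _ _ => poisson_h_zero _ (atiyahHty_rightUnitor _) (atiyahHty_id _))
    (fun _ _ => poisson_h_zero _ (atiyahHty_id _) (atiyahHty_rightUnitor _))

theorem poisson_isTotallySymmetric (hϖ : ϖ ∈ bivectors A) :
    (poisson (bdL _ _ ϖ)).IsTotallySymmetric where
  toIsSymmetric := (poisson_isCoboundarySyllepsis hϖ).isSymmetric
  hty_symm _ _ _ := poisson_h_zero _ (atiyahHty_braiding _ _) (atiyahHty_id _)

theorem poisson_isBreen (π : cot A ⊗ cot A ⟶ 𝟙_ (BasedMod A)) : (poisson π).IsBreen :=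
  fun U V W => by
    rw [poisson_h_zero π (atiyahHty_id U) (atiyahHty_braiding V W),
      poisson_h_zero π (atiyahHty_braiding U V) (atiyahHty_id W)]
    simp only [map_zero, LinearMap.zero_apply, add_zero]

end

end BasedMod

end Syl

theorem mainTheorem8 {K : Type*} [Field K] [CharZero K] :
    (∀ (A : Syl.SemiFreeCDGA K), ∀ ϖ ∈ Syl.BasedMod.bivectors A,
      (Syl.BasedMod.poisson (Syl.BasedMod.bdL _ _ ϖ)).IsInfinitesimal2Braiding ∧
      (Syl.BasedMod.poisson (Syl.BasedMod.bdL _ _ ϖ)).IsStrict ∧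
      (Syl.BasedMod.poisson (Syl.BasedMod.bdL _ _ ϖ)).IsTotallySymmetric ∧
      (Syl.BasedMod.poisson (Syl.BasedMod.bdL _ _ ϖ)).IsBreen ∧
      (Syl.BasedMod.poisson (Syl.BasedMod.bdL _ _ ϖ)).IsCoboundarySyllepsis
        (Syl.BasedMod.poissonHty ϖ)) ∧
    (∀ (C : Type*) [Category C] [Preadditive C] [Linear K C] [MonoidalCategory C]
      [MonoidalPreadditive C] [MonoidalLinear K C] [SymmetricCategory C] [Syl.TwoCells K C]
      [Syl.TwoCellsMonoidal K C] (t : Syl.InfData K C),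
      t.IsInfinitesimal2Braiding → t.IsStrict → t.IsSymmetric → t.IsBreen →
        t.deform1.IsBraided ∧
        ∀ T : ∀ U V : C, Syl.TwoCells.H K (U ⊗ V) (U ⊗ V),
          t.deform1.IsSymmetricSyllepsis (Syl.deformSyllepsis 2 T) ↔ t.IsCoboundarySyllepsis T) ∧
    (∀ (C : Type*) [Category C] [Preadditive C] [Linear K C] [MonoidalCategory C]
      [MonoidalPreadditive C] [MonoidalLinear K C] [SymmetricCategory C] [Syl.TwoCells K C]
      [Syl.TwoCellsMonoidal K C] (t : Syl.InfData K C),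
      t.IsInfinitesimal2Braiding → t.IsStrict → t.IsTotallySymmetric → t.IsCoherent →
        t.deform2.IsBraided ∧
        ∀ T : ∀ U V : C, Syl.TwoCells.H K (U ⊗ V) (U ⊗ V),
          t.IsCoboundarySyllepsis T →
            t.deform2.IsSymmetricSyllepsis (Syl.deformSyllepsis 3 T)) := by
  refine ⟨fun A ϖ hϖ => ?_, fun C => ?_, fun C => ?_⟩
  · have h := Syl.BasedMod.poisson_isCoboundarySyllepsis hϖ
    exact ⟨Syl.BasedMod.poisson_isInfinitesimal2Braiding hϖ, h.isStrict,
      Syl.BasedMod.poisson_isTotallySymmetric hϖ, Syl.BasedMod.poisson_isBreen _, h⟩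
  · intro _ _ _ _ _ _ _ _ _ t ht hst hs hb
    exact ⟨Syl.deform1_isBraided ht hst hs hb, Syl.deform1_isSymmetricSyllepsis_iff ht hs⟩
  · intro _ _ _ _ _ _ _ _ _ t ht hst hs hc
    exact ⟨Syl.deform2_isBraided ht hst hs hc,
      fun T hT => Syl.deform2_isSymmetricSyllepsis ht hs hc hT⟩
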